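/- **Setting.** Fix $m\ge 0$, $\mathfrak R=\mathbb Z/m$ (so $\mathfrak R=\mathbb Z$ for $m=0$) and $\rho\in\mathbb Z$. A *marked bordered Legendrian graph* $\mathbf L$ of type $(\ell,r)$ is given by a regular front diagram in a vertical strip of the $xz$-plane, meeting the left and right borders in $\ell$ and $r$ points, whose crossings, left and right cusps and vertices (all of even valence) are interior and have pairwise different $x$-coordinates, up to planar isotopy preserving the order of the $x$-coordinates, together with a Maslov potential $\mu$ ($\mathfrak R$-valued, locally constant away from cusps and vertices; at each cusp the upper branch has potential one more than the lower one) and a set of crossings called marked; the others are called regular. Slices are numbered from top to bottom. The degree of a crossing is the difference of the potentials of its two strands. **Equivalence** is generated, with borders and potentials there fixed, by the following local moves and their images under reflections of the plane. Reidemeister moves, in which all crossings involved are regular: (0) exchange of the order of two vertically disjoint events (regular crossing, cusp or vertex); (I) creation of a kink with one crossing and two cusps; (II) a strand passes a cusp; (III) triple point; (IV) a strand passes a vertex (crossing all of its left edges, or all of its right edges); (V) the top left edge of a vertex becomes its bottom right edge: after passing above the vertex the edge crosses the other right edges downwards and turns back to the vertex in a right cusp. Marked moves: (0) exchange of the order of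 a marked crossing and a vertically disjoint cusp or marked crossing; (II) a strand passes a marked cusp with $n\ge 0$ strands between its two branches, where a *marked right cusp* joins two strands by letting the upper one cross the $n$ strands in between downwards, with marked crossings, and then form a right cusp with the lower one (a marked left cusp is its mirror image); each of the crossings of the passing strand with the two branches is independently marked or regular, and its crossings with the $n$ strands are all marked or all regular; (III) triple point with at least two of the three crossings marked; (S) a strand lying between the two branches of a cusp leaves through the upper or through the lower branch, with a marked crossing; (T) two successive marked crossings of two strands, adjacent to a third crossing (marked or regular) of the same strands, cancel. **Resolutions.** A perfect matching (fixed point free involution) of the strands of a slice is $\rho$-graded if in each pair the upper strand has potential one more, modulo $\rho\mathfrak R$, than the lower one. A perfect matching $\phi_{\mathsf v}$ of the half-edges at a vertex $\mathsf v$ is $\rho$-graded if matched half-edges on opposite sides of $\mathsf v$ have equal potentials modulo $\rho\mathfrak R$, and of two matched half-edges on the same side the upper one has potential one more, modulo $\rho\mathfrak R$, than the lower one. The resolution of $\mathsf v$ by $\phi_{\mathsf v}$ consists of marked right cusps for the pairs on the left, followed by $\beta\cdot\beta^c\cdot\overline{\beta^c}$ for the pairs joining left to right, followed by marked left cusps for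 the pairs on the right. Here $\beta$ is the positive permutation braid inducing the matching of left to right edges, with regular crossings, $\beta^c$ is the positive braid for which $\beta\beta^c$ is the half-twist, $\overline{\beta^c}$ is its reverse, and all crossings of $\beta^c$ and $\overline{\beta^c}$ are marked. For a collection $\Phi$ of $\rho$-graded matchings, one at each vertex, $\mathbf L^\Phi$ is the marked bordered Legendrian link with all vertices so resolved; its Maslov potential is defined modulo $\rho\mathfrak R$. **Rulings.** Let $\varphi,\psi$ be $\rho$-graded perfect matchings of the left and right border points. A $\rho$-graded normal ruling of boundary type $(\varphi,\psi)$ of a marked bordered Legendrian link $\Lambda$ is a set $\mathfrak r$ of regular crossings of degree in $\rho\mathfrak R$ with a decomposition of the $0$-resolution $\Lambda_{\mathfrak r}$ at $\mathfrak r$ into eyes, half-eyes and parallels (that is, a perfect matching of the strands of every slice, continuous along the strands of $\Lambda_{\mathfrak r}$, for which the two branches of every cusp are matched and matched strands never cross), inducing $\varphi$ and $\psi$ on the borders, such that at each crossing in $\mathfrak r$ the two strands belong to different pairs which are non-interlaced, i.e. bound disjoint or nested vertical intervals. Let $\mathbf R^\rho_{\mathbf L}(\varphi,\psi)$ be the set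 of pairs of a $\Phi$ and a $\rho$-graded normal ruling $S_{\mathfrak r}$ of $\mathbf L^\Phi$ of boundary type $(\varphi,\psi)$. Put $\operatorname{wt}(S_{\mathfrak r})=z^{\#\mathfrak r-c/2}$, where $c$ is the number of cusps of $\mathbf L^\Phi$, and $R^\rho_{\mathbf L}(\varphi,\psi)=\sum_{S}\operatorname{wt}(S)\in\mathbb Z[z^{\pm1/2}]$. **Theorem (Invariance).** If $\mathbf L$ and $\mathbf L'$ are equivalent marked bordered Legendrian graphs and $\varphi,\psi$ are $\rho$-graded perfect matchings of their left and right border points, then $\mathbf R^\rho_{\mathbf L}(\varphi,\psi)$ and $\mathbf R^\rho_{\mathbf L'}(\varphi,\psi)$ are finite and there is a weight-preserving bijection between them. In particular $R^\rho_{\mathbf L}(\varphi,\psi)=R^\rho_{\mathbf L'}(\varphi,\psi)$. -/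

import Mathlib

/-!
Front diagrams of marked bordered Legendrian graphs with Maslov potential, their Reidemeister
moves, vertex resolutions, normal rulings and ruling polynomials.

A regular front has its crossings, cusps and vertices at pairwise different `x`-coordinates, so up
to planar isotopy respecting their order it is the same thing as the list, from left to right, of
its elementary events. In every vertical slice the strands are numbered `0, 1, 2, …` from top to
bottom, and the Maslov potential is recorded by the list of its values on them.
-/

open LaurentPolynomial

/-- The elementary events of a front, labelled by Maslov potentials in `R`; `k` is the number of
strands passing above the event.
* `crossing marked k x y`: strands `k` and `k + 1`, of potentials `x` and `y`, cross; the crossing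
  is marked if `marked = true` and regular otherwise.
* `leftCusp k x`, `rightCusp k x`: a cusp, whose lower branch has potential `x` and whose upper
  branch has potential `x + 1`.
* `vertex k l r`: a vertex of type `(l.length, r.length)`; `l` and `r` list the potentials of the
  edges on its left and on its right, from top to bottom. -/
inductive FrontEvent (R : Type) : Type
  | crossing (marked : Bool) (k : ℕ) (x y : R)
  | leftCusp (k : ℕ) (x : R)
  | rightCusp (k : ℕ) (x : R)
  | vertex (k : ℕ) (l r : List R)

namespace FrontEvent

variable {R : Type}

/-- The number of strands above the event. -/
def pos : FrontEvent R → ℕ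
  | crossing _ k _ _ => k
  | leftCusp k _ => k
  | rightCusp k _ => k
  | vertex k _ _ => k

/-- The same event with `k` strands above it. -/
def moveTo (k : ℕ) : FrontEvent R → FrontEvent R
  | crossing m _ x y => crossing m k x y
  | leftCusp _ x => leftCusp k x
  | rightCusp _ x => rightCusp k x
  | vertex _ l r => vertex k l r

/-- The number of strands that enter the event from the left. -/
def inSize : FrontEvent R → ℕ
  | crossing _ _ _ _ => 2
  | leftCusp _ _ => 0
  | rightCusp _ _ => 2
  | vertex _ l _ => l.length

/-- The number of strands that leave the event to the right. -/
def outSize : FrontEvent R → ℕ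
  | crossing _ _ _ _ => 2
  | leftCusp _ _ => 2
  | rightCusp _ _ => 0
  | vertex _ _ r => r.length

/-- Is the event a marked crossing? -/
def isMarked : FrontEvent R → Bool
  | crossing m _ _ _ => m
  | _ => false

/-- Is the event a cusp? -/
def isCusp : FrontEvent R → Bool
  | leftCusp _ _ => true
  | rightCusp _ _ => true
  | _ => false

/-- Reflection of the front in a vertical line. -/
def mirror : FrontEvent R → FrontEvent R
  | crossing m k x y => crossing m k y x
  | leftCusp k x => rightCusp k x
  | rightCusp k x => leftCusp k x
  | vertex k l r => vertex k r l

/-- `e.Step a b`: the event `e` leads from a slice with potentials `a` to one with potentials `b`.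
All vertices have even valence. -/
inductive Step [CommRing R] : FrontEvent R → List R → List R → Prop
  | crossing (m : Bool) (u d : List R) (x y : R) :
      Step (crossing m u.length x y) (u ++ x :: y :: d) (u ++ y :: x :: d)
  | leftCusp (u d : List R) (x : R) :
      Step (leftCusp u.length x) (u ++ d) (u ++ (x + 1) :: x :: d)
  | rightCusp (u d : List R) (x : R) :
      Step (rightCusp u.length x) (u ++ (x + 1) :: x :: d) (u ++ d)
  | vertex (u d l r : List R) (h : Even (l.length + r.length)) :
      Step (vertex u.length l r) (u ++ (l ++ d)) (u ++ (r ++ d))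

end FrontEvent

/-- `IsFront a w b`: the list of events `w` is a front with Maslov potential whose left border has
the potentials `a` and whose right border has the potentials `b`. -/
def IsFront {R : Type} [CommRing R] : List R → List (FrontEvent R) → List R → Prop
  | a, [], b => a = b
  | a, e :: w, b => ∃ c, e.Step a c ∧ IsFront c w b

/-- A marked bordered Legendrian graph with Maslov potential (in regular front projection), of type
`(a.length, b.length)`, inducing the potentials `a` and `b` on its left and right borders. -/
structure MarkedFront {R : Type} [CommRing R] (a b : List R) : Type where
  word : List (FrontEvent R)
  isFront : IsFront a word b

/-! ### Reidemeister moves -/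

section Moves

variable {R : Type}

/-- Reflection of a front in a vertical line. -/
def mirrorWord (w : List (FrontEvent R)) : List (FrontEvent R) :=
  w.reverse.map FrontEvent.mirror

/-- Strand number `k`, of potential `x`, crosses downwards the strands below it, of potentials `ys`
from top to bottom. All crossings are marked if `m = true` and regular otherwise. -/
def slideDown (m : Bool) (k : ℕ) (x : R) : List R → List (FrontEvent R)
  | [] => []
  | y :: ys => .crossing m k x y :: slideDown m (k + 1) x ys

/-- The strands number `k, k + 1, …`, of potentials `ys` from top to bottom, are crossed upwards by
the strand just below them, of potential `x`. -/
def slideUp (m : Bool) (k : ℕ) (x : R) : List R → List (FrontEvent R)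
  | [] => []
  | y :: ys => slideUp m (k + 1) x ys ++ [.crossing m k y x]

/-- A right cusp joining two strands, of potentials `x + 1` and `x`, between which there are strands
of potentials `ys`: the upper strand crosses these downwards, all crossings being marked. -/
def markedRightCusp [CommRing R] (k : ℕ) (x : R) (ys : List R) : List (FrontEvent R) :=
  slideDown true k (x + 1) ys ++ [.rightCusp (k + ys.length) x]

/-- The Reidemeister moves of fronts of Legendrian graphs, all crossings involved being regular.
The four versions of a move that differ by reflections of the plane are all included. -/
inductive ReidemeisterMove [CommRing R] : List (FrontEvent R) → List (FrontEvent R) → Prop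
  /-- (0): two events which are not marked crossings, the second one entirely below the first one,
  are exchanged. -/
  | move0 (e f : FrontEvent R) (j : ℕ) (he : e.isMarked = false) (hf : f.isMarked = false) :
      ReidemeisterMove [e, f.moveTo (e.pos + e.outSize + j)] [f.moveTo (e.pos + e.inSize + j), e]
  /-- (I): a kink below the strand. -/
  | moveI_below (k : ℕ) (x : R) :
      ReidemeisterMove []
        [.leftCusp (k + 1) (x - 1), .crossing false k x x, .rightCusp (k + 1) (x - 1)]
  /-- (I): a kink above the strand. -/
  | moveI_above (k : ℕ) (x : R) :
      ReidemeisterMove [] [.leftCusp k x, .crossing false (k + 1) x x, .rightCusp k x]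
  /-- (II): a descending strand passes a right cusp. -/
  | moveII_down (k : ℕ) (s x : R) :
      ReidemeisterMove (slideDown false k s [x + 1, x] ++ [.rightCusp k x]) [.rightCusp (k + 1) x]
  /-- (II): an ascending strand passes a right cusp. -/
  | moveII_up (k : ℕ) (s x : R) :
      ReidemeisterMove (slideUp false k s [x + 1, x] ++ [.rightCusp (k + 1) x]) [.rightCusp k x]
  /-- (III): a triple point. -/
  | moveIII (k : ℕ) (x y z : R) :
      ReidemeisterMove
        [.crossing false k x y, .crossing false (k + 1) x z, .crossing false k y z]
        [.crossing false (k + 1) y z, .crossing false k x z, .crossing false (k + 1) x y]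
  /-- (IV): a descending strand passes a vertex. -/
  | moveIV_down (k : ℕ) (s : R) (l r : List R) :
      ReidemeisterMove (slideDown false k s l ++ [.vertex k l r])
        (.vertex (k + 1) l r :: slideDown false k s r)
  /-- (IV): an ascending strand passes a vertex. -/
  | moveIV_up (k : ℕ) (s : R) (l r : List R) :
      ReidemeisterMove (slideUp false k s l ++ [.vertex (k + 1) l r])
        (.vertex k l r :: slideUp false k s r)
  /-- (V): the top left edge at a vertex becomes the bottom right one. -/
  | moveV_top (k : ℕ) (x : R) (l r : List R) :
      ReidemeisterMove [.vertex k (x :: l) r]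
        (.vertex (k + 1) l (r ++ [x - 1]) ::
          (slideDown false k x r ++ [.rightCusp (k + r.length) (x - 1)]))
  /-- (V): the bottom left edge at a vertex becomes the top right one. -/
  | moveV_bottom (k : ℕ) (x : R) (l r : List R) :
      ReidemeisterMove [.vertex k (l ++ [x]) r]
        (.vertex k l ((x + 1) :: r) :: (slideUp false (k + 1) x r ++ [.rightCusp k x]))
  /-- The reflections of the above in a vertical line. -/
  | mirror {w w' : List (FrontEvent R)} (h : ReidemeisterMove w w') :
      ReidemeisterMove (mirrorWord w) (mirrorWord w')

/-- The additional Reidemeister moves in the presence of markings. -/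
inductive MarkedReidemeisterMove [CommRing R] : List (FrontEvent R) → List (FrontEvent R) → Prop
  /-- (0): two events, the second one entirely below the first one, are exchanged; either both are
  marked crossings, or one of them is a marked crossing and the other one is a cusp. -/
  | move0 (e f : FrontEvent R) (j : ℕ)
      (h : e.isMarked = true ∧ f.isMarked = true ∨ e.isMarked = true ∧ f.isCusp = true ∨
        e.isCusp = true ∧ f.isMarked = true) :
      MarkedReidemeisterMove [e, f.moveTo (e.pos + e.outSize + j)]
        [f.moveTo (e.pos + e.inSize + j), e]
  /-- (II): a descending strand passes a marked right cusp with any number of strands in between;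
  its crossings with the two branches may be marked or regular independently of each other, and
  its crossings with the strands in between are all marked or all regular. -/
  | moveII_down (k : ℕ) (s x : R) (ys : List R) (m₁ m₂ m : Bool) :
      MarkedReidemeisterMove
        (.crossing m₁ k s (x + 1) :: (slideDown m (k + 1) s ys ++
          .crossing m₂ (k + 1 + ys.length) s x :: markedRightCusp k x ys))
        (markedRightCusp (k + 1) x ys ++ slideDown m k s ys)
  /-- (II): the same for an ascending strand. -/
  | moveII_up (k : ℕ) (s x : R) (ys : List R) (m₁ m₂ m : Bool) :
      MarkedReidemeisterMove
        (.crossing m₂ (k + 1 + ys.length) x s :: (slideUp m (k + 1) s ys ++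
          .crossing m₁ k (x + 1) s :: markedRightCusp (k + 1) x ys))
        (markedRightCusp k x ys ++ slideUp m k s ys)
  /-- (III): a triple point, at least two of the three crossings being marked. -/
  | moveIII (k : ℕ) (x y z : R) (m₁ m₂ m₃ : Bool)
      (h : m₁ = true ∧ m₂ = true ∨ m₁ = true ∧ m₃ = true ∨ m₂ = true ∧ m₃ = true) :
      MarkedReidemeisterMove
        [.crossing m₁ k x y, .crossing m₂ (k + 1) x z, .crossing m₃ k y z]
        [.crossing m₃ (k + 1) y z, .crossing m₂ k x z, .crossing m₁ (k + 1) x y]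
  /-- (S): a strand leaves a right cusp through its upper or through its lower branch. -/
  | moveS (k : ℕ) (s x : R) :
      MarkedReidemeisterMove [.crossing true k (x + 1) s, .rightCusp (k + 1) x]
        [.crossing true (k + 1) s x, .rightCusp k x]
  /-- (T): two marked crossings cancel next to a further crossing of the same two strands. -/
  | moveT (k : ℕ) (x y : R) (m : Bool) :
      MarkedReidemeisterMove [.crossing true k x y, .crossing true k y x, .crossing m k x y]
        [.crossing m k x y]
  /-- The reflections of the above in a vertical line. -/
  | mirror {w w' : List (FrontEvent R)} (h : MarkedReidemeisterMove w w') :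
      MarkedReidemeisterMove (mirrorWord w) (mirrorWord w')

/-- Two fronts with the same borders differ by a single move, performed somewhere inside. -/
def MarkedFront.Move [CommRing R] {a b : List R} (D D' : MarkedFront a b) : Prop :=
  ∃ p w w' s : List (FrontEvent R),
    D.word = p ++ w ++ s ∧ D'.word = p ++ w' ++ s ∧
      (ReidemeisterMove w w' ∨ MarkedReidemeisterMove w w')

/-- Equivalence of marked bordered Legendrian graphs: a finite sequence of moves and their
inverses. -/
def MarkedFront.Equivalent [CommRing R] {a b : List R} : MarkedFront a b → MarkedFront a b → Prop :=
  Relation.EqvGen MarkedFront.Move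

end Moves

/-! ### Matchings and vertex resolutions -/

/-- `f` is a perfect matching on `{0, …, n - 1}`: a fixed point free involution (extended by the
identity to all natural numbers). -/
def IsPerfectMatching (n : ℕ) (f : ℕ → ℕ) : Prop :=
  (∀ i, f (f i) = i) ∧ ∀ i, f i ≠ i ↔ i < n

section Resolution

variable {R : Type} [CommRing R]

/-- `f` is a `ρ`-graded perfect matching of the strands of a slice with potentials `a`: the upper
strand of each pair has potential one more, modulo `ρ`, than the lower one. -/
def IsGradedMatching (ρ : ℤ) (a : List R) (f : ℕ → ℕ) : Prop :=
  IsPerfectMatching a.length f ∧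
    ∀ i, i < f i → (ρ : R) ∣ a.getD i 0 - a.getD (f i) 0 - 1

/-- The half-edges at a vertex with potentials `l` on the left and `r` on the right are labelled
`0, …, r.length - 1` on the right and `r.length, …, r.length + l.length - 1` on the left, each time
from top to bottom. This is the potential of a half-edge. -/
def halfEdgePotential (l r : List R) (t : ℕ) : R :=
  (r ++ l).getD t 0

/-- `φ` is a `ρ`-graded perfect matching of the half-edges at a vertex: modulo `ρ`, two matched
half-edges on opposite sides have the same potential, and of two matched half-edges on the same side
the upper one has potential one more than the lower one. -/
def IsGradedVertexMatching (ρ : ℤ) (l r : List R) (φ : ℕ → ℕ) : Prop :=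
  IsPerfectMatching (r.length + l.length) φ ∧
    ∀ i, i < φ i →
      (φ i < r.length ∨ r.length ≤ i →
        (ρ : R) ∣ halfEdgePotential l r i - halfEdgePotential l r (φ i) - 1) ∧
      (i < r.length ∧ r.length ≤ φ i →
        (ρ : R) ∣ halfEdgePotential l r i - halfEdgePotential l r (φ i))

/-- The marked right cusps for the pairs of `φ` inside the block of labels `s, …, s + n - 1`, in
increasing order of their upper strands; `μ` is the potential of the strand with a given label. For
the pair `{i, φ i}`, `i < φ i`, strand `i` crosses downwards all the strands that are still present
between the two, with marked crossings, and then forms a right cusp with strand `φ i`. -/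
def markedRightCusps (k : ℕ) (μ : ℕ → R) (φ : ℕ → ℕ) (s n : ℕ) : List (FrontEvent R) :=
  (List.range' s n).flatMap fun i =>
    if i < φ i ∧ φ i < s + n then
      let above := (List.range' s (i - s)).filter fun t => φ t < s ∨ s + n ≤ φ t
      let between := (List.range' (i + 1) (φ i - i - 1)).filter fun t =>
        φ t < s ∨ s + n ≤ φ t ∨ i < φ t
      slideDown true (k + above.length) (μ i) (between.map μ) ++
        [.rightCusp (k + above.length + between.length) (μ (φ i))]
    else []

/-- The potentials of a list of strands (target, potential), in increasing order of targets. -/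
def sortedPotentials (st : List (ℕ × R)) : List R :=
  (st.insertionSort fun s t => s.1 ≤ t.1).map Prod.snd

/-- The permutation braid `β` (regular crossings) that sorts a list of strands (target, potential),
listed from top to bottom, by their targets: the strands other than the first one are sorted
first, then the first one descends to its place. -/
def permutationBraid (k : ℕ) : List (ℕ × R) → List (FrontEvent R)
  | [] => []
  | (p, x) :: st =>
      permutationBraid (k + 1) st ++
        slideDown false k x (sortedPotentials (st.filter fun t => t.1 < p))

/-- The right complement `βᶜ` of `β = permutationBraid k st`, for which `β βᶜ` is the half-twist,
with all crossings marked: the strand that is first at the left end of `β` descends to the bottom,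
and the others continue in the same way above it. -/
def complementBraid (k : ℕ) : List (ℕ × R) → List (FrontEvent R)
  | [] => []
  | (p, x) :: st =>
      slideDown true (k + (st.filter fun t => t.1 < p).length) x
          (sortedPotentials (st.filter fun t => p < t.1)) ++
        complementBraid k st

/-- The resolution of a vertex by a perfect matching `φ` of its half-edges: marked right cusps for
the pairs on the left, then `β βᶜ` followed by the mirror of `βᶜ` for the pairs joining left to
right, then marked left cusps for the pairs on the right. -/
def resolveVertex (k : ℕ) (l r : List R) (φ : ℕ → ℕ) : List (FrontEvent R) :=
  let μ := halfEdgePotential l r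
  let st := ((List.range' r.length l.length).filter fun t => φ t < r.length).map
    fun t => (φ t, μ t)
  markedRightCusps k μ φ r.length l.length ++
    (permutationBraid k st ++ complementBraid k st ++ mirrorWord (complementBraid k st)) ++
      mirrorWord (markedRightCusps k μ φ 0 r.length)

/-- The choices for resolving an event: the `ρ`-graded perfect matchings at a vertex, and a single
choice (do nothing) otherwise. -/
def FrontEvent.Resolution (ρ : ℤ) : FrontEvent R → Type
  | .vertex _ l r => {φ : ℕ → ℕ // IsGradedVertexMatching ρ l r φ}
  | _ => Unit

/-- The diagram by which an event is replaced. -/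
def FrontEvent.resolve (ρ : ℤ) : (e : FrontEvent R) → e.Resolution ρ → List (FrontEvent R)
  | .vertex k l r, φ => resolveVertex k l r φ.1
  | .crossing m k x y, _ => [.crossing m k x y]
  | .leftCusp k x, _ => [.leftCusp k x]
  | .rightCusp k x, _ => [.rightCusp k x]

/-- A collection `Φ` of `ρ`-graded perfect matchings, one for each vertex. -/
def FullResolution (ρ : ℤ) : List (FrontEvent R) → Type
  | [] => Unit
  | e :: w => e.Resolution ρ × FullResolution ρ w

/-- The marked Legendrian link diagram obtained by resolving all vertices according to `Φ`. Its
labels represent the induced Maslov potential modulo `ρ`. -/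
def resolveWord (ρ : ℤ) : (w : List (FrontEvent R)) → FullResolution ρ w → List (FrontEvent R)
  | [], _ => []
  | e :: w, Φ => e.resolve ρ Φ.1 ++ resolveWord ρ w Φ.2

/-! ### Normal rulings -/

/-- The embedding of `ℕ` into itself which leaves out `k` and `k + 1`. -/
def skipTwo (k i : ℕ) : ℕ :=
  if i < k then i else i + 2

/-- Non-interlacing at a switched crossing of strands `k` and `k + 1`, in a slice where strands are
paired by `f`: the two paired regions are disjoint (one above, one below) or nested. -/
def NonInterlaced (f : ℕ → ℕ) (k : ℕ) : Prop :=
  (f k < k ∧ k + 1 < f (k + 1)) ∨ (k + 1 < f (k + 1) ∧ f (k + 1) < f k) ∨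
    (f (k + 1) < f k ∧ f k < k)

/-- The condition on a ruling at an event: `f` and `g` pair the strands of the slices before and
after the event into the boundaries of eyes, half-eyes and parallels, and the flag tells whether the
event is a crossing in `𝔯`. At a crossing outside `𝔯` the strands cross, and must not bound the same
region. A crossing in `𝔯` must be regular, of degree divisible by `ρ` and non-interlaced; it is
replaced by its 0-resolution. At a cusp the two branches are paired with each other. -/
inductive RulingStep (ρ : ℤ) : FrontEvent R → Bool → (ℕ → ℕ) → (ℕ → ℕ) → Prop
  | cross (m : Bool) (k : ℕ) (x y : R) (f : ℕ → ℕ) (h : f k ≠ k + 1) :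
      RulingStep ρ (.crossing m k x y) false f
        (fun i => Equiv.swap k (k + 1) (f (Equiv.swap k (k + 1) i)))
  | switch (k : ℕ) (x y : R) (f : ℕ → ℕ) (hg : (ρ : R) ∣ x - y) (hn : NonInterlaced f k) :
      RulingStep ρ (.crossing false k x y) true f f
  | leftCusp (k : ℕ) (x : R) (f g : ℕ → ℕ) (h₁ : g k = k + 1) (h₂ : g (k + 1) = k)
      (h : ∀ i, g (skipTwo k i) = skipTwo k (f i)) :
      RulingStep ρ (.leftCusp k x) false f g
  | rightCusp (k : ℕ) (x : R) (f g : ℕ → ℕ) (h₁ : f k = k + 1) (h₂ : f (k + 1) = k)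
      (h : ∀ i, f (skipTwo k i) = skipTwo k (g i)) :
      RulingStep ρ (.rightCusp k x) false f g

/-- `S` is a `ρ`-graded normal ruling of the link diagram `Λ` with boundary type `(φ, ψ)`. For each
event, `S` tells whether it belongs to `𝔯` and how the strands just after it are paired. -/
def IsNormalRuling (ρ : ℤ) :
    List (FrontEvent R) → List (Bool × (ℕ → ℕ)) → (ℕ → ℕ) → (ℕ → ℕ) → Prop
  | [], [], φ, ψ => φ = ψ
  | e :: Λ, (b, χ) :: S, φ, ψ => RulingStep ρ e b φ χ ∧ IsNormalRuling ρ Λ S χ ψ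
  | _, _, _, _ => False

/-- A `ρ`-graded normal ruling of boundary type `(φ, ψ)` of a marked bordered Legendrian graph: a
normal ruling of one of its full resolutions. -/
structure GraphRuling (ρ : ℤ) {a b : List R} (D : MarkedFront a b) (φ ψ : ℕ → ℕ) : Type where
  resolution : FullResolution ρ D.word
  ruling : List (Bool × (ℕ → ℕ))
  isRuling : IsNormalRuling ρ (resolveWord ρ D.word resolution) ruling φ ψ

/-- The weight `z ^ (#𝔯 - (number of cusps of the resolution) / 2)`, as a Laurent polynomial in the
variable `T 1 = z ^ (1 / 2)`. -/
noncomputable def GraphRuling.weight {ρ : ℤ} {a b : List R} {D : MarkedFront a b} {φ ψ : ℕ → ℕ}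
    (S : GraphRuling ρ D φ ψ) : LaurentPolynomial ℤ :=
  T (2 * (S.ruling.countP (fun s => s.1) : ℤ) -
    ((resolveWord ρ D.word S.resolution).countP FrontEvent.isCusp : ℤ))

/-- The `ρ`-graded ruling polynomial of boundary type `(φ, ψ)`. -/
noncomputable def rulingPolynomial (ρ : ℤ) {a b : List R} (D : MarkedFront a b) (φ ψ : ℕ → ℕ) :
    LaurentPolynomial ℤ :=
  ∑ᶠ S : GraphRuling ρ D φ ψ, S.weight

end Resolution

/-! The weighted count of rulings is a state sum. A ruling is a path of pairings through the slices
of the diagram, so every event acts linearly on functions of pairings (`eventSum`), a vertex through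
the sum over its graded matchings of the operators of its resolutions (`resolvedEventSum`). By
`rulingPolynomial_eq_graphSum` the ruling polynomial is a matrix entry of the composite operator. A
move inside a diagram therefore preserves it once the two local words act alike on the pairings that
can occur (`TransferEq`). All weights are monomials, so equal polynomials mean equally many rulings
of each weight. The weight-preserving bijection follows by counting (`exists_equiv_of_sum_T_eq`),
and no explicit correspondence of rulings is needed.

Operators are computed on chord words, in which matched strands carry equal letters. A crossing
exchanges two neighbouring letters, a cusp inserts or removes a block `c c`, and normality at a
switched crossing of letters `a`, `b` becomes one cyclic condition: reading on below the crossing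
and then from the top, `b` is met before `a` (`nonInterlaced_chordMatching_iff`). Triple points
(`chordSum_triple`) and slides of a strand over a block are then word computations. Three facts
about slides carry the rest: a strand cannot pass its partner, letters occurring twice inside the
block keep their places, and pairs inside the block that are deleted after the slide may be deleted
before it.

In the resolution of a vertex, `β βᶜ` makes any two strands cross, so states with two matched
strands in the braid contribute nothing; on the other states the marked crossings of `βᶜ` and of its
reverse cancel (`chordSum_halfTwist`). A resolved vertex thus deletes the pairs on the left, tests
that the remaining strands are unmatched, applies `β` and inserts the pairs on the right. A strand
slides past each of these, which gives move (IV) in `chordSum_slide_resolveVertex`. For move (V) the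
matchings at the two vertices are the same, and their contributions agree one by one
(`chordSum_resolveVertex_rotate`): an edge matched on its own side closes in a cusp in either
picture, while an edge matched across is forced to be switched exactly once after the turn, and the
weight of this switch compensates that of the two extra cusps.

Reflected moves come from symmetry. The matrix of an event is the transpose of that of its mirror
image, hence the same holds for words (`IsTransfer.eqOn_mirror`); for vertices this rests on
`transferEq_resolveVertex_reflect`.

Far commutation needs the grading: two distant crossings of the same two chords commute only because
both of them may be switched or neither. States are therefore restricted to `gradedPairings`. For a
switch to respect potentials its degree has to vanish, not only modulo `ρ`, so everything is
transported to the quotient by `ρ` (`DetectsDvd`), which changes no operator. -/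

open List hiding swapAt Pairwise nodup_range'

set_option linter.unusedSectionVars false

/-! ### State sums -/

/-- The words of front events over `R`. -/
abbrev Word (R : Type) : Type := List (FrontEvent R)

/-- Laurent polynomials depending on the pairing of the strands of a slice. -/
abbrev StateFun : Type := (ℕ → ℕ) → ℤ[T;T⁻¹]

section Transfer

variable {R : Type} [CommRing R]

/-- The pairing after strands `k` and `k + 1` have crossed. -/
def conjSwap (k : ℕ) (f : ℕ → ℕ) : ℕ → ℕ :=
  fun i => Equiv.swap k (k + 1) (f (Equiv.swap k (k + 1) i))

/-- A left inverse of `skipTwo k`. -/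
def unskipTwo (k i : ℕ) : ℕ := if i < k then i else i - 2

/-- The pairing after a left cusp. -/
def insertPair (k : ℕ) (f : ℕ → ℕ) : ℕ → ℕ :=
  fun i => if i = k then k + 1 else if i = k + 1 then k else skipTwo k (f (unskipTwo k i))

/-- The pairing after a right cusp. -/
def removePair (k : ℕ) (f : ℕ → ℕ) : ℕ → ℕ := fun i => unskipTwo k (f (skipTwo k i))

lemma unskipTwo_skipTwo (k i : ℕ) : unskipTwo k (skipTwo k i) = i := by
  unfold unskipTwo skipTwo; split_ifs <;> omega

lemma skipTwo_unskipTwo {k i : ℕ} (h : i ≠ k) (h' : i ≠ k + 1) :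
    skipTwo k (unskipTwo k i) = i := by
  unfold unskipTwo skipTwo; split_ifs <;> omega

lemma skipTwo_ne (k i : ℕ) : skipTwo k i ≠ k ∧ skipTwo k i ≠ k + 1 := by
  unfold skipTwo; split_ifs <;> omega

/-- The regular crossings at which a ruling may be switched, as far as the degree is concerned. -/
def Switchable (ρ : ℤ) (m : Bool) (x y : R) : Prop := m = false ∧ (ρ : R) ∣ x - y

noncomputable instance (ρ : ℤ) (m : Bool) (x y : R) : Decidable (Switchable ρ m x y) :=
  Classical.dec _

/-- The condition on a pairing to continue through a right cusp. -/
def CuspCondition (k : ℕ) (f : ℕ → ℕ) : Prop :=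
  f k = k + 1 ∧ f (k + 1) = k ∧ ∀ i, f (skipTwo k i) = skipTwo k (removePair k f i)

open Classical in
/-- The weighted sum of the values of `F` at the pairings to which `f` continues through an
event. -/
noncomputable def eventSum (ρ : ℤ) : FrontEvent R → StateFun → StateFun
  | .crossing m k x y, F, f =>
      (if f k = k + 1 then 0 else F (conjSwap k f)) +
        if Switchable ρ m x y ∧ NonInterlaced f k then T 2 * F f else 0
  | .leftCusp k _, F, f => T (-1) * F (insertPair k f)
  | .rightCusp k _, F, f => if CuspCondition k f then T (-1) * F (removePair k f) else 0
  | .vertex _ _ _, _, _ => 0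

/-- The weighted sum of the values of `F` at the pairings to which `f` continues through a link
diagram. -/
noncomputable def wordSum (ρ : ℤ) : Word R → StateFun → StateFun
  | [], F => F
  | e :: w, F => eventSum ρ e (wordSum ρ w F)

@[simp] lemma wordSum_nil (ρ : ℤ) (F : StateFun) :
    wordSum ρ ([] : Word R) F = F := rfl

lemma wordSum_cons (ρ : ℤ) (e : FrontEvent R) (w : Word R) (F : StateFun) :
    wordSum ρ (e :: w) F = eventSum ρ e (wordSum ρ w F) := rfl

lemma wordSum_append (ρ : ℤ) (w w' : Word R) (F : StateFun) :
    wordSum ρ (w ++ w') F = wordSum ρ w (wordSum ρ w' F) := by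
  induction w with
  | nil => rfl
  | cons e w ih => simp [wordSum_cons, ih]

lemma eventSum_sum {ι : Type*} (ρ : ℤ) (e : FrontEvent R) (s : Finset ι) (F : ι → StateFun)
    (f : ℕ → ℕ) :
    eventSum ρ e (fun g => ∑ i ∈ s, F i g) f = ∑ i ∈ s, eventSum ρ e (F i) f := by
  cases e <;> simp only [eventSum]
  · rw [Finset.sum_add_distrib]
    split_ifs <;> simp [Finset.mul_sum]
  · rw [Finset.mul_sum]
  · split_ifs <;> simp [Finset.mul_sum]
  · simp

lemma wordSum_sum {ι : Type*} (ρ : ℤ) (w : Word R) (s : Finset ι) (F : ι → StateFun) (f : ℕ → ℕ) :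
    wordSum ρ w (fun g => ∑ i ∈ s, F i g) f = ∑ i ∈ s, wordSum ρ w (F i) f := by
  induction w generalizing f with
  | nil => rfl
  | cons e w ih =>
    simp only [wordSum_cons]
    rw [← eventSum_sum]
    congr 1
    funext g
    exact ih g

/-! ### Finiteness of the set of rulings -/

/-- The weight of an event in a ruling. -/
noncomputable def stepWeight (e : FrontEvent R) (b : Bool) : ℤ[T;T⁻¹] :=
  T (2 * (if b then 1 else 0) - if e.isCusp then 1 else 0)

/-- A crossing can be crossed or switched, a cusp leaves at most one choice and an unresolved vertex
none. These finite sets of continuations turn the relation `RulingStep` into the operator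
`eventSum`. -/
lemma exists_ruling_steps (ρ : ℤ) (e : FrontEvent R) (f : ℕ → ℕ) :
    ∃ s : Finset (Bool × (ℕ → ℕ)), (∀ p, p ∈ s ↔ RulingStep ρ e p.1 f p.2) ∧
      ∀ F, eventSum ρ e F f = ∑ p ∈ s, stepWeight e p.1 * F p.2 := by
  classical
  cases e with
  | crossing m k x y =>
    refine ⟨(if f k = k + 1 then ∅ else {(false, conjSwap k f)}) ∪
      (if Switchable ρ m x y ∧ NonInterlaced f k then {(true, f)} else ∅), ?_, ?_⟩
    · rintro ⟨b, g⟩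
      constructor
      · intro h
        rw [Finset.mem_union] at h
        rcases h with h | h
        · split_ifs at h with h₁
          · simp at h
          · simp only [Finset.mem_singleton, Prod.mk.injEq] at h
            obtain ⟨rfl, rfl⟩ := h
            exact RulingStep.cross m k x y f h₁
        · split_ifs at h with h₁
          · simp only [Finset.mem_singleton, Prod.mk.injEq] at h
            obtain ⟨rfl, rfl⟩ := h
            obtain ⟨⟨rfl, h₂⟩, h₃⟩ := h₁
            exact RulingStep.switch k x y g h₂ h₃
          · simp at h
      · intro h
        cases h with
        | cross _ _ _ _ _ h => simp [h]; left; rfl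
        | switch _ _ _ _ hg hn =>
          have : Switchable ρ false x y := ⟨rfl, hg⟩
          simp [this, hn]
    · intro F
      rw [Finset.sum_union]
      · simp only [eventSum]
        congr 1
        · split_ifs <;> simp [stepWeight, FrontEvent.isCusp]
        · split_ifs <;> simp [stepWeight, FrontEvent.isCusp]
      · split_ifs <;> simp
  | leftCusp k x =>
    refine ⟨{(false, insertPair k f)}, ?_, ?_⟩
    · rintro ⟨b, g⟩
      simp only [Finset.mem_singleton, Prod.mk.injEq]
      constructor
      · rintro ⟨rfl, rfl⟩
        refine RulingStep.leftCusp k x f _ (by simp [insertPair]) (by simp [insertPair]) ?_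
        intro i
        simp [insertPair, skipTwo_ne, unskipTwo_skipTwo]
      · intro h
        cases h with
        | leftCusp _ _ _ _ h₁ h₂ h =>
          refine ⟨rfl, ?_⟩
          funext i
          unfold insertPair
          split_ifs with h₃ h₄
          · rw [h₃, h₁]
          · rw [h₄, h₂]
          · rw [← h, skipTwo_unskipTwo h₃ h₄]
    · intro F
      simp [eventSum, stepWeight, FrontEvent.isCusp]
  | rightCusp k x =>
    refine ⟨if CuspCondition k f then {(false, removePair k f)} else ∅, ?_, ?_⟩
    · rintro ⟨b, g⟩
      constructor
      · intro h
        split_ifs at h with h₁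
        · simp only [Finset.mem_singleton, Prod.mk.injEq] at h
          obtain ⟨rfl, rfl⟩ := h
          exact RulingStep.rightCusp k x f _ h₁.1 h₁.2.1 h₁.2.2
        · simp at h
      · intro h
        cases h with
        | rightCusp _ _ _ _ h₁ h₂ h =>
          have hg : g = removePair k f := by
            funext i
            rw [removePair, h, unskipTwo_skipTwo]
          subst hg
          have : CuspCondition k f := ⟨h₁, h₂, h⟩
          simp [this]
    · intro F
      simp only [eventSum]
      split_ifs <;> simp [stepWeight, FrontEvent.isCusp]
  | vertex k l r =>
    refine ⟨∅, ?_, fun F => by simp [eventSum]⟩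
    rintro ⟨b, g⟩
    simp only [Finset.notMem_empty, false_iff]
    intro h
    cases h

open Classical in
/-- The indicator function of a boundary pairing. -/
noncomputable def pairingIndicator (ψ : ℕ → ℕ) : StateFun := fun f => if f = ψ then 1 else 0

/-- The weight of a ruling. -/
noncomputable def rulingWeight (Λ : Word R) (S : List (Bool × (ℕ → ℕ))) : ℤ[T;T⁻¹] :=
  T (2 * (S.countP (fun s => s.1) : ℤ) - (Λ.countP FrontEvent.isCusp : ℤ))

lemma rulingWeight_cons (e : FrontEvent R) (Λ : Word R) (p : Bool × (ℕ → ℕ))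
    (S : List (Bool × (ℕ → ℕ))) :
    rulingWeight (e :: Λ) (p :: S) = stepWeight e p.1 * rulingWeight Λ S := by
  unfold rulingWeight stepWeight
  rw [← T_add, countP_cons, countP_cons]
  congr 1
  push_cast
  ring

/-- A ruling is a first step followed by a ruling of the remaining word, and weights multiply; so
sums over rulings compose like operators. -/
lemma exists_rulings (ρ : ℤ) (Λ : Word R) (φ ψ : ℕ → ℕ) :
    ∃ s : Finset (List (Bool × (ℕ → ℕ))), (∀ S, S ∈ s ↔ IsNormalRuling ρ Λ S φ ψ) ∧
      ∑ S ∈ s, rulingWeight Λ S = wordSum ρ Λ (pairingIndicator ψ) φ := by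
  classical
  induction Λ generalizing φ with
  | nil =>
    refine ⟨if φ = ψ then {[]} else ∅, ?_, ?_⟩
    · intro S
      cases S with
      | nil => simp only [IsNormalRuling]; split_ifs with h <;> simp [h]
      | cons p S => simp only [IsNormalRuling]; split_ifs <;> simp
    · simp only [wordSum_nil, pairingIndicator]
      split_ifs <;> simp [rulingWeight]
  | cons e Λ ih =>
    obtain ⟨s, hs, hsum⟩ := exists_ruling_steps ρ e φ
    choose t ht htsum using fun χ => ih χ
    refine ⟨s.biUnion fun p => (t p.2).map ⟨cons p, cons_injective⟩, ?_, ?_⟩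
    · intro S
      cases S with
      | nil => simp [IsNormalRuling]
      | cons p S =>
        obtain ⟨b, χ⟩ := p
        simp only [Finset.mem_biUnion, Finset.mem_map, Function.Embedding.coeFn_mk, cons.injEq,
          IsNormalRuling, ht, hs]
        constructor
        · rintro ⟨p, hp, S', hS', rfl, rfl⟩
          exact ⟨hp, hS'⟩
        · rintro ⟨h₁, h₂⟩
          exact ⟨(b, χ), h₁, S, h₂, rfl, rfl⟩
    · rw [Finset.sum_biUnion]
      · simp only [Finset.sum_map, Function.Embedding.coeFn_mk, rulingWeight_cons]
        rw [wordSum_cons, hsum]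
        refine Finset.sum_congr rfl fun p _ => ?_
        rw [← Finset.mul_sum, htsum]
      · intro p _ q _ hpq
        simp only [Function.onFun, Finset.disjoint_left, Finset.mem_map,
          Function.Embedding.coeFn_mk, not_exists, not_and]
        rintro _ ⟨S, _, rfl⟩ S' _ h
        exact hpq (cons.inj h).1.symm

/-- A matching fixes everything from `n` on, so its restriction to `Fin (n + 1)` determines it.
Truncation at `n` makes the target finite for every function and loses nothing on matchings. -/
lemma finite_isPerfectMatching (n : ℕ) : {f : ℕ → ℕ | IsPerfectMatching n f}.Finite := by
  refine Set.Finite.of_finite_image (f := fun f (i : Fin (n + 1)) => min (f i) n)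
    ((Set.Finite.pi' (t := fun _ => Set.Iic n) fun _ => Set.finite_Iic n).subset ?_) ?_
  · rintro _ ⟨f, _, rfl⟩ i
    simp
  · intro f hf g hg hfg
    funext i
    by_cases hi : i < n
    · have h₁ : f i < n := by
        rw [← hf.2, hf.1]
        exact fun h => (hf.2 i).2 hi h.symm
      have h₂ : g i < n := by
        rw [← hg.2, hg.1]
        exact fun h => (hg.2 i).2 hi h.symm
      have := congrFun hfg ⟨i, by omega⟩
      simp only at this
      omega
    · have h₁ : f i = i := by
        by_contra h; exact hi ((hf.2 i).1 h)
      have h₂ : g i = i := by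
        by_contra h; exact hi ((hg.2 i).1 h)
      rw [h₁, h₂]

instance finite_resolution (ρ : ℤ) (e : FrontEvent R) : Finite (e.Resolution ρ) := by
  cases e with
  | vertex k l r =>
    exact ((finite_isPerfectMatching (r.length + l.length)).subset
      (t := {φ | IsGradedVertexMatching ρ l r φ}) fun f hf => hf.1).to_subtype
  | crossing m k x y => exact inferInstanceAs (Finite Unit)
  | leftCusp k x => exact inferInstanceAs (Finite Unit)
  | rightCusp k x => exact inferInstanceAs (Finite Unit)

instance finite_fullResolution (ρ : ℤ) : (w : Word R) → Finite (FullResolution ρ w)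
  | [] => inferInstanceAs (Finite Unit)
  | e :: w =>
    have := finite_fullResolution ρ w
    inferInstanceAs (Finite (e.Resolution ρ × FullResolution ρ w))

noncomputable instance fintype_resolution (ρ : ℤ) (e : FrontEvent R) :
    Fintype (e.Resolution ρ) := Fintype.ofFinite _

noncomputable instance fintype_fullResolution (ρ : ℤ) (w : Word R) :
    Fintype (FullResolution ρ w) := Fintype.ofFinite _

/-- The sum of the state sums of the resolutions of an event. -/
noncomputable def resolvedEventSum (ρ : ℤ) (e : FrontEvent R) (F : StateFun)
    (f : ℕ → ℕ) : ℤ[T;T⁻¹] := ∑ a : e.Resolution ρ, wordSum ρ (e.resolve ρ a) F f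

/-- The state sum of a front of a Legendrian graph. -/
noncomputable def graphSum (ρ : ℤ) : Word R → StateFun → StateFun
  | [], F => F
  | e :: w, F => resolvedEventSum ρ e (graphSum ρ w F)

@[simp] lemma graphSum_nil (ρ : ℤ) (F : StateFun) :
    graphSum ρ ([] : Word R) F = F := rfl

lemma graphSum_cons (ρ : ℤ) (e : FrontEvent R) (w : Word R) (F : StateFun) :
    graphSum ρ (e :: w) F = resolvedEventSum ρ e (graphSum ρ w F) := rfl

/-- By linearity of `wordSum`, the sums over the resolutions of later vertices can be pulled out of
the earlier operators. -/
lemma graphSum_eq_sum (ρ : ℤ) (w : Word R) (F : StateFun) (f : ℕ → ℕ) :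
    graphSum ρ w F f = ∑ Φ : FullResolution ρ w, wordSum ρ (resolveWord ρ w Φ) F f := by
  induction w generalizing f with
  | nil =>
    have : ∀ Φ : FullResolution ρ ([] : Word R),
        wordSum ρ (resolveWord ρ [] Φ) F f = F f := fun _ => rfl
    simp only [this, graphSum_nil, Finset.sum_const, Finset.card_univ]
    have : Fintype.card (FullResolution ρ ([] : Word R)) = 1 := by
      rw [Fintype.card_eq_one_iff]
      exact ⟨(), fun _ => rfl⟩
    simp [this]
  | cons e w ih =>
    have key : ∑ Φ : FullResolution ρ (e :: w), wordSum ρ (resolveWord ρ (e :: w) Φ) F f =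
        ∑ p : e.Resolution ρ × FullResolution ρ w,
          wordSum ρ (e.resolve ρ p.1 ++ resolveWord ρ w p.2) F f := by
      let E : FullResolution ρ (e :: w) ≃ e.Resolution ρ × FullResolution ρ w := Equiv.refl _
      exact Fintype.sum_equiv E _ (fun p => wordSum ρ (e.resolve ρ p.1 ++ resolveWord ρ w p.2) F f)
        fun Φ => rfl
    rw [key, graphSum_cons, resolvedEventSum, Fintype.sum_prod_type]
    refine Finset.sum_congr rfl fun a _ => ?_
    have : graphSum ρ w F = fun g => ∑ Φ : FullResolution ρ w, wordSum ρ (resolveWord ρ w Φ) F g :=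
      funext ih
    rw [this, wordSum_sum]
    simp only [wordSum_append]

/-- Graph rulings, as pairs of a resolution and a ruling of it. -/
def graphRulingEquiv (ρ : ℤ) {a b : List R} (D : MarkedFront a b) (φ ψ : ℕ → ℕ) :
    GraphRuling ρ D φ ψ ≃
      Σ Φ : FullResolution ρ D.word, {S // IsNormalRuling ρ (resolveWord ρ D.word Φ) S φ ψ} where
  toFun S := ⟨S.resolution, S.ruling, S.isRuling⟩
  invFun p := ⟨p.1, p.2.1, p.2.2⟩
  left_inv _ := rfl
  right_inv _ := rfl

lemma finite_normalRuling (ρ : ℤ) (Λ : Word R) (φ ψ : ℕ → ℕ) :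
    Finite {S // IsNormalRuling ρ Λ S φ ψ} := by
  obtain ⟨s, hs, -⟩ := exists_rulings ρ Λ φ ψ
  exact (s.finite_toSet.subset (s := s) (t := {S | IsNormalRuling ρ Λ S φ ψ})
    fun S hS => (hs S).2 hS).to_subtype

lemma finite_graphRuling (ρ : ℤ) {a b : List R} (D : MarkedFront a b) (φ ψ : ℕ → ℕ) :
    Finite (GraphRuling ρ D φ ψ) := by
  have := fun Φ : FullResolution ρ D.word => finite_normalRuling ρ (resolveWord ρ D.word Φ) φ ψ
  exact Finite.of_equiv _ (graphRulingEquiv ρ D φ ψ).symm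

/-- This is the bridge from rulings to operators; from here on invariance is a statement about
`graphSum`. -/
lemma rulingPolynomial_eq_graphSum (ρ : ℤ) {a b : List R} (D : MarkedFront a b) (φ ψ : ℕ → ℕ) :
    rulingPolynomial ρ D φ ψ = graphSum ρ D.word (pairingIndicator ψ) φ := by
  classical
  have := fun Φ : FullResolution ρ D.word => finite_normalRuling ρ (resolveWord ρ D.word Φ) φ ψ
  have := fun Φ : FullResolution ρ D.word =>
    Fintype.ofFinite {S // IsNormalRuling ρ (resolveWord ρ D.word Φ) S φ ψ}
  have := finite_graphRuling ρ D φ ψ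
  have := Fintype.ofFinite (GraphRuling ρ D φ ψ)
  rw [rulingPolynomial, finsum_eq_sum_of_fintype, graphSum_eq_sum,
    Fintype.sum_equiv (graphRulingEquiv ρ D φ ψ) (fun S => S.weight)
      (fun p => rulingWeight (resolveWord ρ D.word p.1) p.2.1) fun S => rfl, Fintype.sum_sigma]
  refine Finset.sum_congr rfl fun Φ _ => ?_
  obtain ⟨s, hs, hsum⟩ := exists_rulings ρ (resolveWord ρ D.word Φ) φ ψ
  rw [← hsum]
  exact (Finset.sum_subtype s hs (rulingWeight (resolveWord ρ D.word Φ))).symm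

/-- A sum of monomials remembers how often each exponent occurs, which is what makes the bijection a
matter of counting. -/
lemma coeff_sum_T {γ : Type*} [Fintype γ] (s : γ → ℤ) (n : ℤ) :
    (∑ c, (T (s c) : ℤ[T;T⁻¹])).coeff n = (Nat.card {c // s c = n} : ℤ) := by
  classical
  rw [Nat.card_eq_fintype_card, Fintype.card_subtype, Finset.card_filter,
    AddMonoidAlgebra.coeff_sum, Finsupp.finsetSum_apply]
  simp only [T_apply, Nat.cast_sum, Nat.cast_ite, Nat.cast_one, Nat.cast_zero]

/-- Two finite families of powers of `T` with the same sum correspond to each other. -/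
lemma exists_equiv_of_sum_T_eq {α β : Type*} [Finite α] [Finite β] (p : α → ℤ) (q : β → ℤ)
    (h : ∑ᶠ a, (T (p a) : ℤ[T;T⁻¹]) = ∑ᶠ b, T (q b)) : ∃ F : α ≃ β, ∀ a, q (F a) = p a := by
  classical
  have := Fintype.ofFinite α
  have := Fintype.ofFinite β
  rw [finsum_eq_sum_of_fintype, finsum_eq_sum_of_fintype] at h
  have hcard : ∀ n, Nonempty ({a // p a = n} ≃ {b // q b = n}) := by
    intro n
    refine ⟨(Finite.equivFinOfCardEq rfl).trans (Finite.equivFinOfCardEq ?_).symm⟩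
    have h₁ := congrArg (fun P : ℤ[T;T⁻¹] => P.coeff n) h
    rw [coeff_sum_T, coeff_sum_T] at h₁
    exact_mod_cast h₁.symm
  refine ⟨(Equiv.sigmaFiberEquiv p).symm.trans
    ((Equiv.sigmaCongrRight fun n => (hcard n).some).trans (Equiv.sigmaFiberEquiv q)), ?_⟩
  intro a
  exact ((hcard (p a)).some ⟨a, rfl⟩).2

lemma exists_weight_preserving_equiv (ρ : ℤ) {a b : List R} (D D' : MarkedFront a b) (φ ψ : ℕ → ℕ)
    (h : rulingPolynomial ρ D φ ψ = rulingPolynomial ρ D' φ ψ) :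
    ∃ F : GraphRuling ρ D φ ψ ≃ GraphRuling ρ D' φ ψ, ∀ S, (F S).weight = S.weight := by
  have := finite_graphRuling ρ D φ ψ
  have := finite_graphRuling ρ D' φ ψ
  obtain ⟨F, hF⟩ := exists_equiv_of_sum_T_eq
    (fun S : GraphRuling ρ D φ ψ => 2 * (S.ruling.countP (fun s => s.1) : ℤ) -
      ((resolveWord ρ D.word S.resolution).countP FrontEvent.isCusp : ℤ))
    (fun S : GraphRuling ρ D' φ ψ => 2 * (S.ruling.countP (fun s => s.1) : ℤ) -
      ((resolveWord ρ D'.word S.resolution).countP FrontEvent.isCusp : ℤ)) h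
  exact ⟨F, fun S => congrArg T (hF S)⟩

/-! ### Chord words

A perfect matching of `{0, …, n - 1}` is coded by a word of length `n` in which every letter occurs
exactly twice: matched elements carry equal letters. -/

/-- Every letter of the word occurs exactly twice. -/
def IsChordWord (L : List ℕ) : Prop := ∀ a ∈ L, L.count a = 2

/-- The pairing `f` matches the positions with equal letters, and is the identity beyond `L`. -/
def Codes (L : List ℕ) (f : ℕ → ℕ) : Prop :=
  ∀ i j, f i = j ↔ (i = j ∧ L.length ≤ i) ∨ (i ≠ j ∧ i < L.length ∧ L[i]? = L[j]?)

open Classical in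
/-- The pairing of the positions of a chord word. -/
noncomputable def chordMatching (L : List ℕ) : ℕ → ℕ := fun i =>
  if h : ∃ j, i ≠ j ∧ i < L.length ∧ L[i]? = L[j]? then h.choose else i

lemma Codes.unique {L : List ℕ} {f g : ℕ → ℕ} (hf : Codes L f) (hg : Codes L g) : f = g := by
  funext i
  exact (hf i (g i)).2 ((hg i (g i)).1 rfl)

lemma Codes.symm_iff {L : List ℕ} {f : ℕ → ℕ} (hf : Codes L f) (i j : ℕ) :
    f i = j ↔ f j = i := by
  rw [hf, hf]
  have key : ∀ i j, ((i = j ∧ L.length ≤ i) ∨ (i ≠ j ∧ i < L.length ∧ L[i]? = L[j]?)) →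
      (j = i ∧ L.length ≤ j) ∨ (j ≠ i ∧ j < L.length ∧ L[j]? = L[i]?) := by
    rintro i j (⟨rfl, h⟩ | ⟨h₁, h₂, h₃⟩)
    · exact Or.inl ⟨rfl, h⟩
    · refine Or.inr ⟨h₁.symm, ?_, h₃.symm⟩
      by_contra h
      rw [getElem?_eq_none (not_lt.1 h), getElem?_eq_getElem h₂] at h₃
      simp at h₃
  exact ⟨key i j, key j i⟩

lemma getElem?_ne_of_notMem {α : Type*} {l : List α} {a : α} (h : a ∉ l) (i : ℕ) :
    l[i]? ≠ some a := fun h' => h (mem_of_getElem? h')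

lemma exists_split_of_count_eq_two {L : List ℕ} {a : ℕ} (h : L.count a = 2) :
    ∃ l₁ l₂ l₃, L = l₁ ++ a :: (l₂ ++ a :: l₃) ∧ a ∉ l₁ ∧ a ∉ l₂ ∧ a ∉ l₃ := by
  have h₁ : a ∈ L := count_pos_iff.1 (by omega)
  obtain ⟨l₁, m, rfl, hl₁⟩ := eq_append_cons_of_mem h₁
  have h₂ : m.count a = 1 := by
    simp [count_append, count_eq_zero_of_not_mem hl₁] at h
    omega
  have h₃ : a ∈ m := count_pos_iff.1 (by omega)
  obtain ⟨l₂, l₃, rfl, hl₂⟩ := eq_append_cons_of_mem h₃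
  refine ⟨l₁, l₂, l₃, rfl, hl₁, hl₂, ?_⟩
  simp [count_append, count_eq_zero_of_not_mem hl₂] at h₂
  exact count_eq_zero.1 h₂

lemma getElem?_two_split {l₁ l₂ l₃ : List ℕ} {a : ℕ} (h₁ : a ∉ l₁) (h₂ : a ∉ l₂) (h₃ : a ∉ l₃)
    (i : ℕ) : (l₁ ++ a :: (l₂ ++ a :: l₃))[i]? = some a ↔
      i = l₁.length ∨ i = l₁.length + 1 + l₂.length := by
  constructor
  · intro h
    rw [getElem?_append] at h
    split_ifs at h with h'
    · exact absurd h (getElem?_ne_of_notMem h₁ _)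
    · rw [getElem?_cons] at h
      split_ifs at h with h''
      · omega
      · rw [getElem?_append] at h
        split_ifs at h with h₄
        · exact absurd h (getElem?_ne_of_notMem h₂ _)
        · rw [getElem?_cons] at h
          split_ifs at h with h₅
          · omega
          · exact absurd h (getElem?_ne_of_notMem h₃ _)
  · rintro (rfl | rfl)
    · simp
    · rw [getElem?_append_right (by omega), getElem?_cons, if_neg (by omega),
        getElem?_append_right (by omega), getElem?_cons, if_pos (by omega)]

lemma codes_chordMatching {L : List ℕ} (hL : IsChordWord L) : Codes L (chordMatching L) := by
  intro i j
  unfold chordMatching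
  by_cases hi : i < L.length
  · have ha : L[i]? = some L[i] := getElem?_eq_getElem hi
    obtain ⟨l₁, l₂, l₃, h, h₁, h₂, h₃⟩ := exists_split_of_count_eq_two (hL L[i] (getElem_mem hi))
    have key := getElem?_two_split h₁ h₂ h₃
    rw [← h] at key
    have hex : ∃ j, i ≠ j ∧ i < L.length ∧ L[i]? = L[j]? := by
      rcases (key i).1 ha with h' | h'
      · exact ⟨l₁.length + 1 + l₂.length, by omega, hi, by rw [ha, (key _).2 (Or.inr rfl)]⟩
      · exact ⟨l₁.length, by omega, hi, by rw [ha, (key _).2 (Or.inl rfl)]⟩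
    rw [dif_pos hex]
    obtain ⟨c₁, c₂, c₃⟩ := hex.choose_spec
    generalize hex.choose = c at *
    constructor
    · rintro rfl
      exact Or.inr ⟨c₁, c₂, c₃⟩
    · rintro (⟨_, h'⟩ | ⟨d₁, d₂, d₃⟩)
      · omega
      · have k₁ := (key i).1 ha
        have k₂ := (key c).1 (by rw [← c₃, ha])
        have k₃ := (key j).1 (by rw [← d₃, ha])
        omega
  · rw [dif_neg (by rintro ⟨j, _, h, _⟩; exact hi h)]
    constructor
    · rintro rfl
      exact Or.inl ⟨rfl, not_lt.1 hi⟩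
    · rintro (⟨h, _⟩ | ⟨_, h, _⟩)
      · exact h
      · exact absurd h hi

lemma Codes.isPerfectMatching {L : List ℕ} {f : ℕ → ℕ} (hf : Codes L f) :
    IsPerfectMatching L.length f := by
  refine ⟨fun i => (hf.symm_iff i (f i)).1 rfl, fun i => ?_⟩
  constructor
  · intro h
    by_contra h'
    exact h ((hf i i).2 (Or.inl ⟨rfl, not_lt.1 h'⟩))
  · intro h h'
    rcases (hf i i).1 h' with h'' | h''
    · omega
    · exact h''.1 rfl

lemma isPerfectMatching_chordMatching {L : List ℕ} (hL : IsChordWord L) :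
    IsPerfectMatching L.length (chordMatching L) := (codes_chordMatching hL).isPerfectMatching

lemma Codes.chordMatching_eq {L : List ℕ} {f : ℕ → ℕ} (hf : Codes L f) (hL : IsChordWord L) :
    chordMatching L = f := (codes_chordMatching hL).unique hf

lemma IsPerfectMatching.apply_lt_iff {n : ℕ} {f : ℕ → ℕ} (hf : IsPerfectMatching n f) {i : ℕ} :
    f i < n ↔ i < n := by
  have key : ∀ i, i < n → f i < n := fun i hi => by
    rw [← hf.2, hf.1]
    exact fun h => (hf.2 i).2 hi h.symm
  exact ⟨fun h => hf.1 i ▸ key _ h, key i⟩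

/-- Every perfect matching is coded by a chord word. -/
lemma IsPerfectMatching.exists_chordWord {n : ℕ} {f : ℕ → ℕ} (hf : IsPerfectMatching n f) :
    ∃ L, IsChordWord L ∧ L.length = n ∧ chordMatching L = f := by
  classical
  -- Each pair is named after its smaller element.
  set L := (range n).map fun i => min i (f i) with hLdef
  have hlen : L.length = n := by simp [hLdef]
  have hinj : ∀ i j, min i (f i) = min j (f j) → i = j ∨ j = f i := by
    intro i j h
    have h₁ := hf.1 i
    have h₂ := hf.1 j
    rcases le_total i (f i) with h₃ | h₃ <;> rcases le_total j (f j) with h₄ | h₄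
    · rw [min_eq_left h₃, min_eq_left h₄] at h; exact Or.inl h
    · rw [min_eq_left h₃, min_eq_right h₄] at h; right; rw [h, h₂]
    · rw [min_eq_right h₃, min_eq_left h₄] at h; right; exact h.symm
    · rw [min_eq_right h₃, min_eq_right h₄] at h; left; rw [← h₁, h, h₂]
  have hget : ∀ i, i < n → L[i]? = some (min i (f i)) := by
    intro i hi
    simp [hLdef, hi]
  have hcode : Codes L f := by
    intro i j
    rw [hlen]
    by_cases hi : i < n
    · constructor
      · rintro rfl
        right
        refine ⟨((hf.2 i).2 hi).symm, hi, ?_⟩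
        rw [hget i hi, hget _ (hf.apply_lt_iff.2 hi), hf.1, min_comm]
      · rintro (⟨_, h⟩ | ⟨h₁, h₂, h₃⟩)
        · omega
        · rw [hget i hi] at h₃
          have hj : j < n := by
            rw [← hlen]
            by_contra h
            rw [getElem?_eq_none (not_lt.1 h)] at h₃
            simp at h₃
          rw [hget j hj, Option.some.injEq] at h₃
          rcases hinj i j h₃ with h | h
          · exact absurd h h₁
          · exact h.symm
    · have : f i = i := by
        by_contra h; exact hi ((hf.2 i).1 h)
      rw [this]
      constructor
      · rintro rfl; exact Or.inl ⟨rfl, not_lt.1 hi⟩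
      · rintro (⟨h, _⟩ | ⟨_, h, _⟩)
        · exact h
        · exact absurd h hi
  have hL : IsChordWord L := by
    intro a ha
    simp only [hLdef, mem_map, mem_range] at ha
    obtain ⟨i, hi, rfl⟩ := ha
    rw [hLdef, count, countP_map, countP_eq_length_filter,
      ← toFinset_card_of_nodup (Nodup.filter _ nodup_range)]
    rw [show (filter ((fun x => x == min i (f i)) ∘ fun i => min i (f i))
      (range n)).toFinset = {i, f i} from ?_]
    · exact Finset.card_pair ((hf.2 i).2 hi).symm
    · ext j
      simp only [Function.comp_apply, toFinset_filter, beq_iff_eq, Finset.mem_filter, mem_toFinset,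
        mem_range, Finset.mem_insert, Finset.mem_singleton]
      constructor
      · rintro ⟨_, h⟩
        rcases hinj i j h.symm with h | h
        · exact Or.inl h.symm
        · exact Or.inr h
      · rintro (rfl | rfl)
        · exact ⟨hi, rfl⟩
        · exact ⟨hf.apply_lt_iff.2 hi, by rw [hf.1, min_comm]⟩
  exact ⟨L, hL, hlen, hcode.chordMatching_eq hL⟩

lemma IsChordWord.perm {L L' : List ℕ} (hL : IsChordWord L) (h : L.Perm L') : IsChordWord L' :=
  fun a ha => by rw [← h.count_eq]; exact hL a (h.mem_iff.2 ha)

lemma isChordWord_of_count {L : List ℕ} (h : ∀ a, L.count a = 0 ∨ L.count a = 2) :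
    IsChordWord L := fun a ha => (h a).resolve_left (by simpa [count_eq_zero] using ha)

lemma IsChordWord.count {L : List ℕ} (hL : IsChordWord L) (a : ℕ) :
    L.count a = 0 ∨ L.count a = 2 := by
  by_cases h : a ∈ L
  · exact Or.inr (hL a h)
  · exact Or.inl (count_eq_zero_of_not_mem h)

lemma IsChordWord.map {L : List ℕ} (hL : IsChordWord L) {σ : ℕ → ℕ} (hσ : Function.Injective σ) :
    IsChordWord (L.map σ) := by
  intro a ha
  obtain ⟨b, hb, rfl⟩ := mem_map.1 ha
  rw [count_map_of_injective _ _ hσ]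
  exact hL b hb

lemma chordMatching_map {L : List ℕ} (hL : IsChordWord L) {σ : ℕ → ℕ} (hσ : Function.Injective σ) :
    chordMatching (L.map σ) = chordMatching L := by
  refine Codes.chordMatching_eq ?_ (hL.map hσ)
  intro i j
  rw [codes_chordMatching hL i j, length_map, getElem?_map, getElem?_map,
    (Option.map_injective hσ).eq_iff]

/-! ### Events in terms of chord words -/

/-- The letters `a` and `b` of a word. -/
def lettersOf (a b : ℕ) (l : List ℕ) : List ℕ := l.filter fun c => c = a ∨ c = b

lemma lettersOf_append (a b : ℕ) (l l' : List ℕ) :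
    lettersOf a b (l ++ l') = lettersOf a b l ++ lettersOf a b l' := filter_append ..

lemma lettersOf_nil (a b : ℕ) : lettersOf a b [] = [] := rfl

lemma lettersOf_cons (a b c : ℕ) (l : List ℕ) :
    lettersOf a b (c :: l) = if c = a ∨ c = b then c :: lettersOf a b l else lettersOf a b l := by
  simp [lettersOf, filter_cons]

lemma lettersOf_eq_singleton {s c : ℕ} {l : List ℕ} (hs : l.count s = 1) (hc : c ∉ l) :
    lettersOf s c l = [s] := by
  rw [← replicate_one, ← hs, ← filter_beq]
  exact filter_congr fun t ht => by
    have : t ≠ c := fun h => hc (h ▸ ht)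
    rw [Bool.eq_iff_iff]
    simp [this]

lemma lettersOf_eq_nil {a b : ℕ} {l : List ℕ} (ha : a ∉ l) (hb : b ∉ l) :
    lettersOf a b l = [] := by
  rw [lettersOf, filter_eq_nil_iff]
  rintro c hc
  simp only [decide_eq_true_eq, not_or]
  exact ⟨fun h => ha (h ▸ hc), fun h => hb (h ▸ hc)⟩

lemma mem_lettersOf {a b c : ℕ} {l : List ℕ} :
    c ∈ lettersOf a b l ↔ c ∈ l ∧ (c = a ∨ c = b) := by simp [lettersOf]

lemma getElem?_swap (u v : List ℕ) (a b i : ℕ) :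
    (u ++ b :: a :: v)[i]? = (u ++ a :: b :: v)[Equiv.swap u.length (u.length + 1) i]? := by
  rcases eq_or_ne i u.length with rfl | h
  · simp
  rcases eq_or_ne i (u.length + 1) with rfl | h'
  · simp
  rw [Equiv.swap_apply_of_ne_of_ne h h', getElem?_append, getElem?_append]
  split_ifs with h₁
  · rfl
  · obtain ⟨j, rfl⟩ : ∃ j, i = u.length + 2 + j := ⟨i - u.length - 2, by omega⟩
    rw [show u.length + 2 + j - u.length = j + 2 by omega]
    rfl

lemma swap_lt_iff {k n : ℕ} (hk : k + 1 < n) (i : ℕ) :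
    Equiv.swap k (k + 1) i < n ↔ i < n := by
  rw [Equiv.swap_apply_def]; split_ifs <;> omega

lemma IsChordWord.swap {u v : List ℕ} {a b : ℕ} (h : IsChordWord (u ++ a :: b :: v)) :
    IsChordWord (u ++ b :: a :: v) := h.perm ((Perm.swap b a v).append_left u)

lemma conjSwap_chordMatching {u v : List ℕ} {a b : ℕ} (h : IsChordWord (u ++ a :: b :: v)) :
    conjSwap u.length (chordMatching (u ++ a :: b :: v)) = chordMatching (u ++ b :: a :: v) := by
  refine (Codes.chordMatching_eq (L := u ++ b :: a :: v) ?_ h.swap).symm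
  intro i j
  have h₁ := codes_chordMatching h
  unfold conjSwap
  rw [Equiv.swap_apply_eq_iff, h₁, getElem?_swap u v a b i, getElem?_swap u v a b j]
  have hlen : (u ++ b :: a :: v).length = (u ++ a :: b :: v).length := by simp
  have hk : u.length + 1 < (u ++ a :: b :: v).length := by simp
  rw [hlen, swap_lt_iff hk, (Equiv.injective _).eq_iff, ← not_lt, swap_lt_iff hk,
    (Equiv.injective _).ne_iff, not_lt]

lemma chordMatching_eq_succ_iff {u v : List ℕ} {a b : ℕ} (h : IsChordWord (u ++ a :: b :: v)) :
    chordMatching (u ++ a :: b :: v) u.length = u.length + 1 ↔ a = b := by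
  rw [codes_chordMatching h]
  simp

lemma chordMatching_of_split {l₁ l₂ l₃ : List ℕ} {a : ℕ}
    (h : IsChordWord (l₁ ++ a :: (l₂ ++ a :: l₃))) :
    chordMatching (l₁ ++ a :: (l₂ ++ a :: l₃)) l₁.length = l₁.length + 1 + l₂.length ∧
    chordMatching (l₁ ++ a :: (l₂ ++ a :: l₃)) (l₁.length + 1 + l₂.length) = l₁.length := by
  have h₁ : chordMatching (l₁ ++ a :: (l₂ ++ a :: l₃)) l₁.length = l₁.length + 1 + l₂.length := by
    rw [codes_chordMatching h]
    right
    refine ⟨by omega, by simp, ?_⟩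
    rw [getElem?_append_right le_rfl, getElem?_append_right (by omega)]
    rw [show l₁.length + 1 + l₂.length - l₁.length = l₂.length + 1 by omega]
    simp
  exact ⟨h₁, ((codes_chordMatching h).symm_iff _ _).1 h₁⟩

lemma chordMatching_right {u v v₁ v₂ : List ℕ} {a : ℕ} (hv : v = v₁ ++ a :: v₂)
    (h : IsChordWord (u ++ a :: v)) :
    chordMatching (u ++ a :: v) u.length = u.length + 1 + v₁.length := by
  subst hv
  exact (chordMatching_of_split h).1

lemma chordMatching_left {u v u₁ u₂ : List ℕ} {a : ℕ} (hu : u = u₁ ++ a :: u₂)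
    (h : IsChordWord (u ++ a :: v)) :
    chordMatching (u ++ a :: v) u.length = u₁.length := by
  subst hu
  have h' : IsChordWord (u₁ ++ a :: (u₂ ++ a :: v)) := by simpa using h
  simpa [Nat.add_assoc, Nat.add_comm 1] using (chordMatching_of_split h').2

lemma count_le_one_of_isChordWord {u v : List ℕ} {a b : ℕ} (h : IsChordWord (u ++ a :: b :: v))
    (hab : a ≠ b) :
    (v ++ u).count a = 1 ∧ (v ++ u).count b = 1 := by
  have h₁ := h a (by simp)
  have h₂ := h b (by simp)
  simp [count_append, hab, hab.symm] at h₁ h₂ ⊢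
  omega

/-- The three alternatives of `NonInterlaced` are the three ways in which the cyclic reading `v ++
u`, starting just below the crossing, can meet `b` before `a`: both partners below, the partner of
`a` above and that of `b` below, or both above. The proof locates the two partners in `u` and `v`
and compares positions in each case. -/
lemma nonInterlaced_chordMatching_iff {u v : List ℕ} {a b : ℕ}
    (h : IsChordWord (u ++ a :: b :: v)) :
    NonInterlaced (chordMatching (u ++ a :: b :: v)) u.length ↔
      lettersOf a b (v ++ u) = [b, a] := by
  rcases eq_or_ne a b with rfl | hab
  · have h₁ := (chordMatching_eq_succ_iff h).2 rfl
    have h₂ := ((codes_chordMatching h).symm_iff _ _).1 h₁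
    constructor
    · intro h₃
      unfold NonInterlaced at h₃
      rw [h₁, h₂] at h₃
      omega
    · intro h₃
      have h₄ : a ∈ lettersOf a a (v ++ u) := by simp [h₃]
      have h₅ := (mem_lettersOf.1 h₄).1
      have h₆ := h a (by simp)
      have h₇ := count_pos_iff.2 h₅
      rw [count_append] at h₆ h₇
      simp only [count_cons_self] at h₆
      omega
  · obtain ⟨ha, hb⟩ := count_le_one_of_isChordWord h hab
    have h' : IsChordWord ((u ++ [a]) ++ b :: v) := by simpa using h
    have e : (u ++ [a]) ++ b :: v = u ++ a :: b :: v := by simp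
    have el : (u ++ [a]).length = u.length + 1 := by simp
    -- positions of the partners
    have ra : ∀ v₁ v₂, v = v₁ ++ a :: v₂ →
        chordMatching (u ++ a :: b :: v) u.length = u.length + 2 + v₁.length := by
      intro v₁ v₂ hv
      have := chordMatching_right (u := u) (v := b :: v) (v₁ := b :: v₁) (v₂ := v₂) (a := a)
        (by simp [hv]) h
      rw [this, length_cons]; omega
    have rb : ∀ v₁ v₂, v = v₁ ++ b :: v₂ →
        chordMatching (u ++ a :: b :: v) (u.length + 1) = u.length + 2 + v₁.length := by
      intro v₁ v₂ hv
      have := chordMatching_right hv h'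
      rw [e, el] at this
      rw [this]
    have la : ∀ u₁ u₂, u = u₁ ++ a :: u₂ →
        chordMatching (u ++ a :: b :: v) u.length = u₁.length := fun u₁ u₂ hu =>
      chordMatching_left hu h
    have lb : ∀ u₁ u₂, u = u₁ ++ b :: u₂ →
        chordMatching (u ++ a :: b :: v) (u.length + 1) = u₁.length := by
      intro u₁ u₂ hu
      have := chordMatching_left (u₁ := u₁) (u₂ := u₂ ++ [a]) (by simp [hu]) h'
      rw [e, el] at this
      exact this
    have hal : ∀ l₁ l₂, v ++ u = l₁ ++ a :: l₂ → a ∉ l₁ ∧ a ∉ l₂ := by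
      intro l₁ l₂ hl
      rw [hl] at ha
      simp only [count_append, count_cons_self] at ha
      exact ⟨count_eq_zero.1 (by omega), count_eq_zero.1 (by omega)⟩
    have hbl : ∀ l₁ l₂, v ++ u = l₁ ++ b :: l₂ → b ∉ l₁ ∧ b ∉ l₂ := by
      intro l₁ l₂ hl
      rw [hl] at hb
      simp only [count_append, count_cons_self] at hb
      exact ⟨count_eq_zero.1 (by omega), count_eq_zero.1 (by omega)⟩
    have order : ∀ l₁ l₂ l₃, v ++ u = l₁ ++ a :: (l₂ ++ b :: l₃) →
        lettersOf a b (v ++ u) = [a, b] := by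
      intro l₁ l₂ l₃ hl
      have h₁ := hal l₁ _ hl
      have h₂ := hbl (l₁ ++ a :: l₂) l₃ (by simp [hl])
      simp only [mem_append, mem_cons, not_or] at h₁ h₂
      rw [hl]
      simp [lettersOf_append, lettersOf_cons, lettersOf_eq_nil h₁.1 h₂.1.1,
        lettersOf_eq_nil h₁.2.1 h₂.1.2.2, lettersOf_eq_nil h₁.2.2.2 h₂.2]
    have order' : ∀ l₁ l₂ l₃, v ++ u = l₁ ++ b :: (l₂ ++ a :: l₃) →
        lettersOf a b (v ++ u) = [b, a] := by
      intro l₁ l₂ l₃ hl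
      have h₁ := hal (l₁ ++ b :: l₂) l₃ (by simp [hl])
      have h₂ := hbl l₁ _ hl
      simp only [mem_append, mem_cons, not_or] at h₁ h₂
      rw [hl]
      simp [lettersOf_append, lettersOf_cons, lettersOf_eq_nil h₁.1.1 h₂.1,
        lettersOf_eq_nil h₁.1.2.2 h₂.2.1, lettersOf_eq_nil h₁.2 h₂.2.2.2]
    have nab : [a, b] ≠ [b, a] := by simp [hab]
    have hma : a ∈ v ∨ a ∈ u := mem_append.1 (count_pos_iff.1 (by omega))
    have hmb : b ∈ v ∨ b ∈ u := mem_append.1 (count_pos_iff.1 (by omega))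
    unfold NonInterlaced
    rcases hma with hma | hma <;> rcases hmb with hmb | hmb
    · obtain ⟨v₁, v₂, hv⟩ := append_of_mem hma
      have hb' : b ∈ v₁ ∨ b ∈ v₂ := by
        rw [hv] at hmb
        simpa [hab.symm] using hmb
      rcases hb' with hb' | hb'
      · obtain ⟨w₁, w₂, rfl⟩ := append_of_mem hb'
        rw [order' w₁ w₂ (v₂ ++ u) (by simp [hv]), ra _ _ hv, rb w₁ (w₂ ++ a :: v₂) (by simp [hv])]
        simp only [length_append, length_cons, iff_true]
        omega
      · obtain ⟨w₁, w₂, rfl⟩ := append_of_mem hb'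
        rw [order v₁ w₁ (w₂ ++ u) (by simp [hv]), ra _ _ hv, rb (v₁ ++ a :: w₁) w₂ (by simp [hv])]
        simp [hab]
        omega
    · obtain ⟨v₁, v₂, hv⟩ := append_of_mem hma
      obtain ⟨u₁, u₂, hu⟩ := append_of_mem hmb
      rw [order v₁ (v₂ ++ u₁) u₂ (by simp [hv, hu]), ra _ _ hv, lb _ _ hu]
      have : u.length = u₁.length + 1 + u₂.length := by rw [hu]; simp; omega
      simp only [nab, iff_false]
      omega
    · obtain ⟨v₁, v₂, hv⟩ := append_of_mem hmb
      obtain ⟨u₁, u₂, hu⟩ := append_of_mem hma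
      rw [order' v₁ (v₂ ++ u₁) u₂ (by simp [hv, hu]), la _ _ hu, rb _ _ hv]
      have : u.length = u₁.length + 1 + u₂.length := by rw [hu]; simp; omega
      simp only [iff_true]
      omega
    · obtain ⟨u₁, u₂, hu⟩ := append_of_mem hma
      have hb' : b ∈ u₁ ∨ b ∈ u₂ := by
        rw [hu] at hmb
        simpa [hab.symm] using hmb
      have hlen : u.length = u₁.length + 1 + u₂.length := by rw [hu]; simp; omega
      rcases hb' with hb' | hb'
      · obtain ⟨w₁, w₂, rfl⟩ := append_of_mem hb'
        rw [order' (v ++ w₁) w₂ u₂ (by simp [hu]), la _ _ hu, lb w₁ (w₂ ++ a :: u₂) (by simp [hu])]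
        simp only [length_append, length_cons, iff_true] at *
        omega
      · obtain ⟨w₁, w₂, rfl⟩ := append_of_mem hb'
        rw [order (v ++ u₁) w₁ w₂ (by simp [hu]), la _ _ hu, lb (u₁ ++ a :: w₁) w₂ (by simp [hu])]
        simp only [length_append, length_cons, nab, iff_false] at *
        omega

lemma eventSum_crossing (ρ : ℤ) (m : Bool) (x y : R) (F : StateFun) {k : ℕ} {u v : List ℕ} {a b : ℕ}
    (h : IsChordWord (u ++ a :: b :: v)) (hk : u.length = k) :
    eventSum ρ (.crossing m k x y) F (chordMatching (u ++ a :: b :: v)) =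
      (if a = b then 0 else F (chordMatching (u ++ b :: a :: v))) +
        if Switchable ρ m x y ∧ lettersOf a b (v ++ u) = [b, a] then
          T 2 * F (chordMatching (u ++ a :: b :: v)) else 0 := by
  subst hk
  simp only [eventSum]
  rw [conjSwap_chordMatching h, nonInterlaced_chordMatching_iff h]
  simp only [chordMatching_eq_succ_iff h]
  congr 1
  split_ifs <;> rfl

lemma getElem?_skipTwo (u v : List ℕ) (a b i : ℕ) :
    (u ++ a :: b :: v)[skipTwo u.length i]? = (u ++ v)[i]? := by
  unfold skipTwo
  rw [getElem?_append, getElem?_append]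
  split_ifs with h h'
  · rfl
  · omega
  · rw [show i + 2 - u.length = i - u.length + 2 by omega]
    rfl

lemma skipTwo_injective (k : ℕ) : Function.Injective (skipTwo k) :=
  Function.LeftInverse.injective (unskipTwo_skipTwo k)

lemma exists_skipTwo {k i : ℕ} (h : i ≠ k) (h' : i ≠ k + 1) : ∃ j, i = skipTwo k j :=
  ⟨_, (skipTwo_unskipTwo h h').symm⟩

lemma skipTwo_lt_iff {k n i : ℕ} (hk : k ≤ n) : skipTwo k i < n + 2 ↔ i < n := by
  unfold skipTwo; split_ifs <;> omega

lemma IsChordWord.insert {u v : List ℕ} {c : ℕ} (h : IsChordWord (u ++ v)) (hu : c ∉ u)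
    (hv : c ∉ v) : IsChordWord (u ++ c :: c :: v) := by
  refine isChordWord_of_count fun a => ?_
  have := h.count a
  simp only [count_append, count_cons] at this ⊢
  rcases eq_or_ne c a with rfl | hc
  · simp [count_eq_zero_of_not_mem hu, count_eq_zero_of_not_mem hv]
  · simpa [hc] using this

lemma IsChordWord.remove {u v : List ℕ} {c : ℕ} (h : IsChordWord (u ++ c :: c :: v)) :
    IsChordWord (u ++ v) := by
  refine isChordWord_of_count fun a => ?_
  have := h.count a
  simp only [count_append, count_cons] at this ⊢
  rcases eq_or_ne c a with rfl | hc
  · simp at this ⊢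
    omega
  · simpa [hc] using this

lemma chordMatching_skipTwo {u v : List ℕ} {c : ℕ} (h : IsChordWord (u ++ c :: c :: v)) (i : ℕ) :
    chordMatching (u ++ c :: c :: v) (skipTwo u.length i) =
      skipTwo u.length (chordMatching (u ++ v) i) := by
  have h₂ := codes_chordMatching h.remove
  have h₁ := codes_chordMatching h
  rw [h₁, getElem?_skipTwo, getElem?_skipTwo, (skipTwo_injective _).eq_iff,
    (skipTwo_injective _).ne_iff, ← not_lt]
  rw [show (u ++ c :: c :: v).length = (u ++ v).length + 2 by simp; omega,
    skipTwo_lt_iff (by simp), not_lt, ← h₂]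

lemma chordMatching_pair {u v : List ℕ} {c : ℕ} (h : IsChordWord (u ++ c :: c :: v)) :
    chordMatching (u ++ c :: c :: v) u.length = u.length + 1 ∧
    chordMatching (u ++ c :: c :: v) (u.length + 1) = u.length := by
  have h₁ := (chordMatching_eq_succ_iff h).2 rfl
  exact ⟨h₁, ((codes_chordMatching h).symm_iff _ _).1 h₁⟩

lemma insertPair_chordMatching {u v : List ℕ} {c : ℕ} (h : IsChordWord (u ++ c :: c :: v)) :
    insertPair u.length (chordMatching (u ++ v)) = chordMatching (u ++ c :: c :: v) := by
  funext i
  unfold insertPair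
  split_ifs with h₁ h₂
  · rw [h₁, (chordMatching_pair h).1]
  · rw [h₂, (chordMatching_pair h).2]
  · conv_rhs => rw [← skipTwo_unskipTwo h₁ h₂]
    rw [chordMatching_skipTwo h]

lemma removePair_chordMatching {u v : List ℕ} {c : ℕ} (h : IsChordWord (u ++ c :: c :: v)) :
    removePair u.length (chordMatching (u ++ c :: c :: v)) = chordMatching (u ++ v) := by
  funext i
  rw [removePair, chordMatching_skipTwo h, unskipTwo_skipTwo]

lemma eventSum_leftCusp (ρ : ℤ) (x : R) (F : StateFun) {k : ℕ} {u v : List ℕ} {c : ℕ}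
    (h : IsChordWord (u ++ c :: c :: v)) (hk : u.length = k) :
    eventSum ρ (.leftCusp k x) F (chordMatching (u ++ v)) =
      T (-1) * F (chordMatching (u ++ c :: c :: v)) := by
  subst hk
  simp only [eventSum]
  rw [insertPair_chordMatching h]

lemma eventSum_rightCusp (ρ : ℤ) (x : R) (F : StateFun) {k : ℕ} {u v : List ℕ} {a b : ℕ}
    (h : IsChordWord (u ++ a :: b :: v)) (hk : u.length = k) :
    eventSum ρ (.rightCusp k x) F (chordMatching (u ++ a :: b :: v)) =
      if a = b then T (-1) * F (chordMatching (u ++ v)) else 0 := by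
  subst hk
  simp only [eventSum]
  rcases eq_or_ne a b with rfl | hab
  · have : CuspCondition u.length (chordMatching (u ++ a :: a :: v)) :=
      ⟨(chordMatching_pair h).1, (chordMatching_pair h).2, fun i => by
        rw [removePair_chordMatching h, chordMatching_skipTwo h]⟩
    rw [if_pos this, if_pos rfl, removePair_chordMatching h]
  · rw [if_neg hab, if_neg]
    rintro ⟨h₁, -, -⟩
    exact hab ((chordMatching_eq_succ_iff h).1 h₁)

/-! ### Slides of a strand over several strands -/

/-- The state sum of a link diagram at the pairing coded by a chord word. -/
noncomputable def chordSum (ρ : ℤ) (w : Word R) (F : StateFun)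
    (L : List ℕ) : ℤ[T;T⁻¹] := wordSum ρ w F (chordMatching L)

lemma chordSum_nil (ρ : ℤ) (F : StateFun) (L : List ℕ) :
    chordSum ρ ([] : Word R) F L = F (chordMatching L) := rfl

lemma chordSum_append (ρ : ℤ) (w w' : Word R) (F : StateFun) (L : List ℕ) :
    chordSum ρ (w ++ w') F L = chordSum ρ w (wordSum ρ w' F) L := by
  rw [chordSum, wordSum_append, chordSum]

lemma chordSum_crossing (ρ : ℤ) (m : Bool) (x y : R) (w : Word R) (F : StateFun) {k : ℕ}
    {u v : List ℕ} {a b : ℕ} (h : IsChordWord (u ++ a :: b :: v)) (hk : u.length = k) :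
    chordSum ρ (.crossing m k x y :: w) F (u ++ a :: b :: v) =
      (if a = b then 0 else chordSum ρ w F (u ++ b :: a :: v)) +
        if Switchable ρ m x y ∧ lettersOf a b (v ++ u) = [b, a] then
          T 2 * chordSum ρ w F (u ++ a :: b :: v) else 0 := eventSum_crossing ρ m x y _ h hk

lemma chordSum_leftCusp (ρ : ℤ) (x : R) (w : Word R) (F : StateFun) {k : ℕ} {u v : List ℕ} {c : ℕ}
    (h : IsChordWord (u ++ c :: c :: v)) (hk : u.length = k) :
    chordSum ρ (.leftCusp k x :: w) F (u ++ v) = T (-1) * chordSum ρ w F (u ++ c :: c :: v) :=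
  eventSum_leftCusp ρ x _ h hk

lemma chordSum_rightCusp (ρ : ℤ) (x : R) (w : Word R) (F : StateFun) {k : ℕ} {u v : List ℕ}
    {a b : ℕ} (h : IsChordWord (u ++ a :: b :: v)) (hk : u.length = k) :
    chordSum ρ (.rightCusp k x :: w) F (u ++ a :: b :: v) =
      if a = b then T (-1) * chordSum ρ w F (u ++ v) else 0 := eventSum_rightCusp ρ x _ h hk

/-- Strand number `k` crosses downwards the strands below it; for each of them, the list gives the
marking of the crossing and the potential. -/
def mixedSlide (k : ℕ) (x : R) : List (Bool × R) → Word R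
  | [] => []
  | (m, y) :: l => .crossing m k x y :: mixedSlide (k + 1) x l

lemma slideDown_eq_mixedSlide (m : Bool) (k : ℕ) (x : R) (ys : List R) :
    slideDown m k x ys = mixedSlide k x (ys.map fun y => (m, y)) := by
  induction ys generalizing k with
  | nil => rfl
  | cons y ys ih => simp [slideDown, mixedSlide, ih]

lemma mixedSlide_append (k : ℕ) (x : R) (l l' : List (Bool × R)) :
    mixedSlide k x (l ++ l') = mixedSlide k x l ++ mixedSlide (k + l.length) x l' := by
  induction l generalizing k with
  | nil => rfl
  | cons p l ih =>
    obtain ⟨m, y⟩ := p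
    simp [mixedSlide, ih, Nat.add_assoc, Nat.add_comm 1]

/-- No initial part of the cyclic reading meets `a` without `b`. After a switch this shows that the
strand taking over a slide has its partner still ahead if the previous one had. -/
lemma mem_of_lettersOf_eq {a b : ℕ} {l l' : List ℕ} (hab : a ≠ b)
    (h : lettersOf a b (l ++ l') = [b, a]) : a ∈ l → b ∈ l := by
  intro ha
  rw [lettersOf_append] at h
  have h₁ : a ∈ lettersOf a b l := mem_lettersOf.2 ⟨ha, Or.inl rfl⟩
  by_contra hb
  have h₂ : ∀ c ∈ lettersOf a b l, c = a := by
    intro c hc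
    obtain ⟨h₃, h₄⟩ := mem_lettersOf.1 hc
    exact h₄.resolve_right fun h₅ => hb (h₅ ▸ h₃)
  obtain ⟨c, t, hct⟩ := exists_cons_of_ne_nil (ne_nil_of_mem h₁)
  rw [hct] at h
  simp only [cons_append, cons.injEq] at h
  have := h₂ c (by rw [hct]; simp)
  exact hab (this ▸ h.1)

/-- Dually, no final part meets `b` without `a`: after a switch, the partner of the strand taking
over lies among the strands already passed only if that of the previous one does. -/
lemma mem_right_of_lettersOf_eq {a b : ℕ} {l l' : List ℕ} (hab : a ≠ b)
    (h : lettersOf a b (l ++ l') = [b, a]) : b ∈ l' → a ∈ l' := by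
  intro hb
  by_contra ha
  rw [lettersOf_append] at h
  have h₁ : b ∈ lettersOf a b l' := mem_lettersOf.2 ⟨hb, Or.inr rfl⟩
  have h₂ : ∀ c ∈ lettersOf a b l', c = b := by
    intro c hc
    obtain ⟨h₃, h₄⟩ := mem_lettersOf.1 hc
    exact h₄.resolve_left fun h₅ => ha (h₅ ▸ h₃)
  have h₃ := congrArg getLast? h
  rw [getLast?_append] at h₃
  have h₄ : lettersOf a b l' ≠ [] := ne_nil_of_mem h₁
  rw [getLast?_eq_some_getLast h₄] at h₃
  have := h₂ _ (getLast_mem h₄)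
  rw [this] at h₃
  simp at h₃
  exact hab h₃.symm

lemma ne_of_lettersOf_eq {u v : List ℕ} {a b : ℕ} (h : IsChordWord (u ++ a :: b :: v))
    (h' : lettersOf a b (v ++ u) = [b, a]) : a ≠ b := by
  rintro rfl
  have h₁ : a ∈ lettersOf a a (v ++ u) := by simp [h']
  have h₂ := count_pos_iff.2 (mem_lettersOf.1 h₁).1
  have h₃ := h a (by simp)
  rw [count_append] at h₂ h₃
  simp only [count_cons_self] at h₃
  omega

lemma isChordWord_move {p v : List ℕ} {s y : ℕ} (h : IsChordWord (p ++ s :: y :: v)) :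
    IsChordWord ((p ++ [y]) ++ s :: v) := by simpa using h.swap

lemma chordSum_mixedSlide_cons (ρ : ℤ) (m : Bool) (x z : R) (l : List (Bool × R)) (F : StateFun)
    {k : ℕ} {p v : List ℕ} {s y : ℕ} (h : IsChordWord (p ++ s :: y :: v)) (hk : p.length = k) :
    chordSum ρ (mixedSlide k x ((m, z) :: l)) F (p ++ s :: y :: v) =
      (if s = y then 0 else chordSum ρ (mixedSlide (k + 1) x l) F ((p ++ [y]) ++ s :: v)) +
        if Switchable ρ m x z ∧ lettersOf s y (v ++ p) = [y, s] then
          T 2 * chordSum ρ (mixedSlide (k + 1) x l) F ((p ++ [s]) ++ y :: v) else 0 := by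
  rw [mixedSlide, chordSum_crossing ρ m x z _ F h hk]
  simp only [append_assoc, singleton_append]

/-- A strand cannot slide over its partner. -/
lemma chordSum_mixedSlide_eq_zero (ρ : ℤ) (x : R) (F : StateFun) (l : List (Bool × R)) {k : ℕ}
    {p ys v : List ℕ} {s : ℕ} (h : IsChordWord (p ++ s :: (ys ++ v))) (hk : p.length = k)
    (hl : l.length = ys.length) (hs : s ∈ ys) :
    chordSum ρ (mixedSlide k x l) F (p ++ s :: (ys ++ v)) = 0 := by
  induction ys generalizing l k p s with
  | nil => simp at hs
  | cons y ys ih =>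
    obtain _ | ⟨⟨m, z⟩, l⟩ := l
    · simp at hl
    rw [cons_append] at h ⊢
    rw [chordSum_mixedSlide_cons ρ m x z l F h hk]
    have hl' : l.length = ys.length := by simpa using hl
    -- After a switch the slide is continued by `y`. Normality places the partner of `y` ahead as
    -- well, so the induction hypothesis applies to `y`.
    have h₂ : (if Switchable ρ m x z ∧ lettersOf s y ((ys ++ v) ++ p) = [y, s] then
          T 2 * chordSum ρ (mixedSlide (k + 1) x l) F ((p ++ [s]) ++ y :: (ys ++ v)) else 0) =
        0 := by
      split_ifs with hc
      · have hne := ne_of_lettersOf_eq h hc.2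
        have hsy : s ∈ ys := by simpa [hne] using hs
        rw [append_assoc] at hc
        rw [ih l (by simpa using h) (by simp [hk]) hl' (mem_of_lettersOf_eq hne hc.2 hsy), mul_zero]
      · rfl
    rw [h₂, add_zero]
    split_ifs with hc
    · rfl
    · exact ih l (isChordWord_move h) (by simp [hk]) hl' (by simpa [hc] using hs)

/-- The letters which occur twice in a word, with their places. -/
def doubledLetters (l : List ℕ) : List (Option ℕ) :=
  l.map fun c => if l.count c = 2 then some c else none

lemma doubledLetters_replace {p q : List ℕ} {a b : ℕ} (hap : a ∉ p) (haq : a ∉ q) (hbp : b ∉ p)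
    (hbq : b ∉ q) : doubledLetters (p ++ a :: q) = doubledLetters (p ++ b :: q) := by
  have key : ∀ c, c ≠ a → c ≠ b → (p ++ a :: q).count c = (p ++ b :: q).count c := by
    intro c hca hcb
    simp [count_append, hca.symm, hcb.symm]
  have ha : (p ++ a :: q).count a = 1 := by
    simp [count_append, count_eq_zero_of_not_mem hap, count_eq_zero_of_not_mem haq]
  have hb : (p ++ b :: q).count b = 1 := by
    simp [count_append, count_eq_zero_of_not_mem hbp, count_eq_zero_of_not_mem hbq]
  unfold doubledLetters
  rw [map_append, map_append, map_cons, map_cons, ha, hb]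
  congr 1
  · refine map_congr_left fun c hc => ?_
    rw [key c (fun h => hap (h ▸ hc)) fun h => hbp (h ▸ hc)]
  · congr 1
    refine map_congr_left fun c hc => ?_
    rw [key c (fun h => haq (h ▸ hc)) fun h => hbq (h ▸ hc)]

/-- The state sum of a slide depends only on the final states which are reached. -/
lemma chordSum_mixedSlide_congr_aux (ρ : ℤ) (x : R) {F F' : StateFun} (l : List (Bool × R)) {k : ℕ}
    (u : List ℕ) {p ys v : List ℕ} {s : ℕ} (h : IsChordWord (u ++ p ++ s :: (ys ++ v)))
    (hk : u.length + p.length = k) (hl : l.length = ys.length) (hs : s ∉ p)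
    (hF : ∀ p' s', doubledLetters p' = doubledLetters (p ++ ys) → s' ∉ p' →
      (p' ++ [s']).Perm (p ++ s :: ys) →
        F (chordMatching (u ++ p' ++ s' :: v)) = F' (chordMatching (u ++ p' ++ s' :: v))) :
    chordSum ρ (mixedSlide k x l) F (u ++ p ++ s :: (ys ++ v)) =
      chordSum ρ (mixedSlide k x l) F' (u ++ p ++ s :: (ys ++ v)) := by
  by_cases hsy : s ∈ ys
  · rw [chordSum_mixedSlide_eq_zero ρ x F l h (by simp [hk]) hl hsy,
      chordSum_mixedSlide_eq_zero ρ x F' l h (by simp [hk]) hl hsy]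
  induction ys generalizing l k p s with
  | nil =>
    obtain rfl : l = [] := length_eq_zero_iff.1 hl
    exact hF p s (by simp) hs (by simp)
  | cons y ys ih =>
    obtain _ | ⟨⟨m, z⟩, l⟩ := l
    · simp at hl
    have hl' : l.length = ys.length := by simpa using hl
    have hk' : (u ++ p).length = k := by simp [hk]
    rw [cons_append] at h ⊢
    rw [chordSum_mixedSlide_cons ρ m x z l F h hk', chordSum_mixedSlide_cons ρ m x z l F' h hk']
    simp only [mem_cons, not_or] at hsy
    congr 1
    · rw [if_neg hsy.1, if_neg hsy.1]
      have := ih l (p := p ++ [y]) (s := s) (k := k + 1) (by simpa using isChordWord_move h)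
        (by simp; omega) hl' (by simp [hs, hsy.1]) ?_ hsy.2
      · simpa using this
      · intro p' s' h₁ h₂ h₃
        refine hF p' s' (by simpa using h₁) h₂ (h₃.trans ?_)
        rw [append_assoc]
        exact (Perm.swap s y ys).append_left p
    · split_ifs with hc
      · have hc' := hc.2
        congr 1
        -- Normality of the switch: if the partner of `y` had been passed already, that of `s` would
        -- have been passed too.
        have hys : y ∉ p := by
          intro hy
          rw [← append_assoc] at hc'
          exact hs (mem_right_of_lettersOf_eq hsy.1 hc' hy)
        have hch : IsChordWord (u ++ (p ++ [s]) ++ y :: (ys ++ v)) := by simpa using h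
        by_cases hy : y ∈ ys
        · have e : u ++ p ++ [s] ++ y :: (ys ++ v) = u ++ (p ++ [s]) ++ y :: (ys ++ v) := by simp
          rw [e]
          rw [chordSum_mixedSlide_eq_zero ρ x F l hch (by simp; omega) hl' hy,
            chordSum_mixedSlide_eq_zero ρ x F' l hch (by simp; omega) hl' hy]
        · have := ih l (p := p ++ [s]) (s := y) (k := k + 1) hch
            (by simp; omega) hl' (by simp [hys, Ne.symm hsy.1]) ?_ hy
          · simpa using this
          · intro p' s' h₁ h₂ h₃
            refine hF p' s' (h₁.trans ?_) h₂ (h₃.trans (by simp))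
            rw [append_assoc]
            exact doubledLetters_replace hs hsy.2 hys hy
      · rfl

/-- In a contributing path a switch exchanges two letters whose partners lie outside the block.
Hence the letters occurring twice inside the block, with their places, are the same for all final
states that contribute. If the sliding strand has its partner in the block, there is nothing to
compare because both sums vanish. -/
lemma chordSum_mixedSlide_congr (ρ : ℤ) (x : R) {F F' : StateFun} (l : List (Bool × R)) {k : ℕ}
    {u ys v : List ℕ} {s : ℕ} (h : IsChordWord (u ++ s :: (ys ++ v))) (hk : u.length = k)
    (hl : l.length = ys.length) (hF : ∀ p' s', doubledLetters p' = doubledLetters ys → s' ∉ p' →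
      (p' ++ [s']).Perm (s :: ys) → s ∉ ys →
        F (chordMatching (u ++ (p' ++ s' :: v))) = F' (chordMatching (u ++ (p' ++ s' :: v)))) :
    chordSum ρ (mixedSlide k x l) F (u ++ s :: (ys ++ v)) =
      chordSum ρ (mixedSlide k x l) F' (u ++ s :: (ys ++ v)) := by
  by_cases hs : s ∈ ys
  · rw [chordSum_mixedSlide_eq_zero ρ x F l h hk hl hs,
      chordSum_mixedSlide_eq_zero ρ x F' l h hk hl hs]
  simpa using
    chordSum_mixedSlide_congr_aux ρ x (F := F) (F' := F') l u (p := []) (k := k) (by simpa using h)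
    (by simpa using hk) hl (by simp) (fun p' s' h₁ h₂ h₃ => by
      simpa using hF p' s' (by simpa using h₁) h₂ (by simpa using h₃) hs)

/-- The letters of a word which satisfy `Q`, with their places. -/
def lettersMask (Q : ℕ → Bool) (l : List ℕ) : List (Option ℕ) :=
  l.map fun c => if Q c then some c else none

lemma lettersOf_filter {Q : ℕ → Bool} {a b : ℕ} (ha : Q a = false) (hb : Q b = false) (l : List ℕ) :
    lettersOf a b (l.filter fun c => !Q c) = lettersOf a b l := by
  unfold lettersOf
  rw [filter_filter]
  refine filter_congr fun c _ => ?_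
  by_cases hc : c = a ∨ c = b
  · rcases hc with rfl | rfl <;> simp [ha, hb]
  · simp [hc]

/-- The labels of the letters not satisfying `Q`. -/
def keptLabels {α : Type} (Q : ℕ → Bool) : List α → List ℕ → List α
  | a :: l, c :: ys => if Q c then keptLabels Q l ys else a :: keptLabels Q l ys
  | _, _ => []

/-- Pairs of strands below a sliding strand which are removed after the slide may be removed
before. -/
lemma chordSum_mixedSlide_filter_aux (ρ : ℤ) (x : R) {F F' : StateFun} (Q : ℕ → Bool)
    (l : List (Bool × R)) {k k' : ℕ} (u : List ℕ) {p ys v : List ℕ} {s : ℕ}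
    (h : IsChordWord (u ++ p ++ s :: (ys ++ v))) (hk : u.length + p.length = k)
    (hk' : u.length + (p.filter fun c => !Q c).length = k') (hl : l.length = ys.length) (hs : s ∉ p)
    (hQs : Q s = false) (hQ : ∀ c ∈ p ++ ys, Q c = true → (p ++ ys).count c = 2)
    (hF : ∀ p' s', lettersMask Q p' = lettersMask Q (p ++ ys) → Q s' = false →
      (p' ++ [s']).Perm (p ++ s :: ys) → F (chordMatching (u ++ p' ++ s' :: v)) =
          F' (chordMatching (u ++ (p'.filter fun c => !Q c) ++ s' :: v))) :
    chordSum ρ (mixedSlide k x l) F (u ++ p ++ s :: (ys ++ v)) =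
      chordSum ρ (mixedSlide k' x (keptLabels Q l ys)) F'
        (u ++ (p.filter fun c => !Q c) ++ s :: ((ys.filter fun c => !Q c) ++ v)) := by
  have hQu : ∀ c, Q c = true → c ∈ p ++ ys → c ∉ u ∧ c ∉ v := by
    intro c hc hm
    have h₁ := hQ c hm hc
    have h₂ : IsChordWord ((p ++ ys) ++ (s :: u ++ v)) := h.perm (by
      rw [← Multiset.coe_eq_coe]
      simp only [← Multiset.coe_add, ← Multiset.cons_coe, ← Multiset.singleton_add]
      abel)
    have h₃ := h₂ c (mem_append_left _ hm)
    rw [count_append, h₁] at h₃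
    have h₄ : (s :: u ++ v).count c = 0 := by omega
    have h₅ := count_eq_zero.1 h₄
    simp only [cons_append, mem_cons, mem_append, not_or] at h₅
    exact h₅.2
  have hchord : ∀ {p s ys}, IsChordWord (u ++ p ++ s :: (ys ++ v)) → Q s = false →
      (∀ c ∈ p ++ ys, Q c = true → (p ++ ys).count c = 2) →
      IsChordWord (u ++ (p.filter fun c => !Q c) ++ s :: ((ys.filter fun c => !Q c) ++ v)) := by
    intro p s ys h hs hQ
    refine isChordWord_of_count fun a => ?_
    have h₁ := h.count a
    simp only [count_append, count_cons] at h₁ ⊢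
    cases ha : Q a with
    | false =>
      rw [count_filter (by simp [ha]), count_filter (by simp [ha])]
      exact h₁
    | true =>
      have hz : ∀ l : List ℕ, (l.filter fun c => !Q c).count a = 0 := by
        intro l
        rw [count_eq_zero]
        simp [ha]
      rw [hz, hz]
      have hsa : s ≠ a := by rintro rfl; simp [hs] at ha
      by_cases hm : a ∈ p ++ ys
      · have := hQ a hm ha
        simp only [count_append] at this
        simp [hsa] at h₁ ⊢
        omega
      · simp only [mem_append, not_or] at hm
        simp [hsa, count_eq_zero_of_not_mem hm.1, count_eq_zero_of_not_mem hm.2] at h₁ ⊢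
        exact h₁
  clear hQu
  induction ys generalizing l k k' p s with
  | nil =>
    obtain rfl : l = [] := length_eq_zero_iff.1 hl
    simpa [keptLabels, mixedSlide, chordSum_nil] using hF p s (by simp) hQs (by simp)
  | cons y ys ih =>
    obtain _ | ⟨⟨m, z⟩, l⟩ := l
    · simp at hl
    have hl' : l.length = ys.length := by simpa using hl
    have hkl : (u ++ p).length = k := by simp [hk]
    have hmask : ∀ p' s' t t', lettersMask Q p' = lettersMask Q ((p ++ [t]) ++ ys) → Q s' = false →
      (p' ++ [s']).Perm ((p ++ [t]) ++ t' :: ys) → (t = y ∧ t' = s ∨ t = s ∧ t' = y ∧ Q y = false) →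
        F (chordMatching (u ++ p' ++ s' :: v)) =
          F' (chordMatching (u ++ (p'.filter fun c => !Q c) ++ s' :: v)) := by
      rintro p' s' t t' h₁ h₂ h₃ (⟨rfl, rfl⟩ | ⟨rfl, rfl, h₄⟩)
      · refine hF p' s' (by simpa using h₁) h₂ (h₃.trans ?_)
        rw [append_assoc]
        exact (Perm.swap t' t ys).append_left p
      · refine hF p' s' (h₁.trans ?_) h₂ (h₃.trans (by simp))
        simp [lettersMask, hQs, h₄]
    have hcross : s ≠ y → chordSum ρ (mixedSlide (k + 1) x l) F (u ++ p ++ [y] ++ s :: (ys ++ v)) =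
        chordSum ρ (mixedSlide (u.length + ((p ++ [y]).filter fun c => !Q c).length) x
          (keptLabels Q l ys)) F'
        (u ++ ((p ++ [y]).filter fun c => !Q c) ++ s :: ((ys.filter fun c => !Q c) ++ v)) := by
      intro hne
      simpa using ih (p := p ++ [y]) (s := s) l (k := k + 1) (by simpa using isChordWord_move h)
        (by simp; omega) rfl hl' (by simp [hs, hne]) hQs (by simpa using hQ)
        (fun p' s' h₁ h₂ h₃ => hmask p' s' y s h₁ h₂ h₃ (Or.inl ⟨rfl, rfl⟩))
    rw [cons_append] at h ⊢
    rw [chordSum_mixedSlide_cons ρ m x z l F h hkl]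
    have hpy : s ≠ y → lettersOf s y (ys ++ v ++ (u ++ p)) = [y, s] → y ∉ p := by
      intro hne hc hy
      rw [← append_assoc] at hc
      exact hs (mem_right_of_lettersOf_eq hne hc hy)
    cases hQy : Q y with
    | true =>
      have hne : s ≠ y := by rintro rfl; simp [hQs] at hQy
      rw [if_neg hne, hcross hne]
      -- A switch at a strand of a removable pair would make this strand the sliding one, and it
      -- would run into its partner.
      have hzero : (if Switchable ρ m x z ∧ lettersOf s y (ys ++ v ++ (u ++ p)) = [y, s] then
          T 2 * chordSum ρ (mixedSlide (k + 1) x l) F (u ++ p ++ [s] ++ y :: (ys ++ v)) else 0) =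
          0 := by
        split_ifs with hc
        · have hy := hpy hne hc.2
          have h₁ := hQ y (by simp) hQy
          simp [count_append, count_eq_zero_of_not_mem hy] at h₁
          have hys : y ∈ ys := count_pos_iff.1 (by omega)
          rw [chordSum_mixedSlide_eq_zero ρ x F l (by simpa using h) (by simp; omega) hl' hys,
            mul_zero]
        · rfl
      rw [hzero, add_zero]
      have e : (p ++ [y]).filter (fun c => !Q c) = p.filter fun c => !Q c := by simp [hQy]
      rw [e, hk']
      simp [keptLabels, hQy]
    | false =>
      have h' := hchord h hQs hQ
      have e : (y :: ys).filter (fun c => !Q c) = y :: ys.filter fun c => !Q c := by simp [hQy]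
      rw [e, cons_append] at h' ⊢
      have ek : keptLabels Q ((m, z) :: l) (y :: ys) = (m, z) :: keptLabels Q l ys := by
        simp [keptLabels, hQy]
      rw [ek, chordSum_mixedSlide_cons ρ m x z _ F' h' (by simp [hk'])]
      have el : lettersOf s y ((ys.filter fun c => !Q c) ++ v ++ (u ++ p.filter fun c => !Q c)) =
          lettersOf s y (ys ++ v ++ (u ++ p)) := by
        simp only [lettersOf_append, lettersOf_filter hQs hQy]
      rw [el]
      congr 1
      · split_ifs with hc
        · rfl
        · rw [hcross hc]
          simp [hQy, ← hk', Nat.add_assoc]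
      · split_ifs with hc
        · have hne := ne_of_lettersOf_eq h hc.2
          congr 1
          have := ih (p := p ++ [s]) (s := y) l (k := k + 1) (by simpa using h)
            (by simp; omega) rfl hl' (by simp [Ne.symm hne, hpy hne hc.2]) hQy ?_
            (fun p' s' h₁ h₂ h₃ => hmask p' s' s y h₁ h₂ h₃ (Or.inr ⟨rfl, rfl, hQy⟩))
          · simpa [hQs, ← hk', Nat.add_assoc] using this
          · intro c hm hQc
            have hcs : c ≠ s := by rintro rfl; simp [hQs] at hQc
            have hcy : c ≠ y := by rintro rfl; simp [hQy] at hQc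
            simpa [count_append, hcs.symm, hcy.symm] using hQ c (by simpa [hcs, hcy] using hm) hQc
        · rfl

lemma chordSum_mixedSlide_filter (ρ : ℤ) (x : R) {F F' : StateFun} (Q : ℕ → Bool)
    (l : List (Bool × R)) {k : ℕ} {u ys v : List ℕ} {s : ℕ} (h : IsChordWord (u ++ s :: (ys ++ v)))
    (hk : u.length = k) (hl : l.length = ys.length) (hQ : ∀ c ∈ ys, Q c = true → ys.count c = 2)
    (hQs : Q s = false) (hF : ∀ p' s', lettersMask Q p' = lettersMask Q ys → Q s' = false →
      (p' ++ [s']).Perm (s :: ys) → F (chordMatching (u ++ (p' ++ s' :: v))) =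
          F' (chordMatching (u ++ ((p'.filter fun c => !Q c) ++ s' :: v)))) :
    chordSum ρ (mixedSlide k x l) F (u ++ s :: (ys ++ v)) =
      chordSum ρ (mixedSlide k x (keptLabels Q l ys)) F'
        (u ++ s :: ((ys.filter fun c => !Q c) ++ v)) := by
  simpa using
    chordSum_mixedSlide_filter_aux ρ x (F := F) (F' := F') Q l u (p := []) (k := k) (k' := k)
    (by simpa using h) (by simpa using hk) (by simpa using hk) hl (by simp) hQs (by simpa using hQ)
    (fun p' s' h₁ h₂ h₃ => by simpa using hF p' s' (by simpa using h₁) h₂ (by simpa using h₃))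

/-! ### Braids -/

lemma lettersOf_comm (a b : ℕ) (l : List ℕ) : lettersOf a b l = lettersOf b a l := by
  unfold lettersOf
  congr 1
  funext c
  simp [or_comm]

/-- Cyclic order becomes an inequality of positions, so that inconsistent orders of three letters
can be discarded by `omega` in `chordSum_triple`. -/
lemma lettersOf_eq_iff_idxOf_lt {a b : ℕ} {l : List ℕ} (hab : a ≠ b) (ha : l.count a = 1)
    (hb : l.count b = 1) : lettersOf a b l = [b, a] ↔ l.idxOf b < l.idxOf a := by
  induction l with
  | nil => simp at ha
  | cons c l ih =>
    rw [lettersOf_cons, idxOf_cons, idxOf_cons]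
    rcases eq_or_ne c a with rfl | hca
    · simp [hab]
    · rcases eq_or_ne c b with rfl | hcb
      · have h₁ : l.count c = 0 := by simpa using hb
        have h₂ : l.count a = 1 := by simpa [hca] using ha
        have h₃ : lettersOf a c l = [a] := by
          obtain ⟨l₁, l₂, rfl, hl₁⟩ := eq_append_cons_of_mem
            (count_pos_iff.1 (by omega : 0 < l.count a))
          have h₄ : a ∉ l₂ := by
            simp [count_append, count_eq_zero_of_not_mem hl₁] at h₂
            exact count_eq_zero.1 h₂
          have h₅ := count_eq_zero.1 h₁
          simp only [mem_append, mem_cons, not_or] at h₅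
          simp [lettersOf_append, lettersOf_cons, lettersOf_eq_nil hl₁ h₅.1,
            lettersOf_eq_nil h₄ h₅.2.2]
        have h₆ : (c == a) = false := by simpa using hca
        simp [h₃, h₆]
      · have h₁ : (c == a) = false := by simpa using hca
        have h₂ : (c == b) = false := by simpa using hcb
        rw [if_neg (by simp [hca, hcb]), ih (by simpa [hca] using ha) (by simpa [hcb] using hb), h₁,
          h₂]
        simp

/-- Two link diagrams have the same state sums at the states whose strands number
`k, …, k + n - 1` are pairwise not matched. -/
def BlockEq (ρ : ℤ) (k n : ℕ) (w w' : Word R) : Prop :=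
  ∀ (F : StateFun) (u xs v : List ℕ), u.length = k → xs.length = n → xs.Nodup →
    IsChordWord (u ++ (xs ++ v)) →
      chordSum ρ w F (u ++ (xs ++ v)) = chordSum ρ w' F (u ++ (xs ++ v))

/-- All events of the link diagram are crossings between the strands number `k, …, k + n - 1`. -/
def IsBraid (k n : ℕ) (w : Word R) : Prop :=
  ∀ e ∈ w, ∃ m p x y, e = .crossing m p x y ∧ k ≤ p ∧ p + 2 ≤ k + n

lemma IsBraid.nil (k n : ℕ) : IsBraid k n ([] : Word R) := by simp [IsBraid]

lemma IsBraid.append {k n : ℕ} {w w' : Word R} (h : IsBraid k n w) (h' : IsBraid k n w') :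
    IsBraid k n (w ++ w') := by
  intro e he
  rcases mem_append.1 he with he | he
  · exact h e he
  · exact h' e he

lemma isBraid_cons {k n p : ℕ} {m : Bool} {x y : R} {w : Word R} :
    IsBraid k n (.crossing m p x y :: w) ↔ (k ≤ p ∧ p + 2 ≤ k + n) ∧ IsBraid k n w := by
  constructor
  · intro h
    refine ⟨?_, fun e he => h e (mem_cons_of_mem _ he)⟩
    obtain ⟨m', p', x', y', he, h'⟩ := h _ mem_cons_self
    cases he
    exact h'
  · rintro ⟨h, h'⟩ e he
    rcases mem_cons.1 he with rfl | he
    · exact ⟨m, p, x, y, rfl, h⟩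
    · exact h' e he

lemma IsBraid.mono {k n k' n' : ℕ} {w : Word R} (h : IsBraid k n w) (hk : k' ≤ k)
    (hn : k + n ≤ k' + n') : IsBraid k' n' w := by
  intro e he
  obtain ⟨m, p, x, y, rfl, h₁, h₂⟩ := h e he
  exact ⟨m, p, x, y, rfl, by omega, by omega⟩

lemma isBraid_mixedSlide (k : ℕ) (x : R) (l : List (Bool × R)) :
    IsBraid k (l.length + 1) (mixedSlide k x l) := by
  induction l generalizing k with
  | nil => exact IsBraid.nil _ _
  | cons p l ih =>
    obtain ⟨m, y⟩ := p
    rw [mixedSlide, isBraid_cons]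
    refine ⟨by simp, (ih (k + 1)).mono (by omega) (by simp; omega)⟩

lemma isBraid_slideDown (m : Bool) (k : ℕ) (x : R) (l : List R) :
    IsBraid k (l.length + 1) (slideDown m k x l) := by
  rw [slideDown_eq_mixedSlide]
  simpa using isBraid_mixedSlide k x (l.map fun y => (m, y))

lemma exists_split_pair {xs : List ℕ} {k p : ℕ} (hk : k ≤ p) (h : p + 2 ≤ k + xs.length) :
    ∃ l a b l', xs = l ++ a :: b :: l' ∧ k + l.length = p := by
  refine ⟨xs.take (p - k), xs[p - k], xs[p - k + 1], xs.drop (p - k + 2), ?_, ?_⟩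
  · conv_lhs => rw [← take_append_drop (p - k) xs]
    rw [drop_eq_getElem_cons (by omega), drop_eq_getElem_cons (by omega)]
  · rw [length_take]
    omega

/-- A crossing at a strand of a block, with the rest of the block made explicit. -/
lemma chordSum_crossing_block (ρ : ℤ) (m : Bool) (x y : R) (w : Word R) (F : StateFun) {p : ℕ}
    {u l l' v : List ℕ} {a b : ℕ} (h : IsChordWord (u ++ ((l ++ a :: b :: l') ++ v)))
    (hp : u.length + l.length = p) :
    chordSum ρ (.crossing m p x y :: w) F (u ++ ((l ++ a :: b :: l') ++ v)) =
      (if a = b then 0 else chordSum ρ w F (u ++ ((l ++ b :: a :: l') ++ v))) +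
        if Switchable ρ m x y ∧ lettersOf a b (l' ++ v ++ (u ++ l)) = [b, a] then
          T 2 * chordSum ρ w F (u ++ ((l ++ a :: b :: l') ++ v)) else 0 := by
  have h' : IsChordWord ((u ++ l) ++ a :: b :: (l' ++ v)) := by simpa using h
  simpa using chordSum_crossing ρ m x y w F h' (by simpa using hp)

/-- A crossing inside the block exchanges two of its letters or leaves them in place, so only
permutations of the block are ever reached. -/
lemma IsBraid.chordSum_congr {ρ : ℤ} {k n : ℕ} {w : Word R} (hw : IsBraid k n w) {F F' : StateFun}
    {u xs v : List ℕ} (hu : u.length = k) (hn : xs.length = n) (h : IsChordWord (u ++ (xs ++ v)))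
    (hF : ∀ xs', xs'.Perm xs →
      F (chordMatching (u ++ (xs' ++ v))) = F' (chordMatching (u ++ (xs' ++ v)))) :
    chordSum ρ w F (u ++ (xs ++ v)) = chordSum ρ w F' (u ++ (xs ++ v)) := by
  induction w generalizing xs with
  | nil => exact hF xs (Perm.refl _)
  | cons e w ih =>
    obtain ⟨m, p, x, y, rfl, h₁, h₂⟩ := hw _ mem_cons_self
    have hw' := (isBraid_cons.1 hw).2
    obtain ⟨l, a, b, l', rfl, hp⟩ := exists_split_pair h₁ (by rw [hn]; exact h₂)
    rw [chordSum_crossing_block ρ m x y w F h (by omega),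
      chordSum_crossing_block ρ m x y w F' h (by omega)]
    have hperm : (l ++ b :: a :: l').Perm (l ++ a :: b :: l') := (Perm.swap a b l').append_left l
    have hsw : IsChordWord (u ++ ((l ++ b :: a :: l') ++ v)) :=
      h.perm ((hperm.symm.append_right v).append_left u)
    rw [ih hw' (xs := l ++ b :: a :: l') (by simpa using hn) hsw
        fun xs' hxs' => hF xs' (hxs'.trans hperm),
      ih hw' (xs := l ++ a :: b :: l') hn h fun xs' hxs' => hF xs' hxs']

lemma BlockEq.refl (ρ : ℤ) (k n : ℕ) (w : Word R) : BlockEq ρ k n w w := fun _ _ _ _ _ _ _ _ => rfl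

lemma BlockEq.symm {ρ : ℤ} {k n : ℕ} {w w' : Word R} (h : BlockEq ρ k n w w') :
    BlockEq ρ k n w' w := fun F u xs v h₁ h₂ h₃ h₄ => (h F u xs v h₁ h₂ h₃ h₄).symm

lemma BlockEq.trans {ρ : ℤ} {k n : ℕ} {w w' w'' : Word R} (h : BlockEq ρ k n w w')
    (h' : BlockEq ρ k n w' w'') : BlockEq ρ k n w w'' :=
  fun F u xs v h₁ h₂ h₃ h₄ => (h F u xs v h₁ h₂ h₃ h₄).trans (h' F u xs v h₁ h₂ h₃ h₄)

lemma BlockEq.append_right {ρ : ℤ} {k n : ℕ} {w w' : Word R} (h : BlockEq ρ k n w w') (s : Word R) :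
    BlockEq ρ k n (w ++ s) (w' ++ s) := by
  intro F u xs v h₁ h₂ h₃ h₄
  rw [chordSum_append, chordSum_append, h _ u xs v h₁ h₂ h₃ h₄]

/-- What is put in front has to be a braid on the block: it only permutes the letters there and so
keeps them distinct. -/
lemma BlockEq.append_left {ρ : ℤ} {k n : ℕ} {w w' p : Word R} (hp : IsBraid k n p)
    (h : BlockEq ρ k n w w') : BlockEq ρ k n (p ++ w) (p ++ w') := by
  intro F u xs v h₁ h₂ h₃ h₄
  rw [chordSum_append, chordSum_append]
  refine hp.chordSum_congr h₁ h₂ h₄ fun xs' hxs' => ?_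
  exact h F u xs' v h₁ (hxs'.length_eq.trans h₂) (hxs'.nodup_iff.2 h₃)
    (h₄.perm ((hxs'.symm.append_right v).append_left u))

lemma BlockEq.mono {ρ : ℤ} {k n k' n' : ℕ} {w w' : Word R} (h : BlockEq ρ k n w w') (hk : k' ≤ k)
    (hn : k + n ≤ k' + n') : BlockEq ρ k' n' w w' := by
  intro F u xs v h₁ h₂ h₃ h₄
  obtain ⟨l, m, rfl, hl⟩ : ∃ l m, xs = l ++ m ∧ l.length = k - k' :=
    ⟨xs.take (k - k'), xs.drop (k - k'), (take_append_drop ..).symm, by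
      rw [length_take]; omega⟩
  obtain ⟨m, l', rfl, hm⟩ : ∃ m' l', m = m' ++ l' ∧ m'.length = n :=
    ⟨m.take n, m.drop n, (take_append_drop ..).symm, by
      rw [length_take]; simp at h₂; omega⟩
  have e : u ++ ((l ++ (m ++ l')) ++ v) = (u ++ l) ++ (m ++ (l' ++ v)) := by simp
  rw [e] at h₄ ⊢
  exact h F (u ++ l) m (l' ++ v) (by simp; omega) hm
    ((nodup_append.1 (nodup_append.1 h₃).2.1).1) h₄

/-- Far commutation of crossings of pairwise unmatched strands. -/
lemma blockEq_far_crossing (ρ : ℤ) {k n i j : ℕ} (m m' : Bool) (x y x' y' : R) (hi : k ≤ i)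
    (hij : i + 2 ≤ j) (hj : j + 2 ≤ k + n) :
    BlockEq ρ k n [.crossing m i x y, .crossing m' j x' y']
      [.crossing m' j x' y', .crossing m i x y] := by
  intro F u xs v h₁ h₂ h₃ h₄
  obtain ⟨l, a, b, l', rfl, hp⟩ := exists_split_pair hi (by omega : i + 2 ≤ k + xs.length)
  obtain ⟨q, c, d, q', rfl, hq⟩ := exists_split_pair hij (by simp at h₂; omega : j + 2 ≤ i + 2 + l'.length)
  have e : ∀ a b c d, u ++ ((l ++ a :: b :: (q ++ c :: d :: q')) ++ v) =
      (u ++ l) ++ a :: b :: (q ++ c :: d :: (q' ++ v)) := by simp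
  have e' : ∀ a b c d, (u ++ l) ++ a :: b :: (q ++ c :: d :: (q' ++ v)) =
      (u ++ l ++ a :: b :: q) ++ c :: d :: (q' ++ v) := by simp
  have hab : a ≠ b := by rintro rfl; simp [nodup_append] at h₃
  have hcd : c ≠ d := by rintro rfl; simp [nodup_append] at h₃
  have hac : a ≠ c ∧ a ≠ d ∧ b ≠ c ∧ b ≠ d := by
    simp only [nodup_append, nodup_cons, mem_cons, mem_append, not_or] at h₃
    tauto
  obtain ⟨hac, had, hbc, hbd⟩ := hac
  have hlen : (u ++ l).length = i := by simp; omega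
  have hlen' : ∀ a b, (u ++ l ++ a :: b :: q).length = j := by intro a b; simp; omega
  rw [e] at h₄ ⊢
  have h₅ : IsChordWord ((u ++ l) ++ b :: a :: (q ++ c :: d :: (q' ++ v))) := h₄.swap
  have h₄' := h₄
  rw [e'] at h₄' h₅
  have h₆ := h₄'.swap
  have h₇ := h₆
  rw [← e'] at h₇
  rw [chordSum_crossing ρ m x y _ F h₄ hlen, e', e',
    chordSum_crossing ρ m' x' y' _ F h₅ (hlen' b a),
    chordSum_crossing ρ m' x' y' _ F h₄' (hlen' a b),
    chordSum_crossing ρ m' x' y' _ F h₄' (hlen' a b), ← e', ← e', ← e', ← e',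
    chordSum_crossing ρ m x y _ F h₇ hlen, chordSum_crossing ρ m x y _ F h₄ hlen]
  simp only [chordSum_nil, lettersOf_append, lettersOf_cons, hab, hcd, hac.symm, had.symm, hbc.symm,
    hbd.symm, hac, had, hbc, hbd, if_false, or_self]
  split_ifs <;> ring

lemma chordSum_crossing_succ (ρ : ℤ) (m : Bool) (x y : R) (w : Word R) (F : StateFun) {k : ℕ}
    {u v : List ℕ} {a b c : ℕ} (h : IsChordWord (u ++ a :: b :: c :: v)) (hk : u.length = k) :
    chordSum ρ (.crossing m (k + 1) x y :: w) F (u ++ a :: b :: c :: v) =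
      (if b = c then 0 else chordSum ρ w F (u ++ a :: c :: b :: v)) +
        if Switchable ρ m x y ∧ lettersOf b c (v ++ (u ++ [a])) = [c, b] then
          T 2 * chordSum ρ w F (u ++ a :: b :: c :: v) else 0 := by
  have h' : IsChordWord ((u ++ [a]) ++ b :: c :: v) := by simpa using h
  simpa using chordSum_crossing ρ m x y w F h' (k := k + 1) (by simp [hk])

lemma lettersOf_self_ne {u v : List ℕ} {a : ℕ} (h : IsChordWord (u ++ a :: a :: v)) :
    ¬ lettersOf a a (v ++ u) = [a, a] := fun h' => ne_of_lettersOf_eq h h' rfl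

/-- Triple points. -/
lemma chordSum_triple (ρ : ℤ) {m₁ m₂ m₃ : Bool} {x y z : R} (F : StateFun) {k : ℕ}
    (h₁ : Switchable ρ m₁ x y → Switchable ρ m₂ x z → Switchable ρ m₃ y z)
    (h₂ : Switchable ρ m₁ x y → Switchable ρ m₃ y z → Switchable ρ m₂ x z)
    (h₃ : Switchable ρ m₂ x z → Switchable ρ m₃ y z → Switchable ρ m₁ x y) {u v : List ℕ}
    {a b c : ℕ} (h : IsChordWord (u ++ a :: b :: c :: v)) (hk : u.length = k) :
    chordSum ρ [.crossing m₁ k x y, .crossing m₂ (k + 1) x z, .crossing m₃ k y z] F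
        (u ++ a :: b :: c :: v) =
      chordSum ρ [.crossing m₃ (k + 1) y z, .crossing m₂ k x z, .crossing m₁ (k + 1) x y] F
        (u ++ a :: b :: c :: v) := by
  have p₁ : IsChordWord (u ++ b :: a :: c :: v) := h.swap
  have sw : ∀ {a b c : ℕ}, IsChordWord (u ++ a :: b :: c :: v) →
      IsChordWord (u ++ a :: c :: b :: v) := fun {a b c} h =>
    h.perm ((Perm.cons a (Perm.swap _ _ _)).append_left u)
  have p₂ := sw p₁
  have p₃ := sw h
  have p₄ : IsChordWord (u ++ c :: a :: b :: v) := p₃.swap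
  have p₅ := sw p₄
  have e₁ := fun (m : Bool) (x y : R) (w : Word R) (a b c : ℕ)
    (h : IsChordWord (u ++ a :: b :: c :: v)) => chordSum_crossing ρ m x y w F h hk
  have e₂ := fun (m : Bool) (x y : R) (w : Word R) (a b c : ℕ)
    (h : IsChordWord (u ++ a :: b :: c :: v)) => chordSum_crossing_succ ρ m x y w F h hk
  have ns : ∀ {a c : ℕ}, IsChordWord (u ++ a :: a :: c :: v) →
      ¬ lettersOf a a (c :: (v ++ u)) = [a, a] := fun h => lettersOf_self_ne h
  have ns' : ∀ {a c : ℕ}, IsChordWord (u ++ c :: a :: a :: v) →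
      ¬ lettersOf a a (v ++ (u ++ [c])) = [a, a] := fun {a c} h =>
    lettersOf_self_ne (u := u ++ [c]) (by simpa using h)
  have nh : ∀ {a c : ℕ}, c ≠ a → ¬ lettersOf a c (a :: (v ++ u)) = [c, a] := by
    intro a c hca h
    rw [lettersOf_cons, if_pos (Or.inl rfl)] at h
    exact hca (cons.inj h).1.symm
  have nl : ∀ {a c : ℕ}, c ≠ a → ¬ lettersOf c a (v ++ (u ++ [a])) = [a, c] := by
    intro a c hca h
    rw [← append_assoc, lettersOf_append] at h
    have := congrArg getLast? h
    simp [lettersOf_cons, lettersOf_nil] at this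
    exact hca this.symm
  -- If two of the three strands are matched, all terms on both sides vanish: the two would have to
  -- cross, and the position of the partner forbids the switches that could avoid it.
  rcases eq_or_ne a b with rfl | hab
  · rcases eq_or_ne a c with rfl | hac
    · simp [e₁, e₂, h, ns' h]
    · simp [e₁, e₂, h, p₃, p₄, hac, ns h, ns' p₄, nh hac.symm]
  rcases eq_or_ne a c with rfl | hac
  · simp [e₁, e₂, h, p₁, p₃, hab, hab.symm, ns p₃, ns' p₁, nh hab.symm, nl hab.symm]
  rcases eq_or_ne b c with rfl | hbc
  · simp [e₁, e₂, h, p₁, p₂, hab, ns p₂, ns' h, nl hab]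
  have hcount : ∀ {a b c : ℕ}, IsChordWord (u ++ a :: b :: c :: v) → a ≠ b → a ≠ c →
      (v ++ u).count a = 1 := by
    intro a b c h hab hac
    have := h a (by simp)
    simp [count_append, hab.symm, hac.symm] at this ⊢
    omega
  have ca := hcount h hab hac
  have cb := hcount p₁ hab.symm hbc
  have cc := hcount p₄ hac.symm hbc.symm
  have f₁ : ∀ {a b c : ℕ}, c ≠ a → c ≠ b →
      lettersOf a b (c :: v ++ u) = lettersOf a b (v ++ u) := by
    intro a b c h h'
    simp [lettersOf_cons, h, h']
  have f₂ : ∀ {a b c : ℕ}, c ≠ a → c ≠ b →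
      lettersOf a b (v ++ (u ++ [c])) = lettersOf a b (v ++ u) := by
    intro a b c h h'
    simp [lettersOf_append, lettersOf_cons, lettersOf_nil, h, h']
  simp only [e₁, e₂, h, p₁, p₂, p₃, p₄, hab, hac, hbc, hab.symm, hbc.symm, if_false,
    f₁ hac.symm hbc.symm, f₁ hbc.symm hac.symm, f₁ hab hac, f₁ hab.symm hbc,
    f₂ hab hac, f₂ hac hab, f₂ hab.symm hbc, f₂ hac.symm hbc.symm,
     chordSum_nil, lettersOf_eq_iff_idxOf_lt hab ca cb,
    lettersOf_eq_iff_idxOf_lt hac ca cc, lettersOf_eq_iff_idxOf_lt hbc cb cc,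
    lettersOf_eq_iff_idxOf_lt hab.symm cb ca,
    lettersOf_eq_iff_idxOf_lt hbc.symm cc cb]
  have na : (v ++ u).idxOf a ≠ (v ++ u).idxOf b := by
    rw [Ne, idxOf_inj (count_pos_iff.1 (by omega))]; exact hab
  have nb : (v ++ u).idxOf a ≠ (v ++ u).idxOf c := by
    rw [Ne, idxOf_inj (count_pos_iff.1 (by omega))]; exact hac
  have nc : (v ++ u).idxOf b ≠ (v ++ u).idxOf c := by
    rw [Ne, idxOf_inj (count_pos_iff.1 (by omega))]; exact hbc
  generalize (v ++ u).idxOf a = i at *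
  generalize (v ++ u).idxOf b = j at *
  generalize (v ++ u).idxOf c = l at *
  clear e₁ e₂ f₁ f₂ hcount nh nl ns ns' sw
  -- The hypotheses exclude that exactly two of the crossings are switchable. For each remaining
  -- pattern the identity is checked for every order of the three partners.
  by_cases t₁ : Switchable ρ m₁ x y <;> by_cases t₂ : Switchable ρ m₂ x z <;>
    by_cases t₃ : Switchable ρ m₃ y z <;> simp only [t₁, t₂, t₃, forall_const] at h₁ h₂ h₃
  all_goals
    rcases na.lt_or_gt with na | na <;> rcases nb.lt_or_gt with nb | nb <;>
      rcases nc.lt_or_gt with nc | nc <;>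
      first
      | (exfalso; omega)
      | (simp only [t₁, t₂, t₃, na, nb, nc, na.not_gt, nb.not_gt, nc.not_gt, true_and, false_and,
          if_true, if_false, add_zero]; try ring)

/-- The degrees satisfy `x - z = (x - y) + (y - z)`, so divisibility of any two of them by `ρ`
implies that of the third. -/
lemma blockEq_triple (ρ : ℤ) (k : ℕ) (x y z : R) :
    BlockEq ρ k 3 [.crossing false k x y, .crossing false (k + 1) x z, .crossing false k y z]
      [.crossing false (k + 1) y z, .crossing false k x z, .crossing false (k + 1) x y] := by
  intro F u xs v h₁ h₂ _ h₄
  obtain ⟨a, b, c, rfl⟩ := length_eq_three.1 h₂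
  refine chordSum_triple ρ F ?_ ?_ ?_ h₄ h₁
  · rintro ⟨-, h⟩ ⟨-, h'⟩
    exact ⟨rfl, by simpa using dvd_sub h' h⟩
  · rintro ⟨-, h⟩ ⟨-, h'⟩
    exact ⟨rfl, by simpa using dvd_add h h'⟩
  · rintro ⟨-, h⟩ ⟨-, h'⟩
    exact ⟨rfl, by simpa using dvd_sub h h'⟩

lemma BlockEq.of_eq {ρ : ℤ} {k n : ℕ} {w w' : Word R} (h : w = w') :
    BlockEq ρ k n w w' := h ▸ BlockEq.refl ρ k n w

/-- Far commutation with a single crossing. -/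
lemma blockEq_far_crossing_braid (ρ : ℤ) {k n i k₂ n₂ : ℕ} (m : Bool) (x y : R) {w : Word R}
    (hw : IsBraid k₂ n₂ w) (hi : k ≤ i) (hik : i + 2 ≤ k₂) (hk₂ : k₂ + n₂ ≤ k + n) :
    BlockEq ρ k n (.crossing m i x y :: w) (w ++ [.crossing m i x y]) := by
  induction w with
  | nil => exact BlockEq.refl _ _ _ _
  | cons e w ih =>
    obtain ⟨m', j, x', y', rfl, h₁, h₂⟩ := hw _ mem_cons_self
    have h₃ := (blockEq_far_crossing ρ (k := k) (n := n) (i := i) (j := j) m m' x y x' y' hi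
      (by omega) (by omega)).append_right w
    refine h₃.trans ?_
    exact (ih (isBraid_cons.1 hw).2).append_left (p := [.crossing m' j x' y'])
      (isBraid_cons.2 ⟨⟨by omega, by omega⟩, IsBraid.nil _ _⟩)

/-- Far commutation of braids. -/
lemma blockEq_far (ρ : ℤ) {k n k₁ n₁ k₂ n₂ : ℕ} {w₁ w₂ : Word R} (h₁ : IsBraid k₁ n₁ w₁)
    (h₂ : IsBraid k₂ n₂ w₂) (hk : k ≤ k₁) (h : k₁ + n₁ ≤ k₂) (hn : k₂ + n₂ ≤ k + n) :
    BlockEq ρ k n (w₁ ++ w₂) (w₂ ++ w₁) := by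
  induction w₁ with
  | nil => simpa using BlockEq.refl _ _ _ _
  | cons e w₁ ih =>
    obtain ⟨m, i, x, y, rfl, h₃, h₄⟩ := h₁ _ mem_cons_self
    have h₅ := (ih (isBraid_cons.1 h₁).2).append_left (p := [.crossing m i x y])
      (isBraid_cons.2 ⟨⟨by omega, by omega⟩, IsBraid.nil _ _⟩)
    refine h₅.trans ?_
    have h₆ := (blockEq_far_crossing_braid ρ (k := k) (n := n) (i := i) m x y h₂ (by omega)
      (by omega) hn).append_right w₁
    simpa using h₆

lemma slideDown_append (m : Bool) (k : ℕ) (x : R) (l l' : List R) :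
    slideDown m k x (l ++ l') = slideDown m k x l ++ slideDown m (k + l.length) x l' := by
  simp [slideDown_eq_mixedSlide, mixedSlide_append]

/-- Two strands that cross slide over a set of strands before or after crossing. -/
lemma blockEq_slide_slide (ρ : ℤ) (k : ℕ) (s t : R) (l : List R) :
    BlockEq ρ k (l.length + 2)
      (.crossing false k s t :: (slideDown false (k + 1) s l ++ slideDown false k t l))
      (slideDown false (k + 1) t l ++
        (slideDown false k s l ++ [.crossing false (k + l.length) s t])) := by
  induction l generalizing k with
  | nil => exact BlockEq.refl _ _ _ _
  | cons y l ih =>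
    have hb : ∀ (i : ℕ) (x y : R), k ≤ i → i + 2 ≤ k + (l.length + 3) →
        IsBraid k (l.length + 3) [FrontEvent.crossing false i x y] := fun i x y h h' =>
      isBraid_cons.2 ⟨⟨h, h'⟩, IsBraid.nil _ _⟩
    have h₁ : BlockEq ρ k (l.length + 3)
        (slideDown false (k + 2) s l ++ [.crossing false k t y])
        ([.crossing false k t y] ++ slideDown false (k + 2) s l) :=
      (blockEq_far_crossing_braid ρ false t y (isBraid_slideDown false (k + 2) s l) le_rfl
        le_rfl (by omega)).symm
    have h₂ := (h₁.append_left (p := [.crossing false k s t] ++ [.crossing false (k + 1) s y])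
      ((hb _ _ _ le_rfl (by omega)).append (hb _ _ _ (by omega) (by omega)))).append_right
        (slideDown false (k + 1) t l)
    have h₃ := ((blockEq_triple ρ k s t y).mono (k' := k) (n' := l.length + 3) le_rfl
      (by omega)).append_right (slideDown false (k + 2) s l ++ slideDown false (k + 1) t l)
    have h₄ := ((ih (k + 1)).mono (k' := k) (n' := l.length + 3) (by omega)
      (by omega)).append_left (p := [.crossing false (k + 1) t y] ++ [.crossing false k s y])
      ((hb _ _ _ (by omega) (by omega)).append (hb _ _ _ le_rfl (by omega)))
    have h₅ := ((blockEq_far_crossing_braid ρ (k := k) (n := l.length + 3) (i := k) false s y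
      (isBraid_slideDown false (k + 2) t l) le_rfl le_rfl (by omega)).append_left
        (p := [.crossing false (k + 1) t y]) (hb _ _ _ (by omega) (by omega))).append_right
        (slideDown false (k + 1) s l ++ [.crossing false (k + 1 + l.length) s t])
    refine (BlockEq.of_eq ?_).trans (h₂.trans ((BlockEq.of_eq ?_).trans (h₃.trans
      ((BlockEq.of_eq ?_).trans (h₄.trans ((BlockEq.of_eq ?_).trans (h₅.trans
        (BlockEq.of_eq ?_))))))))
    all_goals simp [slideDown, Nat.add_assoc, Nat.add_comm 1]

/-! ### Sorting by targets -/

/-- The order compares first components only; it is antisymmetric on lists with distinct targets,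
and there the sorted arrangement is unique. -/
lemma insertionSort_eq_of_perm {st l : List (ℕ × R)} (h : l.Perm st)
    (hl : l.Pairwise fun s t => s.1 < t.1) :
    st.insertionSort (fun s t => s.1 ≤ t.1) = l := by
  have : Std.Total (fun s t : ℕ × R => s.1 ≤ t.1) := ⟨fun a b => le_total _ _⟩
  have : IsTrans (ℕ × R) (fun s t : ℕ × R => s.1 ≤ t.1) := ⟨fun a b c h h' => h.trans h'⟩
  have hinj : ∀ a ∈ l, ∀ b ∈ l, a.1 = b.1 → a = b := by
    have h' : (l.map Prod.fst).Nodup := by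
      rw [Nodup, pairwise_map]
      exact hl.imp fun h => h.ne
    exact fun a ha b hb hab => inj_on_of_nodup_map h' ha hb hab
  refine Perm.eq_of_pairwise (le := fun s t : ℕ × R => s.1 ≤ t.1) ?_
    (pairwise_insertionSort _ _) (hl.imp fun h => h.le) ((perm_insertionSort _ _).trans h.symm)
  intro a b ha hb h₁ h₂
  exact hinj a (h.mem_iff.2 ((perm_insertionSort _ _).mem_iff.1 ha)) b hb (le_antisymm h₁ h₂)

lemma pairwise_insertionSort_lt {st : List (ℕ × R)} (h : (st.map Prod.fst).Nodup) :
    (st.insertionSort fun s t => s.1 ≤ t.1).Pairwise fun s t => s.1 < t.1 := by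
  have : Std.Total (fun s t : ℕ × R => s.1 ≤ t.1) := ⟨fun a b => le_total _ _⟩
  have : IsTrans (ℕ × R) (fun s t : ℕ × R => s.1 ≤ t.1) := ⟨fun a b c h h' => h.trans h'⟩
  have h₁ := pairwise_insertionSort (fun s t : ℕ × R => s.1 ≤ t.1) st
  have h₂ : ((st.insertionSort fun s t => s.1 ≤ t.1).map Prod.fst).Nodup :=
    ((perm_insertionSort _ st).map Prod.fst).nodup_iff.2 h
  rw [Nodup, pairwise_map] at h₂
  exact (h₁.and h₂).imp fun h => lt_of_le_of_ne h.1 h.2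

lemma length_sortedPotentials (st : List (ℕ × R)) :
    (sortedPotentials st).length = st.length := by
  simp [sortedPotentials]

lemma nodup_filter_fst {st : List (ℕ × R)} (h : (st.map Prod.fst).Nodup) (q : ℕ × R → Bool) :
    ((st.filter q).map Prod.fst).Nodup := h.sublist (filter_sublist.map Prod.fst)

/-- The first strand acts as a pivot: it crosses the strands of lower target in `permutationBraid`
and those of higher target in `complementBraid`. -/
lemma sortedPotentials_cons {p : ℕ} {x : R} {st : List (ℕ × R)}
    (h : (((p, x) :: st).map Prod.fst).Nodup) :
    sortedPotentials ((p, x) :: st) = sortedPotentials (st.filter fun t => t.1 < p) ++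
        x :: sortedPotentials (st.filter fun t => p < t.1) := by
  simp only [map_cons, nodup_cons] at h
  have hp : ∀ t ∈ st, t.1 ≠ p := fun t ht h' => h.1 (h' ▸ mem_map_of_mem ht)
  have e : ∀ l l' : List (ℕ × R), l.map Prod.snd ++ x :: l'.map Prod.snd =
    (l ++ (p, x) :: l').map Prod.snd := by simp
  unfold sortedPotentials
  rw [e]
  congr 1
  refine insertionSort_eq_of_perm ?_ ?_
  · refine perm_middle.trans (Perm.cons _ ?_)
    refine ((perm_insertionSort _ _).append (perm_insertionSort _ _)).trans ?_
    have e₂ : st.filter (fun t => p < t.1) = st.filter fun t => !decide (t.1 < p) :=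
      filter_congr fun t ht => by
        have := hp t ht
        by_cases h₁ : t.1 < p
        · simp [h₁, h₁.le]
        · simp [h₁, lt_of_le_of_ne (not_lt.1 h₁) (Ne.symm this)]
    rw [e₂]
    exact filter_append_perm _ _
  · rw [pairwise_append]
    refine ⟨pairwise_insertionSort_lt (nodup_filter_fst h.2 _), ?_, ?_⟩
    · rw [pairwise_cons]
      refine ⟨fun t ht => ?_, pairwise_insertionSort_lt (nodup_filter_fst h.2 _)⟩
      rw [(perm_insertionSort _ _).mem_iff] at ht
      simpa using (mem_filter.1 ht).2
    · intro a ha b hb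
      rw [(perm_insertionSort _ _).mem_iff] at ha
      have ha' : a.1 < p := by simpa using (mem_filter.1 ha).2
      rcases mem_cons.1 hb with rfl | hb
      · exact ha'
      · rw [(perm_insertionSort _ _).mem_iff] at hb
        have hb' : p < b.1 := by simpa using (mem_filter.1 hb).2
        exact ha'.trans hb'

lemma sortedPotentials_eq_append {p : ℕ} {st : List (ℕ × R)} (h : (st.map Prod.fst).Nodup)
    (hp : ∀ t ∈ st, t.1 ≠ p) :
    sortedPotentials st = sortedPotentials (st.filter fun t => t.1 < p) ++
      sortedPotentials (st.filter fun t => p < t.1) := by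
  unfold sortedPotentials
  rw [← map_append]
  congr 1
  refine insertionSort_eq_of_perm ?_ ?_
  · refine ((perm_insertionSort _ _).append (perm_insertionSort _ _)).trans ?_
    have e₂ : st.filter (fun t => p < t.1) = st.filter fun t => !decide (t.1 < p) :=
      filter_congr fun t ht => by
        have := hp t ht
        by_cases h₁ : t.1 < p
        · simp [h₁, h₁.le]
        · simp [h₁, lt_of_le_of_ne (not_lt.1 h₁) (Ne.symm this)]
    rw [e₂]
    exact filter_append_perm _ _
  · rw [pairwise_append]
    refine ⟨pairwise_insertionSort_lt (nodup_filter_fst h _),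
      pairwise_insertionSort_lt (nodup_filter_fst h _), ?_⟩
    intro a ha b hb
    rw [(perm_insertionSort _ _).mem_iff] at ha hb
    have ha' : a.1 < p := by simpa using (mem_filter.1 ha).2
    have hb' : p < b.1 := by simpa using (mem_filter.1 hb).2
    exact ha'.trans hb'

lemma length_filter_lt_add {p : ℕ} {st : List (ℕ × R)} (hp : ∀ t ∈ st, t.1 ≠ p) :
    (st.filter fun t => t.1 < p).length + (st.filter fun t => p < t.1).length = st.length := by
  have e₂ : st.filter (fun t => p < t.1) = st.filter fun t => !decide (t.1 < p) :=
    filter_congr fun t ht => by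
      have := hp t ht
      by_cases h₁ : t.1 < p
      · simp [h₁, h₁.le]
      · simp [h₁, lt_of_le_of_ne (not_lt.1 h₁) (Ne.symm this)]
  rw [e₂]
  simpa using (filter_append_perm (fun t : ℕ × R => decide (t.1 < p)) st).length_eq

lemma isBraid_permutationBraid (k : ℕ) (st : List (ℕ × R)) :
    IsBraid k st.length (permutationBraid k st) := by
  induction st generalizing k with
  | nil => exact IsBraid.nil _ _
  | cons a st ih =>
    obtain ⟨p, x⟩ := a
    refine ((ih (k + 1)).mono (by omega) (by simp; omega)).append
      ((isBraid_slideDown _ _ _ _).mono le_rfl ?_)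
    rw [length_sortedPotentials]
    have := length_filter_le (fun t : ℕ × R => decide (t.1 < p)) st
    simp only [length_cons]
    omega

/-- A strand slides past a permutation braid. -/
lemma blockEq_slide_permutationBraid (ρ : ℤ) (k : ℕ) (s : R) (st : List (ℕ × R))
    (h : (st.map Prod.fst).Nodup) :
    BlockEq ρ k (st.length + 1) (slideDown false k s (st.map Prod.snd) ++ permutationBraid k st)
      (permutationBraid (k + 1) st ++ slideDown false k s (sortedPotentials st)) := by
  induction st generalizing k with
  | nil => exact BlockEq.refl _ _ _ _
  | cons a st ih =>
    obtain ⟨p, x⟩ := a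
    have hs := sortedPotentials_cons h
    simp only [map_cons, nodup_cons] at h
    have hp : ∀ t ∈ st, t.1 ≠ p := fun t ht h' => h.1 (h' ▸ mem_map_of_mem ht)
    have hs' := sortedPotentials_eq_append h.2 hp
    have hl := length_filter_lt_add hp
    have hl₁ := length_sortedPotentials (st.filter fun t => t.1 < p)
    have hl₂ := length_sortedPotentials (st.filter fun t => p < t.1)
    set lo := sortedPotentials (st.filter fun t => t.1 < p)
    set hi := sortedPotentials (st.filter fun t => p < t.1)
    have hb : IsBraid k (st.length + 2) [FrontEvent.crossing false k s x] :=
      isBraid_cons.2 ⟨⟨le_rfl, by omega⟩, IsBraid.nil _ _⟩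
    have hβ : IsBraid k (st.length + 2) (permutationBraid (k + 2) st) :=
      (isBraid_permutationBraid (k + 2) st).mono (by omega) (by omega)
    have h₁ := (((ih (k + 1) h.2).mono (k' := k) (n' := st.length + 2) (by omega)
      (by omega)).append_left hb).append_right (slideDown false k x lo)
    have h₂ := ((blockEq_far ρ (k := k) (n := st.length + 2) (isBraid_slideDown false k x lo)
      (isBraid_slideDown false (k + 1 + lo.length) s hi) le_rfl (by omega)
      (by omega)).symm.append_left (p := [.crossing false k s x] ++ permutationBraid (k + 2) st ++
        slideDown false (k + 1) s lo)
      ((hb.append hβ).append ((isBraid_slideDown _ _ _ _).mono (by omega) (by omega))))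
    have h₃ := (blockEq_far_crossing_braid ρ (k := k) (n := st.length + 2) (i := k) false s x
      (isBraid_permutationBraid (k + 2) st) le_rfl le_rfl (by omega)).append_right
        (slideDown false (k + 1) s lo ++ (slideDown false k x lo ++
          slideDown false (k + 1 + lo.length) s hi))
    -- The new strand and the first strand of `st` both descend over the strands of lower target;
    -- their mutual crossing is moved from before these slides to after them.
    have h₄ := (((blockEq_slide_slide ρ k s x lo).mono (k' := k) (n' := st.length + 2) le_rfl
      (by omega)).append_left hβ).append_right (slideDown false (k + 1 + lo.length) s hi)
    refine (BlockEq.of_eq ?_).trans (h₁.trans ((BlockEq.of_eq ?_).trans (h₂.trans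
      ((BlockEq.of_eq ?_).trans (h₃.trans ((BlockEq.of_eq ?_).trans (h₄.trans
        (BlockEq.of_eq ?_))))))))
    · simp [permutationBraid, slideDown, lo]
    · simp [hs', slideDown_append]
    · simp
    · simp
    · simp [permutationBraid, hs, slideDown, slideDown_append, lo, Nat.add_assoc, Nat.add_comm 1]

/-- The strand with the lowest target may cross first. -/
lemma blockEq_permutationBraid_min (ρ : ℤ) (k : ℕ) (p : ℕ) (x : R) (l l' : List (ℕ × R))
    (h : ((l ++ (p, x) :: l').map Prod.fst).Nodup) (hp : ∀ t ∈ l ++ l', p < t.1) :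
    BlockEq ρ k (l.length + l'.length + 1) (permutationBraid k (l ++ (p, x) :: l'))
      (slideUp false k x (l.map Prod.snd) ++ permutationBraid (k + 1) (l ++ l')) := by
  induction l generalizing k with
  | nil =>
    have : l'.filter (fun t => t.1 < p) = [] := by
      rw [filter_eq_nil_iff]
      intro t ht
      have := hp t (by simpa using ht)
      simpa using this.le
    refine BlockEq.of_eq ?_
    simp [permutationBraid, slideUp, this, sortedPotentials, slideDown]
  | cons a l ih =>
    obtain ⟨q, y⟩ := a
    have hpq : p < q := hp (q, y) (by simp)
    have h' : ((l ++ (p, x) :: l').map Prod.fst).Nodup := by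
      simp only [cons_append, map_cons, nodup_cons] at h
      exact h.2
    have hn' : ((l ++ l').map Prod.fst).Nodup :=
      h'.sublist (((sublist_cons_self _ _).append_left l).map Prod.fst)
    have hp' : ∀ t ∈ l ++ l', p < t.1 := fun t ht => hp t (by simp at ht ⊢; tauto)
    -- The strand with the least target is the first one met by an earlier strand in its descent.
    have hsort : sortedPotentials ((l ++ (p, x) :: l').filter fun t => t.1 < q) =
        x :: sortedPotentials ((l ++ l').filter fun t => t.1 < q) := by
      unfold sortedPotentials
      rw [← map_cons (f := Prod.snd) (a := (p, x))]
      congr 1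
      refine insertionSort_eq_of_perm ?_ ?_
      · refine ((perm_insertionSort _ _).cons _).trans ?_
        rw [filter_append, filter_append, filter_cons_of_pos (by simpa using hpq)]
        exact perm_middle.symm
      · rw [pairwise_cons]
        refine ⟨fun t ht => ?_, pairwise_insertionSort_lt (nodup_filter_fst hn' _)⟩
        rw [(perm_insertionSort _ _).mem_iff] at ht
        exact hp' t (mem_filter.1 ht).1
    set lo := sortedPotentials ((l ++ l').filter fun t => t.1 < q) with hlo
    have h₁ := ((ih (k + 1) h' hp').mono (k' := k) (n' := l.length + 1 + l'.length + 1) (by omega)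
      (by omega)).append_right (slideDown false k y (x :: lo))
    have hb : IsBraid k (l.length + 1 + l'.length + 1) (slideUp false (k + 1) x (l.map Prod.snd)) := by
      have : ∀ (k : ℕ) (ys : List R), IsBraid k (ys.length + 1) (slideUp false k x ys) := by
        intro k ys
        induction ys generalizing k with
        | nil => exact IsBraid.nil _ _
        | cons y ys ih =>
          refine ((ih (k + 1)).mono (by omega) (by simp; omega)).append
            (isBraid_cons.2 ⟨⟨le_rfl, by simp⟩, IsBraid.nil _ _⟩)
      exact (this (k + 1) (l.map Prod.snd)).mono (by omega) (by simp; omega)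
    have h₂ := (((blockEq_far_crossing_braid ρ (k := k) (n := l.length + 1 + l'.length + 1) (i := k)
      false y x (isBraid_permutationBraid (k + 2) (l ++ l')) le_rfl le_rfl
      (by simp; omega)).symm.append_left hb)).append_right (slideDown false (k + 1) y lo)
    refine (BlockEq.of_eq ?_).trans (h₁.trans ((BlockEq.of_eq ?_).trans (h₂.trans
      (BlockEq.of_eq ?_))))
    · rw [cons_append, permutationBraid, hsort]
    · simp [slideDown]
    · simp [permutationBraid, slideUp, hlo]

/-! ### The marked half-twist -/

lemma mirrorWord_cons (e : FrontEvent R) (w : Word R) :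
    mirrorWord (e :: w) = mirrorWord w ++ [e.mirror] := by simp [mirrorWord]

lemma mirrorWord_append (w w' : Word R) :
    mirrorWord (w ++ w') = mirrorWord w' ++ mirrorWord w := by simp [mirrorWord]

lemma mirrorWord_mirrorWord (w : Word R) : mirrorWord (mirrorWord w) = w := by
  have : ∀ e : FrontEvent R, e.mirror.mirror = e := fun e => by cases e <;> rfl
  simp [mirrorWord, Function.comp_def, this]

lemma wordSum_zero (ρ : ℤ) (w : Word R) (f : ℕ → ℕ) : wordSum ρ w 0 f = 0 := by
  have := wordSum_sum ρ w (∅ : Finset ℕ) (fun _ => 0) f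
  simp only [Finset.sum_empty] at this
  exact this

/-- Exchange two successive elements of a list. -/
def swapAt {α : Type} : ℕ → List α → List α
  | 0, a :: b :: l => b :: a :: l
  | i + 1, a :: l => a :: swapAt i l
  | _, l => l

lemma swapAt_append {α : Type} (l l' : List α) (a b : α) :
    swapAt l.length (l ++ a :: b :: l') = l ++ b :: a :: l' := by
  induction l with
  | nil => rfl
  | cons c l ih => simp [swapAt, ih]

/-- The letters of a masked word may cross in the given order without meeting an equal letter. -/
def Survives : List ℕ → List (Option ℕ) → Prop
  | [], _ => True
  | i :: is, M => (∀ a, ¬ (M[i]? = some (some a) ∧ M[i + 1]? = some (some a))) ∧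
      Survives is (swapAt i M)

/-- `w` consists of marked crossings at the given heights below `k`. -/
def MarkedAt (k : ℕ) (is : List ℕ) (w : Word R) : Prop :=
  Forall₂ (fun i e => ∃ x y, e = .crossing true (k + i) x y) is w

lemma doubledLetters_perm {l l' : List ℕ} (h : l.Perm l') :
    (fun c => if l.count c = 2 then some c else none) =
      fun c => if l'.count c = 2 then some c else none := by
  funext c
  rw [h.count_eq]

/-- Marked crossings are never switched, so a state follows a single path. Either two equal letters
are made to cross and the sum vanishes, or the mirror image retraces the path. Which case occurs
depends only on the letters occurring twice in the block and on their places, which is why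
`Survives` is a property of `doubledLetters`. -/
lemma chordSum_markedBraid (ρ : ℤ) {k : ℕ} {is : List ℕ} {w : Word R} (hw : MarkedAt k is w)
    (F : StateFun) {u zs v : List ℕ} (hu : u.length = k) (his : ∀ i ∈ is, i + 2 ≤ zs.length)
    (h : IsChordWord (u ++ (zs ++ v))) :
    (Survives is (doubledLetters zs) →
      chordSum ρ (w ++ mirrorWord w) F (u ++ (zs ++ v)) = F (chordMatching (u ++ (zs ++ v)))) ∧
    (¬ Survives is (doubledLetters zs) → chordSum ρ w F (u ++ (zs ++ v)) = 0) := by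
  induction is generalizing w zs F with
  | nil =>
    cases hw
    exact ⟨fun _ => rfl, fun h => absurd trivial h⟩
  | cons i is ih =>
    rcases hw with _ | ⟨⟨x, y, rfl⟩, hw⟩
    obtain ⟨l, a, b, l', rfl, hp⟩ := exists_split_pair (k := 0) (p := i) (xs := zs) (Nat.zero_le _)
      (by have := his i mem_cons_self; omega)
    obtain rfl : l.length = i := by omega
    have hns : ∀ x y : R, ¬ Switchable ρ true x y := fun x y h => by cases h.1
    have hcr := fun (x y : R) (w : Word R) (F : StateFun) a b h =>
      chordSum_crossing_block ρ true x y w F (p := k + l.length) (u := u) (l := l) (l' := l')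
        (v := v) (a := a) (b := b) h (by rw [hu])
    simp only [hns, false_and, if_false, add_zero] at hcr
    have hperm : (l ++ b :: a :: l').Perm (l ++ a :: b :: l') := (Perm.swap a b l').append_left l
    have h' : IsChordWord (u ++ ((l ++ b :: a :: l') ++ v)) :=
      h.perm ((hperm.symm.append_right v).append_left u)
    have hsw : swapAt l.length (doubledLetters (l ++ a :: b :: l')) =
        doubledLetters (l ++ b :: a :: l') := by
      unfold doubledLetters
      rw [doubledLetters_perm hperm, map_append, map_cons, map_cons]
      have := swapAt_append (l.map fun c => if (l ++ a :: b :: l').count c = 2 then some c else none)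
        (l'.map fun c => if (l ++ a :: b :: l').count c = 2 then some c else none)
        (if (l ++ a :: b :: l').count a = 2 then some a else none)
        (if (l ++ a :: b :: l').count b = 2 then some b else none)
      rw [length_map] at this
      rw [this]
      simp
    have hmeet : (∀ c, ¬ ((doubledLetters (l ++ a :: b :: l'))[l.length]? = some (some c) ∧
        (doubledLetters (l ++ a :: b :: l'))[l.length + 1]? = some (some c))) ↔ a ≠ b := by
      have e₁ : (doubledLetters (l ++ a :: b :: l'))[l.length]? =
          some (if (l ++ a :: b :: l').count a = 2 then some a else none) := by
        simp [doubledLetters]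
      have e₂ : (doubledLetters (l ++ a :: b :: l'))[l.length + 1]? =
          some (if (l ++ a :: b :: l').count b = 2 then some b else none) := by
        simp [doubledLetters]
      rw [e₁, e₂]
      constructor
      · rintro hc rfl
        have h₁ := h.count a
        simp only [count_append, count_cons_self] at h₁
        have h₂ : (l ++ a :: a :: l').count a = 2 := by
          simp only [count_append, count_cons_self]
          omega
        exact hc a (by simp [h₂])
      · rintro hab c ⟨h₁, h₂⟩
        rw [Option.some_inj] at h₁ h₂
        split_ifs at h₁
        split_ifs at h₂
        exact hab ((Option.some_inj.1 h₁).trans (Option.some_inj.1 h₂).symm)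
    have hS : Survives (l.length :: is) (doubledLetters (l ++ a :: b :: l')) ↔
        a ≠ b ∧ Survives is (doubledLetters (l ++ b :: a :: l')) := by
      rw [Survives, hmeet, hsw]
    have his' : ∀ i ∈ is, i + 2 ≤ (l ++ b :: a :: l').length := fun i hi => by
      simpa using his i (mem_cons_of_mem _ hi)
    rw [hS]
    constructor
    · rintro ⟨hab, hs⟩
      rw [mirrorWord_cons, ← append_assoc, cons_append, cons_append, hcr _ _ _ _ _ _ h, if_neg hab,
        chordSum_append, (ih hw _ his' h').1 hs]
      have := hcr y x [] F b a h'
      rw [if_neg (Ne.symm hab)] at this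
      exact this
    · intro hs
      rw [hcr _ _ _ _ _ _ h]
      split_ifs with hab
      · rfl
      · exact (ih hw _ his' h').2 fun h => hs ⟨hab, h⟩

lemma survives_of_forall_none (is : List ℕ) {M : List (Option ℕ)} (h : ∀ m ∈ M, m = none) :
    Survives is M := by
  have hsw : ∀ (i : ℕ) (M : List (Option ℕ)), ∀ m ∈ swapAt i M, m ∈ M := by
    intro i
    induction i with
    | zero =>
      intro M
      rcases M with _ | ⟨a, _ | ⟨b, M⟩⟩ <;> simp +contextual [swapAt]
    | succ i ih =>
      intro M
      rcases M with _ | ⟨a, M⟩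
      · simp [swapAt]
      · simp only [swapAt, mem_cons, forall_eq_or_imp, true_or, true_and]
        exact fun m hm => Or.inr (ih M m hm)
  induction is generalizing M with
  | nil => trivial
  | cons i is ih =>
    refine ⟨fun a ha => ?_, ih fun m hm => h m (hsw i M m hm)⟩
    have := h _ (mem_of_getElem? ha.1)
    cases this

lemma doubledLetters_of_nodup {l : List ℕ} (h : l.Nodup) : ∀ m ∈ doubledLetters l, m = none := by
  intro m hm
  obtain ⟨c, -, rfl⟩ := mem_map.1 hm
  have := nodup_iff_count_le_one.1 h c
  rw [if_neg (by omega)]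

lemma markedAt_slideDown (k j : ℕ) (x : R) (l : List R) :
    MarkedAt k (range' j l.length) (slideDown true (k + j) x l) := by
  induction l generalizing j with
  | nil => exact Forall₂.nil
  | cons y l ih =>
    simp only [length_cons, range'_succ, slideDown]
    exact Forall₂.cons ⟨x, y, rfl⟩ (by simpa [Nat.add_assoc, MarkedAt] using ih (j + 1))

/-- One list of heights serves all `k`. This is needed because complement braids based at `k` and at
`k + 1` are compared in `chordSum_halfTwist_eq_zero`. -/
lemma exists_markedAt_complementBraid (st : List (ℕ × R)) (h : (st.map Prod.fst).Nodup) :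
    ∃ is, (∀ i ∈ is, i + 2 ≤ st.length) ∧ ∀ k, MarkedAt k is (complementBraid k st) := by
  induction st with
  | nil => exact ⟨[], by simp, fun _ => Forall₂.nil⟩
  | cons a st ih =>
    obtain ⟨p, x⟩ := a
    simp only [map_cons, nodup_cons] at h
    have hl := length_filter_lt_add (p := p) (st := st) fun t ht h' =>
      h.1 (h' ▸ mem_map_of_mem ht)
    obtain ⟨is, h₁, h₂⟩ := ih h.2
    refine ⟨range' (st.filter fun t => t.1 < p).length
      (sortedPotentials (st.filter fun t => p < t.1)).length ++ is, ?_, fun k => ?_⟩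
    · intro i hi
      rw [length_sortedPotentials] at hi
      rcases mem_append.1 hi with hi | hi
      · rw [mem_range'_1] at hi
        simp only [length_cons]
        omega
      · have := h₁ i hi
        simp only [length_cons]
        omega
    · exact rel_append (markedAt_slideDown k _ x _) (h₂ k)

/-- A permutation braid followed by its complement lets every pair of strands cross, so that no
two of them may be matched. -/
lemma chordSum_halfTwist_eq_zero (ρ : ℤ) (st : List (ℕ × R)) (hst : (st.map Prod.fst).Nodup)
    (F : StateFun) {k : ℕ} {u xs v : List ℕ} (hu : u.length = k) (hn : xs.length = st.length)
    (h : IsChordWord (u ++ (xs ++ v))) (hxs : ¬ xs.Nodup) :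
    chordSum ρ (permutationBraid k st ++ complementBraid k st) F (u ++ (xs ++ v)) = 0 := by
  induction st generalizing k u xs F with
  | nil =>
    obtain rfl := length_eq_zero_iff.1 hn
    simp at hxs
  | cons a st ih =>
    obtain ⟨p, x⟩ := a
    obtain _ | ⟨s, ys⟩ := xs
    · simp at hn
    simp only [map_cons, nodup_cons] at hst
    have hl := length_filter_lt_add (p := p) (st := st) fun t ht h' =>
      hst.1 (h' ▸ mem_map_of_mem ht)
    have hl₁ := length_sortedPotentials (st.filter fun t => t.1 < p)
    have hl₂ := length_sortedPotentials (st.filter fun t => p < t.1)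
    have hn' : ys.length = st.length := by simpa using hn
    obtain ⟨is, his, his'⟩ := exists_markedAt_complementBraid st hst.2
    -- The descents of the first strand in `β` and in `βᶜ` are consecutive and form one slide over
    -- all other strands, with regular crossings above and marked ones below.
    let sl := (sortedPotentials (st.filter fun t => t.1 < p)).map (fun y => (false, y)) ++
      (sortedPotentials (st.filter fun t => p < t.1)).map fun y => (true, y)
    have hsl : sl.length = ys.length := by simp [sl]; omega
    have e : permutationBraid k ((p, x) :: st) ++ complementBraid k ((p, x) :: st) =
        permutationBraid (k + 1) st ++ (mixedSlide k x sl ++ complementBraid k st) := by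
      simp only [permutationBraid, complementBraid, slideDown_eq_mixedSlide, sl, mixedSlide_append,
        append_assoc, length_map, hl₁]
    have e' : u ++ (s :: ys ++ v) = (u ++ [s]) ++ (ys ++ v) := by simp
    have hu' : (u ++ [s]).length = k + 1 := by simp [hu]
    rw [e, e']
    rw [e'] at h
    have hperm : ∀ {zs}, zs.Perm ys → IsChordWord (u ++ s :: (zs ++ v)) := by
      intro zs hzs
      simpa using h.perm ((hzs.symm.append_right v).append_left (u ++ [s]))
    set G := wordSum ρ (mixedSlide k x sl ++ complementBraid k st) F with hG
    rw [chordSum_append, ← hG]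
    have hb : IsBraid (k + 1) st.length (permutationBraid (k + 1) st) :=
      isBraid_permutationBraid _ _
    have hGs : ∀ zs, G (chordMatching (u ++ [s] ++ (zs ++ v))) =
        chordSum ρ (mixedSlide k x sl) (wordSum ρ (complementBraid k st) F)
          (u ++ s :: (zs ++ v)) := by
      intro zs
      rw [hG, wordSum_append, chordSum]
      simp
    -- The induction hypothesis concerns the braid of the other strands followed by its own
    -- complement. So what follows that braid has to be written as the complement braid applied to
    -- some `F'`; the witness first undoes the complement braid by its mirror image.
    suffices hz : ∃ F', ∀ zs, zs.Perm ys → G (chordMatching (u ++ [s] ++ (zs ++ v))) =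
        wordSum ρ (complementBraid (k + 1) st) F' (chordMatching (u ++ [s] ++ (zs ++ v))) ∧
          (s ∈ ys → G (chordMatching (u ++ [s] ++ (zs ++ v))) = 0) by
      obtain ⟨F', hF'⟩ := hz
      by_cases hs : s ∈ ys
      · rw [hb.chordSum_congr (F' := wordSum ρ (permutationBraid (k + 1) st) 0) hu' hn' h
          fun zs hzs => ?_]
        · rw [show wordSum ρ (permutationBraid (k + 1) st) 0 = (0 : StateFun) from
            funext (wordSum_zero ρ _), chordSum, wordSum_zero]
        · rw [(hF' zs hzs).2 hs]
          exact (wordSum_zero ρ _ _).symm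
      · have hys : ¬ ys.Nodup := fun h => hxs (nodup_cons.2 ⟨hs, h⟩)
        rw [hb.chordSum_congr hu' hn' h fun zs hzs => (hF' zs hzs).1, ← chordSum_append]
        exact ih hst.2 F' hu' hn' h hys
    refine ⟨wordSum ρ (mirrorWord (complementBraid (k + 1) st)) G, fun zs hzs => ⟨?_, fun hs => ?_⟩⟩
    · have hc := hperm hzs
      have hc' : IsChordWord ((u ++ [s]) ++ (zs ++ v)) := by simpa using hc
      have hlen : ∀ i ∈ is, i + 2 ≤ zs.length := fun i hi => by
        rw [hzs.length_eq, hn']; exact his i hi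
      have hm := chordSum_markedBraid ρ (his' (k + 1)) (u := u ++ [s]) (zs := zs) (v := v)
      by_cases hsv : Survives is (doubledLetters zs)
      · rw [← wordSum_append]
        exact ((hm G hu' hlen hc').1 hsv).symm
      · refine Eq.trans ?_ ((hm _ hu' hlen hc').2 hsv).symm
        -- The slide preserves `doubledLetters`, so an obstruction to the complement braid before
        -- the slide is still one after it.
        rw [hGs, chordSum_mixedSlide_congr ρ x (F' := 0) sl hc hu (by rw [hsl, hzs.length_eq])]
        · exact wordSum_zero ρ _ _
        · intro p' s' hp' hs' hperm' hsz
          have hlen' : p'.length = zs.length := by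
            simpa using hperm'.length_eq
          refine (chordSum_markedBraid ρ (his' k) F (u := u) (zs := p') (v := s' :: v) hu
            (by rw [hlen']; exact hlen) ?_).2 (by rw [hp']; exact hsv)
          refine hc.perm ?_
          simpa using (hperm'.symm.append_right v).append_left u
    · rw [hGs]
      exact chordSum_mixedSlide_eq_zero ρ x _ sl (hperm hzs) hu (by rw [hsl, hzs.length_eq])
        (hzs.mem_iff.2 hs)

/-- The state sum of `β βᶜ` followed by the reverse of `βᶜ`. -/
lemma chordSum_halfTwist (ρ : ℤ) (st : List (ℕ × R)) (hst : (st.map Prod.fst).Nodup) (F : StateFun)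
    {k : ℕ} {u xs v : List ℕ} (hu : u.length = k) (hn : xs.length = st.length)
    (h : IsChordWord (u ++ (xs ++ v))) :
    chordSum ρ (permutationBraid k st ++ complementBraid k st ++ mirrorWord (complementBraid k st))
        F (u ++ (xs ++ v)) =
      if xs.Nodup then chordSum ρ (permutationBraid k st) F (u ++ (xs ++ v)) else 0 := by
  split_ifs with hxs
  · rw [append_assoc, chordSum_append]
    refine (isBraid_permutationBraid k st).chordSum_congr hu hn h fun zs hzs => ?_
    obtain ⟨is, his, his'⟩ := exists_markedAt_complementBraid st hst
    refine (chordSum_markedBraid ρ (his' k) F hu (by rw [hzs.length_eq, hn]; exact his)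
      (h.perm ((hzs.symm.append_right v).append_left u))).1 (survives_of_forall_none _ ?_)
    exact doubledLetters_of_nodup (hzs.nodup_iff.2 hxs)
  · rw [chordSum_append]
    exact chordSum_halfTwist_eq_zero ρ st hst _ hu hn h hxs

/-! ### Inverse braids and strands ending in a cusp -/

lemma mirrorWord_slideDown (m : Bool) (k : ℕ) (x : R) (l : List R) :
    mirrorWord (slideDown m k x l) = slideUp m k x l := by
  induction l generalizing k with
  | nil => rfl
  | cons y l ih => rw [slideDown, mirrorWord_cons, ih]; rfl

lemma mirrorWord_slideUp (m : Bool) (k : ℕ) (x : R) (l : List R) :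
    mirrorWord (slideUp m k x l) = slideDown m k x l := by
  rw [← mirrorWord_slideDown, mirrorWord_mirrorWord]

lemma IsBraid.mirror {k n : ℕ} {w : Word R} (h : IsBraid k n w) :
    IsBraid k n (mirrorWord w) := by
  intro e he
  simp only [mirrorWord, mem_map, mem_reverse] at he
  obtain ⟨e, he, rfl⟩ := he
  obtain ⟨m, p, x, y, rfl, h₁⟩ := h e he
  exact ⟨m, p, y, x, rfl, h₁⟩

lemma switchable_congr {ρ : ℤ} {m : Bool} {x y x' y' : R} (hx : (ρ : R) ∣ x - x')
    (hy : (ρ : R) ∣ y - y') : Switchable ρ m x y ↔ Switchable ρ m x' y' := by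
  unfold Switchable
  refine and_congr_right fun _ => ?_
  have : x - y = x' - y' + ((x - x') - (y - y')) := by ring
  rw [this]
  exact (dvd_add_left (dvd_sub hx hy))

/-- Potentials enter the operators only through divisibility of their differences by `ρ`. -/
lemma wordSum_slideUp_congr {ρ : ℤ} {m : Bool} {k : ℕ} {x x' : R} {l l' : List R}
    (hx : (ρ : R) ∣ x - x') (hl : Forall₂ (fun y y' => (ρ : R) ∣ y - y') l l') (F : StateFun) :
    wordSum ρ (slideUp m k x l) F = wordSum ρ (slideUp m k x' l') F := by
  induction hl generalizing k F with
  | nil => rfl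
  | @cons y y' l l' hy hl ih =>
    simp only [slideUp, wordSum_append]
    rw [ih]
    congr 1
    funext f
    have h := switchable_congr (m := m) hy hx
    simp only [wordSum_cons, eventSum, wordSum_nil]
    split_ifs <;> first | rfl | (exfalso; tauto)

/-- `T` lists the strands of `st` at the right end of their permutation braid, with their places at
the left end as targets. -/
inductive InverseTargets (ρ : ℤ) : List (ℕ × R) → List (ℕ × R) → Prop
  | nil : InverseTargets ρ [] []
  | cons {p : ℕ} {x : R} {st : List (ℕ × R)} {q : ℕ} {x' : R} {l l' : List (ℕ × R)}
      (h : InverseTargets ρ st (l ++ l'))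
      (hl : Forall₂ (fun y y' => (ρ : R) ∣ y - y')
        (sortedPotentials (st.filter fun t => t.1 < p)) (l.map Prod.snd))
      (hx : (ρ : R) ∣ x - x') (hq : ∀ t ∈ l ++ l', q < t.1) :
      InverseTargets ρ ((p, x) :: st) (l ++ (q, x') :: l')

lemma InverseTargets.length_eq {ρ : ℤ} {st st' : List (ℕ × R)} (h : InverseTargets ρ st st') :
    st'.length = st.length := by
  induction h with
  | nil => rfl
  | cons h _ _ _ ih =>
    simp only [length_append, length_cons] at ih ⊢
    omega

lemma InverseTargets.nodup {ρ : ℤ} {st st' : List (ℕ × R)} (h : InverseTargets ρ st st') :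
    (st'.map Prod.fst).Nodup := by
  induction h with
  | nil => simp
  | @cons p x st q x' l l' h _ _ hq ih =>
    rw [map_append, map_cons, nodup_middle, nodup_cons, ← map_append]
    refine ⟨fun hm => ?_, ih⟩
    obtain ⟨t, ht, rfl⟩ := mem_map.1 hm
    exact lt_irrefl _ (hq t ht)

/-- The reverse of a permutation braid is the permutation braid of the inverse permutation. -/
lemma InverseTargets.blockEq {ρ : ℤ} {st st' : List (ℕ × R)} (h : InverseTargets ρ st st') (k : ℕ) :
    BlockEq ρ k st.length (mirrorWord (permutationBraid k st)) (permutationBraid k st') := by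
  induction h generalizing k with
  | nil => exact BlockEq.refl _ _ _ _
  | @cons p x st q x' l l' h hl hx hq ih =>
    have hlen := h.length_eq
    have hnd := (InverseTargets.cons h hl hx hq).nodup
    have hfl := length_filter_le (fun t : ℕ × R => decide (t.1 < p)) st
    have hl₁ := length_sortedPotentials (st.filter fun t => t.1 < p)
    rw [length_append] at hlen
    rw [permutationBraid, mirrorWord_append, mirrorWord_slideDown]
    have hb : IsBraid k (st.length + 1)
        (slideUp false k x (sortedPotentials (st.filter fun t => t.1 < p))) := by
      rw [← mirrorWord_slideDown]
      exact ((isBraid_slideDown _ _ _ _).mono le_rfl (by omega)).mirror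
    refine (((ih (k + 1)).mono (k' := k) (n' := st.length + 1) (by omega)
      (by omega)).append_left hb).trans ?_
    -- The first strand of `st` has the least target `q` under the inverse permutation. It may
    -- therefore cross first, as it does in the mirror image.
    have h₁ := blockEq_permutationBraid_min ρ k q x' l l' hnd hq
    refine BlockEq.trans ?_ (BlockEq.mono h₁ le_rfl (by simp; omega)).symm
    intro F u xs v _ _ _ _
    rw [chordSum_append, chordSum_append, chordSum, chordSum, wordSum_slideUp_congr hx hl]

/-! ### Braids far away from a pair -/

/-- `w` and `w'` consist of the same crossings, at heights counted from `k` and `k'`. -/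
def ShiftBraid (k k' n : ℕ) (w w' : Word R) : Prop :=
  Forall₂ (fun e e' => ∃ m i x y, e = .crossing m (k + i) x y ∧ e' = .crossing m (k' + i) x y ∧
    i + 2 ≤ n) w w'

lemma ShiftBraid.mono {k k' j n n' : ℕ} {w w' : Word R} (h : ShiftBraid (k + j) (k' + j) n w w')
    (hn : j + n ≤ n') : ShiftBraid k k' n' w w' := by
  refine Forall₂.imp ?_ h
  rintro _ _ ⟨m, i, x, y, rfl, rfl, hi⟩
  exact ⟨m, j + i, x, y, by rw [Nat.add_assoc], by rw [Nat.add_assoc], by omega⟩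

lemma shiftBraid_slideDown (m : Bool) (k k' : ℕ) (x : R) (l : List R) :
    ShiftBraid k k' (l.length + 1) (slideDown m k x l) (slideDown m k' x l) := by
  induction l generalizing k k' with
  | nil => exact Forall₂.nil
  | cons y l ih =>
    refine Forall₂.cons ⟨m, 0, x, y, rfl, rfl, by simp⟩ ?_
    exact (ih (k + 1) (k' + 1)).mono (by simp; omega)

lemma shiftBraid_permutationBraid (k k' : ℕ) (st : List (ℕ × R)) :
    ShiftBraid k k' st.length (permutationBraid k st) (permutationBraid k' st) := by
  induction st generalizing k k' with
  | nil => exact Forall₂.nil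
  | cons a st ih =>
    obtain ⟨p, x⟩ := a
    refine rel_append ((ih (k + 1) (k' + 1)).mono (by simp; omega)) ?_
    refine ShiftBraid.mono (j := 0) (shiftBraid_slideDown _ _ _ _ _) ?_
    rw [length_sortedPotentials]
    have := length_filter_le (fun t : ℕ × R => decide (t.1 < p)) st
    simp only [length_cons]
    omega

/-- A pair of strands which is not involved in a braid may be removed before. -/
lemma ShiftBraid.chordSum_filter {ρ : ℤ} {k k' : ℕ} {w w' : Word R} {s : ℕ} {u xs v : List ℕ}
    (hw : ShiftBraid k k' xs.length w w') {F F' : StateFun} (hk : u.length = k)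
    (hk' : (u.filter fun c => !(c == s)).length = k') (h : IsChordWord (u ++ (xs ++ v)))
    (hs : s ∉ xs) (hF : ∀ zs : List ℕ, zs.Perm xs → F (chordMatching (u ++ (zs ++ v))) =
      F' (chordMatching ((u.filter fun c => !(c == s)) ++ (zs ++ v.filter fun c => !(c == s))))) :
    chordSum ρ w F (u ++ (xs ++ v)) =
      chordSum ρ w' F' ((u.filter fun c => !(c == s)) ++ (xs ++ v.filter fun c => !(c == s))) := by
  have hch : ∀ zs : List ℕ, s ∉ zs → IsChordWord (u ++ (zs ++ v)) →
      IsChordWord ((u.filter fun c => !(c == s)) ++ (zs ++ v.filter fun c => !(c == s))) := by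
    intro zs hs h
    have : (u ++ (zs ++ v)).filter (fun c => !(c == s)) =
        (u.filter fun c => !(c == s)) ++ (zs ++ v.filter fun c => !(c == s)) := by
      rw [filter_append, filter_append, show zs.filter (fun c => !(c == s)) = zs from
        filter_eq_self.2 fun c hc => by
          have : c ≠ s := fun h => hs (h ▸ hc)
          simpa using this]
    rw [← this]
    intro c hc
    obtain ⟨h₁, h₂⟩ := mem_filter.1 hc
    rw [count_filter (p := fun c => !(c == s)) h₂]
    exact h c h₁
  generalize hn : xs.length = n at hw
  induction hw generalizing xs with
  | nil => exact hF xs (Perm.refl _)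
  | cons he hw ih =>
    obtain ⟨m, i, x, y, rfl, rfl, hi⟩ := he
    obtain ⟨l, a, b, l', rfl, hp⟩ := exists_split_pair (k := 0) (p := i) (xs := xs) (Nat.zero_le _)
      (by omega)
    have hperm : (l ++ b :: a :: l').Perm (l ++ a :: b :: l') := (Perm.swap a b l').append_left l
    have h' : IsChordWord (u ++ ((l ++ b :: a :: l') ++ v)) :=
      h.perm ((hperm.symm.append_right v).append_left u)
    have hs' : s ∉ l ++ b :: a :: l' := fun h => hs (hperm.mem_iff.1 h)
    rw [chordSum_crossing_block ρ m x y _ F h (by omega),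
      chordSum_crossing_block ρ m x y _ F' (hch _ hs h) (by omega)]
    have ha : (a == s) = false := by simp at hs ⊢; tauto
    have hb : (b == s) = false := by simp at hs ⊢; tauto
    -- Neither crossing letter is `s`, so removing the pair `s` does not affect the normality
    -- condition.
    have hlet : lettersOf a b (l' ++ (v.filter fun c => !(c == s)) ++
        ((u.filter fun c => !(c == s)) ++ l)) = lettersOf a b (l' ++ v ++ (u ++ l)) := by
      simp only [lettersOf_append]
      rw [lettersOf_filter (Q := fun c => c == s) ha hb, lettersOf_filter (Q := fun c => c == s) ha hb]
    rw [hlet, ih h hs hF hn,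
      ih h' hs' (fun zs hzs => hF zs (hzs.trans hperm)) (by rw [hperm.length_eq, hn])]

/-- A sliding strand that ends in a cusp with a strand of label `t`, when `t` is not among the
strands below it. -/
lemma chordSum_mixedSlide_end (ρ : ℤ) (x : R) {F F' : StateFun} (l : List (Bool × R)) {k : ℕ}
    {u zs v v' : List ℕ} {s t : ℕ} (h : IsChordWord (u ++ s :: (zs ++ v))) (hk : u.length = k)
    (hl : l.length = zs.length) (ht : t ∉ zs) (hF : ∀ zs' s', (zs' ++ [s']).Perm (s :: zs) →
      F (chordMatching (u ++ (zs' ++ s' :: v))) =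
        if s' = t then F' (chordMatching (u ++ (zs' ++ v'))) else 0) :
    chordSum ρ (mixedSlide k x l) F (u ++ s :: (zs ++ v)) =
      if s = t then F' (chordMatching (u ++ (zs ++ v'))) else 0 := by
  induction zs generalizing l k u s with
  | nil =>
    obtain rfl : l = [] := length_eq_zero_iff.1 hl
    exact hF [] s (by simp)
  | cons z zs ih =>
    obtain _ | ⟨⟨m, y⟩, l⟩ := l
    · simp at hl
    have hl' : l.length = zs.length := by simpa using hl
    simp only [mem_cons, not_or] at ht
    rw [cons_append] at h ⊢
    rw [chordSum_mixedSlide_cons ρ m x y l F h hk,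
      ih l (by simpa using h) (by simp [hk]) hl' ht.2 (u := u ++ [s]) (s := z) fun zs' s' hp => by
        simpa using hF (s :: zs') s' (by simpa using hp.cons s),
      ih l (by simpa using isChordWord_move h) (by simp [hk]) hl' ht.2 (u := u ++ [z]) (s := s)
        fun zs' s' hp => by
          simpa using hF (z :: zs') s' ((by simpa using hp.cons z : (z :: zs' ++ [s']).Perm
            (z :: s :: zs)).trans (Perm.swap _ _ _))]
    -- A switch hands the slide to `z ≠ t`, and by induction a slide starting from `z` cannot end in
    -- a cusp with `t`.
    rw [if_neg (Ne.symm ht.1), mul_zero, ite_self, add_zero]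
    split_ifs with h₁ h₂ h₂
    · exact absurd (h₂.symm.trans h₁) ht.1
    · rfl
    · simp
    · rfl

lemma chordSum_eq_zero_of_braid {ρ : ℤ} {k n : ℕ} {w : Word R} (hw : IsBraid k n w) {F : StateFun}
    {u xs v : List ℕ} (hu : u.length = k) (hn : xs.length = n) (h : IsChordWord (u ++ (xs ++ v)))
    (hF : ∀ xs', xs'.Perm xs → F (chordMatching (u ++ (xs' ++ v))) = 0) :
    chordSum ρ w F (u ++ (xs ++ v)) = 0 := by
  rw [hw.chordSum_congr (F' := 0) hu hn h hF, chordSum, wordSum_zero]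

/-- A strand that slides down and is finally matched to the next strand above its block. -/
lemma chordSum_mixedSlide_last (ρ : ℤ) (x : R) {F F' : StateFun} (l : List (Bool × R)) {k : ℕ}
    {u m zs v : List ℕ} {s y : ℕ} (h : IsChordWord (u ++ s :: (m ++ y :: (zs ++ v))))
    (hk : u.length + 1 + m.length = k) (hl : l.length = zs.length) (hnd : (m ++ y :: zs).Nodup)
    (hs : s ∉ m) (hF : ∀ zs' t, (zs' ++ [t]).Perm (y :: zs) →
      F (chordMatching (u ++ s :: (m ++ (zs' ++ t :: v)))) =
        if t = s then F' (chordMatching (u ++ (m ++ (zs' ++ v)))) else 0) :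
    chordSum ρ (mixedSlide k x l) F (u ++ s :: (m ++ y :: (zs ++ v))) =
      if y = s then F' (chordMatching (u ++ (m ++ (zs ++ v)))) else 0 := by
  induction zs generalizing l k m y with
  | nil =>
    obtain rfl : l = [] := length_eq_zero_iff.1 hl
    exact hF [] y (by simp)
  | cons z zs ih =>
    obtain _ | ⟨⟨mk, w⟩, l⟩ := l
    · simp at hl
    have hl' : l.length = zs.length := by simpa using hl
    have hyz : y ≠ z := by
      rintro rfl
      simp [nodup_append] at hnd
    have h' : IsChordWord ((u ++ s :: m) ++ y :: z :: (zs ++ v)) := by simpa using h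
    have hstep := chordSum_mixedSlide_cons ρ mk x w l F h' (by simp; omega : _ = k)
    have e₁ : u ++ s :: (m ++ y :: (z :: zs ++ v)) = (u ++ s :: m) ++ y :: z :: (zs ++ v) := by simp
    have hm : IsChordWord (u ++ s :: ((m ++ [z]) ++ y :: (zs ++ v))) := by
      simpa using isChordWord_move h'
    have hnd' : ((m ++ [z]) ++ y :: zs).Nodup := by
      refine (Perm.nodup_iff ?_).1 hnd
      rw [append_assoc]
      exact (Perm.swap z y zs).append_left m
    rw [e₁, hstep, if_neg hyz]
    -- No switched term survives. If `y = s`, the switch leaves this letter behind in the block,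
    -- while it has to arrive last. Otherwise `z = s` would be needed, but then the cyclic reading
    -- ends with the letter `z` at the place of `s`, contrary to normality.
    have h₂ : (if Switchable ρ mk x w ∧ lettersOf y z (zs ++ v ++ (u ++ s :: m)) = [z, y] then
        T 2 * chordSum ρ (mixedSlide (k + 1) x l) F ((u ++ s :: m) ++ [y] ++ z :: (zs ++ v))
        else 0) = 0 := by
      split_ifs with hc
      · have e₂ : (u ++ s :: m) ++ [y] ++ z :: (zs ++ v) =
            u ++ s :: ((m ++ [y]) ++ z :: (zs ++ v)) := by simp
        by_cases hys : y = s
        · subst hys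
          have hz := chordSum_eq_zero_of_braid (ρ := ρ) (isBraid_mixedSlide (k + 1) x l) (F := F)
            (u := (u ++ y :: m) ++ [y]) (xs := z :: zs) (v := v) (by simp; omega) (by simp [hl'])
            (by simpa using h) fun xs' hxs' => by
              obtain rfl | ⟨zs', t, rfl⟩ := eq_nil_or_concat' xs'
              · simp at hxs'
              have hty : t ≠ y := by
                rintro rfl
                have h₃ : t ∈ z :: zs := hxs'.mem_iff.1 (by simp)
                have := (nodup_append.1 hnd).2.1
                exact (nodup_cons.1 this).1 h₃
              have := hF (y :: zs') t (by simpa using hxs'.cons y)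
              rw [if_neg hty] at this
              simpa using this
          rw [show (u ++ y :: m) ++ [y] ++ z :: (zs ++ v) =
            (u ++ y :: m) ++ [y] ++ (z :: zs ++ v) by simp, hz, mul_zero]
        · rw [e₂, ih l (by simpa using h) (by simp; omega) hl' (by simpa using hnd)
            (by simp [hs, Ne.symm hys]) fun zs' t hp => by
              simpa using hF (y :: zs') t (by simpa using hp.cons y)]
          rw [if_neg, mul_zero]
          rintro rfl
          have hc' := hc.2
          have : zs ++ v ++ (u ++ z :: m) = (zs ++ v ++ u) ++ z :: m := by simp
          rw [this, lettersOf_append, lettersOf_cons, if_pos (Or.inr rfl)] at hc'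
          have h₃ := congrArg length hc'
          have h₄ : lettersOf y z m = [] := by
            refine lettersOf_eq_nil ?_ hs
            intro hym
            exact (nodup_append.1 hnd).2.2 y hym y (by simp) rfl
          rw [h₄] at hc'
          have := congrArg getLast? hc'
          simp at this
          exact hyz this.symm
      · rfl
    rw [h₂, add_zero]
    have e₃ : (u ++ s :: m) ++ [z] ++ y :: (zs ++ v) =
      u ++ s :: ((m ++ [z]) ++ y :: (zs ++ v)) := by simp
    rw [e₃]
    by_cases hsz : s = z
    · subst hsz
      rw [if_neg hyz]
      have hz := chordSum_eq_zero_of_braid (ρ := ρ) (isBraid_mixedSlide (k + 1) x l) (F := F)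
        (u := u ++ s :: (m ++ [s])) (xs := y :: zs) (v := v) (by simp; omega) (by simp [hl'])
        (by simpa using hm) fun xs' hxs' => by
          obtain rfl | ⟨zs', t, rfl⟩ := eq_nil_or_concat' xs'
          · simp at hxs'
          have hts : t ≠ s := by
            rintro rfl
            have h₃ : t ∈ y :: zs := hxs'.mem_iff.1 (by simp)
            exact (nodup_append.1 hnd').2.2 t (by simp) t h₃ rfl
          have := hF (s :: zs') t
            (by simpa using (hxs'.cons s).trans (Perm.swap y s zs))
          rw [if_neg hts] at this
          simpa using this
      simpa using hz
    · rw [ih l hm (by simp; omega) hl' hnd' (by simp [hs, hsz])]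
      · simp
      · intro zs' t hp
        simpa using hF (z :: zs') t (by
          simpa using (hp.cons z).trans (Perm.swap y z zs))

lemma notMem_of_isChordWord {u m v : List ℕ} {s : ℕ} (h : IsChordWord (u ++ s :: (m ++ s :: v))) :
    s ∉ u ∧ s ∉ m ∧ s ∉ v := by
  have := h s (by simp)
  simp only [count_append, count_cons_self] at this
  refine ⟨count_eq_zero.1 (by omega), count_eq_zero.1 (by omega), count_eq_zero.1 (by omega)⟩

lemma filter_ne_eq_self {l : List ℕ} {s : ℕ} (h : s ∉ l) :
    l.filter (fun c => !(c == s)) = l := filter_eq_self.2 fun c hc => by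
    have : c ≠ s := fun h' => h (h' ▸ hc)
    simpa using this

/-- The state sum of a permutation braid whose lowest strand at the right end is matched to a strand
just above the braid. -/
lemma chordSum_permutationBraid_last (ρ : ℤ) {F F' : StateFun} {p : ℕ} {x : R}
    {st₁ st₂ : List (ℕ × R)} {k k' : ℕ} {u m xs₁ xs₂ v : List ℕ} {s y : ℕ}
    (hp : ∀ t ∈ st₁ ++ st₂, t.1 < p) (h : IsChordWord (u ++ s :: (m ++ ((xs₁ ++ y :: xs₂) ++ v))))
    (hk : u.length + 1 + m.length = k) (hk' : u.length + m.length = k')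
    (h₁ : xs₁.length = st₁.length) (h₂ : xs₂.length = st₂.length)
    (hnd : (m ++ (xs₁ ++ y :: xs₂)).Nodup) (hs : s ∉ m)
    (hF : ∀ zs t, (zs ++ [t]).Perm (xs₁ ++ y :: xs₂) →
      F (chordMatching (u ++ s :: (m ++ (zs ++ t :: v)))) =
        if t = s then F' (chordMatching (u ++ (m ++ (zs ++ v)))) else 0) :
    chordSum ρ (permutationBraid k (st₁ ++ (p, x) :: st₂)) F
        (u ++ s :: (m ++ ((xs₁ ++ y :: xs₂) ++ v))) =
      if y = s then chordSum ρ (permutationBraid k' (st₁ ++ st₂)) F'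
        (u ++ (m ++ ((xs₁ ++ xs₂) ++ v))) else 0 := by
  induction st₁ generalizing F F' k k' m xs₁ with
  | nil =>
    obtain rfl := length_eq_zero_iff.1 h₁
    have hfil : st₂.filter (fun t => t.1 < p) = st₂ :=
      filter_eq_self.2 fun t ht => by simpa using hp t (by simpa using ht)
    simp only [nil_append, cons_append] at h hnd hF ⊢
    rw [permutationBraid, hfil, chordSum_append]
    have hlen : (sortedPotentials st₂).length = xs₂.length := by
      rw [length_sortedPotentials, h₂]
    have hF₁ : ∀ zs : List ℕ, zs.Perm xs₂ → wordSum ρ (slideDown false k x (sortedPotentials st₂)) F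
          (chordMatching (u ++ s :: (m ++ y :: (zs ++ v)))) =
        if y = s then F' (chordMatching (u ++ (m ++ (zs ++ v)))) else 0 := by
      intro zs hzs
      rw [slideDown_eq_mixedSlide]
      refine chordSum_mixedSlide_last ρ x _ ?_ hk (by simp [hlen, hzs.length_eq]) ?_ hs ?_
      · refine h.perm ?_
        exact ((((hzs.symm.append_right v).cons y).append_left m).cons s).append_left u
      · exact (((hzs.cons y).append_left m).nodup_iff).2 hnd
      · exact fun zs' t ht => hF zs' t (ht.trans (hzs.cons y))
    split_ifs with hys
    · subst hys
      obtain ⟨hu, hm, hv⟩ := notMem_of_isChordWord h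
      have hs₂ : y ∉ xs₂ := fun hy => hv (mem_append_left _ hy)
      have hv' : y ∉ v := fun hy => hv (mem_append_right _ hy)
      have e : (u ++ y :: (m ++ [y])).filter (fun c => !(c == y)) = u ++ m := by
        simp [filter_append, filter_ne_eq_self hu, filter_ne_eq_self hm]
      have hsh := shiftBraid_permutationBraid (k + 1) k' st₂
      rw [← h₂] at hsh
      have := hsh.chordSum_filter (ρ := ρ)
        (F := wordSum ρ (slideDown false k x (sortedPotentials st₂)) F) (F' := F') (s := y)
        (u := u ++ y :: (m ++ [y])) (xs := xs₂) (v := v)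
      rw [e, filter_ne_eq_self hv'] at this
      have := this (by simp; omega)
        (by simp; omega) (by simpa using h) hs₂ fun zs hzs => by
          simpa using hF₁ zs hzs
      simpa using this
    · simpa using chordSum_eq_zero_of_braid (ρ := ρ) (isBraid_permutationBraid (k + 1) st₂)
        (F := wordSum ρ (slideDown false k x (sortedPotentials st₂)) F)
        (u := u ++ s :: (m ++ [y])) (xs := xs₂) (v := v) (by simp; omega) h₂ (by simpa using h)
        fun xs' hxs' => by simpa [hys] using hF₁ xs' hxs'
  | cons a st₁ ih =>
    obtain ⟨q, z⟩ := a
    obtain _ | ⟨x₀, xs₁⟩ := xs₁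
    · simp at h₁
    have hqp : q < p := hp (q, z) (by simp)
    have hp' : ∀ t ∈ st₁ ++ st₂, t.1 < p := fun t ht => hp t (by simp at ht ⊢; tauto)
    have h₁' : xs₁.length = st₁.length := by simpa using h₁
    have hfil : (st₁ ++ (p, x) :: st₂).filter (fun t => t.1 < q) =
        (st₁ ++ st₂).filter fun t => t.1 < q := by
      rw [filter_append, filter_cons_of_neg (by simpa using hqp.le), filter_append]
    have hlen : (sortedPotentials ((st₁ ++ st₂).filter fun t => t.1 < q)).length ≤
        (xs₁ ++ xs₂).length := by
      rw [length_sortedPotentials, length_append, h₁', h₂, ← length_append]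
      exact length_filter_le _ _
    rw [cons_append, permutationBraid, hfil, chordSum_append]
    set lo := sortedPotentials ((st₁ ++ st₂).filter fun t => t.1 < q) with hlo
    have hnd' : ((m ++ [x₀]) ++ (xs₁ ++ y :: xs₂)).Nodup := by simpa using hnd
    have hch : ∀ zs t, (zs ++ [t]).Perm (xs₁ ++ y :: xs₂) →
        IsChordWord (u ++ s :: (m ++ x₀ :: (zs ++ t :: v))) := by
      intro zs t hzt
      refine h.perm ?_
      simpa using (((((hzt.symm.cons x₀).append_right v).append_left m).cons s).append_left u)
    -- The descent over `lo` does not involve the lowest strand `t`. If `t` is matched with `s`,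
    -- this pair may be removed before the descent; if not, the final condition fails for every
    -- outcome.
    have hF₁ : ∀ zs t, (zs ++ [t]).Perm (xs₁ ++ y :: xs₂) → wordSum ρ (slideDown false k z lo) F
          (chordMatching (u ++ s :: ((m ++ [x₀]) ++ (zs ++ t :: v)))) =
        if t = s then wordSum ρ (slideDown false k' z lo) F'
          (chordMatching (u ++ ((m ++ [x₀]) ++ (zs ++ v)))) else 0 := by
      intro zs t hzt
      have hzl : lo.length ≤ zs.length := by
        have := hzt.length_eq
        simp only [length_append, length_cons, length_nil] at this hlen
        omega
      obtain ⟨zs₁, zs₂, rfl, hz₁⟩ : ∃ zs₁ zs₂, zs = zs₁ ++ zs₂ ∧ zs₁.length = lo.length :=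
        ⟨zs.take lo.length, zs.drop lo.length, (take_append_drop ..).symm, by simpa using hzl⟩
      have hc := hch _ _ hzt
      split_ifs with hts
      · subst hts
        have hc' : IsChordWord (u ++ t :: ((m ++ x₀ :: (zs₁ ++ zs₂)) ++ t :: v)) := by
          simpa using hc
        obtain ⟨hu, hm, hv⟩ := notMem_of_isChordWord hc'
        simp only [mem_append, mem_cons, not_or] at hm
        have e₁ : (u ++ t :: m).filter (fun c => !(c == t)) = u ++ m := by
          simp [filter_append, filter_ne_eq_self hu, filter_ne_eq_self hm.1]
        have e₂ : (zs₂ ++ t :: v).filter (fun c => !(c == t)) = zs₂ ++ v := by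
          simp [filter_append, filter_ne_eq_self hm.2.2.2, filter_ne_eq_self hv]
        have hsh := shiftBraid_slideDown false k k' z lo
        rw [← hz₁, ← length_cons (a := x₀)] at hsh
        have := hsh.chordSum_filter (ρ := ρ) (F := F) (F' := F') (s := t) (u := u ++ t :: m)
          (v := zs₂ ++ t :: v) (by simp; omega) (by rw [e₁]; simpa using hk') (by simpa using hc)
          (by simp only [mem_cons, not_or]; exact ⟨hm.2.1, hm.2.2.1⟩) fun ws hws => by
            rw [e₁, e₂]
            have := hF (ws ++ zs₂) t (by
              have h₃ := ((hws.append_right zs₂).append_right [t])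
              have h₄ := hzt.cons x₀
              simp only [append_assoc, cons_append] at h₃ h₄ ⊢
              exact h₃.trans h₄)
            rw [if_pos rfl] at this
            simpa using this
        rw [e₁, e₂] at this
        simpa [chordSum] using this
      · have := chordSum_eq_zero_of_braid (ρ := ρ) (isBraid_slideDown false k z lo) (F := F)
          (u := u ++ s :: m) (xs := x₀ :: zs₁) (v := zs₂ ++ t :: v) (by simp; omega)
          (by simp [hz₁]) (by simpa using hc) fun ws hws => by
            have := hF (ws ++ zs₂) t (by
              have h₃ := ((hws.append_right zs₂).append_right [t])
              have h₄ := hzt.cons x₀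
              simp only [append_assoc, cons_append] at h₃ h₄ ⊢
              exact h₃.trans h₄)
            rw [if_neg hts] at this
            simpa using this
        simpa [chordSum] using this
    have hchs : IsChordWord (u ++ s :: ((m ++ [x₀]) ++ ((xs₁ ++ y :: xs₂) ++ v))) := by
      simpa using h
    by_cases hx₀ : x₀ = s
    · have hys : y ≠ s := by
        rintro rfl
        subst hx₀
        simp [nodup_append] at hnd
      rw [if_neg hys]
      have := chordSum_eq_zero_of_braid (ρ := ρ) (isBraid_permutationBraid (k + 1)
        (st₁ ++ (p, x) :: st₂)) (F := wordSum ρ (slideDown false k z lo) F)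
        (u := u ++ s :: (m ++ [x₀])) (xs := xs₁ ++ y :: xs₂) (v := v) (by simp; omega)
        (by simp [h₁', h₂]) (by simpa using h) fun xs' hxs' => by
          obtain rfl | ⟨zs', t, rfl⟩ := eq_nil_or_concat' xs'
          · simp at hxs'
          have hts : t ≠ s := by
            rintro rfl
            have h₃ : t ∈ xs₁ ++ y :: xs₂ := hxs'.mem_iff.1 (by simp)
            exact (nodup_append.1 hnd').2.2 x₀ (by simp) t h₃ hx₀
          have := hF₁ zs' t hxs'
          rw [if_neg hts] at this
          simpa using this
      simpa using this
    · have := ih (F := wordSum ρ (slideDown false k z lo) F)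
        (F' := wordSum ρ (slideDown false k' z lo) F') (k := k + 1) (k' := k' + 1) (m := m ++ [x₀])
        (xs₁ := xs₁) hp' hchs (by simp; omega) (by simp; omega) h₁' hnd'
        (by simp [hs, Ne.symm hx₀]) hF₁
      simp only [append_assoc, cons_append, nil_append] at this ⊢
      rw [this, permutationBraid, chordSum_append]

/-! ### Marked cusps -/

lemma not_switchable_true (ρ : ℤ) (x y : R) : ¬ Switchable ρ true x y := fun h => by cases h.1

/-- Without switches the strand runs straight through, and the only obstruction is its own partner.
-/
lemma chordSum_slideDown_marked (ρ : ℤ) (x : R) (l : List R) (w : Word R) (F : StateFun) {k : ℕ}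
    {u ys v : List ℕ} {a : ℕ} (h : IsChordWord (u ++ a :: (ys ++ v))) (hk : u.length = k)
    (hl : l.length = ys.length) :
    chordSum ρ (slideDown true k x l ++ w) F (u ++ a :: (ys ++ v)) =
      if a ∈ ys then 0 else chordSum ρ w F (u ++ (ys ++ a :: v)) := by
  induction ys generalizing l k u with
  | nil =>
    obtain rfl := length_eq_zero_iff.1 hl
    simp [slideDown]
  | cons y ys ih =>
    obtain _ | ⟨z, l⟩ := l
    · simp at hl
    rw [cons_append] at h
    have := ih (u := u ++ [y]) (k := k + 1) l (by simpa using isChordWord_move h) (by simp [hk])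
      (by simpa using hl)
    rw [slideDown, cons_append, cons_append, chordSum_crossing ρ true x z _ F h hk]
    simp only [not_switchable_true, false_and, if_false, add_zero]
    simp only [append_assoc, cons_append, nil_append] at this
    rw [this]
    by_cases hay : a = y <;> simp [hay]

lemma chordSum_slideUp_marked (ρ : ℤ) (x : R) (l : List R) (F : StateFun) {k : ℕ} {u ys v : List ℕ}
    {a : ℕ} (h : IsChordWord (u ++ (ys ++ a :: v))) (hk : u.length = k)
    (hl : l.length = ys.length) :
    chordSum ρ (slideUp true k x l) F (u ++ (ys ++ a :: v)) =
      if a ∈ ys then 0 else F (chordMatching (u ++ a :: (ys ++ v))) := by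
  induction ys generalizing l k u F with
  | nil =>
    obtain rfl := length_eq_zero_iff.1 hl
    simp [slideUp, chordSum_nil]
  | cons y ys ih =>
    obtain _ | ⟨z, l⟩ := l
    · simp at hl
    rw [slideUp, chordSum_append]
    have := ih (u := u ++ [y]) (k := k + 1) l (wordSum ρ [.crossing true k z x] F)
      (by simpa using h) (by simp [hk]) (by simpa using hl)
    simp only [append_assoc, cons_append, nil_append] at this
    rw [cons_append, this]
    by_cases hay : a ∈ ys
    · simp [hay]
    · have h' : IsChordWord (u ++ y :: a :: (ys ++ v)) :=
        h.perm (((Perm.append_left u (Perm.cons y perm_middle))))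
      have := chordSum_crossing ρ true z x [] F h' hk
      simp only [not_switchable_true, false_and, if_false, add_zero, chordSum_nil] at this
      rw [if_neg hay]
      refine Eq.trans this ?_
      by_cases hay' : y = a
      · simp [hay']
      · simp [hay', hay, Ne.symm hay']

/-- The state sum of a marked right cusp. -/
lemma chordSum_markedRightCusp (ρ : ℤ) (x z : R) (l : List R) (w : Word R) (F : StateFun) {k : ℕ}
    {u ys v : List ℕ} {a b : ℕ} (h : IsChordWord (u ++ a :: (ys ++ b :: v))) (hk : u.length = k)
    (hl : l.length = ys.length) :
    chordSum ρ (slideDown true k x l ++ .rightCusp (k + ys.length) z :: w) F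
        (u ++ a :: (ys ++ b :: v)) =
      if a = b then T (-1) * chordSum ρ w F (u ++ (ys ++ v)) else 0 := by
  rw [chordSum_slideDown_marked ρ x l _ F h hk hl]
  have h' : IsChordWord ((u ++ ys) ++ a :: b :: v) := by
    refine h.perm ?_
    rw [append_assoc]
    exact perm_middle.symm.append_left u
  have := chordSum_rightCusp ρ z w F h' (k := k + ys.length) (by simp [hk])
  simp only [append_assoc] at this
  rw [this]
  split_ifs with h₁ h₂
  · subst h₂
    exact absurd h₁ (notMem_of_isChordWord h).2.1
  · rfl
  · rfl
  · rfl

/-- The state sum of a marked left cusp. -/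
lemma chordSum_markedLeftCusp (ρ : ℤ) (x z : R) (l : List R) (F : StateFun) {k : ℕ}
    {u ys v : List ℕ} {c : ℕ} (h : IsChordWord (u ++ c :: (ys ++ c :: v))) (hk : u.length = k)
    (hl : l.length = ys.length) :
    chordSum ρ (.leftCusp (k + ys.length) z :: slideUp true k x l) F (u ++ (ys ++ v)) =
      T (-1) * F (chordMatching (u ++ c :: (ys ++ c :: v))) := by
  have h' : IsChordWord ((u ++ ys) ++ c :: c :: v) := by
    refine h.perm ?_
    rw [append_assoc]
    exact perm_middle.symm.append_left u
  have := chordSum_leftCusp ρ z (slideUp true k x l) F h' (k := k + ys.length) (by simp [hk])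
  simp only [append_assoc] at this h'
  rw [this, chordSum_slideUp_marked ρ x l F h' hk hl, if_neg (notMem_of_isChordWord h).2.1]

section Deletions

/-- `Deletion k μ φ ts ps w rest`: the link diagram `w` consists of marked right cusps for the pairs
`{i, φ i}`, `i ∈ ps`, of strands below the `k`-th one. The strands before and after `w` are labelled
by `ts` and `rest`, and `μ` is their potential. -/
inductive Deletion (k : ℕ) (μ : ℕ → R) (φ : ℕ → ℕ) : List ℕ → List ℕ → Word R → List ℕ → Prop
  | nil (ts : List ℕ) : Deletion k μ φ ts [] [] ts
  | cons {a b c ps : List ℕ} {i : ℕ} {w : Word R} {rest : List ℕ}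
      (h : Deletion k μ φ (a ++ (b ++ c)) ps w rest) :
      Deletion k μ φ (a ++ i :: (b ++ φ i :: c)) (i :: ps)
        (slideDown true (k + a.length) (μ i) (b.map μ) ++
          .rightCusp (k + a.length + b.length) (μ (φ i)) :: w) rest

variable {k : ℕ} {μ : ℕ → R} {φ : ℕ → ℕ} {ts ps rest : List ℕ} {w : Word R}

-- Letters are recorded as labels `χ` of strands rather than by positions, since positions shift
-- after each deletion. Every marked cusp asks that its two strands be matched and contributes `T
-- (-1)`.
open Classical in
lemma Deletion.chordSum_eq (h : Deletion k μ φ ts ps w rest) (ρ : ℤ) (F : StateFun) {u v : List ℕ}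
    (χ : ℕ → ℕ) (hu : u.length = k) (hL : IsChordWord (u ++ (ts.map χ ++ v))) :
    chordSum ρ w F (u ++ (ts.map χ ++ v)) = if ∀ i ∈ ps, χ i = χ (φ i) then
        T (-(ps.length : ℤ)) * F (chordMatching (u ++ (rest.map χ ++ v))) else 0 := by
  induction h generalizing F with
  | nil ts => simp [chordSum_nil]
  | @cons a b c ps i w rest h ih =>
    have e : u ++ ((a ++ i :: (b ++ φ i :: c)).map χ ++ v) =
        (u ++ a.map χ) ++ χ i :: (b.map χ ++ χ (φ i) :: (c.map χ ++ v)) := by simp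
    rw [e] at hL ⊢
    have h₁ := chordSum_markedRightCusp ρ (μ i) (μ (φ i)) (b.map μ) w F hL
      (k := k + a.length) (by simp [hu]) (by simp)
    rw [length_map] at h₁
    rw [h₁]
    by_cases hi : χ i = χ (φ i)
    · have h₂ : IsChordWord (u ++ ((a ++ (b ++ c)).map χ ++ v)) := by
        rw [← hi] at hL
        have h₃ : IsChordWord ((u ++ a.map χ ++ b.map χ) ++ χ i :: χ i :: (c.map χ ++ v)) := by
          refine hL.perm ?_
          rw [append_assoc (u ++ a.map χ)]
          exact perm_middle.symm.append_left _
        simpa using h₃.remove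
      have h₃ := ih F h₂
      simp only [map_append, append_assoc] at h₃
      rw [if_pos hi]
      simp only [append_assoc]
      rw [h₃]
      have hall : (∀ j ∈ i :: ps, χ j = χ (φ j)) ↔ ∀ j ∈ ps, χ j = χ (φ j) := by
        rw [forall_mem_cons]
        exact and_iff_right hi
      rw [if_congr hall rfl rfl]
      split_ifs
      · rw [← mul_assoc, ← T_add]
        congr 2
        push_cast [length_cons]
        ring
      · rw [mul_zero]
    · rw [if_neg hi, if_neg]
      simp [hi]

/-- The labels `χ` on the strands `ts` already provide letters for the inserted pairs; any
admissible choice codes the same pairing. -/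
lemma Deletion.chordSum_mirror (h : Deletion k μ φ ts ps w rest) (ρ : ℤ) (F : StateFun)
    {u v : List ℕ} (χ : ℕ → ℕ) (hu : u.length = k) (hL : IsChordWord (u ++ (ts.map χ ++ v)))
    (hχ : ∀ i ∈ ps, χ i = χ (φ i)) :
    chordSum ρ (mirrorWord w) F (u ++ (rest.map χ ++ v)) =
      T (-(ps.length : ℤ)) * F (chordMatching (u ++ (ts.map χ ++ v))) := by
  induction h generalizing F with
  | nil ts => simp [chordSum_nil, mirrorWord]
  | @cons a b c ps i w rest h ih =>
    have hi : χ i = χ (φ i) := hχ i mem_cons_self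
    have e : u ++ ((a ++ i :: (b ++ φ i :: c)).map χ ++ v) =
        (u ++ a.map χ) ++ χ i :: (b.map χ ++ χ i :: (c.map χ ++ v)) := by simp [hi]
    rw [e] at hL ⊢
    have h₂ : IsChordWord (u ++ ((a ++ (b ++ c)).map χ ++ v)) := by
      have h₃ : IsChordWord ((u ++ a.map χ ++ b.map χ) ++ χ i :: χ i :: (c.map χ ++ v)) := by
        refine hL.perm ?_
        rw [append_assoc (u ++ a.map χ)]
        exact perm_middle.symm.append_left _
      simpa using h₃.remove
    have h₁ := chordSum_markedLeftCusp ρ (μ i) (μ (φ i)) (b.map μ) F hL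
      (k := k + a.length) (by simp [hu]) (by simp)
    have ew : mirrorWord (slideDown true (k + a.length) (μ i) (b.map μ) ++
        .rightCusp (k + a.length + b.length) (μ (φ i)) :: w) =
        mirrorWord w ++ .leftCusp (k + a.length + b.length) (μ (φ i)) ::
          slideUp true (k + a.length) (μ i) (b.map μ) := by
      simp [mirrorWord_append, mirrorWord_cons, mirrorWord_slideDown, FrontEvent.mirror]
    rw [ew, chordSum_append, ih _ h₂ fun j hj => hχ j (mem_cons_of_mem _ hj)]
    rw [length_map] at h₁
    have e₂ : u ++ ((a ++ (b ++ c)).map χ ++ v) = (u ++ a.map χ) ++ (b.map χ ++ (c.map χ ++ v)) := by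
      simp
    have h₁' := h₁
    rw [chordSum] at h₁'
    rw [e₂, h₁', ← mul_assoc, ← T_add]
    congr 2
    push_cast [length_cons]
    ring

lemma Deletion.map (h : Deletion k μ φ ts ps w rest) {μ' : ℕ → R} {φ' σ : ℕ → ℕ}
    (hμ : ∀ t ∈ ts, μ' (σ t) = μ t) (hφ : ∀ t ∈ ps, φ' (σ t) = σ (φ t)) :
    Deletion k μ' φ' (ts.map σ) (ps.map σ) w (rest.map σ) := by
  induction h with
  | nil ts => exact Deletion.nil _
  | @cons a b c ps i w rest h ih =>
    have h₁ := ih (fun t ht => hμ t (by simp at ht ⊢; tauto))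
      fun t ht => hφ t (mem_cons_of_mem _ ht)
    simp only [map_append] at h₁
    have h₂ := Deletion.cons (i := σ i) h₁
    have e₁ : (b.map σ).map μ' = b.map μ := by
      rw [map_map]
      exact map_congr_left fun t ht => hμ t (by simp [ht])
    rw [e₁, hμ i (by simp), hφ i mem_cons_self, hμ (φ i) (by simp)] at h₂
    simpa using h₂

lemma range'_split {s n i : ℕ} (h₁ : s ≤ i) (h₂ : i < s + n) :
    range' s n = range' s (i - s) ++ i :: range' (i + 1) (s + n - i - 1) := by
  have := range'_append_1 (s := s) (m := i - s) (n := s + n - i)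
  rw [show s + (i - s) = i by omega, show s + n - i = (s + n - i - 1) + 1 by omega,
    range'_succ, show i - s + (s + n - i - 1 + 1) = n by omega] at this
  exact this.symm

/-- The pairs of `φ` inside the block `s, …, s + n - 1`, given by their first elements. -/
def innerPairs (φ : ℕ → ℕ) (s n : ℕ) : List ℕ := (range' s n).filter fun i => i < φ i ∧ φ i < s + n

/-- The elements of the block `s, …, s + n - 1` that `φ` matches to elements outside. -/
def outerStrands (φ : ℕ → ℕ) (s n : ℕ) : List ℕ :=
  (range' s n).filter fun t => φ t < s ∨ s + n ≤ φ t

lemma deletion_markedRightCusps (k : ℕ) (μ : ℕ → R) (φ : ℕ → ℕ) (s n : ℕ) (hφ : ∀ i, φ (φ i) = i)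
    (hφ' : ∀ i, s ≤ i → i < s + n → φ i ≠ i) :
    Deletion k μ φ (range' s n) (innerPairs φ s n) (markedRightCusps k μ φ s n) (outerStrands φ s n)
      := by
  -- After the pairs with upper strand before `i` have been deleted, the strands that remain are
  -- those matched outside the block and those for which both ends are at least `i`. At `i = s` this
  -- is the whole block, at `i = s + n` only the outer strands.
  suffices h : ∀ d i, s ≤ i → i + d = s + n →
      Deletion k μ φ ((range' s n).filter fun t => (φ t < s ∨ s + n ≤ φ t) ∨ i ≤ t ∧ i ≤ φ t)
        ((range' i d).filter fun i => i < φ i ∧ φ i < s + n)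
        ((range' i d).flatMap fun i => if i < φ i ∧ φ i < s + n then
            let above := (range' s (i - s)).filter fun t => φ t < s ∨ s + n ≤ φ t
            let between := (range' (i + 1) (φ i - i - 1)).filter fun t =>
              φ t < s ∨ s + n ≤ φ t ∨ i < φ t
            slideDown true (k + above.length) (μ i) (between.map μ) ++
              [.rightCusp (k + above.length + between.length) (μ (φ i))] else [])
        (outerStrands φ s n) by
    have h₁ := h n s le_rfl rfl
    rw [filter_eq_self.2] at h₁
    · exact h₁
    · intro t ht
      rw [mem_range'_1] at ht
      simp only [decide_eq_true_eq]
      omega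
  intro d
  induction d with
  | zero =>
    intro i _ hi
    have : (range' s n).filter (fun t => (φ t < s ∨ s + n ≤ φ t) ∨ i ≤ t ∧ i ≤ φ t) =
        outerStrands φ s n := by
      refine filter_congr fun t ht => ?_
      rw [mem_range'_1] at ht
      simp only [decide_eq_decide]
      omega
    rw [this]
    exact Deletion.nil _
  | succ d ih =>
    intro i hi hid
    have h₁ := ih (i + 1) (by omega) (by omega)
    rw [range'_succ, flatMap_cons]
    by_cases hc : i < φ i ∧ φ i < s + n
    · rw [if_pos hc, filter_cons_of_pos (by simpa using hc)]
      have hne : ∀ t, t ≠ φ i → φ t ≠ i := fun t ht h => ht (by rw [← h, hφ])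
      have e₀ : range' s n = range' s (i - s) ++ i ::
          (range' (i + 1) (φ i - i - 1) ++ φ i :: range' (φ i + 1) (s + n - φ i - 1)) := by
        rw [range'_split hi (by omega : i < s + n)]
        congr 2
        rw [range'_split (s := i + 1) (n := s + n - i - 1) (i := φ i) (by omega) (by omega)]
        congr 2
        congr 1; omega
      have f₁ : ∀ j, i ≤ j → (range' s (i - s)).filter
          (fun t => (φ t < s ∨ s + n ≤ φ t) ∨ j ≤ t ∧ j ≤ φ t) =
          (range' s (i - s)).filter fun t => φ t < s ∨ s + n ≤ φ t := by
        intro j hj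
        refine filter_congr fun t ht => ?_
        rw [mem_range'_1] at ht
        simp only [decide_eq_decide]
        omega
      have f₂ : ∀ j, i ≤ j → j ≤ i + 1 → (range' (i + 1) (φ i - i - 1)).filter
          (fun t => (φ t < s ∨ s + n ≤ φ t) ∨ j ≤ t ∧ j ≤ φ t) =
          (range' (i + 1) (φ i - i - 1)).filter fun t =>
            φ t < s ∨ s + n ≤ φ t ∨ i < φ t := by
        intro j hj hj'
        refine filter_congr fun t ht => ?_
        rw [mem_range'_1] at ht
        have := hne t (by omega)
        simp only [decide_eq_decide]
        omega
      have f₃ : (range' (φ i + 1) (s + n - φ i - 1)).filter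
          (fun t => (φ t < s ∨ s + n ≤ φ t) ∨ i ≤ t ∧ i ≤ φ t) =
          (range' (φ i + 1) (s + n - φ i - 1)).filter
          fun t => (φ t < s ∨ s + n ≤ φ t) ∨ i + 1 ≤ t ∧ i + 1 ≤ φ t := by
        refine filter_congr fun t ht => ?_
        rw [mem_range'_1] at ht
        have := hne t (by omega)
        simp only [decide_eq_decide]
        omega
      have hii := hφ i
      have e₁ : (range' s n).filter (fun t => (φ t < s ∨ s + n ≤ φ t) ∨ i ≤ t ∧ i ≤ φ t) =
          ((range' s (i - s)).filter fun t => φ t < s ∨ s + n ≤ φ t) ++ i ::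
            (((range' (i + 1) (φ i - i - 1)).filter fun t =>
              φ t < s ∨ s + n ≤ φ t ∨ i < φ t) ++ φ i :: (range' (φ i + 1) (s + n - φ i - 1)).filter
                fun t => (φ t < s ∨ s + n ≤ φ t) ∨ i + 1 ≤ t ∧ i + 1 ≤ φ t) := by
        rw [e₀, filter_append, filter_cons_of_pos (by simp; omega), filter_append,
          filter_cons_of_pos (by simp [hii]; omega), f₁ i le_rfl, f₂ i le_rfl (by omega), f₃]
      have e₂ : (range' s n).filter
          (fun t => (φ t < s ∨ s + n ≤ φ t) ∨ i + 1 ≤ t ∧ i + 1 ≤ φ t) =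
          ((range' s (i - s)).filter fun t => φ t < s ∨ s + n ≤ φ t) ++
            (((range' (i + 1) (φ i - i - 1)).filter fun t => φ t < s ∨ s + n ≤ φ t ∨ i < φ t) ++
              (range' (φ i + 1) (s + n - φ i - 1)).filter
                fun t => (φ t < s ∨ s + n ≤ φ t) ∨ i + 1 ≤ t ∧ i + 1 ≤ φ t) := by
        rw [e₀, filter_append, filter_cons_of_neg (by simp; omega), filter_append,
          filter_cons_of_neg (by simp [hii]; omega), f₁ (i + 1) (by omega),
          f₂ (i + 1) (by omega) le_rfl]
      rw [e₂] at h₁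
      rw [e₁]
      simpa using Deletion.cons (i := i) h₁
    · rw [if_neg hc, filter_cons_of_neg (by simpa using hc), nil_append]
      have e₁ : (range' s n).filter (fun t => (φ t < s ∨ s + n ≤ φ t) ∨ i ≤ t ∧ i ≤ φ t) =
          (range' s n).filter
            (fun t => (φ t < s ∨ s + n ≤ φ t) ∨ i + 1 ≤ t ∧ i + 1 ≤ φ t) := by
        refine filter_congr fun t ht => ?_
        rw [mem_range'_1] at ht
        have h₂ := hφ' i hi (by omega)
        have h₃ : t = i ∨ t ≠ i := eq_or_ne _ _
        have h₄ : φ t = i → t = φ i := fun h => by rw [← h, hφ]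
        simp only [decide_eq_decide]
        rcases h₃ with rfl | h₃
        · omega
        · by_cases h₅ : φ t = i
          · have := h₄ h₅; omega
          · omega
      rw [e₁]
      exact h₁

end Deletions

section DeletionSlides

lemma eventSum_mul (ρ : ℤ) (e : FrontEvent R) (c : ℤ[T;T⁻¹]) (F : StateFun) (f : ℕ → ℕ) :
    eventSum ρ e (fun g => c * F g) f = c * eventSum ρ e F f := by
  cases e <;> simp only [eventSum]
  · split_ifs <;> ring
  · ring
  · split_ifs <;> ring
  · ring

lemma wordSum_mul (ρ : ℤ) (w : Word R) (c : ℤ[T;T⁻¹]) (F : StateFun) (f : ℕ → ℕ) :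
    wordSum ρ w (fun g => c * F g) f = c * wordSum ρ w F f := by
  induction w generalizing f with
  | nil => rfl
  | cons e w ih =>
    simp only [wordSum_cons]
    rw [← eventSum_mul]
    congr 1
    funext g
    exact ih g

lemma chordSum_mul (ρ : ℤ) (w : Word R) (c : ℤ[T;T⁻¹]) (F : StateFun) (L : List ℕ) :
    chordSum ρ w (fun g => c * F g) L = c * chordSum ρ w F L := wordSum_mul ρ w c F _

lemma exists_map_eq_of_nodup {ts xs : List ℕ} (h : ts.Nodup) (hl : ts.length = xs.length) :
    ∃ χ : ℕ → ℕ, ts.map χ = xs := by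
  induction ts generalizing xs with
  | nil => exact ⟨id, by rw [length_eq_zero_iff.1 hl.symm]; rfl⟩
  | cons t ts ih =>
    obtain _ | ⟨x, xs⟩ := xs
    · simp at hl
    obtain ⟨χ, rfl⟩ := ih (nodup_cons.1 h).2 (by simpa using hl)
    refine ⟨Function.update χ t x, ?_⟩
    rw [map_cons, Function.update_self]
    congr 1
    refine map_congr_left fun a ha => Function.update_of_ne ?_ _ _
    rintro rfl
    exact (nodup_cons.1 h).1 ha

lemma chordWord_remove_pair {u v a b c : List ℕ} {x : ℕ}
    (h : IsChordWord (u ++ ((a ++ x :: (b ++ x :: c)) ++ v))) :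
    IsChordWord (u ++ ((a ++ (b ++ c)) ++ v)) := by
  have h₃ : IsChordWord ((u ++ a ++ b) ++ x :: x :: (c ++ v)) := by
    refine h.perm ?_
    simp only [append_assoc, cons_append]
    exact ((perm_middle.symm.append_left a)).append_left u
  simpa using h₃.remove

variable {k : ℕ} {μ : ℕ → R} {φ : ℕ → ℕ} {ts ps rest : List ℕ} {w : Word R}

lemma Deletion.mem (h : Deletion k μ φ ts ps w rest) {i : ℕ} (hi : i ∈ ps) :
    i ∈ ts ∧ φ i ∈ ts := by
  induction h with
  | nil ts => simp at hi
  | @cons a b c ps j w rest h ih =>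
    rcases mem_cons.1 hi with rfl | hi
    · simp
    · have := ih hi
      simp only [mem_append, mem_cons] at this ⊢
      tauto

lemma Deletion.rest_eq (h : Deletion k μ φ ts ps w rest) (hts : ts.Nodup) :
    rest = ts.filter fun t => t ∉ ps ∧ ∀ i ∈ ps, t ≠ φ i := by
  induction h with
  | nil ts => simp
  | @cons a b c ps j w rest h ih =>
    have hnd : (j :: φ j :: (a ++ (b ++ c))).Nodup := by
      refine (Perm.nodup_iff ?_).1 hts
      refine perm_middle.trans (Perm.cons j ?_)
      have : a ++ (b ++ φ j :: c) = (a ++ b) ++ φ j :: c := by simp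
      rw [this, ← append_assoc]
      exact perm_middle
    simp only [nodup_cons, mem_cons, not_or] at hnd
    rw [ih hnd.2.2]
    have key : ∀ l : List ℕ, l ⊆ a ++ (b ++ c) → l.filter (fun t => t ∉ ps ∧ ∀ i ∈ ps, t ≠ φ i) =
        l.filter fun t => t ∉ j :: ps ∧ ∀ i ∈ j :: ps, t ≠ φ i := by
      intro l hl
      refine filter_congr fun t ht => ?_
      have h₁ : t ≠ j := fun h => hnd.1.2 (h ▸ hl ht)
      have h₂ : t ≠ φ j := fun h => hnd.2.1 (h ▸ hl ht)
      simp [h₁, h₂]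
    rw [filter_append, filter_append, filter_append, filter_cons_of_neg (by simp), filter_append,
      filter_cons_of_neg (by simp), key a (by simp), key b (fun x hx => by simp [hx]),
      key c (fun x hx => by simp [hx])]

lemma Deletion.length_eq (h : Deletion k μ φ ts ps w rest) :
    ts.length = rest.length + 2 * ps.length := by
  induction h with
  | nil ts => simp
  | cons h ih =>
    simp only [length_append, length_cons] at ih ⊢
    omega

/-- Labels of the strands after a deletion extend to the strands before it. -/
lemma Deletion.exists_labels (h : Deletion k μ φ ts ps w rest) (hts : ts.Nodup) {u zs v : List ℕ}
    (hz : zs.length = rest.length) (hL : IsChordWord (u ++ (zs ++ v))) :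
    ∃ χ : ℕ → ℕ, rest.map χ = zs ∧ (∀ i ∈ ps, χ i = χ (φ i)) ∧
      IsChordWord (u ++ (ts.map χ ++ v)) := by
  induction h with
  | nil ts =>
    obtain ⟨χ, rfl⟩ := exists_map_eq_of_nodup hts hz.symm
    exact ⟨χ, rfl, by simp, hL⟩
  | @cons a b c ps j w rest h ih =>
    have hnd : (j :: φ j :: (a ++ (b ++ c))).Nodup := by
      refine (Perm.nodup_iff ?_).1 hts
      refine perm_middle.trans (Perm.cons j ?_)
      have : a ++ (b ++ φ j :: c) = (a ++ b) ++ φ j :: c := by simp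
      rw [this, ← append_assoc]
      exact perm_middle
    simp only [nodup_cons, mem_cons, not_or] at hnd
    obtain ⟨χ, h₁, h₂, h₃⟩ := ih hnd.2.2 hz
    obtain ⟨N, hN⟩ : ∃ N, N ∉ u ++ ((a ++ (b ++ c)).map χ ++ v) :=
      Infinite.exists_notMem_finset (u ++ ((a ++ (b ++ c)).map χ ++ v)).toFinset |>.imp
        fun N hN => by simpa using hN
    -- Both strands of the pair put back receive the fresh letter `N`.
    let χ' : ℕ → ℕ := fun t => if t = j ∨ t = φ j then N else χ t
    have hχ' : ∀ t ∈ a ++ (b ++ c), χ' t = χ t := by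
      intro t ht
      refine if_neg ?_
      rintro (rfl | rfl)
      · exact hnd.1.2 ht
      · exact hnd.2.1 ht
    have hrest : rest ⊆ a ++ (b ++ c) := by
      rw [h.rest_eq hnd.2.2]
      exact filter_subset_self _
    refine ⟨χ', ?_, ?_, ?_⟩
    · rw [← h₁]
      exact map_congr_left fun t ht => hχ' t (hrest ht)
    · intro i hi
      rcases mem_cons.1 hi with rfl | hi
      · simp [χ']
      · rw [hχ' _ (h.mem hi).1, hχ' _ (h.mem hi).2]
        exact h₂ i hi
    · have e : u ++ ((a ++ j :: (b ++ φ j :: c)).map χ' ++ v) =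
          u ++ ((a.map χ ++ N :: (b.map χ ++ N :: c.map χ)) ++ v) := by
        rw [map_append, map_cons, map_append, map_cons,
          map_congr_left (f := χ') (g := χ) (l := a) fun t ht => hχ' t (by simp [ht]),
          map_congr_left (f := χ') (g := χ) (l := b) fun t ht => hχ' t (by simp [ht]),
          map_congr_left (f := χ') (g := χ) (l := c) fun t ht => hχ' t (by simp [ht])]
        simp [χ']
      rw [e]
      have h₄ : IsChordWord ((u ++ a.map χ ++ b.map χ) ++ N :: N :: (c.map χ ++ v)) := by
        refine IsChordWord.insert (by simpa using h₃) ?_ ?_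
        · simp at hN ⊢; tauto
        · simp at hN ⊢; tauto
      refine h₄.perm ?_
      simp only [append_assoc, cons_append]
      exact ((perm_middle.append_left _)).append_left u

lemma keptLabels_map {α : Type} (Q : ℕ → Bool) (lab : ℕ → α) (χ : ℕ → ℕ) (ts : List ℕ) :
    keptLabels Q (ts.map lab) (ts.map χ) = (ts.filter fun t => !Q (χ t)).map lab := by
  induction ts with
  | nil => rfl
  | cons t ts ih =>
    rw [map_cons, map_cons, keptLabels, ih]
    cases h : Q (χ t) <;> simp [h]

/-- A strand slides over strands some of which are deleted in pairs afterwards. -/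
lemma Deletion.chordSum_slide (h : Deletion k μ φ ts ps w rest) (hts : ts.Nodup) (ρ : ℤ) (x : R)
    (lab : ℕ → Bool × R) {F F' : StateFun} {j : ℕ} {u v : List ℕ} {s : ℕ} {χ : ℕ → ℕ}
    (hL : IsChordWord (u ++ s :: (ts.map χ ++ v))) (hu : u.length = j)
    (hχ : ∀ i ∈ ps, χ i = χ (φ i)) (hφ : ∀ i ∈ ps, φ i ≠ i)
    (hF : ∀ (χ' : ℕ → ℕ) (s' : ℕ), (∀ i ∈ ps, χ' i = χ' (φ i)) →
      (ts.map χ' ++ [s']).Perm (s :: ts.map χ) → IsChordWord (u ++ (ts.map χ' ++ s' :: v)) →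
      F (chordMatching (u ++ (ts.map χ' ++ s' :: v))) =
        F' (chordMatching (u ++ (rest.map χ' ++ s' :: v)))) :
    chordSum ρ (mixedSlide j x (ts.map lab)) F (u ++ s :: (ts.map χ ++ v)) =
      chordSum ρ (mixedSlide j x (rest.map lab)) F' (u ++ s :: (rest.map χ ++ v)) := by
  classical
  -- `Q` selects the letters of the pairs to be deleted. A letter occurs at most twice, so it labels
  -- exactly the two strands of one pair, and discarding the letters in `Q` amounts to passing from
  -- `ts` to `rest`.
  let Q : ℕ → Bool := fun c => c ∈ ps.map χ
  have hcount : ∀ i ∈ ps, 2 ≤ (ts.map χ).count (χ i) := by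
    intro i hi
    obtain ⟨h₁, h₂⟩ := h.mem hi
    have hsub : ({i, φ i} : Multiset ℕ) ≤ (ts : Multiset ℕ) := by
      rw [Multiset.le_iff_subset (by simpa using (hφ i hi).symm)]
      intro t ht
      simp only [Multiset.insert_eq_cons, Multiset.mem_cons, Multiset.mem_singleton] at ht
      rcases ht with rfl | rfl
      · exact h₁
      · exact h₂
    simpa [Multiset.insert_eq_cons, ← hχ i hi] using
      Multiset.count_le_of_le (χ i) (Multiset.map_le_map (f := χ) hsub)
  have htot : ∀ c, (ts.map χ).count c ≤ 2 := by
    intro c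
    have := hL.count c
    simp only [count_append, count_cons] at this
    omega
  have hQ : ∀ t ∈ ts, Q (χ t) = true ↔ t ∉ rest := by
    intro t ht
    rw [h.rest_eq hts]
    simp only [Q, decide_eq_true_eq, mem_map, mem_filter, not_and, not_not, not_forall]
    constructor
    · rintro ⟨i, hi, hit⟩ _
      by_contra hcon
      push Not at hcon
      have hti : t ≠ i := fun h => hcon.1 (h ▸ hi)
      have htφ := hcon.2 i hi
      have hsub : ({t, i, φ i} : Multiset ℕ) ≤ (ts : Multiset ℕ) := by
        rw [Multiset.le_iff_subset (by simp [hti, htφ, (hφ i hi).symm])]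
        intro a ha
        simp only [Multiset.insert_eq_cons, Multiset.mem_cons, Multiset.mem_singleton] at ha
        rcases ha with rfl | rfl | rfl
        · exact ht
        · exact (h.mem hi).1
        · exact (h.mem hi).2
      have h₃ := Multiset.count_le_of_le (χ t) (Multiset.map_le_map (f := χ) hsub)
      have h₄ := htot (χ t)
      simp [Multiset.insert_eq_cons, ← hχ i hi, hit] at h₃
      omega
    · intro h'
      by_cases h₁ : t ∈ ps
      · exact ⟨t, h₁, rfl⟩
      · obtain ⟨i, hi, rfl⟩ := h' ht h₁
        exact ⟨i, hi, hχ i hi⟩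
  have hrest : ∀ χ' : ℕ → ℕ, (∀ t ∈ ts, Q (χ' t) = Q (χ t)) →
      (ts.filter fun t => !Q (χ' t)) = rest := by
    intro χ' hχ'
    have h₁ := h.rest_eq hts
    have h₂ : ts.filter (fun t => t ∈ rest) = rest := by
      conv_rhs => rw [h₁]
      refine filter_congr fun t ht => ?_
      rw [h₁]
      simp [ht]
    conv_rhs => rw [← h₂]
    refine filter_congr fun t ht => ?_
    rw [hχ' t ht]
    have := hQ t ht
    by_cases hr : t ∈ rest <;> simp [hr] at this ⊢ <;> exact this
  have hkey := chordSum_mixedSlide_filter ρ x (F := F) (F' := F') Q (ts.map lab) hL hu (by simp)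
    ?_ ?_ ?_
  · have e₁ : (ts.map χ).filter (fun c => !Q c) = rest.map χ := by
      rw [filter_map]
      congr 1
      exact hrest χ fun _ _ => rfl
    rw [hkey, keptLabels_map, hrest χ (fun _ _ => rfl), e₁]
  · intro c _ hQc
    obtain ⟨i, hi, rfl⟩ : ∃ i ∈ ps, χ i = c := by simpa [Q] using hQc
    exact le_antisymm (htot _) (hcount i hi)
  · by_contra hQs
    obtain ⟨i, hi, rfl⟩ : ∃ i ∈ ps, χ i = s := by simpa [Q] using hQs
    have h₁ := hL.count (χ i)
    have h₂ := hcount i hi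
    simp only [count_append, count_cons_self] at h₁
    omega
  · intro p' s' hmask hQs' hperm
    obtain ⟨χ', rfl⟩ := exists_map_eq_of_nodup (xs := p') hts (by
      have := congrArg length hmask
      simpa [lettersMask] using this.symm)
    -- By the mask condition the letters of the pairs to be deleted have kept their places, so the
    -- pairs can still be deleted after the slide.
    have hm : ∀ t ∈ ts, (if Q (χ' t) then some (χ' t) else none) =
        if Q (χ t) then some (χ t) else none := by
      simp only [lettersMask, map_map] at hmask
      exact map_inj_left.1 hmask
    have hQQ : ∀ t ∈ ts, Q (χ' t) = Q (χ t) := by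
      intro t ht
      have := hm t ht
      cases h₁ : Q (χ' t) <;> cases h₂ : Q (χ t) <;> simp [h₁, h₂] at this ⊢
    have hχχ : ∀ t ∈ ts, Q (χ t) = true → χ' t = χ t := by
      intro t ht hq
      have := hm t ht
      rw [hQQ t ht, hq] at this
      simpa using this
    have hps : ∀ i ∈ ps, χ' i = χ' (φ i) := by
      intro i hi
      have hq : Q (χ i) = true := by simp only [Q, decide_eq_true_eq]; exact mem_map_of_mem hi
      rw [hχχ i (h.mem hi).1 hq, hχχ (φ i) (h.mem hi).2 (by rw [← hχ i hi]; exact hq), hχ i hi]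
    have e₁ : (ts.map χ').filter (fun c => !Q c) = rest.map χ' := by
      rw [filter_map]
      congr 1
      exact hrest χ' hQQ
    rw [e₁]
    refine hF χ' s' hps hperm (hL.perm ?_)
    simpa using (hperm.symm.append_right v).append_left u

/-- A strand slides over strands which cannot be deleted in pairs afterwards. -/
lemma Deletion.chordSum_slide_eq_zero (h : Deletion k μ φ ts ps w rest) (hts : ts.Nodup) (ρ : ℤ)
    (x : R) (l : List (Bool × R)) {F : StateFun} {j : ℕ} {u v : List ℕ} {s : ℕ} {χ : ℕ → ℕ}
    (hL : IsChordWord (u ++ s :: (ts.map χ ++ v))) (hu : u.length = j) (hl : l.length = ts.length)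
    (hχ : ¬ ∀ i ∈ ps, χ i = χ (φ i)) (hφ : ∀ i ∈ ps, φ i ≠ i)
    (hF : ∀ (χ' : ℕ → ℕ) (s' : ℕ), (¬ ∀ i ∈ ps, χ' i = χ' (φ i)) →
      IsChordWord (u ++ (ts.map χ' ++ s' :: v)) →
      F (chordMatching (u ++ (ts.map χ' ++ s' :: v))) = 0) :
    chordSum ρ (mixedSlide j x l) F (u ++ s :: (ts.map χ ++ v)) = 0 := by
  rw [chordSum_mixedSlide_congr ρ x (F' := 0) l hL hu (by simpa using hl), chordSum, wordSum_zero]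
  intro p' s' hd hs' hperm _
  obtain ⟨χ', rfl⟩ := exists_map_eq_of_nodup (xs := p') hts (by
    have := congrArg length hd
    simpa [doubledLetters] using this.symm)
  have hch : IsChordWord (u ++ (ts.map χ' ++ s' :: v)) := by
    refine hL.perm ?_
    simpa using (hperm.symm.append_right v).append_left u
  refine hF χ' s' (fun hall => hχ fun i hi => ?_) hch
  -- If all pairs could be deleted after the slide, their letters would occur twice inside the
  -- block. Such letters do not move, so the pairs would have been matched before the slide.
  have hd' : ∀ t ∈ ts, (if (ts.map χ').count (χ' t) = 2 then some (χ' t) else none) =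
      if (ts.map χ).count (χ t) = 2 then some (χ t) else none := by
    simp only [doubledLetters, map_map] at hd
    exact map_inj_left.1 hd
  have hcount : (ts.map χ').count (χ' i) = 2 := by
    obtain ⟨h₁, h₂⟩ := h.mem hi
    have hsub : ({i, φ i} : Multiset ℕ) ≤ (ts : Multiset ℕ) := by
      rw [Multiset.le_iff_subset (by simpa using (hφ i hi).symm)]
      intro t ht
      simp only [Multiset.insert_eq_cons, Multiset.mem_cons, Multiset.mem_singleton] at ht
      rcases ht with rfl | rfl
      · exact h₁
      · exact h₂
    have h₃ := Multiset.count_le_of_le (χ' i) (Multiset.map_le_map (f := χ') hsub)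
    have h₄ : 2 ≤ (ts.map χ').count (χ' i) := by
      simpa [Multiset.insert_eq_cons, ← hall i hi] using h₃
    have h₅ := hch.count (χ' i)
    simp only [count_append] at h₅
    omega
  have h₁ := hd' i (h.mem hi).1
  have h₂ := hd' (φ i) (h.mem hi).2
  rw [if_pos hcount] at h₁
  rw [← hall i hi, if_pos hcount] at h₂
  split_ifs at h₁ h₂
  rw [← Option.some_inj.1 h₁, ← Option.some_inj.1 h₂]

end DeletionSlides

/-! ### Resolutions of vertices -/

lemma mem_outerStrands {φ : ℕ → ℕ} {s n t : ℕ} :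
    t ∈ outerStrands φ s n ↔ (s ≤ t ∧ t < s + n) ∧ (φ t < s ∨ s + n ≤ φ t) := by
  simp [outerStrands, mem_range'_1]

lemma mem_innerPairs {φ : ℕ → ℕ} {s n t : ℕ} :
    t ∈ innerPairs φ s n ↔ (s ≤ t ∧ t < s + n) ∧ t < φ t ∧ φ t < s + n := by
  simp [innerPairs, mem_range'_1]

lemma pairwise_outerStrands (φ : ℕ → ℕ) (s n : ℕ) :
    (outerStrands φ s n).Pairwise (· < ·) :=
  List.Pairwise.filter _ (pairwise_lt_range' (step := 1) (by omega))

lemma nodup_outerStrands (φ : ℕ → ℕ) (s n : ℕ) : (outerStrands φ s n).Nodup :=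
  (pairwise_outerStrands φ s n).imp fun h => h.ne

lemma IsPerfectMatching.ne {n : ℕ} {φ : ℕ → ℕ} (hφ : IsPerfectMatching n φ) {i : ℕ} (hi : i < n) :
    φ i ≠ i := (hφ.2 i).2 hi

lemma IsPerfectMatching.deletion {n : ℕ} {φ : ℕ → ℕ} (hφ : IsPerfectMatching n φ) (k : ℕ)
    (μ : ℕ → R) {s m : ℕ} (h : s + m ≤ n) :
    Deletion k μ φ (range' s m) (innerPairs φ s m) (markedRightCusps k μ φ s m) (outerStrands φ s m)
      := deletion_markedRightCusps k μ φ s m hφ.1 fun _ _ hi => hφ.ne (by omega)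

lemma nodup_range' (s n : ℕ) : (range' s n).Nodup := List.nodup_range'

lemma innerPairs_ne {φ : ℕ → ℕ} {s n : ℕ} : ∀ i ∈ innerPairs φ s n, φ i ≠ i := fun i hi => by
  have := (mem_innerPairs.1 hi).2.1
  omega

/-- The strands of the braid in the resolution of a vertex, with their targets. -/
def crossingStrands (a b : ℕ) (μ : ℕ → R) (φ : ℕ → ℕ) : List (ℕ × R) :=
  (outerStrands φ a b).map fun t => (φ t, μ t)

lemma map_snd_crossingStrands (a b : ℕ) (μ : ℕ → R) (φ : ℕ → ℕ) :
    (crossingStrands a b μ φ).map Prod.snd = (outerStrands φ a b).map μ := by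
  simp [crossingStrands, Function.comp_def]

lemma length_crossingStrands (a b : ℕ) (μ : ℕ → R) (φ : ℕ → ℕ) :
    (crossingStrands a b μ φ).length = (outerStrands φ a b).length := by
  simp [crossingStrands]

lemma nodup_crossingStrands (a b : ℕ) (μ : ℕ → R) {φ : ℕ → ℕ} (hφ : ∀ i, φ (φ i) = i) :
    ((crossingStrands a b μ φ).map Prod.fst).Nodup := by
  have : (crossingStrands a b μ φ).map Prod.fst = (outerStrands φ a b).map φ := by
    simp [crossingStrands, Function.comp_def]
  rw [this]
  exact (nodup_outerStrands φ a b).map fun i j h => by rw [← hφ i, h, hφ]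

lemma IsPerfectMatching.map_outerStrands_perm {a b : ℕ} {φ : ℕ → ℕ}
    (hφ : IsPerfectMatching (a + b) φ) :
    ((outerStrands φ a b).map φ).Perm (outerStrands φ 0 a) := by
  rw [perm_ext_iff_of_nodup ((nodup_outerStrands φ a b).map fun i j h => by rw [← hφ.1 i, h, hφ.1])
    (nodup_outerStrands φ 0 a)]
  intro t
  rw [mem_outerStrands, mem_map]
  constructor
  · rintro ⟨i, hi, rfl⟩
    have h₁ := mem_outerStrands.1 hi
    have h₂ := hφ.apply_lt_iff (i := i)
    rw [hφ.1]
    omega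
  · intro h
    have h₂ := hφ.apply_lt_iff (i := t)
    refine ⟨φ t, ?_, hφ.1 t⟩
    rw [mem_outerStrands, hφ.1]
    omega

/-- After sorting, the strands stand in the order of the right half-edges; each still carries the
potential of its left half-edge, which agrees with the right one only modulo `ρ`. -/
lemma sortedPotentials_crossingStrands {a b : ℕ} (μ : ℕ → R) {φ : ℕ → ℕ}
    (hφ : IsPerfectMatching (a + b) φ) :
    sortedPotentials (crossingStrands a b μ φ) = (outerStrands φ 0 a).map fun t => μ (φ t) := by
  have : (crossingStrands a b μ φ).insertionSort (fun s t => s.1 ≤ t.1) =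
      (outerStrands φ 0 a).map fun t => (t, μ (φ t)) := by
    refine insertionSort_eq_of_perm ?_ ?_
    · have h₁ := hφ.map_outerStrands_perm.symm.map fun t => (t, μ (φ t))
      rw [map_map] at h₁
      have e : crossingStrands a b μ φ =
          (outerStrands φ a b).map ((fun t => (t, μ (φ t))) ∘ φ) := by
        unfold crossingStrands
        refine map_congr_left fun t _ => ?_
        simp [hφ.1]
      rw [e]
      exact h₁
    · rw [pairwise_map]
      exact pairwise_outerStrands φ 0 a
  rw [sortedPotentials, this, map_map]
  rfl

lemma resolveVertex_eq (k : ℕ) (l r : List R) {φ : ℕ → ℕ}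
    (hφ : IsPerfectMatching (r.length + l.length) φ) :
    resolveVertex k l r φ = markedRightCusps k (halfEdgePotential l r) φ r.length l.length ++
        ((permutationBraid k (crossingStrands r.length l.length (halfEdgePotential l r) φ) ++
          complementBraid k (crossingStrands r.length l.length (halfEdgePotential l r) φ) ++
          mirrorWord (complementBraid k
            (crossingStrands r.length l.length (halfEdgePotential l r) φ))) ++
        mirrorWord (markedRightCusps k (halfEdgePotential l r) φ 0 r.length)) := by
  have : (range' r.length l.length).filter (fun t => φ t < r.length) =
      outerStrands φ r.length l.length := by
    refine filter_congr fun t ht => ?_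
    rw [mem_range'_1] at ht
    have := hφ.apply_lt_iff (i := t)
    simp only [decide_eq_decide]
    omega
  simp only [resolveVertex, this, crossingStrands, append_assoc]

lemma IsChordWord.of_deletion {k : ℕ} {μ : ℕ → R} {φ : ℕ → ℕ} {ts ps rest : List ℕ} {w : Word R}
    (h : Deletion k μ φ ts ps w rest) {u v : List ℕ} {χ : ℕ → ℕ}
    (hL : IsChordWord (u ++ (ts.map χ ++ v))) (hχ : ∀ i ∈ ps, χ i = χ (φ i)) :
    IsChordWord (u ++ (rest.map χ ++ v)) := by
  induction h with
  | nil ts => exact hL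
  | @cons a b c ps i w rest h ih =>
    refine ih ?_ fun j hj => hχ j (mem_cons_of_mem _ hj)
    rw [map_append, map_append]
    refine chordWord_remove_pair (x := χ i) ?_
    have := hχ i mem_cons_self
    simpa [← this] using hL

/-- The state sum of a resolution of a vertex. -/
lemma chordSum_resolveVertex (ρ : ℤ) {k : ℕ} {l r : List R} {φ : ℕ → ℕ}
    (hφ : IsPerfectMatching (r.length + l.length) φ) (w : Word R) (F : StateFun) {u v : List ℕ}
    (χ : ℕ → ℕ) (hu : u.length = k)
    (hL : IsChordWord (u ++ ((range' r.length l.length).map χ ++ v))) :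
    chordSum ρ (resolveVertex k l r φ ++ w) F (u ++ ((range' r.length l.length).map χ ++ v)) =
      if (∀ i ∈ innerPairs φ r.length l.length, χ i = χ (φ i)) ∧
          ((outerStrands φ r.length l.length).map χ).Nodup then
        T (-((innerPairs φ r.length l.length).length : ℤ)) * chordSum ρ
            (permutationBraid k (crossingStrands r.length l.length (halfEdgePotential l r) φ))
            (wordSum ρ (mirrorWord (markedRightCusps k (halfEdgePotential l r) φ 0 r.length) ++ w) F)
            (u ++ ((outerStrands φ r.length l.length).map χ ++ v)) else 0 := by
  have hd := hφ.deletion k (halfEdgePotential l r) (le_refl (r.length + l.length))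
  rw [resolveVertex_eq k l r hφ, append_assoc, chordSum_append, hd.chordSum_eq ρ _ χ hu hL]
  by_cases hχ : ∀ i ∈ innerPairs φ r.length l.length, χ i = χ (φ i)
  · have hL' := hL.of_deletion hd hχ
    have := chordSum_halfTwist ρ (crossingStrands r.length l.length (halfEdgePotential l r) φ)
      (nodup_crossingStrands _ _ _ hφ.1)
      (wordSum ρ (mirrorWord (markedRightCusps k (halfEdgePotential l r) φ 0 r.length) ++ w) F) hu
      (by rw [length_crossingStrands, length_map]) hL'
    rw [chordSum, ← wordSum_append] at this
    rw [if_pos hχ, append_assoc, this]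
    by_cases hn : ((outerStrands φ r.length l.length).map χ).Nodup
    · rw [if_pos hn, if_pos ⟨hχ, hn⟩]
    · rw [if_neg hn, if_neg fun h => hn h.2, mul_zero]
  · rw [if_neg hχ, if_neg fun h => hχ h.1]

lemma map_halfEdgePotential_left (l r : List R) :
    (range' r.length l.length).map (halfEdgePotential l r) = l := by
  refine ext_getElem (by simp) fun i h₁ h₂ => ?_
  simp only [getElem_map, getElem_range', halfEdgePotential]
  rw [getD_eq_getElem?_getD, getElem?_append_right (by omega)]
  simp [h₂]

lemma map_halfEdgePotential_right (l r : List R) :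
    (range' 0 r.length).map (halfEdgePotential l r) = r := by
  refine ext_getElem (by simp) fun i h₁ h₂ => ?_
  simp only [getElem_map, getElem_range', halfEdgePotential]
  rw [getD_eq_getElem?_getD, getElem?_append_left (by omega)]
  simp [h₂]

/-! ### Move (IV): a strand passes a resolved vertex -/

lemma wordSum_slideDown_congr {ρ : ℤ} {m : Bool} {k : ℕ} {x x' : R} {l l' : List R}
    (hx : (ρ : R) ∣ x - x') (hl : Forall₂ (fun y y' => (ρ : R) ∣ y - y') l l') (F : StateFun) :
    wordSum ρ (slideDown m k x l) F = wordSum ρ (slideDown m k x' l') F := by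
  induction hl generalizing k F with
  | nil => rfl
  | @cons y y' l l' hy hl ih =>
    simp only [slideDown, wordSum_cons]
    rw [ih]
    funext f
    have h := switchable_congr (m := m) hx hy
    simp only [eventSum]
    split_ifs <;> first | rfl | (exfalso; tauto)

/-- A strand slides over the left half-edges of a resolved vertex, up to their deletion. -/
lemma chordSum_slide_insertion (ρ : ℤ) {n k : ℕ} (x : R) (μ : ℕ → R) {φ : ℕ → ℕ} {N : ℕ}
    (hφ : IsPerfectMatching N φ) (hn : n ≤ N) (F : StateFun) {u v : List ℕ} {s : ℕ} {χ : ℕ → ℕ}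
    (hL : IsChordWord (u ++ s :: ((range' 0 n).map χ ++ v))) (hu : u.length = k)
    (hχ : ∀ i ∈ innerPairs φ 0 n, χ i = χ (φ i)) :
    chordSum ρ (slideDown false k x ((range' 0 n).map μ)) F (u ++ s :: ((range' 0 n).map χ ++ v)) =
      T ((innerPairs φ 0 n).length : ℤ) *
        chordSum ρ (slideDown false k x ((outerStrands φ 0 n).map μ))
          (wordSum ρ (mirrorWord (markedRightCusps k μ φ 0 n)) F)
          (u ++ s :: ((outerStrands φ 0 n).map χ ++ v)) := by
  have hd := hφ.deletion k μ (s := 0) (m := n) (by omega)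
  rw [← chordSum_mul, slideDown_eq_mixedSlide, slideDown_eq_mixedSlide, map_map, map_map]
  refine hd.chordSum_slide (nodup_range' _ _) ρ x _ hL hu hχ innerPairs_ne ?_
  intro χ' s' hχ' _ hch
  have := hd.chordSum_mirror ρ F χ' hu hch hχ'
  rw [chordSum] at this
  rw [this, ← mul_assoc, ← T_add]
  simp

/-- A strand sliding behind the braid meets potentials of left half-edges in one picture and of
right half-edges in the other; the grading of `φ` makes them congruent. -/
lemma forall₂_outerStrands {ρ : ℤ} {l r : List R} {φ : ℕ → ℕ} (hφ : IsGradedVertexMatching ρ l r φ)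
    (ts : List ℕ) (hts : ts ⊆ outerStrands φ 0 r.length) :
    Forall₂ (fun y y' => (ρ : R) ∣ y - y') (ts.map fun t => halfEdgePotential l r (φ t))
      (ts.map (halfEdgePotential l r)) := by
  rw [forall₂_map_left_iff, forall₂_map_right_iff, forall₂_same]
  intro t ht
  have h₁ := mem_outerStrands.1 (hts ht)
  have h₂ := (hφ.2 t (by omega)).2 ⟨by omega, by omega⟩
  rw [← neg_sub]
  exact (dvd_neg).2 h₂

/-- A descending strand passes a resolved vertex. -/
lemma chordSum_slide_resolveVertex (ρ : ℤ) {k : ℕ} {l r : List R} (x : R) {φ : ℕ → ℕ}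
    (hφ : IsGradedVertexMatching ρ l r φ) (F : StateFun) {u v : List ℕ} {s : ℕ} (χ : ℕ → ℕ)
    (hu : u.length = k) (hL : IsChordWord (u ++ s :: ((range' r.length l.length).map χ ++ v))) :
    chordSum ρ (slideDown false k x l ++ resolveVertex k l r φ) F
        (u ++ s :: ((range' r.length l.length).map χ ++ v)) =
      chordSum ρ (resolveVertex (k + 1) l r φ ++ slideDown false k x r) F
        (u ++ s :: ((range' r.length l.length).map χ ++ v)) := by
  have hpm := hφ.1
  set μ := halfEdgePotential l r with hμ
  have hdl := hpm.deletion k μ (le_refl (r.length + l.length))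
  have hL' : IsChordWord ((u ++ [s]) ++ ((range' r.length l.length).map χ ++ v)) := by
    simpa using hL
  have hu' : (u ++ [s]).length = k + 1 := by simp [hu]
  have hright := chordSum_resolveVertex ρ hpm (slideDown false k x r) F χ hu' hL'
  have hleft := fun (χ' : ℕ → ℕ) (s' : ℕ) hch => chordSum_resolveVertex ρ hpm [] F (k := k)
    (v := s' :: v) χ' hu hch
  simp only [append_nil] at hleft
  have eL : u ++ s :: ((range' r.length l.length).map χ ++ v) =
    (u ++ [s]) ++ ((range' r.length l.length).map χ ++ v) := by simp
  have hpot : l = (range' r.length l.length).map μ := (map_halfEdgePotential_left l r).symm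
  by_cases hχ : ∀ i ∈ innerPairs φ r.length l.length, χ i = χ (φ i)
  swap
  -- A left pair of `φ` that is not matched by the state kills the resolution, and sliding the
  -- strand first cannot repair this.
  · rw [eL, hright, if_neg fun h => hχ h.1, ← eL, chordSum_append, slideDown_eq_mixedSlide]
    refine hdl.chordSum_slide_eq_zero (nodup_range' _ _) ρ x _ hL hu (by simp) hχ innerPairs_ne ?_
    intro χ' s' hχ' hch
    exact (hleft χ' s' hch).trans (if_neg fun h => hχ' h.1)
  -- the deletion of the pairs on the left
  set st := crossingStrands r.length l.length μ φ with hst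
  set nl : ℤ := ((innerPairs φ r.length l.length).length : ℤ)
  set Del := markedRightCusps k μ φ 0 r.length with hDel
  set mid := permutationBraid k st ++ complementBraid k st ++ mirrorWord (complementBraid k st)
    with hmid
  have hstn : (st.map Prod.fst).Nodup := nodup_crossingStrands _ _ _ hpm.1
  set xs := (outerStrands φ r.length l.length).map χ with hxs
  have hlen : xs.length = st.length := by simp [hxs, hst, length_crossingStrands]
  have hL₂ : IsChordWord ((u ++ [s]) ++ (xs ++ v)) := hL'.of_deletion hdl hχ
  have hL₃ : IsChordWord (u ++ s :: (xs ++ v)) := by simpa using hL₂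
  have hstep : chordSum ρ (slideDown false k x l ++ resolveVertex k l r φ) F
      (u ++ s :: ((range' r.length l.length).map χ ++ v)) =
      T (-nl) * chordSum ρ (slideDown false k x (st.map Prod.snd))
        (wordSum ρ (mid ++ mirrorWord Del) F) (u ++ s :: (xs ++ v)) := by
    rw [chordSum_append, ← chordSum_mul, hst, map_snd_crossingStrands]
    conv_lhs => rw [show slideDown false k x l = slideDown false k x
      ((range' r.length l.length).map μ) by rw [← hpot]]
    rw [slideDown_eq_mixedSlide, slideDown_eq_mixedSlide, map_map, map_map]
    refine hdl.chordSum_slide (nodup_range' _ _) ρ x _ hL hu hχ innerPairs_ne ?_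
    intro χ' s' hχ' _ hch
    have := hdl.chordSum_eq ρ (wordSum ρ (mid ++ mirrorWord Del) F) χ' hu hch
    rw [if_pos hχ', chordSum, ← wordSum_append] at this
    rw [resolveVertex_eq k l r hpm]
    exact this
  rw [hstep, eL, hright]
  clear hstep hright hleft
  by_cases hnd : xs.Nodup
  swap
  -- Two matched strands of the braid keep their places during the slide, so the half-twist still
  -- vanishes after it.
  · rw [if_neg fun h => hnd h.2, slideDown_eq_mixedSlide]
    rw [chordSum_mixedSlide_congr ρ x (F' := 0) _ hL₃ hu (by simp [hlen]), chordSum, wordSum_zero,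
      mul_zero]
    intro p' s' hd _ hperm _
    have hch : IsChordWord (u ++ (p' ++ s' :: v)) := by
      refine hL₃.perm ?_
      simpa using (hperm.symm.append_right v).append_left u
    have hp'l : p'.length = st.length := by
      have := congrArg length hd
      simp only [doubledLetters, length_map] at this
      rw [this, hlen]
    have := chordSum_halfTwist ρ st hstn (wordSum ρ (mirrorWord Del) F) hu hp'l hch
    rw [chordSum, ← wordSum_append] at this
    rw [hmid]
    refine this.trans (if_neg fun hp' => hnd ?_)
    rw [nodup_iff_count_le_one]
    intro c
    by_contra hc
    have h₁ := hL₂.count c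
    simp only [count_append] at h₁
    have h₂ : some c ∈ doubledLetters xs := by
      refine mem_map.2 ⟨c, count_pos_iff.1 (by omega), ?_⟩
      rw [if_pos (by omega)]
    rw [← hd] at h₂
    exact Option.some_ne_none _ (doubledLetters_of_nodup hp' _ h₂)
  rw [if_pos ⟨hχ, hnd⟩]
  congr 1
  have hdr := hpm.deletion (k + 1) μ (s := 0) (m := r.length) (by omega)
  have hzlen : ∀ zs : List ℕ, zs.Perm xs → zs.length = (outerStrands φ 0 r.length).length := by
    intro zs hzs
    have := hpm.map_outerStrands_perm.length_eq
    simp only [length_map] at this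
    rw [hzs.length_eq, hxs, length_map, this]
  have hzch : ∀ zs : List ℕ, zs.Perm xs → IsChordWord ((u ++ [s]) ++ (zs ++ v)) :=
    fun zs hzs => hL₂.perm ((hzs.symm.append_right v).append_left _)
  have hbr := isBraid_permutationBraid (k + 1) st
  -- If the partner of the sliding strand runs through the braid, neither picture contributes: the
  -- strand has to pass its partner before the braid or after it.
  by_cases hs : s ∈ xs
  · rw [slideDown_eq_mixedSlide, chordSum_mixedSlide_eq_zero ρ x _ _ hL₃ hu (by simp [hlen]) hs]
    refine (chordSum_eq_zero_of_braid hbr hu' hlen hL₂ fun zs hzs => ?_).symm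
    obtain ⟨χ', hχ'₁, hχ'₂, hχ'₃⟩ := hdr.exists_labels (nodup_range' _ _) (hzlen zs hzs) (hzch zs hzs)
    rw [wordSum_append, ← hχ'₁]
    have := hdr.chordSum_mirror ρ (wordSum ρ (slideDown false k x r) F) χ' hu' hχ'₃ hχ'₂
    rw [chordSum] at this
    rw [this]
    have hz := chordSum_mixedSlide_eq_zero ρ x F (r.map fun y => (false, y)) (k := k) (p := u)
      (ys := (range' 0 r.length).map χ') (v := v) (s := s) (by simpa using hχ'₃) hu (by simp)
      (by
        have h₁ : s ∈ zs := hzs.mem_iff.2 hs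
        rw [← hχ'₁] at h₁
        obtain ⟨t, ht, h₂⟩ := mem_map.1 h₁
        exact mem_map.2 ⟨t, mem_of_mem_filter ht, h₂⟩)
    rw [← slideDown_eq_mixedSlide, chordSum] at hz
    simp only [append_assoc, cons_append, nil_append] at hz ⊢
    rw [hz, mul_zero]
  · have hnd' : (s :: xs).Nodup := nodup_cons.2 ⟨hs, hnd⟩
    -- Now the letters of the sliding strand and of the braid strands are all distinct and stay so.
    -- The marked crossings cancel, and what remains is the slide past `β` itself.
    have e₁ : chordSum ρ (slideDown false k x (st.map Prod.snd))
        (wordSum ρ (mid ++ mirrorWord Del) F) (u ++ s :: (xs ++ v)) =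
        chordSum ρ (slideDown false k x (st.map Prod.snd) ++ permutationBraid k st)
          (wordSum ρ (mirrorWord Del) F) (u ++ ((s :: xs) ++ v)) := by
      rw [chordSum_append]
      refine (isBraid_slideDown false k x (st.map Prod.snd)).chordSum_congr (xs := s :: xs) (v := v)
        hu (by simp [hlen]) hL₃ ?_
      intro ys hys
      obtain rfl | ⟨p', s', rfl⟩ := eq_nil_or_concat' ys
      · simp at hys
      have hp'l : p'.length = st.length := by
        have := hys.length_eq
        simp at this
        omega
      have hp'n : p'.Nodup := (nodup_append.1 (hys.nodup_iff.2 hnd')).1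
      have hch : IsChordWord (u ++ (p' ++ s' :: v)) := by
        refine hL₃.perm ?_
        simpa using (hys.symm.append_right v).append_left u
      have := chordSum_halfTwist ρ st hstn (wordSum ρ (mirrorWord Del) F) hu hp'l hch
      rw [if_pos hp'n, chordSum, ← wordSum_append, chordSum] at this
      simp only [append_assoc, cons_append, nil_append] at this ⊢
      rw [← this, hmid]
      simp only [append_assoc]
    have hblock := blockEq_slide_permutationBraid ρ k x st hstn (wordSum ρ (mirrorWord Del) F)
      u (s :: xs) v hu (by simp [hlen]) hnd' (by simpa using hL₃)
    rw [e₁, hblock, chordSum_append]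
    have e₂ : u ++ (s :: xs ++ v) = (u ++ [s]) ++ (xs ++ v) := by simp
    rw [e₂]
    refine hbr.chordSum_congr hu' hlen hL₂ fun zs hzs => ?_
    obtain ⟨χ', hχ'₁, hχ'₂, hχ'₃⟩ := hdr.exists_labels (nodup_range' _ _) (hzlen zs hzs) (hzch zs hzs)
    have h₁ := hdr.chordSum_mirror ρ (wordSum ρ (slideDown false k x r) F) χ' hu' hχ'₃ hχ'₂
    rw [chordSum] at h₁
    rw [wordSum_append, ← hχ'₁, h₁]
    have h₂ := chordSum_slide_insertion ρ x μ hpm (n := r.length) (by omega) F (u := u) (v := v)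
      (s := s) (χ := χ') (k := k) (by simpa using hχ'₃) hu hχ'₂
    rw [hμ, map_halfEdgePotential_right, ← hμ, chordSum, chordSum] at h₂
    simp only [append_assoc, cons_append, nil_append] at h₂ ⊢
    rw [h₂, ← mul_assoc, ← T_add, hst, sortedPotentials_crossingStrands μ hpm]
    rw [wordSum_slideDown_congr (x' := x) (by simp) (forall₂_outerStrands hφ _ (Subset.refl _))]
    simp [hμ, hDel]

/-! ### Move (V): the top left edge of a vertex is turned to the right -/

lemma halfEdgePotential_rotate_of_lt {l r : List R} {x y : R} {t : ℕ} (ht : t < r.length) :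
    halfEdgePotential l (r ++ [y]) t = halfEdgePotential (x :: l) r t := by
  simp only [halfEdgePotential]
  rw [append_assoc, getD_append _ _ _ _ ht, getD_append _ _ _ _ ht]

lemma halfEdgePotential_rotate_of_gt {l r : List R} {x y : R} {t : ℕ} (ht : r.length < t) :
    halfEdgePotential l (r ++ [y]) t = halfEdgePotential (x :: l) r t := by
  simp only [halfEdgePotential]
  obtain ⟨d, rfl⟩ : ∃ d, t = r.length + (d + 1) := ⟨t - r.length - 1, by omega⟩
  have h₁ : (r ++ [y] ++ l)[r.length + (d + 1)]? = l[d]? := by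
    rw [append_assoc, getElem?_append_right (by omega), Nat.add_sub_cancel_left]
    rfl
  have h₂ : (r ++ x :: l)[r.length + (d + 1)]? = l[d]? := by
    rw [getElem?_append_right (by omega), Nat.add_sub_cancel_left]
    rfl
  rw [getD_eq_getElem?_getD, getD_eq_getElem?_getD, h₁, h₂]

lemma halfEdgePotential_rotate_self {l r : List R} {y : R} :
    halfEdgePotential l (r ++ [y]) r.length = y := by
  simp [halfEdgePotential]

lemma halfEdgePotential_cons_self {l r : List R} {x : R} :
    halfEdgePotential (x :: l) r r.length = x := by
  simp [halfEdgePotential]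

/-- The top left half-edge of a vertex and the bottom right one have the same matchings. -/
lemma isGradedVertexMatching_rotate (ρ : ℤ) (l r : List R) (x : R) (φ : ℕ → ℕ) :
    IsGradedVertexMatching ρ (x :: l) r φ ↔ IsGradedVertexMatching ρ l (r ++ [x - 1]) φ := by
  -- With right half-edges numbered before left ones, the label `r.length` denotes the top left
  -- half-edge of one vertex and the bottom right one of the other. Lowering its potential by one
  -- converts the condition for opposite sides into the one for equal sides, and conversely.
  have hlen : r.length + (x :: l).length = (r ++ [x - 1]).length + l.length := by
    simp only [length_append, length_cons, length_nil]; omega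
  unfold IsGradedVertexMatching
  rw [hlen]
  refine and_congr_right fun hφ => forall_congr' fun i => forall_congr' fun hi => ?_
  have h₁ : (r ++ [x - 1]).length = r.length + 1 := by simp
  rw [h₁]
  rcases lt_trichotomy i r.length with hir | rfl | hir
  · rw [halfEdgePotential_rotate_of_lt (x := x) hir]
    rcases lt_trichotomy (φ i) r.length with hj | hj | hj
    · rw [halfEdgePotential_rotate_of_lt (x := x) hj]
      constructor <;> rintro ⟨h, h'⟩ <;> refine ⟨fun _ => h (by omega), fun h => by omega⟩
    · rw [hj, halfEdgePotential_rotate_self, halfEdgePotential_cons_self,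
        show halfEdgePotential (x :: l) r i - (x - 1) - 1 = halfEdgePotential (x :: l) r i - x by ring]
      constructor
      · rintro ⟨_, h⟩; exact ⟨fun _ => h (by omega), fun h => by omega⟩
      · rintro ⟨h, _⟩; exact ⟨fun h => by omega, fun _ => h (by omega)⟩
    · rw [halfEdgePotential_rotate_of_gt (x := x) hj]
      constructor <;> rintro ⟨h, h'⟩ <;> refine ⟨fun h => by omega, fun _ => h' (by omega)⟩
  · rw [halfEdgePotential_rotate_self, halfEdgePotential_cons_self,
      halfEdgePotential_rotate_of_gt (x := x) hi,
      show x - 1 - halfEdgePotential (x :: l) r (φ r.length) =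
        x - halfEdgePotential (x :: l) r (φ r.length) - 1 by ring]
    constructor
    · rintro ⟨h, _⟩; exact ⟨fun h => by omega, fun _ => h (by omega)⟩
    · rintro ⟨_, h⟩; exact ⟨fun _ => h (by omega), fun h => by omega⟩
  · rw [halfEdgePotential_rotate_of_gt (x := x) hir,
      halfEdgePotential_rotate_of_gt (x := x) (hir.trans hi)]
    constructor <;> rintro ⟨h, h'⟩ <;> refine ⟨fun _ => h (by omega), fun h => by omega⟩

lemma range'_succ_right (s n : ℕ) : range' s (n + 1) = range' s n ++ [s + n] := by
  simpa using (range'_1_concat (s := s) (n := n))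

lemma crossingStrands_congr {a a' b b' : ℕ} {μ μ' : ℕ → R} {φ : ℕ → ℕ}
    (h : outerStrands φ a b = outerStrands φ a' b') (hμ : ∀ t ∈ outerStrands φ a b, μ t = μ' t) :
    crossingStrands a b μ φ = crossingStrands a' b' μ' φ := by
  unfold crossingStrands
  rw [← h]
  exact map_congr_left fun t ht => by rw [hμ t ht]

/-- A strand that slides over the strands of a resolved vertex on the right and ends in a cusp. -/
lemma chordSum_slide_cusp_insertion (ρ : ℤ) {n k : ℕ} (x y : R) (μ : ℕ → R) {φ : ℕ → ℕ} {N : ℕ}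
    (hφ : IsPerfectMatching N φ) (hn : n ≤ N) (F : StateFun) {u v : List ℕ} {s t : ℕ} {χ : ℕ → ℕ}
    (hL : IsChordWord (u ++ s :: ((range' 0 n).map χ ++ t :: v))) (hu : u.length = k)
    (hχ : ∀ i ∈ innerPairs φ 0 n, χ i = χ (φ i)) :
    chordSum ρ (slideDown false k x ((range' 0 n).map μ) ++ [.rightCusp (k + n) y]) F
        (u ++ s :: ((range' 0 n).map χ ++ t :: v)) = T ((innerPairs φ 0 n).length : ℤ) *
        chordSum ρ (slideDown false k x ((outerStrands φ 0 n).map μ) ++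
            .rightCusp (k + (outerStrands φ 0 n).length) y :: mirrorWord (markedRightCusps k μ φ 0 n))
          F (u ++ s :: ((outerStrands φ 0 n).map χ ++ t :: v)) := by
  have hd := hφ.deletion k μ (s := 0) (m := n) (by omega)
  rw [chordSum_append, chordSum_append, ← chordSum_mul, slideDown_eq_mixedSlide,
    slideDown_eq_mixedSlide, map_map, map_map]
  refine hd.chordSum_slide (nodup_range' _ _) ρ x _ hL hu hχ innerPairs_ne ?_
  intro χ' s' hχ' _ hch
  have h₁ : IsChordWord ((u ++ (range' 0 n).map χ') ++ s' :: t :: v) := by simpa using hch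
  have h₂ : IsChordWord ((u ++ (outerStrands φ 0 n).map χ') ++ s' :: t :: v) := by
    simpa using hch.of_deletion hd hχ'
  have h₃ := chordSum_rightCusp ρ y [] F h₁ (k := k + n) (by simp [hu])
  have h₄ := chordSum_rightCusp ρ y (mirrorWord (markedRightCusps k μ φ 0 n)) F h₂
    (k := k + (outerStrands φ 0 n).length) (by simp [hu])
  rw [chordSum, chordSum_nil] at h₃
  rw [chordSum] at h₄
  simp only [append_assoc] at h₃ h₄
  rw [h₃, h₄]
  split_ifs with hst
  · subst hst
    have h₅ : IsChordWord (u ++ ((range' 0 n).map χ' ++ v)) := by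
      simpa using h₁.remove
    have := hd.chordSum_mirror ρ F χ' hu h₅ hχ'
    rw [this, mul_left_comm, ← mul_assoc (T _) (T _) (F _), ← T_add, add_neg_cancel, T_zero,
      one_mul]
  · rw [mul_zero]

section TopEdge

/-- A strand that slides down and ends in a cusp with a strand it is not allowed to switch past. -/
lemma chordSum_mixedSlide_rightCusp (ρ : ℤ) (x y : R) (l : List (Bool × R)) (w : Word R)
    (F : StateFun) {k j : ℕ} {u zs v : List ℕ} {s t : ℕ}
    (h : IsChordWord (u ++ s :: (zs ++ t :: v))) (hk : u.length = k) (hl : l.length = zs.length)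
    (hj : k + l.length = j) (ht : t ∉ zs) :
    chordSum ρ (mixedSlide k x l ++ .rightCusp j y :: w) F (u ++ s :: (zs ++ t :: v)) =
      if s = t then T (-1) * chordSum ρ w F (u ++ (zs ++ v)) else 0 := by
  rw [chordSum_append]
  refine chordSum_mixedSlide_end ρ x (F' := fun f => T (-1) * wordSum ρ w F f) (v' := v) l h hk hl ht ?_
  intro zs' s' hp
  have h₁ : IsChordWord ((u ++ zs') ++ s' :: t :: v) := by
    refine h.perm ?_
    simpa using (hp.symm.append_right (t :: v)).append_left u
  have h₂ := hp.length_eq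
  simp only [length_append, length_cons, length_nil] at h₂
  simpa [chordSum] using chordSum_rightCusp ρ y w F h₁ (k := j) (by simp; omega)

lemma isPerfectMatching_length_outerStrands {a b : ℕ} {φ : ℕ → ℕ}
    (hφ : IsPerfectMatching (a + b) φ) :
    (outerStrands φ a b).length = (outerStrands φ 0 a).length := by
  simpa using hφ.map_outerStrands_perm.length_eq

variable (ρ : ℤ) {k : ℕ} {l r : List R} {x : R} {φ : ℕ → ℕ}

local notation "μ₀" => halfEdgePotential (x :: l) r
local notation "μ₁" => halfEdgePotential l (r ++ [x - 1])
local notation "cusps₀" => mirrorWord (markedRightCusps k μ₀ φ 0 r.length)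
local notation "turn₁" => slideDown false k x r ++ [FrontEvent.rightCusp (k + r.length) (x - 1)]
local notation "tail₁" =>
  mirrorWord (markedRightCusps (k + 1) μ₁ φ 0 (r.length + 1)) ++ turn₁

/-- The case of `chordSum_resolveVertex_rotate` in which the top left edge is matched with another
left edge: what happens to the right of the permutation braid. -/
lemma chordSum_insertion_slide_cusp (hφ : IsPerfectMatching (r.length + 1 + l.length) φ)
    (hj : r.length < φ r.length) (F : StateFun) {u zs v : List ℕ} {s t : ℕ} (hu : u.length = k)
    (hz : zs.length = (outerStrands φ 0 r.length).length)
    (hL : IsChordWord (u ++ s :: (zs ++ t :: v))) (ht : t ∉ zs) :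
    chordSum ρ tail₁ F (u ++ s :: (zs ++ t :: v)) =
      if s = t then T (-1) * chordSum ρ cusps₀ F (u ++ (zs ++ v)) else 0 := by
  have hn : φ r.length ≠ r.length := hj.ne'
  have ho : outerStrands φ 0 (r.length + 1) = outerStrands φ 0 r.length ++ [r.length] := by
    rw [outerStrands, range'_succ_right, filter_append]
    congr 1
    · refine filter_congr fun t ht => ?_
      rw [mem_range'_1] at ht
      have : φ t ≠ r.length := fun h => by
        have := hφ.1 t; rw [h] at this; omega
      rw [Bool.eq_iff_iff]
      simp; omega
    · simp; omega
  have hi : innerPairs φ 0 (r.length + 1) = innerPairs φ 0 r.length := by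
    rw [innerPairs, range'_succ_right, filter_append]
    have : filter (fun i => decide (i < φ i ∧ φ i < 0 + (r.length + 1))) [0 + r.length] = [] := by
      simp
    rw [this, append_nil]
    refine filter_congr fun t ht => ?_
    rw [mem_range'_1] at ht
    have : φ t ≠ r.length := fun h => by
      have := hφ.1 t; rw [h] at this; omega
    rw [Bool.eq_iff_iff]
    simp; omega
  have hd := hφ.deletion (k + 1) μ₁ (s := 0) (m := r.length + 1)
    (by omega)
  have hL' : IsChordWord ((u ++ [s]) ++ ((zs ++ [t]) ++ v)) := by simpa using hL
  obtain ⟨χ, h₁, h₂, h₃⟩ := hd.exists_labels (nodup_range' _ _) (u := u ++ [s]) (zs := zs ++ [t])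
    (v := v) (by rw [ho]; simp [hz]) hL'
  rw [ho, map_append] at h₁
  obtain ⟨h₁, h₁'⟩ := append_inj' h₁ (by simp)
  simp only [map_cons, map_nil, cons.injEq, and_true] at h₁'
  have h₄ := hd.chordSum_mirror ρ (wordSum ρ turn₁ F) χ (u := u ++ [s]) (v := v) (by simp [hu]) h₃ h₂
  rw [range'_succ_right, map_append, zero_add] at h₃ h₄
  simp only [ho, map_append, h₁, map_cons, map_nil, h₁', hi, append_assoc, cons_append,
    nil_append] at h₃ h₄
  rw [chordSum_append, h₄]
  have hr := map_halfEdgePotential_right (x :: l) r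
  have h₅ := chordSum_slide_cusp_insertion ρ (k := k) x (x - 1) μ₀ hφ
    (n := r.length) (by omega) F h₃ hu (by rwa [hi] at h₂)
  rw [hr, slideDown_eq_mixedSlide false k x ((outerStrands φ 0 r.length).map _), h₁,
    chordSum_mixedSlide_rightCusp ρ x (x - 1) _ _ F hL hu (by simp [hz]) (by simp) ht] at h₅
  rw [← chordSum, h₅, ← mul_assoc, ← T_add, neg_add_cancel, T_zero, one_mul]

/-- The edge is matched with the left edge `φ r.length`. At the original vertex the two form a
marked cusp. After the turn the strand of `φ r.length` has the largest target, runs through `β` to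
the lowest place on the right and there meets the turned edge in a cusp.
`chordSum_permutationBraid_last` removes this strand from `β`, and both pictures have the same
number of cusps. -/
lemma chordSum_resolveVertex_rotate_of_gt (hφ : IsPerfectMatching (r.length + 1 + l.length) φ)
    (hj : r.length < φ r.length) (F : StateFun) {u v : List ℕ} (χ : ℕ → ℕ) (hu : u.length = k)
    (hL : IsChordWord (u ++ χ r.length :: ((range' (r.length + 1) l.length).map χ ++ v))) :
    chordSum ρ (resolveVertex k (x :: l) r φ) F
        (u ++ χ r.length :: ((range' (r.length + 1) l.length).map χ ++ v)) =
      chordSum ρ (resolveVertex (k + 1) l (r ++ [x - 1]) φ ++ turn₁) F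
        (u ++ χ r.length :: ((range' (r.length + 1) l.length).map χ ++ v)) := by
  have hj' : φ r.length < r.length + 1 + l.length := hφ.apply_lt_iff.2 (by omega)
  have hlen : (r ++ [x - 1]).length = r.length + 1 := by simp
  have hφ₁ : IsPerfectMatching (r.length + (x :: l).length) φ := by
    convert hφ using 1; simp; omega
  have hφ₂ : IsPerfectMatching ((r ++ [x - 1]).length + l.length) φ := by rwa [hlen]
  have hl := chordSum_resolveVertex ρ hφ₁ [] F χ hu (v := v) (by
    simpa [range'_succ] using hL)
  have hr := chordSum_resolveVertex ρ hφ₂ turn₁ F χ (k := k + 1) (u := u ++ [χ r.length]) (v := v)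
    (by simp [hu]) (by rw [hlen]; simpa using hL)
  obtain ⟨O₁, O₂, hO⟩ : ∃ O₁ O₂, outerStrands φ (r.length + 1) l.length =
      O₁ ++ φ r.length :: O₂ := by
    refine append_of_mem (mem_outerStrands.2 ?_)
    rw [hφ.1]; omega
  have hnd := nodup_outerStrands φ (r.length + 1) l.length
  have hO' : outerStrands φ r.length (l.length + 1) = O₁ ++ O₂ := by
    rw [hO] at hnd
    have h₁ : (outerStrands φ (r.length + 1) l.length).filter (fun t => t ≠ φ r.length) =
        O₁ ++ O₂ := by
      rw [hO, filter_append, filter_cons_of_neg (by simp)]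
      congr 1 <;> refine filter_eq_self.2 fun t ht => ?_
      · simpa using (nodup_append.1 hnd).2.2 t ht (φ r.length) (by simp)
      · have := (nodup_cons.1 (nodup_append.1 hnd).2.1).1
        simp only [ne_eq, decide_not, Bool.not_eq_eq_eq_not, Bool.not_true, decide_eq_false_iff_not]
        rintro rfl; exact this ht
    rw [← h₁, outerStrands, range'_succ, filter_cons_of_neg (by simp; omega), outerStrands,
      filter_filter]
    refine filter_congr fun t ht => ?_
    rw [mem_range'_1] at ht
    have : φ t = r.length ↔ t = φ r.length := ⟨fun h => by rw [← h, hφ.1], fun h => by rw [h, hφ.1]⟩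
    rw [Bool.eq_iff_iff]
    simp
    omega
  have hi : innerPairs φ r.length (l.length + 1) =
      r.length :: innerPairs φ (r.length + 1) l.length := by
    rw [innerPairs, range'_succ, filter_cons_of_pos (by simp; omega), innerPairs]
    congr 1
    refine filter_congr fun t ht => ?_
    rw [Bool.eq_iff_iff]
    simp; omega
  simp only [length_cons, hi, hO', append_nil, range'_succ, map_cons, cons_append] at hl
  simp only [hlen, hO, append_assoc, cons_append, nil_append] at hr
  rw [hl, hr]
  by_cases hν : ∀ i ∈ innerPairs φ (r.length + 1) l.length, χ i = χ (φ i)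
  swap
  · rw [if_neg fun h => hν fun i hi => h.1 i (mem_cons_of_mem _ hi), if_neg fun h => hν h.1]
  have hd := hφ.deletion (k + 1) μ₁ (s := r.length + 1)
    (m := l.length) le_rfl
  have hC : IsChordWord (u ++ χ r.length :: (((O₁.map χ) ++ χ (φ r.length) :: O₂.map χ) ++ v)) := by
    simpa [hO] using
      IsChordWord.of_deletion hd (u := u ++ [χ r.length]) (v := v) (χ := χ) (by simpa using hL)
      hν
  set st₁ : List (ℕ × R) := O₁.map fun t => (φ t, μ₀ t) with hst₁
  set st₂ : List (ℕ × R) := O₂.map fun t => (φ t, μ₀ t) with hst₂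
  have hmemO : ∀ t ∈ O₁ ++ O₂, r.length < t ∧ φ t < r.length := by
    intro t ht
    have h₁ : t ∈ outerStrands φ r.length (l.length + 1) := hO' ▸ ht
    have h₂ : t ∈ outerStrands φ (r.length + 1) l.length := by
      rw [hO]; simp only [mem_append, mem_cons] at ht ⊢; tauto
    rw [mem_outerStrands] at h₁ h₂
    have := hφ.apply_lt_iff.2 (show t < r.length + 1 + l.length by omega)
    omega
  have hcs₁ : crossingStrands r.length (l.length + 1) μ₀ φ = st₁ ++ st₂ := by
    rw [crossingStrands, hO', map_append]
  have hcs₂ : crossingStrands (r.length + 1) l.length μ₁ φ =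
      st₁ ++ (r.length, μ₁ (φ r.length)) :: st₂ := by
    rw [crossingStrands, hO, map_append, map_cons, hφ.1]
    congr 1
    · refine map_congr_left fun t ht => ?_
      rw [halfEdgePotential_rotate_of_gt (x := x) (hmemO t (by simp [ht])).1]
    · congr 1
      refine map_congr_left fun t ht => ?_
      rw [halfEdgePotential_rotate_of_gt (x := x) (hmemO t (by simp [ht])).1]
  rw [hcs₁, hcs₂]
  -- The turned edge lies directly above the braid, hence `m = []`; the strand to be removed has the
  -- largest target `r.length`.
  have hlast := fun hnd' => chordSum_permutationBraid_last ρ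
    (F := wordSum ρ tail₁ F)
    (F' := fun f => T (-1) * wordSum ρ cusps₀ F f)
    (p := r.length) (x := μ₁ (φ r.length))
    (st₁ := st₁) (st₂ := st₂) (k := k + 1) (k' := k) (u := u) (m := []) (xs₁ := O₁.map χ)
    (xs₂ := O₂.map χ) (v := v) (s := χ r.length) (y := χ (φ r.length))
    (by
      intro t ht
      simp only [hst₁, hst₂, ← map_append, mem_map] at ht
      obtain ⟨t, ht, rfl⟩ := ht
      exact (hmemO t ht).2)
    hC (by simp [hu]) (by simp [hu]) (by simp [hst₁]) (by simp [hst₂]) hnd' (by simp)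
    (by
      intro zs t hp
      have hp' := hp.nodup_iff.2 hnd'
      have hC' : IsChordWord (u ++ χ r.length :: (zs ++ t :: v)) := by
        refine hC.perm ?_
        simpa using ((hp.symm.append_right v).cons (χ r.length)).append_left u
      have ho : (outerStrands φ 0 (r.length + 1)).length = (outerStrands φ 0 r.length).length + 1 := by
        have h₁ := isPerfectMatching_length_outerStrands hφ
        have h₂ := isPerfectMatching_length_outerStrands hφ₁
        rw [length_cons, hO'] at h₂
        rw [hO] at h₁
        simp only [length_append, length_cons] at h₁ h₂
        omega
      have hz : zs.length = (outerStrands φ 0 r.length).length := by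
        have h₁ := isPerfectMatching_length_outerStrands hφ
        have h₂ := hp.length_eq
        rw [hO] at h₁
        simp only [length_append, length_cons, length_map, length_nil] at h₁ h₂
        omega
      have := chordSum_insertion_slide_cusp ρ (x := x) hφ hj F hu hz hC' (by
        intro h; exact (nodup_append.1 hp').2.2 t h t (by simp) rfl)
      simp only [chordSum] at this
      simp only [nil_append, eq_comm (a := t)]
      exact this)
  simp only [nil_append, append_assoc, cons_append] at hlast
  by_cases hs : χ (φ r.length) = χ r.length
  · have hnd'' : ((O₁ ++ O₂).map χ).Nodup ↔ ((O₁ ++ φ r.length :: O₂).map χ).Nodup := by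
      have hnm : χ (φ r.length) ∉ O₁.map χ ∧ χ (φ r.length) ∉ O₂.map χ := by
        rw [hs] at hC ⊢
        have := hC (χ r.length) (by simp)
        simp only [count_append, count_cons_self] at this
        exact ⟨count_eq_zero.1 (by omega), count_eq_zero.1 (by omega)⟩
      rw [map_append, map_append, map_cons, nodup_middle, nodup_cons, mem_append]
      tauto
    by_cases hN : ((O₁ ++ φ r.length :: O₂).map χ).Nodup
    · rw [if_pos ⟨by simpa [hs] using fun i hi => hν i hi, hnd''.2 hN⟩, if_pos ⟨hν, hN⟩]
      have := hlast (by simpa using hN)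
      rw [if_pos hs] at this
      simp only [map_append, map_cons, append_assoc, cons_append]
      rw [this, chordSum_mul ρ (permutationBraid k (st₁ ++ st₂)) (T (-1)), ← mul_assoc, ← T_add]
      congr 2
      push_cast
      ring
    · rw [if_neg fun h => hN (hnd''.1 h.2), if_neg fun h => hN h.2]
  · rw [if_neg fun h => hs (h.1 _ (by simp)).symm]
    split_ifs with h
    · have := hlast (by simpa using h.2)
      rw [if_neg hs] at this
      simp only [map_append, map_cons, append_assoc, cons_append]
      rw [this, mul_zero]
    · rfl

/-- The edge is matched with the right edge `i = φ r.length`. At the turned vertex a marked left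
cusp joins `i` to the new bottom edge, with which the turned edge finally forms a right cusp. For
this it must carry the letter of `i` at the end, which forces a switch exactly at its crossing with
strand `i`. Up to there it performs the descent of the first strand of `β` at the original vertex.
The left cusp, the switch and the right cusp have total weight `T (-1 + 2 - 1) = 1`. -/
lemma chordSum_slide_insertion_switch (hφ : IsGradedVertexMatching ρ (x :: l) r φ)
    (hj : φ r.length < r.length) (F : StateFun) {u zs v : List ℕ} {s : ℕ} (hu : u.length = k)
    (hz : zs.length = (outerStrands φ 0 (r.length + 1)).length)
    (hL : IsChordWord (u ++ s :: (zs ++ v))) (hnd : zs.Nodup) {lower : List R}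
    (hlow : Forall₂ (fun y y' => (ρ : R) ∣ y - y') lower
      (((outerStrands φ 0 (r.length + 1)).filter fun t => t < φ r.length).map μ₀)) :
    chordSum ρ tail₁ F (u ++ s :: (zs ++ v)) =
      if s ∈ zs then 0 else chordSum ρ (slideDown false k x lower ++ cusps₀) F (u ++ s :: (zs ++ v)) := by
  have hφ₁ : IsPerfectMatching (r.length + 1 + l.length) φ := by
    convert hφ.1 using 1; simp; omega
  have hinv := hφ.1.1
  obtain ⟨i, hi⟩ : ∃ i, i = φ r.length := ⟨_, rfl⟩
  have hin : φ i = r.length := by rw [hi, hinv]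
  have hir : i < r.length := hi ▸ hj
  have hne : ∀ t, φ t = r.length ↔ t = i :=
    fun t => ⟨fun h => by rw [hi, ← h, hinv], fun h => by rw [h, hin]⟩
  have ho : outerStrands φ 0 (r.length + 1) =
      (outerStrands φ 0 r.length).filter fun t => t ≠ i := by
    rw [outerStrands, range'_succ_right, filter_append, outerStrands, filter_filter,
      filter_cons_of_neg (by simp [hj.le]), filter_nil, append_nil]
    refine filter_congr fun t ht => ?_
    rw [mem_range'_1] at ht
    have := hne t
    rw [Bool.eq_iff_iff]
    simp
    omega
  obtain ⟨A, B, hAB⟩ : ∃ A B, outerStrands φ 0 r.length = A ++ i :: B := by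
    refine append_of_mem (mem_outerStrands.2 ?_)
    omega
  have hpw := pairwise_outerStrands φ 0 r.length
  rw [hAB, pairwise_append, pairwise_cons] at hpw
  have hA : ∀ t ∈ A, t < i := fun t ht => hpw.2.2 t ht i (by simp)
  have hB : ∀ t ∈ B, i < t := hpw.2.1.1
  have ho' : outerStrands φ 0 (r.length + 1) = A ++ B := by
    rw [ho, hAB, filter_append, filter_cons_of_neg (by simp)]
    congr 1 <;> refine filter_eq_self.2 fun t ht => ?_
    · simpa using (hA t ht).ne
    · simpa using (hB t ht).ne'
  have hAf : (outerStrands φ 0 (r.length + 1)).filter (fun t => t < φ r.length) = A := by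
    rw [ho', filter_append, ← hi, filter_eq_self.2 fun t ht => by simpa using hA t ht,
      filter_eq_nil_iff.2 fun t ht => by simpa using (hB t ht).le, append_nil]
  rw [hAf] at hlow
  have hd := hφ₁.deletion (k + 1) μ₁ (s := 0) (m := r.length + 1)
    (by omega)
  -- The new pair consists of `i` and the bottom right edge.
  have hcount : (innerPairs φ 0 (r.length + 1)).length = (innerPairs φ 0 r.length).length + 1 := by
    have h₁ := hd.length_eq
    have h₂ := (hφ₁.deletion k μ₀ (s := 0) (m := r.length) (by omega)).length_eq
    rw [ho'] at h₁
    rw [hAB] at h₂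
    simp only [length_range', length_append, length_cons] at h₁ h₂
    omega
  have hL' : IsChordWord ((u ++ [s]) ++ (zs ++ v)) := by simpa using hL
  obtain ⟨χ, h₁, h₂, h₃⟩ := hd.exists_labels (nodup_range' _ _) (u := u ++ [s]) (zs := zs)
    (v := v) hz hL'
  have h₂i : χ i = χ r.length := by
    have := h₂ i (mem_innerPairs.2 (by omega))
    rwa [hin] at this
  have h₂' : ∀ i ∈ innerPairs φ 0 r.length, χ i = χ (φ i) := fun t ht =>
    h₂ t (by rw [mem_innerPairs] at ht ⊢; omega)
  have h₄ := hd.chordSum_mirror ρ (wordSum ρ turn₁ F) χ (u := u ++ [s]) (v := v) (by simp [hu]) h₃ h₂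
  rw [range'_succ_right, map_append, zero_add] at h₃ h₄
  rw [h₁] at h₄
  simp only [map_cons, map_nil, append_assoc, cons_append, nil_append] at h₃ h₄
  have h₅ := chordSum_slide_cusp_insertion ρ (k := k) x (x - 1) μ₀ hφ₁
    (n := r.length) (by omega) F h₃ hu h₂'
  rw [map_halfEdgePotential_right (x :: l) r] at h₅
  rw [chordSum_append, h₄, ← chordSum, h₅, ← mul_assoc, ← T_add, hcount]
  have h₆ : IsChordWord (u ++ s :: ((A.map χ ++ χ i :: B.map χ) ++ χ i :: v)) := by
    have hd' := hφ₁.deletion (k + 1) μ₀ (s := 0) (m := r.length)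
      (by omega)
    simpa [hAB, h₂i] using
      IsChordWord.of_deletion hd' (u := u ++ [s]) (v := χ r.length :: v) (χ := χ)
      (by simpa using h₃) h₂'
  rw [ho', map_append] at h₁
  rw [← h₂i, hAB]
  simp only [map_append, map_cons]
  subst h₁
  obtain ⟨hcA, hcB, hcv, hcu, hcs⟩ : χ i ∉ A.map χ ∧ χ i ∉ B.map χ ∧ χ i ∉ v ∧ χ i ∉ u ∧ s ≠ χ i := by
    have := h₆ (χ i) (by simp)
    simp only [count_append, count_cons, beq_self_eq_true, if_true, beq_iff_eq] at this
    refine ⟨count_eq_zero.1 (by omega), count_eq_zero.1 (by omega),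
      count_eq_zero.1 (by omega), count_eq_zero.1 (by omega), fun h => ?_⟩
    rw [if_pos h] at this
    omega
  by_cases hs : s ∈ A.map χ ++ B.map χ
  · rw [if_pos hs, chordSum_append, slideDown_eq_mixedSlide,
      chordSum_mixedSlide_eq_zero ρ x _ _ h₆ hu (by simp) (by
        simp only [mem_append, mem_cons] at hs ⊢; tauto), mul_zero]
  rw [if_neg hs]
  simp only [mem_append, not_or] at hs
  have hnd' := nodup_append.1 hnd
  have hsA : (s :: A.map χ).Nodup := nodup_cons.2 ⟨hs.1, hnd'.1⟩
  have hfilt : ∀ {l : List ℕ}, χ i ∉ l → l.filter (fun c => !(c == χ i)) = l := filter_ne_eq_self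
  have hslide : wordSum ρ (slideDown false k x lower) =
      wordSum ρ (slideDown false k x (A.map μ₀)) := by
    funext G
    exact wordSum_slideDown_congr (by simp) hlow G
  have hright : ∀ (G : StateFun) (w : Word R) (L : List ℕ),
      chordSum ρ (slideDown false k x lower ++ w) G L = chordSum ρ (mixedSlide k x
        ((A.map μ₀).map fun y => (false, y))) (wordSum ρ w G) L := by
    intro G w L
    rw [chordSum_append, chordSum, hslide, ← slideDown_eq_mixedSlide, chordSum]
  rw [hright, slideDown_eq_mixedSlide, map_append, mixedSlide_append, append_assoc, chordSum_append]
  have key := ShiftBraid.chordSum_filter (ρ := ρ) (k := k) (k' := k) (s := χ i) (u := u)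
    (xs := s :: A.map χ) (v := χ i :: (B.map χ ++ χ i :: v))
    (w := mixedSlide k x ((A.map μ₀).map fun y => (false, y)))
    (w' := mixedSlide k x ((A.map μ₀).map fun y => (false, y)))
    (F := fun f => T (-((((innerPairs φ 0 r.length).length + 1 : ℕ) : ℤ)) + (innerPairs φ 0 r.length).length) *
      wordSum ρ (mixedSlide (k + ((A.map μ₀).map fun y => (false, y)).length) x
        ((μ₀ i :: B.map μ₀).map fun y => (false, y)) ++
        .rightCusp (k + (A ++ i :: B).length) (x - 1) :: cusps₀) F f)
    (F' := wordSum ρ cusps₀ F)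
    (by
      have := shiftBraid_slideDown false k k x (A.map μ₀)
      rw [slideDown_eq_mixedSlide] at this
      simpa using this) hu (by rw [hfilt hcu, hu])
    (by simpa using h₆) (by simp only [mem_cons, not_or]; exact ⟨hcs.symm, hcA⟩) (by
      intro zs hzs
      rw [filter_cons_of_neg (by simp), filter_append, filter_cons_of_neg (by simp), hfilt hcB,
        hfilt hcv, hfilt hcu]
      obtain rfl | ⟨p, s', rfl⟩ := eq_nil_or_concat' zs
      · simpa using hzs.length_eq
      have hlen : p.length = A.length := by simpa using hzs.length_eq
      have hC : IsChordWord ((u ++ p) ++ s' :: χ i :: (B.map χ ++ χ i :: v)) := by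
        refine h₆.perm ?_
        simpa using (hzs.symm.append_right (χ i :: (B.map χ ++ χ i :: v))).append_left u
      have hps : (p ++ [s']).Nodup := hzs.nodup_iff.2 hsA
      have hs'm : s' ∈ s :: A.map χ := hzs.subset (by simp)
      have hs'B : s' ∉ B.map χ := by
        rw [mem_cons] at hs'm
        rcases hs'm with rfl | h
        · exact hs.2
        · exact fun h' => hnd'.2.2 _ h _ h' rfl
      have hs'p : s' ∉ p := fun h => (nodup_append.1 hps).2.2 _ h s' (by simp) rfl
      have hcp : χ i ∉ p := fun h => by
        have : χ i ∈ s :: A.map χ := hzs.subset (by simp [h])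
        rw [mem_cons] at this
        exact this.elim (fun h => hcs h.symm) hcA
      have hs'c : s' ≠ χ i := by
        rintro rfl
        rw [mem_cons] at hs'm
        exact hs'm.elim (fun h => hcs h.symm) hcA
      rw [map_cons]
      -- The matched edges `i` and `r.length` lie on opposite sides, so their potentials are
      -- congruent modulo `ρ`.
      have hsw : Switchable ρ false x (μ₀ i) := by
        refine ⟨rfl, ?_⟩
        have := (hφ.2 i (by omega)).2 ⟨hir, hin.ge⟩
        rwa [hin, halfEdgePotential_cons_self, dvd_sub_comm] at this
      -- The strands of `B` carry neither letter. Hence the bottom strand, the partner of `i`, is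
      -- the first one met, and the switch is automatically normal.
      have hlet : lettersOf s' (χ i) ((B.map χ ++ χ i :: v) ++ (u ++ p)) = [χ i, s'] := by
        have h₇ := hC s' (by simp)
        have h₈ : (v ++ (u ++ p)).count s' = 1 := by
          simp only [count_append, count_cons, count_eq_zero.2 hs'B, beq_iff_eq, if_neg hs'c.symm,
            beq_self_eq_true, if_true] at h₇ ⊢
          omega
        have h₉ := lettersOf_eq_singleton h₈ (c := χ i) (by simp; tauto)
        rw [append_assoc, lettersOf_append, lettersOf_eq_nil hs'B hcB, nil_append, cons_append,
          lettersOf_cons, if_pos (Or.inr rfl), h₉]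
      have hcross := chordSum_crossing ρ false x (μ₀ i)
        (mixedSlide (k + A.length + 1) x ((B.map μ₀).map
          fun y => (false, y)) ++ .rightCusp (k + (A ++ i :: B).length) (x - 1) :: cusps₀) F hC
          (k := k + A.length) (by simp [hu, hlen])
      have hC₁ : IsChordWord ((u ++ p ++ [χ i]) ++ s' :: (B.map χ ++ χ i :: v)) := by
        simpa using hC.swap
      have hC₂ : IsChordWord ((u ++ p ++ [s']) ++ χ i :: (B.map χ ++ χ i :: v)) := by
        simpa using hC
      have e₁ := chordSum_mixedSlide_rightCusp ρ x (x - 1) ((B.map μ₀).map fun y => (false, y))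
          cusps₀ F hC₁
          (k := k + A.length + 1) (j := k + (A ++ i :: B).length) (by simp [hu, hlen]; omega) (by simp) (by simp; omega) hcB
      have e₂ := chordSum_mixedSlide_rightCusp ρ x (x - 1) ((B.map μ₀).map fun y => (false, y))
          cusps₀ F hC₂
          (k := k + A.length + 1) (j := k + (A ++ i :: B).length) (by simp [hu, hlen]; omega) (by simp) (by simp; omega) hcB
      -- Crossing strand `i` instead of switching there leads to a final cusp of two different
      -- letters.
      rw [if_neg hs'c] at e₁
      rw [if_pos rfl] at e₂
      simp only [append_assoc, cons_append, nil_append] at e₁ e₂ hcross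
      rw [e₁, e₂, if_neg hs'c, if_pos ⟨hsw, by simpa using hlet⟩, zero_add] at hcross
      simp only [length_map, append_assoc, cons_append, nil_append, mixedSlide]
      simp only [chordSum] at hcross
      rw [hcross, ← mul_assoc, ← mul_assoc, ← T_add, ← T_add]
      rw [show (-(((innerPairs φ 0 r.length).length + 1 : ℕ) : ℤ) +
        (innerPairs φ 0 r.length).length + 2 + -1) = 0 by push_cast; ring, T_zero, one_mul])
  rw [filter_cons_of_neg (by simp), filter_append, filter_cons_of_neg (by simp), hfilt hcB,
        hfilt hcv, hfilt hcu] at key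
  simp only [cons_append, append_assoc] at key ⊢
  rw [← key, chordSum_mul ρ _ (T _) (wordSum ρ _ F)]

/-- At the original vertex the edge is the first strand of `β` and descends over the strands of
lower target; by `chordSum_slide_insertion_switch` the turned edge does the same. If the edge is
matched with another strand of the braid, the half-twist kills one side and the forbidden crossing
the other. -/
lemma chordSum_resolveVertex_rotate_of_lt (hφ : IsGradedVertexMatching ρ (x :: l) r φ)
    (hj : φ r.length < r.length) (F : StateFun) {u v : List ℕ} (χ : ℕ → ℕ) (hu : u.length = k)
    (hL : IsChordWord (u ++ χ r.length :: ((range' (r.length + 1) l.length).map χ ++ v))) :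
    chordSum ρ (resolveVertex k (x :: l) r φ) F
        (u ++ χ r.length :: ((range' (r.length + 1) l.length).map χ ++ v)) =
      chordSum ρ (resolveVertex (k + 1) l (r ++ [x - 1]) φ ++ turn₁) F
        (u ++ χ r.length :: ((range' (r.length + 1) l.length).map χ ++ v)) := by
  have hlen : (r ++ [x - 1]).length = r.length + 1 := by simp
  have hφ₀ : IsPerfectMatching (r.length + 1 + l.length) φ := by
    convert hφ.1 using 1; simp; omega
  have hinv := hφ.1.1
  have hφ₂ : IsPerfectMatching ((r ++ [x - 1]).length + l.length) φ := by rwa [hlen]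
  have hl := chordSum_resolveVertex ρ hφ.1 [] F χ hu (v := v) (by
    simpa [range'_succ] using hL)
  have hr := chordSum_resolveVertex ρ hφ₂ turn₁ F χ (k := k + 1) (u := u ++ [χ r.length]) (v := v)
    (by simp [hu]) (by rw [hlen]; simpa using hL)
  have hne : ∀ t, φ t = r.length ↔ t = φ r.length :=
    fun t => ⟨fun h => by rw [← h, hinv], fun h => by rw [h, hinv]⟩
  have hO : outerStrands φ r.length (l.length + 1) =
      r.length :: outerStrands φ (r.length + 1) l.length := by
    rw [outerStrands, range'_succ, filter_cons_of_pos (by simp [hj]), outerStrands]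
    congr 1
    refine filter_congr fun t ht => ?_
    rw [mem_range'_1] at ht
    have := hne t
    rw [Bool.eq_iff_iff]
    simp
    omega
  have hi : innerPairs φ r.length (l.length + 1) = innerPairs φ (r.length + 1) l.length := by
    rw [innerPairs, range'_succ, filter_cons_of_neg (by simp; omega), innerPairs]
    refine filter_congr fun t ht => ?_
    rw [Bool.eq_iff_iff]
    simp; omega
  simp only [length_cons, hi, hO, append_nil, range'_succ, map_cons, cons_append] at hl
  simp only [hlen, append_assoc, cons_append, nil_append] at hr
  rw [hl, hr]
  by_cases hν : ∀ i ∈ innerPairs φ (r.length + 1) l.length, χ i = χ (φ i)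
  swap
  · rw [if_neg fun h => hν h.1, if_neg fun h => hν h.1]
  by_cases hN : ((outerStrands φ (r.length + 1) l.length).map χ).Nodup
  swap
  · rw [if_neg fun h => hN (nodup_cons.1 h.2).2, if_neg fun h => hN h.2]
  rw [if_pos (c := _ ∧ (map χ (outerStrands φ (r.length + 1) l.length)).Nodup) ⟨hν, hN⟩]
  have hd := hφ₀.deletion (k + 1) μ₁ (s := r.length + 1)
    (m := l.length) le_rfl
  have hC : IsChordWord ((u ++ [χ r.length]) ++ ((outerStrands φ (r.length + 1) l.length).map χ ++ v)) :=
    IsChordWord.of_deletion hd (χ := χ) (by simpa using hL) hν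
  have hcs : crossingStrands (r.length + 1) l.length μ₁ φ =
      crossingStrands (r.length + 1) l.length μ₀ φ := crossingStrands_congr rfl fun t ht =>
      halfEdgePotential_rotate_of_gt (by rw [mem_outerStrands] at ht; omega)
  have hcs' : crossingStrands r.length (l.length + 1) μ₀ φ =
      (φ r.length, x) :: crossingStrands (r.length + 1) l.length μ₀ φ := by
    rw [crossingStrands, hO, map_cons, halfEdgePotential_cons_self]
    rfl
  rw [hcs, hcs', permutationBraid, chordSum_append]
  set st := crossingStrands (r.length + 1) l.length μ₀ φ with hst
  have hlow : Forall₂ (fun y y' => (ρ : R) ∣ y - y')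
      (sortedPotentials (st.filter fun t => t.1 < φ r.length))
      (((outerStrands φ 0 (r.length + 1)).filter fun t => t < φ r.length).map μ₀) := by
    have hsort : sortedPotentials (st.filter fun t => t.1 < φ r.length) =
        ((outerStrands φ 0 (r.length + 1)).filter fun t => t < φ r.length).map
          fun t => μ₀ (φ t) := by
      have hp : (((outerStrands φ 0 (r.length + 1)).filter fun t => t < φ r.length).map
          fun t => (t, μ₀ (φ t))).Perm
            (st.filter fun t => t.1 < φ r.length) := by
        have := ((hφ₀.map_outerStrands_perm.symm.map
          fun t => (t, μ₀ (φ t))).filter fun t => decide (t.1 < φ r.length))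
        rw [filter_map, map_map] at this
        convert this using 2
        · rfl
        · rw [hst, crossingStrands]
          exact map_congr_left fun t _ => by simp [hinv]
      rw [sortedPotentials, insertionSort_eq_of_perm hp, map_map]
      · rfl
      · rw [pairwise_map]
        exact (pairwise_outerStrands φ 0 (r.length + 1)).filter _
    rw [hsort]
    refine forall₂_outerStrands hφ _ fun t ht => ?_
    rw [mem_filter, mem_outerStrands] at ht
    rw [mem_outerStrands]
    have h₁ := of_decide_eq_true ht.2
    omega
  have hlenO : (outerStrands φ (r.length + 1) l.length).length = st.length := by
    rw [hst, length_crossingStrands]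
  have key : ∀ zs : List ℕ, zs.Perm ((outerStrands φ (r.length + 1) l.length).map χ) →
      chordSum ρ tail₁ F
        (u ++ χ r.length :: (zs ++ v)) =
      if χ r.length ∈ (outerStrands φ (r.length + 1) l.length).map χ then 0 else
        chordSum ρ (slideDown false k x (sortedPotentials (st.filter fun t => t.1 < φ r.length)) ++
          cusps₀) F
          (u ++ χ r.length :: (zs ++ v)) := by
    intro zs hp
    have hC' : IsChordWord (u ++ χ r.length :: (zs ++ v)) := by
      refine hC.perm ?_
      simpa using ((hp.symm.append_right v).cons (χ r.length)).append_left u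
    have := chordSum_slide_insertion_switch ρ hφ hj F hu (by
      rw [hp.length_eq, length_map, isPerfectMatching_length_outerStrands hφ₀]) hC'
      (hp.nodup_iff.2 hN) hlow
    rw [this]
    simp only [hp.mem_iff]
  split_ifs with h₀
  · congr 1
    have hnm := (nodup_cons.1 h₀.2).1
    have := (isBraid_permutationBraid (k + 1) st).chordSum_congr (ρ := ρ)
      (F := wordSum ρ (slideDown false k x (sortedPotentials (st.filter fun t => t.1 < φ r.length)))
        (wordSum ρ cusps₀ F))
      (F' := wordSum ρ tail₁ F)
      (u := u ++ [χ r.length]) (by simp [hu]) (by simp [hlenO]) hC (by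
        intro zs hp
        have := key zs hp
        rw [if_neg hnm] at this
        simp only [chordSum, wordSum_append] at this
        simp only [append_assoc, cons_append, nil_append, wordSum_append]
        exact this.symm)
    simpa using this
  · have hm : χ r.length ∈ (outerStrands φ (r.length + 1) l.length).map χ := by
      by_contra h
      exact h₀ ⟨hν, nodup_cons.2 ⟨h, hN⟩⟩
    have := chordSum_eq_zero_of_braid (ρ := ρ) (isBraid_permutationBraid (k + 1) st)
      (F := wordSum ρ tail₁ F)
      (u := u ++ [χ r.length]) (by simp [hu]) (by simp [hlenO]) hC (by
        intro zs hp
        have := key zs hp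
        rw [if_pos hm] at this
        simpa [chordSum] using this)
    simp only [append_assoc, cons_append, nil_append] at this
    rw [this, mul_zero]

/-- The top left edge of a vertex becomes the bottom right one. -/
lemma chordSum_resolveVertex_rotate (hφ : IsGradedVertexMatching ρ (x :: l) r φ) (F : StateFun)
    {u v : List ℕ} (χ : ℕ → ℕ) (hu : u.length = k)
    (hL : IsChordWord (u ++ χ r.length :: ((range' (r.length + 1) l.length).map χ ++ v))) :
    chordSum ρ (resolveVertex k (x :: l) r φ) F
        (u ++ χ r.length :: ((range' (r.length + 1) l.length).map χ ++ v)) =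
      chordSum ρ (resolveVertex (k + 1) l (r ++ [x - 1]) φ ++ turn₁) F
        (u ++ χ r.length :: ((range' (r.length + 1) l.length).map χ ++ v)) := by
  rcases lt_trichotomy (φ r.length) r.length with h | h | h
  · exact chordSum_resolveVertex_rotate_of_lt ρ hφ h F χ hu hL
  · exact absurd h (hφ.1.ne (by simp))
  · refine chordSum_resolveVertex_rotate_of_gt ρ ?_ h F χ hu hL
    convert hφ.1 using 1; simp; omega

end TopEdge

/-! ### Graded states and symmetric transfer operators -/

/-- A slice whose strands are listed with their chords and potentials: the upper end of each chord
has potential one more than the lower one. -/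
def IsGradedState (Z : List (ℕ × R)) : Prop :=
  IsChordWord (Z.map Prod.fst) ∧ Z.Pairwise fun p q => p.1 = q.1 → p.2 = q.2 + 1

/-- The graded pairings of a slice with potentials `a`. -/
def gradedPairings (a : List R) : Set (ℕ → ℕ) :=
  {f | ∃ Z : List (ℕ × R), IsGradedState Z ∧ Z.map Prod.snd = a ∧ chordMatching (Z.map Prod.fst) = f}

lemma gradedPairings_finite (a : List R) : (gradedPairings a).Finite := by
  refine (finite_isPerfectMatching a.length).subset ?_
  rintro f ⟨Z, hZ, rfl, rfl⟩
  simpa using isPerfectMatching_chordMatching hZ.1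

lemma involutive_of_mem_gradedPairings {a : List R} {f : ℕ → ℕ} (hf : f ∈ gradedPairings a)
    (i : ℕ) : f (f i) = i := by
  obtain ⟨Z, hZ, -, rfl⟩ := hf
  exact (isPerfectMatching_chordMatching hZ.1).1 i

/-- A symmetric way to propagate weights through events, of which `eventSum` and `resolvedEventSum`
are examples. -/
structure IsTransfer (E : FrontEvent R → StateFun → StateFun) : Prop where
  sum : ∀ (e : FrontEvent R) (s : Finset (ℕ → ℕ)) (c : StateFun)
    (F : (ℕ → ℕ) → StateFun) (f : ℕ → ℕ),
    E e (fun g => ∑ i ∈ s, c i * F i g) f = ∑ i ∈ s, c i * E e (F i) f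
  support : ∀ {e : FrontEvent R} {a b : List R} {F F' : StateFun}, e.Step a b →
    Set.EqOn F F' (gradedPairings b) → Set.EqOn (E e F) (E e F') (gradedPairings a)
  symm : ∀ {e : FrontEvent R} {a b : List R} {f g : ℕ → ℕ}, e.Step a b → f ∈ gradedPairings a →
    g ∈ gradedPairings b → E e.mirror (pairingIndicator f) g = E e (pairingIndicator g) f

lemma isFront_append {a b : List R} {w w' : Word R} :
    IsFront a (w ++ w') b ↔ ∃ c, IsFront a w c ∧ IsFront c w' b := by
  induction w generalizing a with
  | nil => simp [IsFront]
  | cons e w ih =>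
    simp only [cons_append, IsFront, ih]
    constructor
    · rintro ⟨c, h, d, h', h''⟩; exact ⟨d, ⟨c, h, h'⟩, h''⟩
    · rintro ⟨d, ⟨c, h, h'⟩, h''⟩; exact ⟨c, h, d, h', h''⟩

lemma FrontEvent.Step.mirror {e : FrontEvent R} {a b : List R} (h : e.Step a b) :
    e.mirror.Step b a := by
  cases h with
  | crossing m u d x y => exact .crossing m u d y x
  | leftCusp u d x => exact .rightCusp u d x
  | rightCusp u d x => exact .leftCusp u d x
  | vertex u d l r h => exact .vertex u d r l (by rwa [add_comm])

lemma isFront_mirrorWord {a b : List R} {w : Word R} (h : IsFront a w b) :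
    IsFront b (mirrorWord w) a := by
  induction w generalizing a with
  | nil => exact h.symm
  | cons e w ih =>
    obtain ⟨c, h, h'⟩ := h
    rw [mirrorWord_cons, isFront_append]
    exact ⟨c, ih h', a, h.mirror, rfl⟩

lemma FrontEvent.Step.unique {e : FrontEvent R} {a b b' : List R} (h : e.Step a b)
    (h' : e.Step a b') : b = b' := by
  generalize ha : a = a' at h'
  cases h with
  | crossing m u d x y =>
    generalize he : FrontEvent.crossing m u.length x y = e' at h'
    cases h' with
    | crossing m' u' d' x' y' =>
      injection he with _ hk
      obtain ⟨rfl, ha'⟩ := append_inj ha hk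
      injection ha' with h₁ ha'
      injection ha' with h₂ h₃
      rw [h₁, h₂, h₃]
    | _ => cases he
  | leftCusp u d x =>
    generalize he : FrontEvent.leftCusp u.length x = e' at h'
    cases h' with
    | leftCusp u' d' x' =>
      injection he with hk hx
      obtain ⟨rfl, rfl⟩ := append_inj ha hk
      rw [hx]
    | _ => cases he
  | rightCusp u d x =>
    generalize he : FrontEvent.rightCusp u.length x = e' at h'
    cases h' with
    | rightCusp u' d' x' =>
      injection he with hk hx
      obtain ⟨rfl, ha'⟩ := append_inj ha hk
      injection ha' with h₁ ha'
      injection ha' with h₂ h₃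
      rw [h₃]
    | _ => cases he
  | vertex u d l r h =>
    generalize he : FrontEvent.vertex u.length l r = e' at h'
    cases h' with
    | vertex u' d' l' r' =>
      injection he with hk hl hr
      subst hl hr
      obtain ⟨rfl, ha'⟩ := append_inj ha hk
      rw [append_cancel_left ha']
    | _ => cases he

lemma isFront_unique {a b b' : List R} {w : Word R} (h : IsFront a w b) (h' : IsFront a w b') :
    b = b' := by
  induction w generalizing a with
  | nil => exact h.symm.trans h'
  | cons e w ih =>
    obtain ⟨c, h₁, h₂⟩ := h
    obtain ⟨c', h₁', h₂'⟩ := h'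
    obtain rfl := h₁.unique h₁'
    exact ih h₂ h₂'

namespace IsTransfer

variable {E : FrontEvent R → StateFun → StateFun}

lemma foldr_support (hE : IsTransfer E) {w : Word R} {a b : List R} {F F' : StateFun}
    (hw : IsFront a w b) (hF : Set.EqOn F F' (gradedPairings b)) :
    Set.EqOn (w.foldr E F) (w.foldr E F') (gradedPairings a) := by
  induction w generalizing a with
  | nil => obtain rfl := hw; exact hF
  | cons e w ih =>
    obtain ⟨c, h, h'⟩ := hw
    exact hE.support h (ih h')

lemma foldr_sum (hE : IsTransfer E) (w : Word R) (s : Finset (ℕ → ℕ)) (c : StateFun)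
    (F : (ℕ → ℕ) → StateFun) :
    w.foldr E (fun g => ∑ i ∈ s, c i * F i g) = fun f => ∑ i ∈ s, c i * w.foldr E (F i) f := by
  induction w with
  | nil => rfl
  | cons e w ih =>
    rw [foldr_cons, ih]
    funext f
    rw [hE.sum]
    rfl

/-- On graded pairings, of which there are finitely many, `F` is a combination of indicators. So a
word acts there by a finite matrix. -/
lemma foldr_eq_sum (hE : IsTransfer E) {w : Word R} {a b : List R} (hw : IsFront a w b)
    (F : StateFun) {f : ℕ → ℕ} (hf : f ∈ gradedPairings a) :
    w.foldr E F f = ∑ g ∈ (gradedPairings_finite b).toFinset,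
      F g * w.foldr E (pairingIndicator g) f := by
  have h : Set.EqOn F (fun f => ∑ g ∈ (gradedPairings_finite b).toFinset, F g * pairingIndicator g f)
      (gradedPairings b) := by
    intro f hf
    simp only [pairingIndicator]
    rw [Finset.sum_eq_single f]
    · simp
    · intro g _ hg; rw [if_neg hg.symm, mul_zero]
    · intro h; exact absurd ((Set.Finite.mem_toFinset _).2 hf) h
  rw [hE.foldr_support hw h hf, hE.foldr_sum]

/-- The matrix of a product of transposed factors in reverse order is the transpose of the product.
-/
lemma foldr_mirror (hE : IsTransfer E) {w : Word R} {a b : List R} (hw : IsFront a w b)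
    {f g : ℕ → ℕ} (hf : f ∈ gradedPairings a) (hg : g ∈ gradedPairings b) :
    (mirrorWord w).foldr E (pairingIndicator f) g = w.foldr E (pairingIndicator g) f := by
  induction w generalizing a f with
  | nil =>
    by_cases h : f = g
    · simp [mirrorWord, pairingIndicator, h]
    · simp [mirrorWord, pairingIndicator, h, Ne.symm h]
  | cons e w ih =>
    obtain ⟨c, h, h'⟩ := hw
    rw [mirrorWord_cons, foldr_append, hE.foldr_eq_sum (isFront_mirrorWord h') _ hg, foldr_cons]
    have := hE.foldr_eq_sum (w := [e]) ⟨c, h, rfl⟩ (w.foldr E (pairingIndicator g)) hf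
    simp only [foldr_cons, foldr_nil] at this ⊢
    rw [this]
    refine Finset.sum_congr rfl fun k hk => ?_
    rw [Set.Finite.mem_toFinset] at hk
    rw [ih h' hk, hE.symm h hf hk, mul_comm]

/-- Two fronts that cannot be distinguished have mirror images that cannot be distinguished. -/
lemma eqOn_mirror (hE : IsTransfer E) {w w' : Word R} {a b : List R} (hw : IsFront a w b)
    (hw' : IsFront a w' b) (h : ∀ F, Set.EqOn (w.foldr E F) (w'.foldr E F) (gradedPairings a))
    (F : StateFun) :
    Set.EqOn ((mirrorWord w).foldr E F) ((mirrorWord w').foldr E F) (gradedPairings b) := by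
  intro g hg
  rw [hE.foldr_eq_sum (isFront_mirrorWord hw) F hg, hE.foldr_eq_sum (isFront_mirrorWord hw') F hg]
  refine Finset.sum_congr rfl fun f hf => ?_
  rw [Set.Finite.mem_toFinset] at hf
  rw [hE.foldr_mirror hw hf hg, hE.foldr_mirror hw' hf hg, h _ hf]

end IsTransfer

lemma wordSum_eq_foldr (ρ : ℤ) (w : Word R) (F : StateFun) :
    wordSum ρ w F = w.foldr (eventSum ρ) F := by
  induction w with
  | nil => rfl
  | cons e w ih => rw [wordSum_cons, ih]; rfl

lemma dvd_sub_iff_eq {ρ : ℤ} (hρ : (ρ : R) = 0) {x y : R} : (ρ : R) ∣ x - y ↔ x = y := by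
  rw [hρ, zero_dvd_iff, sub_eq_zero]

lemma exists_notMem (l : List ℕ) : ∃ c, c ∉ l := by
  obtain ⟨c, hc⟩ := l.toFinset.exists_notMem
  exact ⟨c, by simpa using hc⟩

lemma IsGradedState.swap {U V : List (ℕ × R)} {p q : ℕ × R} (h : IsGradedState (U ++ p :: q :: V))
    (hpq : p.1 ≠ q.1) : IsGradedState (U ++ q :: p :: V) := by
  refine ⟨by simpa using IsChordWord.swap (u := U.map Prod.fst) (by simpa using h.1), ?_⟩
  have h₂ := h.2
  simp only [pairwise_append, pairwise_cons, mem_cons, forall_eq_or_imp] at h₂ ⊢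
  exact ⟨h₂.1, ⟨⟨fun h => absurd h.symm hpq, h₂.2.1.2.1⟩, h₂.2.1.1.2, h₂.2.1.2.2⟩, fun a ha =>
    ⟨(h₂.2.2 a ha).2.1, (h₂.2.2 a ha).1, (h₂.2.2 a ha).2.2⟩⟩

lemma IsGradedState.remove {U V : List (ℕ × R)} {c : ℕ} {x y : R}
    (h : IsGradedState (U ++ (c, x) :: (c, y) :: V)) : IsGradedState (U ++ V) := by
  refine ⟨by simpa using IsChordWord.remove (u := U.map Prod.fst) (c := c) (by simpa using h.1), ?_⟩
  refine h.2.sublist (Sublist.append_left ?_ U)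
  exact (sublist_cons_self _ _).trans (sublist_cons_self _ _)

lemma IsGradedState.insert {U V : List (ℕ × R)} (h : IsGradedState (U ++ V)) {c : ℕ} (x : R)
    (hU : c ∉ U.map Prod.fst) (hV : c ∉ V.map Prod.fst) :
    IsGradedState (U ++ (c, x + 1) :: (c, x) :: V) := by
  refine ⟨by simpa using IsChordWord.insert (u := U.map Prod.fst) (by simpa using h.1) hU hV, ?_⟩
  have h₂ := h.2
  have hU' : ∀ p ∈ U, p.1 ≠ c := fun p hp h => hU (h ▸ mem_map_of_mem hp)
  have hV' : ∀ p ∈ V, c ≠ p.1 := fun p hp h => hV (h ▸ mem_map_of_mem hp)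
  simp only [pairwise_append, pairwise_cons, mem_cons, forall_eq_or_imp] at h₂ ⊢
  exact ⟨h₂.1, ⟨⟨fun _ => trivial, fun p hp h => absurd h (hV' p hp)⟩,
    fun p hp h => absurd h (hV' p hp), h₂.2.1⟩, fun p hp =>
      ⟨fun h => absurd h (hU' p hp), fun h => absurd h (hU' p hp), h₂.2.2 p hp⟩⟩

/-- Events lead from graded pairings to graded pairings. The delicate case is a switch: the chords
stay in place while the list of potentials is exchanged, and this is consistent because `ρ = 0`
forces the two potentials to be equal. -/
lemma eventSum_support {ρ : ℤ} (hρ : (ρ : R) = 0) {e : FrontEvent R} {a b : List R}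
    {F F' : StateFun} (he : e.Step a b) (hF : Set.EqOn F F' (gradedPairings b)) :
    Set.EqOn (eventSum ρ e F) (eventSum ρ e F') (gradedPairings a) := by
  rintro f ⟨Z, hZ, hZa, rfl⟩
  cases he with
  | crossing m u d x y =>
    obtain ⟨U, Z, rfl, rfl, hZb⟩ := map_eq_append_iff.1 hZa
    obtain ⟨p, Z, rfl, rfl, hZc⟩ := map_eq_cons_iff.1 hZb
    obtain ⟨q, V, rfl, rfl, rfl⟩ := map_eq_cons_iff.1 hZc
    have hc : IsChordWord (U.map Prod.fst ++ p.1 :: q.1 :: V.map Prod.fst) := by simpa using hZ.1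
    simp only [map_append, map_cons]
    rw [eventSum_crossing ρ m p.2 q.2 F hc (by simp), eventSum_crossing ρ m p.2 q.2 F' hc (by simp)]
    congr 1
    · split_ifs with h
      · rfl
      · exact hF ⟨U ++ q :: p :: V, hZ.swap h, by simp, by simp⟩
    · split_ifs with h
      · have hpq : p.2 = q.2 := (dvd_sub_iff_eq hρ).1 h.1.2
        rw [hF ⟨U ++ p :: q :: V, hZ, by simp [hpq], by simp⟩]
      · rfl
  | leftCusp u d x =>
    obtain ⟨U, V, rfl, rfl, rfl⟩ := map_eq_append_iff.1 hZa
    obtain ⟨c, hc⟩ := exists_notMem (U.map Prod.fst ++ V.map Prod.fst)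
    rw [mem_append, not_or] at hc
    have hins := hZ.insert x hc.1 hc.2
    rw [map_append, eventSum_leftCusp ρ x F (c := c) (by simpa using hins.1) (by simp),
      eventSum_leftCusp ρ x F' (c := c) (by simpa using hins.1) (by simp),
      hF ⟨_, hins, by simp, by simp⟩]
  | rightCusp u d x =>
    obtain ⟨U, Z, rfl, rfl, hZb⟩ := map_eq_append_iff.1 hZa
    obtain ⟨p, Z, rfl, hp, hZc⟩ := map_eq_cons_iff.1 hZb
    obtain ⟨q, V, rfl, rfl, rfl⟩ := map_eq_cons_iff.1 hZc
    have hc : IsChordWord (U.map Prod.fst ++ p.1 :: q.1 :: V.map Prod.fst) := by simpa using hZ.1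
    simp only [map_append, map_cons]
    rw [eventSum_rightCusp ρ q.2 F hc (by simp), eventSum_rightCusp ρ q.2 F' hc (by simp)]
    split_ifs with h
    · obtain ⟨c, x⟩ := p
      obtain ⟨c', y⟩ := q
      obtain rfl : c = c' := h
      rw [hF ⟨_, hZ.remove, by simp, by simp⟩]
    · rfl
  | vertex => rfl

/-- The relation defined by a left cusp is the converse of that defined by a right cusp, which gives
the symmetry of cusps. -/
lemma insertPair_eq_iff (k : ℕ) (f g : ℕ → ℕ) :
    insertPair k f = g ↔ CuspCondition k g ∧ removePair k g = f := by
  have h₀ : ∀ i, insertPair k f (skipTwo k i) = skipTwo k (f i) := fun i => by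
    rw [insertPair, if_neg (skipTwo_ne k i).1, if_neg (skipTwo_ne k i).2, unskipTwo_skipTwo]
  constructor
  · rintro rfl
    have h : removePair k (insertPair k f) = f := by
      funext i
      rw [removePair, h₀, unskipTwo_skipTwo]
    exact ⟨⟨by simp [insertPair], by simp [insertPair], fun i => by rw [h, h₀]⟩, h⟩
  · rintro ⟨⟨h₁, h₂, h₃⟩, rfl⟩
    funext i
    by_cases hi : i = k
    · rw [hi, h₁, insertPair, if_pos rfl]
    by_cases hi' : i = k + 1
    · rw [hi', h₂, insertPair, if_neg (by omega), if_pos rfl]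
    obtain ⟨j, rfl⟩ := exists_skipTwo hi hi'
    rw [h₃, insertPair, if_neg hi, if_neg hi', unskipTwo_skipTwo]

lemma conjSwap_conjSwap (k : ℕ) (f : ℕ → ℕ) : conjSwap k (conjSwap k f) = f := by
  funext i
  simp [conjSwap]

lemma eventSum_symm_cusp {ρ : ℤ} (k : ℕ) (x x' : R) {f g : ℕ → ℕ} :
    eventSum ρ (.rightCusp k x) (pairingIndicator f) g =
      eventSum ρ (.leftCusp k x') (pairingIndicator g) f := by
  simp only [eventSum, pairingIndicator]
  by_cases h : insertPair k f = g
  · have h' := (insertPair_eq_iff k f g).1 h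
    rw [if_pos h, if_pos h'.1, if_pos h'.2]
  · rw [if_neg h, mul_zero]
    by_cases h' : CuspCondition k g
    · rw [if_pos h', if_neg fun h'' => h ((insertPair_eq_iff k f g).2 ⟨h', h''⟩), mul_zero]
    · rw [if_neg h']

-- Crossing two strands is an involution on pairings and a switch is diagonal, while the two kinds
-- of cusp are exchanged. That `f` is an involution is needed to see that the two strands are
-- unmatched before the crossing exactly when they are after it.
open Classical in
lemma eventSum_symm {ρ : ℤ} (e : FrontEvent R) {f g : ℕ → ℕ} (hf : ∀ i, f (f i) = i)
    (hg : ∀ i, g (g i) = i) :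
    eventSum ρ e.mirror (pairingIndicator f) g = eventSum ρ e (pairingIndicator g) f := by
  cases e with
  | crossing m k x y =>
    have hs : Switchable ρ m y x ↔ Switchable ρ m x y := by
      simp only [Switchable, dvd_sub_comm]
    have h₁ : conjSwap k g = f ↔ conjSwap k f = g :=
      ⟨fun h => by rw [← h, conjSwap_conjSwap], fun h => by rw [← h, conjSwap_conjSwap]⟩
    have h₂ : conjSwap k f = g → (g k = k + 1 ↔ f k = k + 1) := by
      rintro rfl
      have : conjSwap k f k = k + 1 ↔ f (k + 1) = k := by
        rw [conjSwap, Equiv.swap_apply_left]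
        constructor
        · intro h
          simpa using congrArg (Equiv.swap k (k + 1)) h
        · intro h; rw [h, Equiv.swap_apply_left]
      rw [this]
      exact ⟨fun h => by rw [← hf (k + 1), h], fun h => by rw [← h, hf]⟩
    have h₃ : (if g k = k + 1 then 0 else pairingIndicator f (conjSwap k g)) =
        if f k = k + 1 then 0 else pairingIndicator g (conjSwap k f) := by
      simp only [pairingIndicator]
      by_cases h : conjSwap k f = g
      · rw [if_pos h, if_pos (h₁.2 h)]
        exact if_congr (h₂ h) rfl rfl
      · rw [if_neg h, if_neg (mt h₁.1 h), ite_self, ite_self]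
    have h₄ : (if Switchable ρ m y x ∧ NonInterlaced g k then T 2 * pairingIndicator f g else 0) =
        if Switchable ρ m x y ∧ NonInterlaced f k then T 2 * pairingIndicator g f else 0 := by
      simp only [pairingIndicator]
      by_cases h : f = g
      · subst h
        exact if_congr (and_congr_left' hs) rfl rfl
      · rw [if_neg h, if_neg (Ne.symm h), mul_zero, ite_self, ite_self]
    exact congrArg₂ (· + ·) h₃ h₄
  | leftCusp k x => exact eventSum_symm_cusp k x x
  | rightCusp k x => exact (eventSum_symm_cusp k x x).symm
  | vertex => rfl

lemma isTransfer_eventSum {ρ : ℤ} (hρ : (ρ : R) = 0) :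
    IsTransfer (eventSum ρ : FrontEvent R → _) where
  sum e s c F f := by
    rw [eventSum_sum]
    exact Finset.sum_congr rfl fun i _ => eventSum_mul ρ e (c i) (F i) f
  support := eventSum_support hρ
  symm {e} _ _ _ _ _ hf hg := eventSum_symm e (involutive_of_mem_gradedPairings hf)
    (involutive_of_mem_gradedPairings hg)

/-- Two words of events that cannot be distinguished on slices with potentials `a`. -/
def TransferEq (E : FrontEvent R → StateFun → StateFun) (a : List R)
    (w w' : Word R) : Prop := ∀ F, Set.EqOn (w.foldr E F) (w'.foldr E F) (gradedPairings a)

namespace TransferEq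

variable {E : FrontEvent R → StateFun → StateFun} {a b : List R}
  {w w' w'' : Word R}

lemma refl : TransferEq E a w w := fun _ _ _ => rfl

lemma symm (h : TransferEq E a w w') : TransferEq E a w' w := fun F => (h F).symm

lemma trans (h : TransferEq E a w w') (h' : TransferEq E a w' w'') : TransferEq E a w w'' :=
  fun F => (h F).trans (h' F)

lemma append_right (h : TransferEq E a w w') (s : Word R) :
    TransferEq E a (w ++ s) (w' ++ s) := fun F => by
  rw [foldr_append, foldr_append]
  exact h _

lemma append_left (hE : IsTransfer E) {p : Word R} (hp : IsFront a p b) (h : TransferEq E b w w') :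
    TransferEq E a (p ++ w) (p ++ w') := fun F => by
  rw [foldr_append, foldr_append]
  exact hE.foldr_support hp (h F)

lemma mirror (hE : IsTransfer E) (hw : IsFront a w b) (hw' : IsFront a w' b)
    (h : TransferEq E a w w') : TransferEq E b (mirrorWord w) (mirrorWord w') :=
  hE.eqOn_mirror hw hw' h

end TransferEq

lemma transferEq_of_chordSum {ρ : ℤ} {a : List R} {w w' : Word R}
    (h : ∀ F (Z : List (ℕ × R)), IsGradedState Z → Z.map Prod.snd = a →
      chordSum ρ w F (Z.map Prod.fst) = chordSum ρ w' F (Z.map Prod.fst)) :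
    TransferEq (eventSum ρ) a w w' := by
  rintro F f ⟨Z, hZ, hZa, rfl⟩
  have := h F Z hZ hZa
  rwa [chordSum, chordSum, wordSum_eq_foldr, wordSum_eq_foldr] at this

/-! ### Local words and far commutation -/

/-- The same word with `j` more strands above. -/
def shiftWord (j : ℕ) (w : Word R) : Word R := w.map fun e => e.moveTo (j + e.pos)

lemma shiftWord_append (j : ℕ) (w w' : Word R) :
    shiftWord j (w ++ w') = shiftWord j w ++ shiftWord j w' := map_append

lemma shiftWord_cons (j : ℕ) (e : FrontEvent R) (w : Word R) :
    shiftWord j (e :: w) = e.moveTo (j + e.pos) :: shiftWord j w := rfl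

lemma shiftWord_shiftWord (i j : ℕ) (w : Word R) :
    shiftWord i (shiftWord j w) = shiftWord (i + j) w := by
  rw [shiftWord, shiftWord, shiftWord, map_map]
  refine map_congr_left fun e _ => ?_
  cases e <;> simp [FrontEvent.moveTo, FrontEvent.pos, add_assoc]

lemma shiftWord_mirrorWord (j : ℕ) (w : Word R) :
    shiftWord j (mirrorWord w) = mirrorWord (shiftWord j w) := by
  rw [shiftWord, mirrorWord, mirrorWord, shiftWord, map_map, ← map_reverse, map_map]
  refine map_congr_left fun e _ => ?_
  cases e <;> rfl

/-- `w` leads from a block of strands with potentials `l` to one with potentials `r`. -/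
def IsLocalFront (l r : List R) (w : Word R) : Prop :=
  ∀ u d, IsFront (u ++ (l ++ d)) (shiftWord u.length w) (u ++ (r ++ d))

lemma IsLocalFront.append {l m r : List R} {w w' : Word R} (h : IsLocalFront l m w)
    (h' : IsLocalFront m r w') : IsLocalFront l r (w ++ w') := by
  intro u d
  rw [shiftWord_append, isFront_append]
  exact ⟨_, h u d, h' u d⟩

lemma IsLocalFront.extend {l r : List R} {w : Word R} (h : IsLocalFront l r w) (p q : List R) :
    IsLocalFront (p ++ (l ++ q)) (p ++ (r ++ q)) (shiftWord p.length w) := by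
  intro u d
  have := h (u ++ p) (q ++ d)
  rw [shiftWord_shiftWord]
  simpa using this

lemma IsLocalFront.mirror {l r : List R} {w : Word R} (h : IsLocalFront l r w) :
    IsLocalFront r l (mirrorWord w) := fun u d => by
  rw [shiftWord_mirrorWord]
  exact isFront_mirrorWord (h u d)

lemma isLocalFront_nil (l : List R) : IsLocalFront l l [] := fun _ _ => rfl

lemma isLocalFront_crossing (m : Bool) (x y : R) :
    IsLocalFront [x, y] [y, x] [.crossing m 0 x y] := fun u d =>
  ⟨_, .crossing m u d x y, rfl⟩

/-- A word that acts on the chords through its block of strands in a single way, by removing or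
inserting whole chords, or not at all. -/
def IsPure (ρ : ℤ) (l r : List R) (w : Word R) : Prop :=
  IsLocalFront l r w ∧ ∀ xs : List ℕ, xs.length = l.length →
    ∃ (c : ℤ[T;T⁻¹]) (out : ℕ → List ℕ), ∀ (u v : List ℕ) (t : ℕ), t ∉ u ++ (xs ++ v) →
      IsChordWord (u ++ (xs ++ v)) → (out t).length = r.length ∧
      (∀ F, chordSum ρ (shiftWord u.length w) F (u ++ (xs ++ v)) =
        c * F (chordMatching (u ++ (out t ++ v)))) ∧
      (c ≠ 0 → IsChordWord (u ++ (out t ++ v)) ∧ (∀ a ∈ out t, a ∈ xs ∨ a = t) ∧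
        ∀ a b, a ∈ u ++ v → b ∈ u ++ v → lettersOf a b (out t) = lettersOf a b xs)

/-- Words whose crossings are regular, apart from those that occur in pure words. -/
inductive Piece (ρ : ℤ) : List R → List R → Word R → Prop
  | crossing (x y : R) : Piece ρ [x, y] [y, x] [.crossing false 0 x y]
  | pure {l r : List R} {w : Word R} (h : IsPure ρ l r w) : Piece ρ l r w
  | nil (l : List R) : Piece ρ l l []
  | append {l m r : List R} {w w' : Word R} (h : Piece ρ l m w) (h' : Piece ρ m r w') :
      Piece ρ l r (w ++ w')
  | extend {l r : List R} {w : Word R} (h : Piece ρ l r w) (p q : List R) :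
      Piece ρ (p ++ (l ++ q)) (p ++ (r ++ q)) (shiftWord p.length w)
  | congr {l r : List R} {w w' : Word R} (h : Piece ρ l r w) (h' : IsLocalFront l r w')
      (hw : ∀ u d, TransferEq (eventSum ρ) (u ++ (l ++ d)) (shiftWord u.length w)
        (shiftWord u.length w')) : Piece ρ l r w'

lemma Piece.isLocalFront {ρ : ℤ} {l r : List R} {w : Word R} (h : Piece ρ l r w) :
    IsLocalFront l r w := by
  induction h with
  | crossing x y => exact isLocalFront_crossing false x y
  | pure h => exact h.1
  | nil l => exact isLocalFront_nil l
  | append _ _ h h' => exact h.append h'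
  | extend _ p q h => exact h.extend p q
  | congr _ h' _ _ => exact h'

/-- `w` and `w'` commute when `w'` is performed below `w`. -/
def FarCommute (ρ : ℤ) (l r : List R) (w : Word R) (l' r' : List R)
    (w' : Word R) : Prop := ∀ u mid d, TransferEq (eventSum ρ) (u ++ (l ++ (mid ++ (l' ++ d))))
    (shiftWord u.length w ++ shiftWord (u ++ (r ++ mid)).length w')
    (shiftWord (u ++ (l ++ mid)).length w' ++ shiftWord u.length w)

lemma farCommute_of_chordSum {ρ : ℤ} {l r : List R} {w : Word R} {l' r' : List R} {w' : Word R}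
    (h : ∀ (F : StateFun) (U X M Y V : List (ℕ × R)),
      IsGradedState (U ++ (X ++ (M ++ (Y ++ V)))) → X.map Prod.snd = l → Y.map Prod.snd = l' →
      chordSum ρ (shiftWord U.length w ++ shiftWord (U.length + (r.length + M.length)) w') F
        (U.map Prod.fst ++ (X.map Prod.fst ++ (M.map Prod.fst ++
          (Y.map Prod.fst ++ V.map Prod.fst)))) =
      chordSum ρ (shiftWord (U.length + (l.length + M.length)) w' ++ shiftWord U.length w) F
        (U.map Prod.fst ++ (X.map Prod.fst ++ (M.map Prod.fst ++
          (Y.map Prod.fst ++ V.map Prod.fst))))) : FarCommute ρ l r w l' r' w' := by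
  intro u mid d
  refine transferEq_of_chordSum fun F Z hZ hZa => ?_
  obtain ⟨U, Z, rfl, rfl, hZb⟩ := map_eq_append_iff.1 hZa
  obtain ⟨X, Z, rfl, hX, hZc⟩ := map_eq_append_iff.1 hZb
  obtain ⟨M, Z, rfl, rfl, hZd⟩ := map_eq_append_iff.1 hZc
  obtain ⟨Y, V, rfl, hY, rfl⟩ := map_eq_append_iff.1 hZd
  simpa using h F U X M Y V hZ hX hY

lemma map_swap_eq_self {a b : ℕ} {l : List ℕ} (ha : a ∉ l) (hb : b ∉ l) :
    l.map (Equiv.swap a b) = l := (map_congr_left (g := id) fun _ hc => Equiv.swap_apply_of_ne_of_ne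
    (fun h => ha (h.subst hc)) (fun h => hb (h.subst hc))).trans (map_id l)

lemma lettersOf_swap {a b c d : ℕ} (h : ¬ (c = a ∧ d = b ∨ c = b ∧ d = a)) (hcd : c ≠ d)
    (l l' : List ℕ) :
    lettersOf a b (l ++ c :: d :: l') = lettersOf a b (l ++ d :: c :: l') := by
  rw [lettersOf_append, lettersOf_append]
  congr 1
  simp only [lettersOf_cons]
  by_cases hc : c = a ∨ c = b
  · rw [if_neg (c := d = a ∨ d = b), if_neg (c := d = a ∨ d = b)] <;> grind
  · simp only [if_neg hc]

/-- Exchanging two neighbouring letters affects normality elsewhere only for a crossing of the same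
two letters. If both crossings concern the same two chords, the mixed outcomes correspond after the
chords are renamed, provided both crossings are switchable or neither is. -/
lemma chordSum_far_crossings (ρ : ℤ) {m m' : Bool} {x y x' y' : R} (F : StateFun) {U M V : List ℕ}
    {a b a' b' : ℕ} {k j : ℕ} (h : IsChordWord (U ++ a :: b :: (M ++ a' :: b' :: V)))
    (hk : U.length = k) (hj : U.length + (2 + M.length) = j)
    (hs : a' = a ∧ b' = b ∨ a' = b ∧ b' = a → (Switchable ρ m x y ↔ Switchable ρ m' x' y')) :
    chordSum ρ [.crossing m k x y, .crossing m' j x' y'] F (U ++ a :: b :: (M ++ a' :: b' :: V)) =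
      chordSum ρ [.crossing m' j x' y', .crossing m k x y] F (U ++ a :: b :: (M ++ a' :: b' :: V))
        := by
  have h' : ∀ {p q p' q' : ℕ}, [p, q].Perm [a, b] → [p', q'].Perm [a', b'] →
      IsChordWord (U ++ p :: q :: (M ++ p' :: q' :: V)) := by
    intro p q p' q' h₁ h₂
    refine h.perm (Perm.append_left U ?_)
    exact (h₁.symm.append (Perm.append_left M (h₂.symm.append_right V)))
  have up : ∀ {p q p' q' : ℕ} (G : StateFun) (w : Word R),
      [p, q].Perm [a, b] → [p', q'].Perm [a', b'] →
      chordSum ρ (.crossing m k x y :: w) G (U ++ p :: q :: (M ++ p' :: q' :: V)) =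
        (if p = q then 0 else chordSum ρ w G (U ++ q :: p :: (M ++ p' :: q' :: V))) +
        if Switchable ρ m x y ∧ lettersOf p q ((M ++ p' :: q' :: V) ++ U) = [q, p] then
          T 2 * chordSum ρ w G (U ++ p :: q :: (M ++ p' :: q' :: V)) else 0 :=
    fun G w h₁ h₂ => chordSum_crossing ρ m x y w G (h' h₁ h₂) hk
  have low : ∀ {p q p' q' : ℕ} (G : StateFun) (w : Word R),
      [p, q].Perm [a, b] → [p', q'].Perm [a', b'] →
      chordSum ρ (.crossing m' j x' y' :: w) G (U ++ p :: q :: (M ++ p' :: q' :: V)) =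
        (if p' = q' then 0 else chordSum ρ w G (U ++ p :: q :: (M ++ q' :: p' :: V))) +
        if Switchable ρ m' x' y' ∧ lettersOf p' q' (V ++ (U ++ p :: q :: M)) = [q', p'] then
          T 2 * chordSum ρ w G (U ++ p :: q :: (M ++ p' :: q' :: V)) else 0 := by
    intro p q p' q' G w h₁ h₂
    simpa using
      chordSum_crossing ρ m' x' y' w G (u := U ++ p :: q :: M) (v := V) (a := p') (b := q')
      (by simpa using h' h₁ h₂) (k := j) (by simp; omega)
  have rp : [a, b].Perm [a, b] := Perm.refl _
  have rp' : [a', b'].Perm [a', b'] := Perm.refl _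
  have sp : [b, a].Perm [a, b] := Perm.swap _ _ _
  have sp' : [b', a'].Perm [a', b'] := Perm.swap _ _ _
  rw [up F _ rp rp', low F _ sp rp', low F _ rp rp', low F _ rp rp', up F _ rp sp', up F _ rp rp']
  simp only [chordSum_nil]
  by_cases hab : a = b
  · subst hab
    have h₁ := lettersOf_self_ne (u := U) h
    by_cases hab' : a' = b'
    · subst hab'
      have h₂ := lettersOf_self_ne (u := U ++ a :: a :: M) (v := V) (a := a') (by simpa using h)
      simp only [if_true, zero_add, h₁, h₂, and_false, if_false]
    · have h₃ : ¬ lettersOf a a ((M ++ b' :: a' :: V) ++ U) = [a, a] :=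
        lettersOf_self_ne (h' rp sp')
      simp only [if_true, if_neg hab', h₁, h₃, and_false, if_false, mul_zero, ite_self,
        add_zero]
  by_cases hab' : a' = b'
  · subst hab'
    have h₂ := lettersOf_self_ne (u := U ++ a :: b :: M) (v := V) (a := a') (by simpa using h)
    have h₃ := lettersOf_self_ne (u := U ++ b :: a :: M) (v := V) (a := a') (by simpa using h' sp rp')
    simp only [if_true, if_neg hab, h₂, h₃, and_false, if_false, mul_zero, ite_self,
      add_zero]
  simp only [if_neg hab, if_neg hab']
  by_cases hsame : a' = a ∧ b' = b ∨ a' = b ∧ b' = a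
  · have hcount : ∀ c, c = a ∨ c = b → c ∉ U ∧ c ∉ M ∧ c ∉ V := by
      intro c hc
      have h₁ := h c (by rcases hc with rfl | rfl <;> simp)
      rcases hc with rfl | rfl <;> rcases hsame with ⟨rfl, rfl⟩ | ⟨rfl, rfl⟩ <;>
      · simp only [count_append, count_cons, beq_self_eq_true, if_true, beq_iff_eq, hab, if_false,
          Ne.symm hab] at h₁
        exact ⟨count_eq_zero.1 (by omega), count_eq_zero.1 (by omega), count_eq_zero.1 (by omega)⟩
    have hA := hcount a (Or.inl rfl)
    have hB := hcount b (Or.inr rfl)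
    have e₁ : ∀ {l}, a ∉ l → b ∉ l → lettersOf a b l = [] := lettersOf_eq_nil
    have e₂ : ∀ {l}, a ∉ l → b ∉ l → lettersOf b a l = [] := fun h h' => lettersOf_eq_nil h' h
    rcases hsame with ⟨rfl, rfl⟩ | ⟨rfl, rfl⟩ <;>
    · simp only [lettersOf_append, lettersOf_cons, e₁ hA.1 hB.1, e₁ hA.2.1 hB.2.1, e₁ hA.2.2 hB.2.2,
        e₂ hA.1 hB.1, e₂ hA.2.1 hB.2.1, e₂ hA.2.2 hB.2.2, true_or, or_true, if_true, hs (by simp)]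
      simp only [nil_append, cons.injEq, Ne.symm hab, hab, and_true, and_false, if_false,
        append_nil, and_self]
      -- The two letters occur nowhere else in the word, and interchanging their names does not
      -- change the pairing.
      have hsw : ∀ {p q p' q' : ℕ}, IsChordWord (U ++ p :: q :: (M ++ p' :: q' :: V)) →
          chordMatching (U ++ p :: q :: (M ++ p' :: q' :: V)) =
            chordMatching (U ++ Equiv.swap a' b' p :: Equiv.swap a' b' q ::
              (M ++ Equiv.swap a' b' p' :: Equiv.swap a' b' q' :: V)) := by
        intro p q p' q' hw
        rw [← chordMatching_map hw (Equiv.swap a' b').injective]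
        have hA' := hcount a' (by simp)
        have hB' := hcount b' (by simp)
        simp [map_swap_eq_self hA'.1 hB'.1, map_swap_eq_self hA'.2.1 hB'.2.1,
          map_swap_eq_self hA'.2.2 hB'.2.2]
      have e₃ := hsw (h' sp rp')
      have e₄ := hsw (h' sp sp')
      simp only [Equiv.swap_apply_left, Equiv.swap_apply_right] at e₃ e₄
      simp only [e₃, e₄]
  · have f₁ : lettersOf a b ((M ++ b' :: a' :: V) ++ U) = lettersOf a b ((M ++ a' :: b' :: V) ++ U) := by
      have := lettersOf_swap hsame hab' M (V ++ U)
      simpa using this.symm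
    have f₂ : lettersOf a' b' (V ++ (U ++ b :: a :: M)) = lettersOf a' b' (V ++ (U ++ a :: b :: M)) := by
      have := lettersOf_swap (a := a') (b := b') (c := a) (d := b) (by grind) hab (V ++ U) M
      simpa using this.symm
    rw [f₁, f₂]
    split_ifs <;> ring

lemma exists_of_map_eq_pair {α β : Type*} {f : α → β} {l : List α} {x y : β}
    (h : l.map f = [x, y]) : ∃ p q, l = [p, q] ∧ f p = x ∧ f q = y := by
  obtain ⟨p, l', rfl, hp, h'⟩ := map_eq_cons_iff.1 h
  obtain ⟨q, l'', rfl, hq, h''⟩ := map_eq_cons_iff.1 h'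
  obtain rfl := map_eq_nil_iff.1 h''
  exact ⟨p, q, rfl, hp, hq⟩

/-- When the crossings concern the same two chords, the grading makes both upper potentials exceed
the lower ones by one. So the two degrees agree up to sign and vanish together. -/
lemma farCommute_crossings {ρ : ℤ} (hρ : (ρ : R) = 0) (m : Bool) (x y x' y' : R) :
    FarCommute ρ [x, y] [y, x] [.crossing m 0 x y] [x', y'] [y', x'] [.crossing m 0 x' y'] := by
  refine farCommute_of_chordSum fun F U X M Y V hZ hX hY => ?_
  obtain ⟨p, q, rfl, rfl, rfl⟩ := exists_of_map_eq_pair hX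
  obtain ⟨p', q', rfl, rfl, rfl⟩ := exists_of_map_eq_pair hY
  have hc := hZ.1
  have hg := (pairwise_append.1 hZ.2).2.1
  simp only [cons_append, nil_append, pairwise_cons, mem_cons, mem_append, map_append,
    map_cons] at hc hg
  simpa [shiftWord, FrontEvent.moveTo, FrontEvent.pos] using
    chordSum_far_crossings ρ (m := m) (m' := m) (x := p.2) (y := q.2) (x' := p'.2)
    (y' := q'.2) F (M := M.map Prod.fst) hc rfl rfl (by
      have h₁ := hg.1 p' (by simp)
      have h₂ := hg.1 q' (by simp)
      have h₃ := hg.2.1 p' (by simp)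
      have h₄ := hg.2.1 q' (by simp)
      unfold Switchable
      rw [dvd_sub_iff_eq hρ, dvd_sub_iff_eq hρ]
      refine fun h => and_congr_right' ?_
      rcases h with ⟨e₁, e₂⟩ | ⟨e₁, e₂⟩
      · rw [h₁ e₁.symm, h₄ e₂.symm, add_left_inj]
      · rw [h₂ e₂.symm, h₃ e₁.symm, add_left_inj, eq_comm])

lemma farCommute_of_isChordWord {ρ : ℤ} {l r : List R} {w : Word R} {l' r' : List R} {w' : Word R}
    (h : ∀ (F : StateFun) (U X M Y V : List ℕ), IsChordWord (U ++ (X ++ (M ++ (Y ++ V)))) →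
      X.length = l.length → Y.length = l'.length →
      chordSum ρ (shiftWord U.length w ++ shiftWord (U.length + (r.length + M.length)) w') F
        (U ++ (X ++ (M ++ (Y ++ V)))) =
      chordSum ρ (shiftWord (U.length + (l.length + M.length)) w' ++ shiftWord U.length w) F
        (U ++ (X ++ (M ++ (Y ++ V))))) : FarCommute ρ l r w l' r' w' :=
  farCommute_of_chordSum fun F U X M Y V hZ hX hY => by
    simpa using h F (U.map Prod.fst) (X.map Prod.fst) (M.map Prod.fst) (Y.map Prod.fst)
      (V.map Prod.fst) (by simpa using hZ.1) (by simp [← hX]) (by simp [← hY])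

/-- A pure word has a single outcome with a coefficient independent of the rest, and it leaves the
relative order of all other letters unchanged. The distant crossing therefore does not notice it. -/
lemma farCommute_crossing_pure {ρ : ℤ} (m : Bool) (x y : R) {l r : List R} {w : Word R}
    (hw : IsPure ρ l r w) :
    FarCommute ρ [x, y] [y, x] [.crossing m 0 x y] l r w := by
  refine farCommute_of_isChordWord fun F U X M Y V hc hX hY => ?_
  obtain ⟨p, q, rfl⟩ := length_eq_two.1 hX
  obtain ⟨c, out, hout⟩ := hw.2 Y hY
  obtain ⟨t, ht⟩ := exists_notMem (U ++ p :: q :: (M ++ (Y ++ V)))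
  rw [cons_append, cons_append, nil_append] at hc ⊢
  have h₁ := hout (U ++ p :: q :: M) V t
    (by simpa using ht) (by simpa using hc)
  have h₂ := hout (U ++ q :: p :: M) V t
    (by simp at ht ⊢; tauto) (by simpa using hc.swap)
  simp only [length_append, length_cons, append_assoc, cons_append, chordSum] at h₁ h₂
  have hpos : U.length + (M.length + 1 + 1) = U.length + ([y, x].length + M.length) := by
    simp; omega
  have e₁ := chordSum_crossing ρ m x y (shiftWord (U.length + ([y, x].length + M.length)) w) F hc
    (k := U.length) (by simp)
  simp only [cons_append, shiftWord_cons, FrontEvent.moveTo,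
    FrontEvent.pos, length_cons, length_nil, zero_add, add_zero]
    at e₁ hpos ⊢
  simp only [chordSum] at e₁
  rw [hpos] at h₁ h₂
  have hs : shiftWord U.length ([] : Word R) = [] := rfl
  rw [hs, nil_append, chordSum, e₁, h₁.2.1, h₂.2.1, chordSum_append, chordSum, h₁.2.1]
  by_cases hc0 : c = 0
  · simp [hc0]
  have e₂ := chordSum_crossing ρ m x y [] F (u := U) (v := M ++ (out t ++ V)) (a := p) (b := q) (by simpa using (h₁.2.2 hc0).1) (k := U.length) (by simp)
  have e₃ := (h₁.2.2 hc0).2.2 p q (by simp) (by simp)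
  simp only [chordSum, wordSum_nil] at e₂
  rw [e₂, mul_add]
  simp only [lettersOf_append, e₃]
  split_ifs <;> ring

lemma farCommute_pure_crossing {ρ : ℤ} (m : Bool) (x y : R) {l r : List R} {w : Word R}
    (hw : IsPure ρ l r w) :
    FarCommute ρ l r w [x, y] [y, x] [.crossing m 0 x y] := by
  refine farCommute_of_isChordWord fun F U X M Y V hc hX hY => ?_
  obtain ⟨p, q, rfl⟩ := length_eq_two.1 hY
  obtain ⟨c, out, hout⟩ := hw.2 X hX
  obtain ⟨t, ht⟩ := exists_notMem (U ++ (X ++ (M ++ p :: q :: V)))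
  rw [cons_append, cons_append, nil_append] at hc ⊢
  have hc' : IsChordWord ((U ++ (X ++ M)) ++ p :: q :: V) := by simpa using hc
  have h₁ := hout U (M ++ p :: q :: V) t ht hc
  have h₂ := hout U (M ++ q :: p :: V) t
    (by simp at ht ⊢; tauto) (by simpa using hc'.swap)
  simp only [chordSum] at h₁ h₂
  have e₁ := chordSum_crossing ρ m x y (shiftWord U.length w) F hc'
    (k := U.length + (l.length + M.length)) (by simp [← hX])
  simp only [cons_append, shiftWord_cons, FrontEvent.moveTo,
    FrontEvent.pos, add_zero, append_assoc] at e₁ ⊢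
  have hs : ∀ j, shiftWord j ([] : Word R) = [] := fun _ => rfl
  simp only [chordSum] at e₁
  rw [chordSum_append, chordSum, h₁.2.1, hs, hs, nil_append, chordSum, e₁, h₁.2.1, h₂.2.1]
  by_cases hc0 : c = 0
  · simp [hc0]
  have e₂ := chordSum_crossing ρ m x y [] F (u := U ++ (out t ++ M))
    (v := V) (a := p) (b := q) (by simpa using (h₁.2.2 hc0).1)
    (k := U.length + (r.length + M.length)) (by simp [h₁.1])
  have e₃ := (h₁.2.2 hc0).2.2 p q (by simp) (by simp)
  simp only [chordSum, wordSum_nil, append_assoc] at e₂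
  rw [e₂, mul_add]
  simp only [lettersOf_append, e₃]
  split_ifs <;> ring

lemma farCommute_pure {ρ : ℤ} {l r l' r' : List R} {w w' : Word R} (hw : IsPure ρ l r w)
    (hw' : IsPure ρ l' r' w') : FarCommute ρ l r w l' r' w' := by
  refine farCommute_of_isChordWord fun F U X M Y V hc hX hY => ?_
  obtain ⟨c, out, hout⟩ := hw.2 X hX
  obtain ⟨c', out', hout'⟩ := hw'.2 Y hY
  obtain ⟨t, ht⟩ := exists_notMem (U ++ (X ++ (M ++ (Y ++ V))))
  -- The two words may both insert chords, and these need different letters.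
  obtain ⟨t', ht'⟩ := exists_notMem (t :: (U ++ (X ++ (M ++ (Y ++ V)))))
  rw [mem_cons, not_or] at ht'
  have h₁ := hout U _ t ht hc
  have h₂ := hout' (U ++ (X ++ M)) V t'
    (by simpa using ht'.2) (by simpa using hc)
  simp only [length_append, append_assoc, chordSum] at h₁ h₂
  rw [chordSum_append, chordSum_append, chordSum, h₁.2.1, chordSum, ← hX, h₂.2.1]
  have h₃ (hc0' : c' ≠ 0) := hout U (M ++ (out' t' ++ V)) t (by
    have := (h₂.2.2 hc0').2.1 t
    simp only [mem_append, not_or] at ht ht' ⊢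
    grind) (h₂.2.2 hc0').1
  simp only [chordSum] at h₃
  by_cases hc0 : c = 0
  · by_cases hc0' : c' = 0
    · simp [hc0, hc0']
    · rw [(h₃ hc0').2.1, hc0]
      simp
  · have h₄ := hout' (U ++ (out t ++ M)) V t' (by
      intro h
      simp only [mem_append, not_or] at ht' h
      rcases h with (h | h | h) | h | h
      · tauto
      · rcases (h₁.2.2 hc0).2.1 t' h with h | h <;> tauto
      · tauto
      · tauto
      · tauto) (by simpa using (h₁.2.2 hc0).1)
    simp only [length_append, append_assoc, chordSum, h₁.1] at h₄
    rw [h₄.2.1]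
    by_cases hc0' : c' = 0
    · simp [hc0']
    · rw [(h₃ hc0').2.1]
      ring

section Composition

variable {ρ : ℤ} {l m r l' m' r' : List R} {w v w' v' : Word R}

lemma FarCommute.nil_left : FarCommute ρ l l [] l' r' w' := fun _ _ _ => by
  simpa [shiftWord] using TransferEq.refl

lemma FarCommute.nil_right : FarCommute ρ l r w l' l' [] := fun _ _ _ => by
  simpa [shiftWord] using TransferEq.refl

lemma FarCommute.append_left (hρ : (ρ : R) = 0) (h : FarCommute ρ l m w l' r' w') (h' : FarCommute ρ m r v l' r' w')
    (hw : IsLocalFront l m w) : FarCommute ρ l r (w ++ v) l' r' w' := fun u mid d => by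
  rw [shiftWord_append, append_assoc, ← append_assoc (shiftWord _ w')]
  exact (TransferEq.append_left (isTransfer_eventSum hρ) (hw u _) (h' u mid d)).trans
    (by simpa using (h u mid d).append_right (shiftWord u.length v))

lemma FarCommute.append_right (hρ : (ρ : R) = 0) (h : FarCommute ρ l r w l' m' w') (h' : FarCommute ρ l r w m' r' v')
    (hw : IsLocalFront l' m' w') : FarCommute ρ l r w l' r' (w' ++ v') := fun u mid d => by
  rw [shiftWord_append, shiftWord_append, ← append_assoc (shiftWord _ w),
    append_assoc (shiftWord _ w')]
  refine ((h u mid d).append_right _).trans ?_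
  rw [append_assoc]
  refine TransferEq.append_left (isTransfer_eventSum hρ) (b := u ++ (l ++ (mid ++ (m' ++ d)))) ?_
    (h' u mid d)
  simpa using hw (u ++ (l ++ mid)) d

lemma FarCommute.extend_left (h : FarCommute ρ l r w l' r' w') (p q : List R) :
    FarCommute ρ (p ++ (l ++ q)) (p ++ (r ++ q)) (shiftWord p.length w) l' r' w' := fun u mid d => by
  have := h (u ++ p) (q ++ mid) d
  rw [shiftWord_shiftWord]
  simpa using this

lemma FarCommute.extend_right (h : FarCommute ρ l r w l' r' w') (p q : List R) :
    FarCommute ρ l r w (p ++ (l' ++ q)) (p ++ (r' ++ q)) (shiftWord p.length w') :=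
  fun u mid d => by
  have := h u (mid ++ p) (q ++ d)
  rw [shiftWord_shiftWord, shiftWord_shiftWord]
  simpa [add_assoc] using this

lemma FarCommute.congr_left (hρ : (ρ : R) = 0) (h : FarCommute ρ l r w l' r' w') (hw' : IsLocalFront l' r' w')
    (hv : ∀ u d, TransferEq (eventSum ρ) (u ++ (l ++ d)) (shiftWord u.length w)
        (shiftWord u.length v)) : FarCommute ρ l r v l' r' w' := fun u mid d => by
  refine (((hv u _).append_right _).symm.trans (h u mid d)).trans ?_
  refine TransferEq.append_left (isTransfer_eventSum hρ) (b := u ++ (l ++ (mid ++ (r' ++ d)))) ?_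
    (hv u _)
  simpa using hw' (u ++ (l ++ mid)) d

lemma FarCommute.congr_right (hρ : (ρ : R) = 0) (h : FarCommute ρ l r w l' r' w') (hw : IsLocalFront l r w)
    (hv : ∀ u d, TransferEq (eventSum ρ) (u ++ (l' ++ d)) (shiftWord u.length w')
        (shiftWord u.length v')) : FarCommute ρ l r w l' r' v' := fun u mid d => by
  refine (TransferEq.trans ?_ (h u mid d)).trans ?_
  · refine TransferEq.append_left (isTransfer_eventSum hρ) (hw u _) ?_
    simpa using (hv (u ++ (r ++ mid)) d).symm
  · refine TransferEq.append_right ?_ _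
    simpa using hv (u ++ (l ++ mid)) d

/-- Far commutation passes to concatenations, to larger blocks and to words with the same operator,
on either side. Only single crossings and pure words have to be checked against each other. -/
lemma Piece.farCommute (hρ : (ρ : R) = 0) (h : Piece ρ l r w) (h' : Piece ρ l' r' w') :
    FarCommute ρ l r w l' r' w' := by
  induction h generalizing l' r' w' with
  | crossing x y =>
    induction h' with
    | crossing x' y' => exact farCommute_crossings hρ _ _ _ _ _
    | pure h => exact farCommute_crossing_pure _ _ _ h
    | nil l => exact .nil_right
    | append h₁ _ ih ih' => exact FarCommute.append_right hρ ih ih' h₁.isLocalFront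
    | extend _ p q ih => exact ih.extend_right p q
    | congr _ _ hw ih => exact FarCommute.congr_right hρ ih (isLocalFront_crossing _ _ _) hw
  | pure h =>
    induction h' with
    | crossing x' y' => exact farCommute_pure_crossing _ _ _ h
    | pure h' => exact farCommute_pure h h'
    | nil l => exact .nil_right
    | append h₁ _ ih ih' => exact FarCommute.append_right hρ ih ih' h₁.isLocalFront
    | extend _ p q ih => exact ih.extend_right p q
    | congr _ _ hw ih => exact FarCommute.congr_right hρ ih h.1 hw
  | nil l => exact .nil_left
  | append h₁ _ ih ih' => exact FarCommute.append_left hρ (ih h') (ih' h') h₁.isLocalFront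
  | extend _ p q ih => exact (ih h').extend_left p q
  | congr _ _ hw ih => exact FarCommute.congr_left hρ (ih h') h'.isLocalFront hw

end Composition

/-! ### Resolved vertices are composed of pieces -/

@[simp] lemma shiftWord_nil (j : ℕ) : shiftWord j ([] : Word R) = [] := rfl

lemma shiftWord_slideDown (j : ℕ) (m : Bool) (k : ℕ) (x : R) (l : List R) :
    shiftWord j (slideDown m k x l) = slideDown m (j + k) x l := by
  induction l generalizing k with
  | nil => rfl
  | cons y l ih => rw [slideDown, shiftWord_cons, ih]; rfl

lemma shiftWord_permutationBraid (j k : ℕ) (st : List (ℕ × R)) :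
    shiftWord j (permutationBraid k st) = permutationBraid (j + k) st := by
  induction st generalizing k with
  | nil => rfl
  | cons t st ih => rw [permutationBraid, shiftWord_append, ih, shiftWord_slideDown]; rfl

lemma shiftWord_complementBraid (j k : ℕ) (st : List (ℕ × R)) :
    shiftWord j (complementBraid k st) = complementBraid (j + k) st := by
  induction st generalizing k with
  | nil => rfl
  | cons t st ih =>
    rw [complementBraid, shiftWord_append, ih, shiftWord_slideDown, ← add_assoc]; rfl

lemma shiftWord_markedRightCusps (k : ℕ) (μ : ℕ → R) (φ : ℕ → ℕ) (s n : ℕ) :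
    shiftWord k (markedRightCusps 0 μ φ s n) = markedRightCusps k μ φ s n := by
  rw [markedRightCusps, shiftWord, map_flatMap, markedRightCusps]
  refine flatMap_congr fun i _ => ?_
  split_ifs
  · simp only [map_append, map_cons, map_nil, FrontEvent.moveTo, FrontEvent.pos, zero_add]
    rw [← add_assoc]
    congr 1
    exact shiftWord_slideDown _ _ _ _ _
  · rfl

lemma shiftWord_resolveVertex (k : ℕ) (l r : List R) (φ : ℕ → ℕ) :
    shiftWord k (resolveVertex 0 l r φ) = resolveVertex k l r φ := by
  simp only [resolveVertex, shiftWord_append, shiftWord_mirrorWord, shiftWord_markedRightCusps,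
    shiftWord_permutationBraid, shiftWord_complementBraid, add_zero]

lemma isFront_slideDown (m : Bool) (u : List R) (x : R) (l d : List R) :
    IsFront (u ++ x :: (l ++ d)) (slideDown m u.length x l) (u ++ (l ++ x :: d)) := by
  induction l generalizing u with
  | nil => rfl
  | cons y l ih =>
    refine ⟨_, .crossing m u _ x y, ?_⟩
    simpa using ih (u ++ [y])

lemma isLocalFront_slideDown (m : Bool) (x : R) (l : List R) :
    IsLocalFront (x :: l) (l ++ [x]) (slideDown m 0 x l) := fun u d => by
  rw [shiftWord_slideDown]
  simpa using isFront_slideDown m u x l d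

lemma isLocalFront_markedRightCusp (x : R) (l : List R) :
    IsLocalFront ((x + 1) :: (l ++ [x])) l (markedRightCusp 0 x l) := by
  have h₁ := (isLocalFront_slideDown true (x + 1) l).extend [] [x]
  have h₂ : IsLocalFront (l ++ [x + 1, x]) l [.rightCusp (0 + l.length) x] := fun u d =>
    ⟨_, by simpa [FrontEvent.moveTo, FrontEvent.pos] using FrontEvent.Step.rightCusp (u ++ l) d x,
      by simp [IsFront]⟩
  simpa [shiftWord_slideDown, markedRightCusp] using h₁.append (by simpa using h₂)

lemma isPure_markedRightCusp (ρ : ℤ) (x : R) (l : List R) :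
    IsPure ρ ((x + 1) :: (l ++ [x])) l (markedRightCusp 0 x l) := by
  refine ⟨isLocalFront_markedRightCusp x l, fun xs hxs => ?_⟩
  obtain _ | ⟨a, xs⟩ := xs
  · simp at hxs
  obtain rfl | ⟨ys, b, rfl⟩ := eq_nil_or_concat' xs
  · simp at hxs
  have hl : l.length = ys.length := by simpa using hxs.symm
  classical
  refine ⟨if a = b then T (-1) else 0, fun _ => ys, fun u v t _ h => ⟨hl.symm, fun F => ?_, fun hc => ?_⟩⟩
  · have := chordSum_markedRightCusp ρ (x + 1) x l [] F (u := u) (ys := ys) (v := v) (a := a) (b := b)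
      (by simpa using h) rfl hl
    simp only [chordSum_nil] at this
    have hw : shiftWord u.length (markedRightCusp 0 x l) =
        slideDown true u.length (x + 1) l ++ [.rightCusp (u.length + ys.length) x] := by
      rw [markedRightCusp, shiftWord_append, shiftWord_slideDown]
      simp [shiftWord, FrontEvent.moveTo, FrontEvent.pos, hl]
    rw [hw]
    simp only [cons_append, append_assoc, nil_append]
    rw [this, ite_mul, zero_mul]
  · obtain rfl : a = b := by
      by_contra h
      exact hc (if_neg h)
    have h' : IsChordWord (u ++ a :: (ys ++ a :: v)) := by simpa using h
    have hnot := notMem_of_isChordWord h'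
    refine ⟨?_, fun b hb => Or.inl (by simp [hb]), fun b c hb hc => ?_⟩
    · simpa using chordWord_remove_pair (u := u) (v := v) (a := []) (b := ys) (c := []) (x := a)
        (by simpa using h)
    · have hba : a ≠ b := by
        rintro rfl; simp only [mem_append] at hb; tauto
      have hca : a ≠ c := by
        rintro rfl; simp only [mem_append] at hc; tauto
      simp [lettersOf_cons, lettersOf_append, hba, hca, lettersOf_nil]

lemma isPure_markedLeftCusp (ρ : ℤ) (x : R) (l : List R) :
    IsPure ρ l ((x + 1) :: (l ++ [x])) (mirrorWord (markedRightCusp 0 x l)) := by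
  refine ⟨(isLocalFront_markedRightCusp x l).mirror, fun xs hxs => ?_⟩
  refine ⟨T (-1), fun t => t :: (xs ++ [t]), fun u v t ht h => ⟨by simp [hxs], fun F => ?_, fun _ => ?_⟩⟩
  · have hw : shiftWord u.length (mirrorWord (markedRightCusp 0 x l)) =
        .leftCusp (u.length + xs.length) x :: slideUp true u.length (x + 1) l := by
      rw [shiftWord_mirrorWord, markedRightCusp, shiftWord_append, shiftWord_slideDown,
        mirrorWord_append, mirrorWord_slideDown]
      simp [shiftWord, FrontEvent.moveTo, FrontEvent.pos, hxs, mirrorWord, FrontEvent.mirror]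
    rw [hw]
    have h' : IsChordWord (u ++ t :: (xs ++ t :: v)) := by
      have := h.insert (u := u) (c := t) (by simp at ht; tauto) (by simp at ht ⊢; tauto)
      refine this.perm (Perm.append_left u (Perm.cons t ?_))
      exact perm_middle.symm
    have := chordSum_markedLeftCusp ρ (x + 1) x l F h' rfl hxs.symm
    rw [this]
    simp
  · have h' : IsChordWord (u ++ t :: (xs ++ t :: v)) := by
      have := h.insert (u := u) (c := t) (by simp at ht; tauto) (by simp at ht ⊢; tauto)
      refine this.perm (Perm.append_left u (Perm.cons t ?_))
      exact perm_middle.symm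
    refine ⟨by simpa using h', fun a ha => ?_, fun b c hb hc => ?_⟩
    · simp at ha; tauto
    · have hba : t ≠ b := by
        rintro rfl; simp only [mem_append] at hb ht; tauto
      have hca : t ≠ c := by
        rintro rfl; simp only [mem_append] at hc ht; tauto
      simp [lettersOf_cons, lettersOf_append, hba, hca, lettersOf_nil]

lemma isFront_complementBraid (st : List (ℕ × R)) (h : (st.map Prod.fst).Nodup) (u d : List R) :
    IsFront (u ++ (sortedPotentials st ++ d)) (complementBraid u.length st)
      (u ++ ((st.map Prod.snd).reverse ++ d)) := by
  induction st generalizing d with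
  | nil => rfl
  | cons t st ih =>
    obtain ⟨p, x⟩ := t
    have hp : p ∉ st.map Prod.fst ∧ (st.map Prod.fst).Nodup := by simpa using h
    rw [sortedPotentials_cons h, complementBraid, isFront_append]
    refine ⟨u ++ (sortedPotentials st ++ (x :: d)), ?_, ?_⟩
    · have := isFront_slideDown true (u ++ sortedPotentials (st.filter fun t => t.1 < p)) x
        (sortedPotentials (st.filter fun t => p < t.1)) d
      rw [sortedPotentials_eq_append hp.2 (p := p) fun t ht h => hp.1 (h ▸ mem_map_of_mem ht)]
      simpa [length_sortedPotentials] using this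
    · simpa using ih hp.2 (x :: d)

lemma piece_slideDown (ρ : ℤ) (x : R) (l : List R) :
    Piece ρ (x :: l) (l ++ [x]) (slideDown false 0 x l) := by
  induction l with
  | nil => exact .nil _
  | cons y l ih =>
    have := ((Piece.crossing (ρ := ρ) x y).extend [] l).append
      (m := [y, x] ++ l) (by simpa using ih.extend [y] [])
    simpa [shiftWord_slideDown, shiftWord_cons, FrontEvent.moveTo, FrontEvent.pos, slideDown,
      shiftWord_nil] using this

lemma piece_permutationBraid (ρ : ℤ) (st : List (ℕ × R)) (h : (st.map Prod.fst).Nodup) :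
    Piece ρ (st.map Prod.snd) (sortedPotentials st) (permutationBraid 0 st) := by
  induction st with
  | nil => exact .nil _
  | cons t st ih =>
    obtain ⟨p, x⟩ := t
    have hp : p ∉ st.map Prod.fst ∧ (st.map Prod.fst).Nodup := by simpa using h
    have h₁ := (ih hp.2).extend [x] []
    have h₂ := (piece_slideDown ρ x (sortedPotentials (st.filter fun t => t.1 < p))).extend []
      (sortedPotentials (st.filter fun t => p < t.1))
    rw [sortedPotentials_cons h, permutationBraid]
    rw [sortedPotentials_eq_append hp.2 (p := p) fun t ht h => hp.1 (h ▸ mem_map_of_mem ht)] at h₁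
    have := h₁.append (by simpa using h₂)
    simpa [shiftWord_permutationBraid, shiftWord_slideDown] using this

lemma permutationBraid_eq_nil (k : ℕ) {st : List (ℕ × R)} (h : st.Pairwise fun s t => s.1 < t.1) :
    permutationBraid k st = [] := by
  induction st generalizing k with
  | nil => rfl
  | cons t st ih =>
    rw [pairwise_cons] at h
    rw [permutationBraid, ih _ h.2, filter_eq_nil_iff.2 fun s hs => by
      simpa using (h.1 s hs).le]
    rfl

/-- The matchings joining left to right in a resolution: `β βᶜ` followed by the mirror of `βᶜ`. -/
def resolvedBraid (k : ℕ) (st : List (ℕ × R)) : Word R :=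
  permutationBraid k st ++ complementBraid k st ++ mirrorWord (complementBraid k st)

lemma shiftWord_resolvedBraid (j k : ℕ) (st : List (ℕ × R)) :
    shiftWord j (resolvedBraid k st) = resolvedBraid (j + k) st := by
  simp only [resolvedBraid, shiftWord_append, shiftWord_mirrorWord, shiftWord_permutationBraid,
    shiftWord_complementBraid]

lemma isLocalFront_resolvedBraid {st : List (ℕ × R)} (h : (st.map Prod.fst).Nodup) :
    IsLocalFront (st.map Prod.snd) (sortedPotentials st) (resolvedBraid 0 st) := by
  have hc : IsLocalFront (sortedPotentials st) (st.map Prod.snd).reverse (complementBraid 0 st) :=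
    fun u d => by
      rw [shiftWord_complementBraid]
      exact isFront_complementBraid st h u d
  exact ((piece_permutationBraid 0 st h).isLocalFront.append hc).append hc.mirror

/-- For increasing targets `β` is empty and `βᶜ` is the full half-twist, all of it marked. The word
only tests whether its strands are unmatched. -/
lemma isPure_resolvedBraid (ρ : ℤ) {st : List (ℕ × R)} (h : st.Pairwise fun s t => s.1 < t.1) :
    IsPure ρ (st.map Prod.snd) (st.map Prod.snd) (resolvedBraid 0 st) := by
  have hnd : (st.map Prod.fst).Nodup := by
    rw [Nodup, pairwise_map]
    exact h.imp fun h => h.ne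
  have hs : sortedPotentials st = st.map Prod.snd := by
    rw [sortedPotentials, insertionSort_eq_of_perm (Perm.refl st) h]
  refine ⟨by simpa [hs] using isLocalFront_resolvedBraid hnd, fun xs hxs => ?_⟩
  classical
  refine ⟨if xs.Nodup then 1 else 0, fun _ => xs, fun u v t _ hc => ⟨hxs, fun F => ?_, fun _ =>
    ⟨hc, fun a ha => Or.inl ha, fun _ _ _ _ => rfl⟩⟩⟩
  rw [shiftWord_resolvedBraid, resolvedBraid, add_zero,
    chordSum_halfTwist ρ st hnd F rfl (by simpa using hxs) hc, permutationBraid_eq_nil _ h,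
    chordSum_nil, ite_mul, one_mul, zero_mul]

/-- By `chordSum_halfTwist` the word acts like this test followed by the bare braid `β`. Here `s`
carries the potentials of `st` with increasing targets and supplies the test. -/
lemma piece_resolvedBraid (ρ : ℤ) {st : List (ℕ × R)} (h : (st.map Prod.fst).Nodup) :
    Piece ρ (st.map Prod.snd) (sortedPotentials st) (resolvedBraid 0 st) := by
  obtain ⟨s, hs⟩ : ∃ s, s = (range st.length).zip (st.map Prod.snd) := ⟨_, rfl⟩
  have hfst : s.map Prod.fst = range st.length := by
    rw [hs, map_fst_zip (by simp)]
  have hsnd : s.map Prod.snd = st.map Prod.snd := by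
    rw [hs, map_snd_zip (by simp)]
  have hpw : s.Pairwise fun s t => s.1 < t.1 := by
    have := pairwise_lt_range (n := st.length)
    rwa [← hfst, pairwise_map] at this
  have hp := isPure_resolvedBraid ρ hpw
  rw [hsnd] at hp
  refine ((Piece.pure hp).append (piece_permutationBraid ρ st h)).congr
    (isLocalFront_resolvedBraid h) fun u d => transferEq_of_chordSum fun F Z hZ hZa => ?_
  obtain ⟨U, Z, rfl, rfl, hZb⟩ := map_eq_append_iff.1 hZa
  obtain ⟨X, V, rfl, hX, -⟩ := map_eq_append_iff.1 hZb
  have hc : IsChordWord (U.map Prod.fst ++ (X.map Prod.fst ++ V.map Prod.fst)) := by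
    simpa using hZ.1
  have hlen : X.length = st.length := by simpa using congrArg length hX
  have hnd : (s.map Prod.fst).Nodup := hfst ▸ nodup_range
  have hsl : st.length = s.length := by simpa using (congrArg length hfst).symm
  simp only [shiftWord_append, shiftWord_resolvedBraid, shiftWord_permutationBraid, map_append,
    add_zero, length_map]
  rw [chordSum_append, resolvedBraid,
    chordSum_halfTwist ρ s hnd _ (by simp) (by simp [hlen, hsl]) hc, resolvedBraid,
    chordSum_halfTwist ρ st h _ (by simp) (by simp [hlen]) hc, permutationBraid_eq_nil _ hpw]
  rfl

lemma Deletion.piece {ρ : ℤ} {μ : ℕ → R} {φ : ℕ → ℕ} {ts ps rest : List ℕ} {w : Word R}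
    (h : Deletion 0 μ φ ts ps w rest) (hμ : ∀ i ∈ ps, μ i = μ (φ i) + 1) :
    Piece ρ (ts.map μ) (rest.map μ) w ∧ Piece ρ (rest.map μ) (ts.map μ) (mirrorWord w) := by
  induction h with
  | nil ts => exact ⟨.nil _, .nil _⟩
  | @cons a b c ps i w rest h ih =>
    have ih := ih fun i hi => hμ i (mem_cons_of_mem _ hi)
    have hi := hμ i (by simp)
    have hw : slideDown true (0 + a.length) (μ i) (b.map μ) ++
        .rightCusp (0 + a.length + b.length) (μ (φ i)) :: w =
        shiftWord (a.map μ).length (markedRightCusp 0 (μ (φ i)) (b.map μ)) ++ w := by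
      rw [markedRightCusp, shiftWord_append, shiftWord_slideDown, hi]
      simp [shiftWord, FrontEvent.moveTo, FrontEvent.pos]
    have hts : (a ++ i :: (b ++ φ i :: c)).map μ =
        a.map μ ++ (((μ (φ i) + 1) :: (b.map μ ++ [μ (φ i)])) ++ c.map μ) := by
      simp [hi]
    rw [hw, hts, mirrorWord_append, ← shiftWord_mirrorWord]
    have h₁ := (Piece.pure (isPure_markedRightCusp ρ (μ (φ i)) (b.map μ))).extend (a.map μ) (c.map μ)
    have h₂ := (Piece.pure (isPure_markedLeftCusp ρ (μ (φ i)) (b.map μ))).extend (a.map μ) (c.map μ)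
    exact ⟨h₁.append (by simpa using ih.1), Piece.append (by simpa using ih.2) h₂⟩

lemma map_outerStrands_eq {ρ : ℤ} (hρ : (ρ : R) = 0) {l r : List R} {φ : ℕ → ℕ}
    (hφ : IsGradedVertexMatching ρ l r φ) :
    sortedPotentials (crossingStrands r.length l.length (halfEdgePotential l r) φ) =
      (outerStrands φ 0 r.length).map (halfEdgePotential l r) := by
  rw [sortedPotentials_crossingStrands _ hφ.1]
  have := forall₂_outerStrands hφ _ (Subset.refl (outerStrands φ 0 r.length))
  simp only [dvd_sub_iff_eq hρ] at this
  exact forall₂_eq_eq_eq ▸ this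

lemma potential_innerPairs {ρ : ℤ} (hρ : (ρ : R) = 0) {l r : List R} {φ : ℕ → ℕ}
    (hφ : IsGradedVertexMatching ρ l r φ) {s n i : ℕ} (hi : i ∈ innerPairs φ s n)
    (hs : s + n ≤ r.length ∨ r.length ≤ s) :
    halfEdgePotential l r i = halfEdgePotential l r (φ i) + 1 := by
  rw [mem_innerPairs] at hi
  have := (hφ.2 i hi.2.1).1 (by omega)
  rwa [sub_sub, dvd_sub_iff_eq hρ] at this

/-- The point is that a vertex, once resolved, commutes with distant events. The deleted and
inserted pairs are pure because the grading holds exactly when `ρ = 0`. -/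
lemma piece_resolveVertex {ρ : ℤ} (hρ : (ρ : R) = 0) {l r : List R} {φ : ℕ → ℕ}
    (hφ : IsGradedVertexMatching ρ l r φ) : Piece ρ l r (resolveVertex 0 l r φ) := by
  rw [resolveVertex_eq _ _ _ hφ.1]
  have h₁ := (Deletion.piece (ρ := ρ) (hφ.1.deletion 0 (halfEdgePotential l r) (s := r.length)
    (m := l.length) le_rfl) fun i hi => potential_innerPairs hρ hφ hi (Or.inr le_rfl)).1
  have h₂ := (Deletion.piece (ρ := ρ) (hφ.1.deletion 0 (halfEdgePotential l r) (s := 0)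
    (m := r.length) (by omega)) fun i hi => potential_innerPairs hρ hφ hi (Or.inl (by omega))).2
  have h₃ := piece_resolvedBraid ρ
    (nodup_crossingStrands r.length l.length (halfEdgePotential l r) hφ.1.1)
  rw [map_halfEdgePotential_left] at h₁
  rw [map_halfEdgePotential_right] at h₂
  rw [map_snd_crossingStrands, map_outerStrands_eq hρ hφ] at h₃
  exact h₁.append (h₃.append h₂)

lemma isFront_resolveVertex {ρ : ℤ} (hρ : (ρ : R) = 0) {l r : List R} {φ : ℕ → ℕ}
    (hφ : IsGradedVertexMatching ρ l r φ) (u d : List R) :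
    IsFront (u ++ (l ++ d)) (resolveVertex u.length l r φ) (u ++ (r ++ d)) := by
  rw [← shiftWord_resolveVertex]
  exact (piece_resolveVertex hρ hφ).isLocalFront u d

/-! ### Reflection of a resolved vertex in a vertical line -/

lemma Deletion.unique {k : ℕ} {μ : ℕ → R} {φ : ℕ → ℕ} {ts ps rest rest' : List ℕ} {w w' : Word R}
    (h : Deletion k μ φ ts ps w rest) (h' : Deletion k μ φ ts ps w' rest') (hts : ts.Nodup) :
    w = w' := by
  induction h generalizing w' rest' with
  | nil ts => cases h'; rfl
  | @cons a b c ps i w rest h ih =>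
    generalize hT : a ++ i :: (b ++ φ i :: c) = T at h'
    generalize hP : i :: ps = P at h'
    cases h' with
    | nil => cases hP
    | @cons a' b' c' ps' i' w' rest' h' =>
      injection hP with h₁ h₂
      subst h₁ h₂
      have hi : (i ∉ a ∧ i ∉ b ++ φ i :: c) ∧ φ i ∉ b ∧ φ i ∉ c := by
        simp only [nodup_append, nodup_cons, mem_cons, mem_append] at hts ⊢
        grind
      obtain ⟨rfl, -, hT'⟩ := (append_cons_inj_of_notMem hi.1.1 hi.1.2).1 hT
      obtain ⟨rfl, -, rfl⟩ := (append_cons_inj_of_notMem hi.2.1 hi.2.2).1 hT'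
      have hsub : (a ++ (b ++ c)).Sublist (a ++ i :: (b ++ φ i :: c)) :=
        Sublist.append_left ((Sublist.append_left (sublist_cons_self _ _) b).trans
          (sublist_cons_self _ _)) a
      rw [ih h' (hts.sublist hsub)]

/-- The right ends `qs`, in increasing order, are sent back by `φ` to their left ends, which `g`
renumbers monotonically. Each strand of `ts`, being first at the left among those that remain, has
the least target in the inverse permutation. -/
lemma inverseTargets_of_involutive {ρ : ℤ} {μ : ℕ → R} {φ g : ℕ → ℕ} (hφ : ∀ i, φ (φ i) = i)
    {ts qs : List ℕ} (hts : ts.Pairwise (· < ·)) (hqs : qs.Pairwise (· < ·))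
    (hp : qs.Perm (ts.map φ)) (hg : ∀ s ∈ ts, ∀ t ∈ ts, s < t → g s < g t)
    (hμ : ∀ t ∈ ts, μ t = μ (φ t)) :
    InverseTargets ρ (ts.map fun t => (φ t, μ t)) (qs.map fun q => (g (φ q), μ q)) := by
  induction ts generalizing qs with
  | nil =>
    obtain rfl : qs = [] := by simpa using hp
    exact .nil
  | cons t ts ih =>
    obtain ⟨l, l', rfl⟩ := append_of_mem (hp.mem_iff.2 (by simp : φ t ∈ (t :: ts).map φ))
    have hp' : (l ++ l').Perm (ts.map φ) := by
      have := perm_middle.symm.trans hp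
      exact (perm_cons (φ t)).1 this
    rw [pairwise_cons] at hts
    have hsub : (l ++ l').Sublist (l ++ φ t :: l') := Sublist.append_left (sublist_cons_self _ _) l
    have hmem : ∀ q ∈ l ++ l', φ q ∈ ts := fun q hq => by
      obtain ⟨s, hs, rfl⟩ := mem_map.1 (hp'.mem_iff.1 hq)
      rwa [hφ]
    have := ih hts.2 (hqs.sublist hsub) hp' (fun s hs t ht => hg s (by simp [hs]) t (by simp [ht]))
      fun s hs => hμ s (by simp [hs])
    simp only [map_append, map_cons, hφ] at this ⊢
    refine .cons this ?_ (by simp [hμ t (by simp)]) ?_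
    · have hlt : ∀ q ∈ l, q < φ t := fun q hq => (pairwise_append.1 hqs).2.2 q hq _ (by simp)
      have hgt : ∀ q ∈ l', φ t < q := fun q hq =>
        (pairwise_cons.1 (pairwise_append.1 hqs).2.1).1 q hq
      have hs : ((ts.map fun t => (φ t, μ t)).filter fun s => s.1 < φ t).insertionSort
          (fun s t => s.1 ≤ t.1) = l.map fun q => (q, μ q) := by
        refine insertionSort_eq_of_perm ?_ ?_
        · have h₁ : (ts.map fun t => (φ t, μ t)) = (ts.map φ).map fun q => (q, μ q) := by
            rw [map_map]
            exact map_congr_left fun s hs => by simp [hμ s (by simp [hs])]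
          rw [h₁]
          refine Perm.trans (Perm.of_eq ?_) ((hp'.map fun q => (q, μ q)).filter _)
          rw [map_append, filter_append, filter_eq_self.2, filter_eq_nil_iff.2, append_nil]
          · simpa using fun q hq => (hgt q hq).le
          · simpa using hlt
        · rw [pairwise_map]
          exact (pairwise_append.1 hqs).1
      rw [sortedPotentials, hs]
      simp only [map_map]
      exact forall₂_same.2 fun y _ => by simp
    · intro s hs
      rw [← map_append] at hs
      obtain ⟨q, hq, rfl⟩ := mem_map.1 hs
      exact hg t (by simp) _ (by simp [hmem q hq]) (hts.1 _ (hmem q hq))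

/-- Whether a block contains a matched pair depends on the pairing and not on the word that codes
it. -/
lemma nodup_of_chordMatching_eq {u v xs u' v' xs' : List ℕ} (hu : u.length = u'.length)
    (hxs : xs.length = xs'.length) (h : IsChordWord (u ++ (xs ++ v)))
    (h' : IsChordWord (u' ++ (xs' ++ v')))
    (he : chordMatching (u ++ (xs ++ v)) = chordMatching (u' ++ (xs' ++ v'))) (hnd : xs.Nodup) :
    xs'.Nodup := by
  rw [nodup_iff_getElem?_ne_getElem?]
  intro i j hij hj heq
  have hg : ∀ {u xs v : List ℕ} {i : ℕ}, i < xs.length → (u ++ (xs ++ v))[u.length + i]? = xs[i]? :=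
    fun hi => by
      rw [getElem?_append_right (by omega), Nat.add_sub_cancel_left, getElem?_append_left hi]
  have h₁ : chordMatching (u' ++ (xs' ++ v')) (u'.length + i) = u'.length + j := by
    rw [codes_chordMatching h']
    refine Or.inr ⟨by omega, by simp; omega, ?_⟩
    rw [hg (by omega), hg hj, heq]
  rw [← he, ← hu, codes_chordMatching h] at h₁
  obtain h₁ | ⟨-, -, h₁⟩ := h₁
  · omega
  · rw [hg (by omega), hg (by omega)] at h₁
    exact (nodup_iff_getElem?_ne_getElem?.1 hnd) i j hij (by omega) h₁

/-- On an unmatched block the marked crossings cancel, and the reverse of `β` is the permutation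
braid of the inverse. On a matched block the first word gives zero by `chordSum_halfTwist`. The
second one does so by transposition: its matrix entries are those of the unreflected word, whose
half-twist admits only unmatched blocks and whose braid keeps them unmatched. -/
lemma transferEq_mirror_resolvedBraid {ρ : ℤ} (hρ : (ρ : R) = 0) {st st' : List (ℕ × R)}
    (hst : (st.map Prod.fst).Nodup) (h : InverseTargets ρ st st')
    (hs : sortedPotentials st = st'.map Prod.snd) (u d : List R) :
    TransferEq (eventSum ρ) (u ++ (st'.map Prod.snd ++ d)) (resolvedBraid u.length st')
      (mirrorWord (resolvedBraid u.length st)) := by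
  refine transferEq_of_chordSum fun F Z hZ hZa => ?_
  have hfront : IsFront (u ++ (st.map Prod.snd ++ d)) (resolvedBraid u.length st)
      (u ++ (st'.map Prod.snd ++ d)) := by
    have := isLocalFront_resolvedBraid hst u d
    rwa [shiftWord_resolvedBraid, add_zero, hs] at this
  have hg : chordMatching (Z.map Prod.fst) ∈ gradedPairings (u ++ (st'.map Prod.snd ++ d)) :=
    ⟨Z, hZ, hZa, rfl⟩
  obtain ⟨U, Z, rfl, rfl, hZb⟩ := map_eq_append_iff.1 hZa
  obtain ⟨Y, V, rfl, hY, rfl⟩ := map_eq_append_iff.1 hZb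
  have hc : IsChordWord (U.map Prod.fst ++ (Y.map Prod.fst ++ V.map Prod.fst)) := by
    simpa using hZ.1
  have hlen : (Y.map Prod.fst).length = st'.length := by simpa using congrArg length hY
  have hlen' : (Y.map Prod.fst).length = st.length := hlen.trans h.length_eq
  simp only [map_append] at hg ⊢
  by_cases hnd : (Y.map Prod.fst).Nodup
  · rw [resolvedBraid, chordSum_halfTwist ρ st' h.nodup F (by simp) hlen hc, if_pos hnd]
    obtain ⟨is, his, hw⟩ := exists_markedAt_complementBraid st hst
    have hw := chordSum_markedBraid ρ (hw (U.map Prod.snd).length)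
      (wordSum ρ (mirrorWord (permutationBraid (U.map Prod.snd).length st)) F) (by simp)
      (fun i hi => by rw [hlen']; exact his i hi) hc
    rw [resolvedBraid, mirrorWord_append, mirrorWord_append, mirrorWord_mirrorWord,
      ← append_assoc (complementBraid _ st), chordSum_append,
      hw.1 (survives_of_forall_none is (doubledLetters_of_nodup hnd))]
    exact (h.blockEq _ F _ _ _ (by simp) hlen' hnd hc).symm
  · rw [resolvedBraid, chordSum_halfTwist ρ st' h.nodup F (by simp) hlen hc, if_neg hnd, chordSum,
      wordSum_eq_foldr, (isTransfer_eventSum hρ).foldr_eq_sum (isFront_mirrorWord hfront) _ hg]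
    refine (Finset.sum_eq_zero fun f hf => ?_).symm
    rw [Set.Finite.mem_toFinset] at hf
    rw [(isTransfer_eventSum hρ).foldr_mirror hfront hf hg, ← wordSum_eq_foldr]
    obtain ⟨Z, hZ', hZa', rfl⟩ := hf
    obtain ⟨U', Z, rfl, hU', hZb'⟩ := map_eq_append_iff.1 hZa'
    obtain ⟨X, V', rfl, hX, hV'⟩ := map_eq_append_iff.1 hZb'
    have hc' : IsChordWord (U'.map Prod.fst ++ (X.map Prod.fst ++ V'.map Prod.fst)) := by
      simpa using hZ'.1
    have hlU : U'.length = U.length := by simpa using congrArg length hU'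
    have hlX : (X.map Prod.fst).length = st.length := by simpa using congrArg length hX
    simp only [map_append]
    have := chordSum_halfTwist ρ st hst (pairingIndicator (chordMatching
      (U.map Prod.fst ++ (Y.map Prod.fst ++ V.map Prod.fst)))) (k := (U.map Prod.snd).length)
      (u := U'.map Prod.fst) (v := V'.map Prod.fst) (by simpa using hlU) hlX hc'
    rw [← resolvedBraid, chordSum] at this
    rw [this]
    split_ifs with hnd'
    · rw [chordSum_eq_zero_of_braid (isBraid_permutationBraid _ st) (by simpa using hlU) hlX hc',
        mul_zero]
      intro zs hzs
      rw [pairingIndicator, if_neg]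
      intro he
      refine hnd (nodup_of_chordMatching_eq (by simpa using hlU) ?_ ?_ hc he (hzs.nodup_iff.2 hnd'))
      · rw [hzs.length_eq, hlX, hlen']
      · exact hc'.perm (Perm.append_left _ (hzs.symm.append_right _))
    · rw [mul_zero]

/-- Relabelling of the half-edges at a vertex when it is reflected in a vertical line. -/
def swapBlocks (a b t : ℕ) : ℕ := if t < a then t + b else if t < a + b then t - a else t

lemma swapBlocks_swapBlocks (a b t : ℕ) : swapBlocks b a (swapBlocks a b t) = t := by
  unfold swapBlocks; split_ifs <;> omega

/-- The matching at the reflected vertex. -/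
def reflectMatching (a b : ℕ) (φ : ℕ → ℕ) : ℕ → ℕ := fun t => swapBlocks a b (φ (swapBlocks b a t))

lemma reflectMatching_swapBlocks (a b : ℕ) (φ : ℕ → ℕ) (t : ℕ) :
    reflectMatching a b φ (swapBlocks a b t) = swapBlocks a b (φ t) := by
  rw [reflectMatching, swapBlocks_swapBlocks]

lemma reflectMatching_reflectMatching (a b : ℕ) (φ : ℕ → ℕ) :
    reflectMatching b a (reflectMatching a b φ) = φ := by
  funext t
  simp [reflectMatching, swapBlocks_swapBlocks]

lemma halfEdgePotential_swapBlocks (l r : List R) (t : ℕ) :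
    halfEdgePotential r l (swapBlocks r.length l.length t) = halfEdgePotential l r t := by
  unfold swapBlocks halfEdgePotential
  simp only [getD_eq_getElem?_getD]
  congr 1
  split_ifs with h₁ h₂
  · rw [getElem?_append_right (by omega), getElem?_append_left h₁, Nat.add_sub_cancel]
  · rw [getElem?_append_left (by omega), getElem?_append_right (by omega)]
  · rw [getElem?_eq_none (by simp; omega), getElem?_eq_none (by simp; omega)]

lemma IsPerfectMatching.reflect {a b : ℕ} {φ : ℕ → ℕ} (hφ : IsPerfectMatching (a + b) φ) :
    IsPerfectMatching (b + a) (reflectMatching a b φ) := by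
  refine ⟨fun i => by simp [reflectMatching, swapBlocks_swapBlocks, hφ.1], fun i => ?_⟩
  have h₁ : reflectMatching a b φ i = i ↔ φ (swapBlocks b a i) = swapBlocks b a i := by
    rw [reflectMatching]
    exact ⟨fun h => by rw [← swapBlocks_swapBlocks a b (φ _), h], fun h => by
      rw [h, swapBlocks_swapBlocks]⟩
  rw [ne_eq, h₁, ← ne_eq, hφ.2]
  unfold swapBlocks; split_ifs <;> omega

lemma IsGradedVertexMatching.reflect {ρ : ℤ} (hρ : (ρ : R) = 0) {l r : List R} {φ : ℕ → ℕ}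
    (hφ : IsGradedVertexMatching ρ l r φ) :
    IsGradedVertexMatching ρ r l (reflectMatching r.length l.length φ) := by
  refine ⟨hφ.1.reflect, fun i hi => ?_⟩
  obtain ⟨t, rfl⟩ : ∃ t, i = swapBlocks r.length l.length t := ⟨_, (swapBlocks_swapBlocks _ _ i).symm⟩
  rw [reflectMatching_swapBlocks] at hi ⊢
  simp only [halfEdgePotential_swapBlocks]
  have h₁ := hφ.2 t
  have h₂ := hφ.2 (φ t)
  have h₃ := hφ.1.apply_lt_iff (i := t)
  rw [hφ.1.1] at h₂
  have h₄ : ¬ t < r.length + l.length → φ t = t := fun h => by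
    by_contra h'; exact h ((hφ.1.2 t).1 h')
  simp only [sub_sub, dvd_sub_iff_eq hρ] at h₁ h₂ ⊢
  unfold swapBlocks at hi ⊢
  constructor
  · intro h
    refine (h₁ ?_).1 ?_
    · split_ifs at hi h <;> omega
    · split_ifs at hi h <;> omega
  · intro h
    refine ((h₂ ?_).2 ?_).symm
    · split_ifs at hi h <;> omega
    · split_ifs at hi h <;> omega

lemma map_swapBlocks_right (a b : ℕ) : (range' 0 a).map (swapBlocks a b) = range' b a := by
  rw [show range' b a = (range' 0 a).map (b + ·) by simp [map_add_range']]
  refine map_congr_left fun t ht => ?_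
  rw [mem_range'_1] at ht
  rw [swapBlocks, if_pos (by omega), add_comm]

lemma map_swapBlocks_left (a b : ℕ) : (range' a b).map (swapBlocks a b) = range' 0 b := by
  rw [← map_swapBlocks_right b a, map_map]
  exact (map_congr_left fun t _ => swapBlocks_swapBlocks b a t).trans (map_id _)

/-- Relabelling half-edges preserves their order within each side, so the same deletions are
performed on either side of the reflection. -/
lemma markedRightCusps_reflect {k s n s' : ℕ} {l r : List R} {φ : ℕ → ℕ}
    (hφ : IsPerfectMatching (r.length + l.length) φ)
    (h : s = 0 ∧ n = r.length ∧ s' = l.length ∨ s = r.length ∧ n = l.length ∧ s' = 0) :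
    markedRightCusps k (halfEdgePotential r l) (reflectMatching r.length l.length φ) s' n =
      markedRightCusps k (halfEdgePotential l r) φ s n := by
  have h₁ := hφ.deletion k (halfEdgePotential l r) (s := s) (m := n) (by omega)
  have h₂ := hφ.reflect.deletion k (halfEdgePotential r l) (s := s') (m := n) (by omega)
  have h₃ := h₁.map (μ' := halfEdgePotential r l) (φ' := reflectMatching r.length l.length φ)
    (σ := swapBlocks r.length l.length) (fun t _ => halfEdgePotential_swapBlocks l r t)
    fun t _ => reflectMatching_swapBlocks _ _ _ _
  have hr : (range' s n).map (swapBlocks r.length l.length) = range' s' n := by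
    rcases h with ⟨rfl, rfl, rfl⟩ | ⟨rfl, rfl, rfl⟩
    · exact map_swapBlocks_right _ _
    · exact map_swapBlocks_left _ _
  have hp : (innerPairs φ s n).map (swapBlocks r.length l.length) =
      innerPairs (reflectMatching r.length l.length φ) s' n := by
    rw [innerPairs, innerPairs, ← hr, filter_map]
    congr 1
    refine filter_congr fun t ht => ?_
    rw [mem_range'_1] at ht
    simp only [Function.comp, reflectMatching_swapBlocks, decide_eq_decide]
    have := hφ.apply_lt_iff (i := t)
    unfold swapBlocks
    split_ifs <;> omega
  rw [hr, hp] at h₃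
  exact h₂.unique h₃ (nodup_range' _ _)

lemma outerStrands_reflect {a b : ℕ} {φ : ℕ → ℕ} (hφ : IsPerfectMatching (a + b) φ) :
    outerStrands (reflectMatching a b φ) b a = (outerStrands φ 0 a).map (swapBlocks a b) := by
  rw [outerStrands, outerStrands, ← map_swapBlocks_right, filter_map]
  congr 1
  refine filter_congr fun t ht => ?_
  rw [mem_range'_1] at ht
  simp only [Function.comp, reflectMatching_swapBlocks, decide_eq_decide]
  have := hφ.apply_lt_iff (i := t)
  unfold swapBlocks
  split_ifs <;> omega

/-- Reflection exchanges the deletions on the left with the insertions on the right, which are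
literally the same up to labels. Only the braid in the middle changes as a word, and
`transferEq_mirror_resolvedBraid` takes care of it. -/
lemma transferEq_resolveVertex_reflect {ρ : ℤ} (hρ : (ρ : R) = 0) {l r : List R} {φ : ℕ → ℕ}
    (hφ : IsGradedVertexMatching ρ l r φ) (u d : List R) :
    TransferEq (eventSum ρ) (u ++ (r ++ d))
      (resolveVertex u.length r l (reflectMatching r.length l.length φ))
      (mirrorWord (resolveVertex u.length l r φ)) := by
  rw [resolveVertex_eq _ _ _ hφ.1, resolveVertex_eq _ _ _ hφ.1.reflect,
    markedRightCusps_reflect hφ.1 (Or.inl ⟨rfl, rfl, rfl⟩),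
    markedRightCusps_reflect hφ.1 (Or.inr ⟨rfl, rfl, rfl⟩)]
  rw [mirrorWord_append, mirrorWord_append, mirrorWord_mirrorWord, append_assoc]
  obtain ⟨st, hst⟩ : ∃ st, st = crossingStrands r.length l.length (halfEdgePotential l r) φ := ⟨_, rfl⟩
  obtain ⟨st', hst'⟩ : ∃ st', st' = crossingStrands l.length r.length (halfEdgePotential r l)
    (reflectMatching r.length l.length φ) := ⟨_, rfl⟩
  rw [← hst, ← hst']
  have h₁ : st' = (outerStrands φ 0 r.length).map fun q =>
      (swapBlocks r.length l.length (φ q), halfEdgePotential l r q) := by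
    rw [hst', crossingStrands, outerStrands_reflect hφ.1, map_map]
    refine map_congr_left fun t _ => ?_
    simp only [Function.comp, reflectMatching_swapBlocks, halfEdgePotential_swapBlocks]
  have hsnd : st'.map Prod.snd = (outerStrands φ 0 r.length).map (halfEdgePotential l r) := by
    rw [h₁, map_map]; rfl
  have hout := map_outerStrands_eq hρ hφ
  rw [← hst] at hout
  have hinv : InverseTargets ρ st st' := by
    rw [hst, h₁]
    refine inverseTargets_of_involutive hφ.1.1 (pairwise_outerStrands _ _ _)
      (pairwise_outerStrands _ _ _) hφ.1.map_outerStrands_perm.symm (fun s hs t ht hlt => ?_) ?_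
    · rw [mem_outerStrands] at hs ht
      unfold swapBlocks
      split_ifs <;> omega
    · intro t ht
      rw [mem_outerStrands] at ht
      have := hφ.1.apply_lt_iff (i := t)
      have h' := (hφ.2 (φ t) (by rw [hφ.1.1]; omega)).2 (by rw [hφ.1.1]; omega)
      rw [hφ.1.1, dvd_sub_iff_eq hρ] at h'
      exact h'.symm
  have hmid := transferEq_mirror_resolvedBraid hρ
    (hst ▸ nodup_crossingStrands r.length l.length (halfEdgePotential l r) hφ.1.1) hinv
    (hout.trans hsnd.symm) u d
  have hdel := (Deletion.piece (ρ := ρ) (hφ.1.deletion 0 (halfEdgePotential l r) (s := 0)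
    (m := r.length) (by omega)) fun i hi => potential_innerPairs hρ hφ hi
      (Or.inl (by omega))).1.isLocalFront u d
  rw [map_halfEdgePotential_right, shiftWord_markedRightCusps, ← hsnd] at hdel
  simpa only [resolvedBraid, append_assoc] using
    (hmid.append_right (mirrorWord (markedRightCusps u.length (halfEdgePotential l r) φ
    r.length l.length))).append_left (isTransfer_eventSum hρ) hdel

lemma resolvedEventSum_vertex (ρ : ℤ) (k : ℕ) (l r : List R) (F : StateFun) (f : ℕ → ℕ) :
    resolvedEventSum ρ (.vertex k l r) F f =
      ∑ φ : (FrontEvent.vertex k l r).Resolution ρ, wordSum ρ (resolveVertex k l r φ.1) F f := rfl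

lemma resolvedEventSum_of_not_vertex (ρ : ℤ) {e : FrontEvent R} (he : ∀ k l r, e ≠ .vertex k l r) :
    resolvedEventSum ρ e = eventSum ρ e := by
  funext F f
  let u : Unique (e.Resolution ρ) := by
    cases e with
    | vertex k l r => exact absurd rfl (he k l r)
    | _ => exact inferInstanceAs (Unique Unit)
  refine (Fintype.sum_unique _).trans ?_
  cases e with
  | vertex k l r => exact absurd rfl (he k l r)
  | _ => rfl

lemma resolvedEventSum_symm_vertex {ρ : ℤ} (hρ : (ρ : R) = 0) (u d l r : List R) {f g : ℕ → ℕ}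
    (hf : f ∈ gradedPairings (u ++ (l ++ d))) (hg : g ∈ gradedPairings (u ++ (r ++ d))) :
    resolvedEventSum ρ (.vertex u.length r l) (pairingIndicator f) g =
      resolvedEventSum ρ (.vertex u.length l r) (pairingIndicator g) f := by
  rw [resolvedEventSum_vertex, resolvedEventSum_vertex]
  refine (Fintype.sum_bijective (κ := (FrontEvent.vertex u.length r l).Resolution ρ) (fun φ : (FrontEvent.vertex u.length l r).Resolution ρ =>
    ⟨reflectMatching r.length l.length φ.1, φ.2.reflect hρ⟩) ?_ _ _ fun φ => ?_).symm
  · refine Function.bijective_iff_has_inverse.2 ⟨fun φ =>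
      ⟨reflectMatching l.length r.length φ.1, φ.2.reflect hρ⟩, fun φ => ?_, fun φ => ?_⟩ <;>
    exact Subtype.ext (reflectMatching_reflectMatching _ _ _)
  · have h := transferEq_resolveVertex_reflect hρ φ.2 u d (pairingIndicator f) hg
    rw [← wordSum_eq_foldr] at h
    rw [h, (isTransfer_eventSum hρ).foldr_mirror (isFront_resolveVertex hρ φ.2 u d) hf hg,
      ← wordSum_eq_foldr]

lemma isTransfer_resolvedEventSum {ρ : ℤ} (hρ : (ρ : R) = 0) :
    IsTransfer (resolvedEventSum ρ : FrontEvent R → _) where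
  sum e s c F f := by
    simp only [resolvedEventSum, wordSum_sum, wordSum_mul, Finset.mul_sum]
    exact Finset.sum_comm
  support {e} a b F F' h hF f hf := by
    cases h with
    | vertex u d l r _ =>
      refine Finset.sum_congr rfl fun φ _ => ?_
      have := (isTransfer_eventSum hρ).foldr_support (isFront_resolveVertex hρ φ.2 u d) hF hf
      rwa [← wordSum_eq_foldr, ← wordSum_eq_foldr] at this
    | crossing m u d x y =>
      rw [resolvedEventSum_of_not_vertex ρ (by simp)]
      exact eventSum_support hρ (.crossing m u d x y) hF hf
    | leftCusp u d x =>
      rw [resolvedEventSum_of_not_vertex ρ (by simp)]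
      exact eventSum_support hρ (.leftCusp u d x) hF hf
    | rightCusp u d x =>
      rw [resolvedEventSum_of_not_vertex ρ (by simp)]
      exact eventSum_support hρ (.rightCusp u d x) hF hf
  symm {e} _ _ _ _ h hf hg := by
    cases h with
    | vertex u d l r _ => exact resolvedEventSum_symm_vertex hρ u d l r hf hg
    | _ =>
      rw [resolvedEventSum_of_not_vertex ρ (by simp [FrontEvent.mirror]),
        resolvedEventSum_of_not_vertex ρ (by simp)]
      exact eventSum_symm _ (involutive_of_mem_gradedPairings hf)
        (involutive_of_mem_gradedPairings hg)

/-! ### Words without vertices, and the number of strands a word needs -/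

/-- No event of the word is a vertex. -/
def VertexFree (w : Word R) : Prop := ∀ e ∈ w, ∀ k l r, e ≠ .vertex k l r

lemma VertexFree.foldr_eq {w : Word R} (h : VertexFree w) (ρ : ℤ) (F : StateFun) :
    w.foldr (resolvedEventSum ρ) F = wordSum ρ w F := by
  induction w with
  | nil => rfl
  | cons e w ih =>
    rw [foldr_cons, resolvedEventSum_of_not_vertex ρ (h e (by simp)),
      ih fun e he => h e (by simp [he]), wordSum_cons]

lemma VertexFree.append {w w' : Word R} (h : VertexFree w) (h' : VertexFree w') :
    VertexFree (w ++ w') := fun e he => by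
  rcases mem_append.1 he with he | he
  exacts [h e he, h' e he]

lemma vertexFree_slideDown (m : Bool) (k : ℕ) (x : R) (l : List R) :
    VertexFree (slideDown m k x l) := by
  induction l generalizing k with
  | nil => simp [VertexFree, slideDown]
  | cons y l ih =>
    intro e he
    rcases mem_cons.1 he with rfl | he
    · simp
    · exact ih _ e he

lemma vertexFree_slideUp (m : Bool) (k : ℕ) (x : R) (l : List R) :
    VertexFree (slideUp m k x l) := by
  induction l generalizing k with
  | nil => simp [VertexFree, slideUp]
  | cons y l ih => exact (ih _).append (by simp [VertexFree])

lemma VertexFree.mirror {w : Word R} (h : VertexFree w) :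
    VertexFree (mirrorWord w) := fun e he k l r hv => by
  simp only [mirrorWord, map_reverse, mem_reverse, mem_map] at he
  obtain ⟨e', he', rfl⟩ := he
  cases e' with
  | vertex k l r => exact h _ he' k l r rfl
  | _ => cases hv

lemma vertexFree_cons_crossing {m : Bool} {k : ℕ} {x y : R} {w : Word R} (h : VertexFree w) :
    VertexFree (.crossing m k x y :: w) :=
  VertexFree.append (w := [.crossing m k x y]) (by simp [VertexFree]) h

lemma vertexFree_markedRightCusp (k : ℕ) (x : R) (l : List R) :
    VertexFree (markedRightCusp k x l) :=
  (vertexFree_slideDown _ _ _ _).append (by simp [VertexFree])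

lemma TransferEq.resolved {ρ : ℤ} {a : List R} {w w' : Word R} (hw : VertexFree w)
    (hw' : VertexFree w') (h : TransferEq (eventSum ρ) a w w') :
    TransferEq (resolvedEventSum ρ) a w w' := fun F => by
  rw [hw.foldr_eq, hw'.foldr_eq, wordSum_eq_foldr, wordSum_eq_foldr]
  exact h F

/-- The potentials of the strands that enter an event from the left. -/
def FrontEvent.leftEnds : FrontEvent R → List R
  | .crossing _ _ x y => [x, y]
  | .leftCusp _ _ => []
  | .rightCusp _ x => [x + 1, x]
  | .vertex _ l _ => l

/-- The potentials of the strands that leave an event to the right. -/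
def FrontEvent.rightEnds : FrontEvent R → List R
  | .crossing _ _ x y => [y, x]
  | .leftCusp _ x => [x + 1, x]
  | .rightCusp _ _ => []
  | .vertex _ _ r => r

lemma FrontEvent.length_leftEnds (e : FrontEvent R) : e.leftEnds.length = e.inSize := by
  cases e <;> rfl

lemma FrontEvent.length_rightEnds (e : FrontEvent R) : e.rightEnds.length = e.outSize := by
  cases e <;> rfl

lemma FrontEvent.Step.exists_split {e : FrontEvent R} {a b : List R} (h : e.Step a b) :
    ∃ u d, u.length = e.pos ∧ a = u ++ (e.leftEnds ++ d) ∧ b = u ++ (e.rightEnds ++ d) := by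
  cases h with
  | crossing m u d x y => exact ⟨u, d, rfl, rfl, rfl⟩
  | leftCusp u d x => exact ⟨u, d, rfl, rfl, rfl⟩
  | rightCusp u d x => exact ⟨u, d, rfl, rfl, rfl⟩
  | vertex u d l r => exact ⟨u, d, rfl, rfl, rfl⟩

lemma FrontEvent.Step.length_eq {e : FrontEvent R} {a b : List R} (h : e.Step a b) :
    e.pos + e.inSize ≤ a.length ∧ a.length + e.outSize = b.length + e.inSize := by
  obtain ⟨u, d, hu, rfl, rfl⟩ := h.exists_split
  simp only [length_append, e.length_leftEnds, e.length_rightEnds]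
  omega

lemma IsFront.length_le {e : FrontEvent R} {w : Word R} {a b : List R} (h : IsFront a (e :: w) b) :
    e.pos + e.inSize ≤ a.length := let ⟨_, h, _⟩ := h
  h.length_eq.1

lemma IsFront.length_le_of_isBraid {k n : ℕ} {e : FrontEvent R} {w w' : Word R} {a b : List R}
    (hw : IsBraid k n w) (h : IsFront a (w ++ e :: w') b) :
    e.pos + e.inSize ≤ a.length := by
  induction w generalizing a with
  | nil => exact h.length_le
  | cons e' w ih =>
    obtain ⟨c, h, h'⟩ := h
    obtain ⟨m, p, x, y, rfl, -⟩ := hw e' (by simp)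
    have h₁ := ih (fun e he => hw e (by simp [he])) h'
    have h₂ := h.length_eq.2
    simp only [FrontEvent.inSize, FrontEvent.outSize, Nat.add_right_cancel_iff] at h₂
    omega

/-- The bound `n` guarantees enough strands to split a chord word around the events, without keeping
track of potentials. -/
lemma transferEq_resolved_of_chordSum {ρ : ℤ} {a : List R} {w w' : Word R} {n : ℕ}
    (hn : n ≤ a.length) (hw : VertexFree w) (hw' : VertexFree w')
    (h : ∀ F L, IsChordWord L → n ≤ L.length → chordSum ρ w F L = chordSum ρ w' F L) :
    TransferEq (resolvedEventSum ρ) a w w' :=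
  (transferEq_of_chordSum fun F Z hZ hZa => h F _ hZ.1 (by
    rw [← hZa, length_map] at hn
    rwa [length_map])).resolved hw hw'

lemma exists_append_of_le_length {α : Type*} {k n : ℕ} {L : List α} (h : k + n ≤ L.length) :
    ∃ u xs v, L = u ++ (xs ++ v) ∧ u.length = k ∧ xs.length = n :=
  ⟨L.take k, (L.drop k).take n, (L.drop k).drop n, by simp, by simp; omega, by simp; omega⟩

/-! ### Kinks, strands leaving a cusp, cancelling marked crossings -/

section ChordMoves

variable (ρ : ℤ) (F : StateFun) {k : ℕ} {u v : List ℕ}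

/-- A left cusp, a switch and a right cusp together have weight one. -/
lemma T_cancel (c : ℤ[T;T⁻¹]) : (T (-1) : ℤ[T;T⁻¹]) * (T 2 * (T (-1) * c)) = c := by
  rw [← mul_assoc, ← mul_assoc, ← T_add, ← T_add]
  norm_num [T_zero]

/-- The chord created by the left cusp has to be closed by the right one. Crossing would bring
different letters to the right cusp, so the crossing is switched. The switch is normal because the
partner of the new strand comes immediately below the crossing. -/
lemma chordSum_kink_below (x y : R) {s : ℕ} (h : IsChordWord (u ++ s :: v)) (hk : u.length = k) :
    chordSum ρ [.leftCusp (k + 1) y, .crossing false k x x, .rightCusp (k + 1) y] F (u ++ s :: v) =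
      F (chordMatching (u ++ s :: v)) := by
  obtain ⟨c, hc⟩ := exists_notMem (u ++ s :: v)
  simp only [mem_append, mem_cons, not_or] at hc
  have hs : (v ++ u).count s = 1 := by
    have := h s (by simp); simp at this ⊢; omega
  have h₁ : IsChordWord ((u ++ [s]) ++ c :: c :: v) :=
    IsChordWord.insert (by simpa using h) (by simp; tauto) hc.2.2
  have h₂ : IsChordWord (u ++ s :: c :: c :: v) := by simpa using h₁
  have e₁ := chordSum_leftCusp ρ y [.crossing false k x x, .rightCusp (k + 1) y] F h₁
    (k := k + 1) (by simp [hk])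
  simp only [append_assoc, cons_append, nil_append] at e₁
  have h₃ : IsChordWord ((u ++ [c]) ++ s :: c :: v) := by simpa using h₂.swap
  have e₃ := chordSum_rightCusp ρ y [] F h₃ (k := k + 1) (by simp [hk])
  have e₄ := chordSum_rightCusp ρ y [] F h₁ (k := k + 1) (by simp [hk])
  simp only [append_assoc, cons_append, nil_append] at e₃ e₄
  rw [e₁, chordSum_crossing ρ _ _ _ _ F h₂ hk, e₃, e₄, if_neg (Ne.symm hc.2.1),
    if_neg (Ne.symm hc.2.1), if_pos trivial, if_pos, chordSum_nil, zero_add, T_cancel]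
  refine ⟨⟨rfl, by simp⟩, ?_⟩
  rw [cons_append, lettersOf_cons, if_pos (Or.inr rfl), lettersOf_eq_singleton hs (by simp; tauto)]

lemma chordSum_kink_above (x y : R) {s : ℕ} (h : IsChordWord (u ++ s :: v)) (hk : u.length = k) :
    chordSum ρ [.leftCusp k y, .crossing false (k + 1) x x, .rightCusp k y] F (u ++ s :: v) =
      F (chordMatching (u ++ s :: v)) := by
  obtain ⟨c, hc⟩ := exists_notMem (u ++ s :: v)
  simp only [mem_append, mem_cons, not_or] at hc
  have hs : (v ++ u).count s = 1 := by
    have := h s (by simp); simp at this ⊢; omega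
  have h₁ : IsChordWord (u ++ c :: c :: s :: v) := h.insert hc.1 (by simp; tauto)
  have h₃ : IsChordWord (u ++ c :: s :: c :: v) := by
    simpa using IsChordWord.swap (u := u ++ [c]) (by simpa using h₁)
  rw [chordSum_leftCusp ρ y _ F h₁ hk, chordSum_crossing_succ ρ _ _ _ _ F h₁ hk,
    chordSum_rightCusp ρ y [] F h₃ hk, chordSum_rightCusp ρ y [] F h₁ hk, if_neg hc.2.1,
    if_neg hc.2.1, if_pos rfl, if_pos, chordSum_nil, zero_add, T_cancel]
  refine ⟨⟨rfl, by simp⟩, ?_⟩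
  rw [← append_assoc, lettersOf_append, lettersOf_comm, lettersOf_eq_singleton hs (by simp; tauto),
    lettersOf_cons, if_pos (Or.inl rfl)]
  simp [lettersOf_nil]

/-- Both sides vanish unless the two branches are matched. In that case the strand between them
carries a different letter and may leave through either branch. -/
lemma chordSum_cusp_exit (x y z z' : R) {a s b : ℕ} (h : IsChordWord (u ++ a :: s :: b :: v))
    (hk : u.length = k) :
    chordSum ρ [.crossing true k x y, .rightCusp (k + 1) z] F (u ++ a :: s :: b :: v) =
      chordSum ρ [.crossing true (k + 1) y z', .rightCusp k z] F (u ++ a :: s :: b :: v) := by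
  have h₁ : IsChordWord ((u ++ [s]) ++ a :: b :: v) := by simpa using h.swap
  have h₂ : IsChordWord (u ++ a :: b :: s :: v) := by
    simpa using IsChordWord.swap (u := u ++ [a]) (by simpa using h)
  have e₁ := chordSum_rightCusp ρ z [] F h₁ (k := k + 1) (by simp [hk])
  simp only [append_assoc, cons_append, nil_append] at e₁
  rw [chordSum_crossing ρ _ _ _ _ F h hk, chordSum_crossing_succ ρ _ _ _ _ F h hk, e₁,
    chordSum_rightCusp ρ z [] F h₂ hk]
  simp only [not_switchable_true, false_and, if_false, add_zero]
  by_cases hab : a = b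
  · subst hab
    have hs : a ≠ s := by
      rintro rfl
      have := h a (by simp)
      simp at this; omega
    rw [if_neg hs, if_neg hs.symm]
  · simp [hab]

lemma chordSum_cancel_marked (m : Bool) (x y x' y' : R) {a b : ℕ}
    (h : IsChordWord (u ++ a :: b :: v)) (hk : u.length = k) :
    chordSum ρ [.crossing true k x' y', .crossing true k y' x', .crossing m k x y] F
        (u ++ a :: b :: v) = chordSum ρ [.crossing m k x y] F (u ++ a :: b :: v) := by
  rw [chordSum_crossing ρ _ _ _ _ F h hk, chordSum_crossing ρ _ _ _ _ F h.swap hk]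
  simp only [not_switchable_true, false_and, if_false, add_zero]
  by_cases hab : a = b
  · subst hab
    rw [if_pos rfl, chordSum_crossing ρ _ _ _ _ F h hk, if_pos rfl, if_neg fun h' =>
      lettersOf_self_ne h h'.2, add_zero]
  · rw [if_neg hab, if_neg (Ne.symm hab)]

end ChordMoves

/-! ### A strand passes a marked cusp -/

section MarkedCusps

variable (ρ : ℤ) (F : StateFun) {k : ℕ} {u v : List ℕ}

/-- The labels of the crossings of a strand with a marked cusp. -/
def cuspLabels (x : R) (ys : List R) (m₁ m₂ m : Bool) : List (Bool × R) :=
  (m₁, x + 1) :: (ys.map (fun y => (m, y)) ++ [(m₂, x)])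

lemma mixedSlide_cuspLabels (s x : R) (ys : List R) (m₁ m₂ m : Bool) :
    mixedSlide k s (cuspLabels x ys m₁ m₂ m) =
      .crossing m₁ k s (x + 1) :: (slideDown m (k + 1) s ys ++
        [.crossing m₂ (k + 1 + ys.length) s x]) := by
  rw [cuspLabels, mixedSlide, mixedSlide_append, ← slideDown_eq_mixedSlide, length_map]
  rfl

lemma keptLabels_cuspLabels (x : R) {ys : List R} (m₁ m₂ m : Bool) {zs : List ℕ} {c : ℕ}
    (hc : c ∉ zs) (hl : zs.length = ys.length) :
    keptLabels (fun t => t == c) (cuspLabels x ys m₁ m₂ m) (c :: (zs ++ [c])) =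
      ys.map fun y => (m, y) := by
  rw [cuspLabels, keptLabels, if_pos (by simp)]
  induction ys generalizing zs with
  | nil => obtain rfl := length_eq_zero_iff.1 hl; simp [keptLabels]
  | cons y ys ih =>
    obtain _ | ⟨z, zs⟩ := zs
    · simp at hl
    simp only [mem_cons, not_or] at hc
    have := ih hc.2 (by simpa using hl)
    simp [keptLabels, Ne.symm hc.1, this]

lemma exists_of_lettersMask_eq {c : ℕ} {zs p : List ℕ}
    (h : lettersMask (fun t => t == c) p = lettersMask (fun t => t == c) (c :: (zs ++ [c]))) :
    ∃ p', p = c :: (p' ++ [c]) ∧ p'.length = zs.length := by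
  have hl : p.length = zs.length + 2 := by
    simpa [lettersMask] using congrArg length h
  obtain _ | ⟨a, p⟩ := p
  · simp at hl
  obtain rfl | ⟨p, b, rfl⟩ := eq_nil_or_concat' p
  · simp at hl
  have hl' : p.length = zs.length := by simpa using hl
  simp only [lettersMask, map_cons, map_append, map_nil, cons.injEq] at h
  have h' := append_inj h.2 (by simpa using hl')
  obtain rfl : a = c := by
    by_contra hne; simp [hne] at h
  obtain rfl : b = a := by
    by_contra hne; simp [hne] at h'
  exact ⟨p, rfl, hl'⟩

lemma notMem_of_isChordWord_cusp {p u' v' : List ℕ} {c s : ℕ}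
    (h : IsChordWord (u' ++ (c :: (p ++ [c]) ++ s :: v'))) : c ∉ p ∧ s ≠ c ∧ c ∉ u' ∧ c ∉ v' := by
  have := notMem_of_isChordWord (u := u') (m := p) (v := s :: v') (s := c) (by simpa using h)
  simp only [mem_cons, not_or] at this
  exact ⟨this.2.1, Ne.symm this.2.2.1, this.1, this.2.2.2⟩

lemma filter_cusp {c : ℕ} {p : List ℕ} (h : c ∉ p) :
    (c :: (p ++ [c])).filter (fun t => !(t == c)) = p := by
  simp [filter_append, filter_ne_eq_self h]

/-- If the branches are matched, they are a pair which is deleted after the slide.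
`chordSum_mixedSlide_filter` deletes it before, together with the two crossings whatever their
markings; this is why `m₁` and `m₂` are independent. If the branches are not matched, the slide
cannot make them so, because doubled letters keep their places, and both sides vanish. -/
lemma chordSum_slide_markedRightCusp (s x : R) (ys : List R) (m₁ m₂ m : Bool) {a b t : ℕ}
    {zs : List ℕ} (h : IsChordWord (u ++ t :: (a :: (zs ++ [b]) ++ v))) (hk : u.length = k)
    (hl : zs.length = ys.length) :
    chordSum ρ (mixedSlide k s (cuspLabels x ys m₁ m₂ m) ++ markedRightCusp k x ys) F
        (u ++ t :: (a :: (zs ++ [b]) ++ v)) =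
      chordSum ρ (markedRightCusp (k + 1) x ys ++ slideDown m k s ys) F
        (u ++ t :: (a :: (zs ++ [b]) ++ v)) := by
  have hlab : (cuspLabels x ys m₁ m₂ m).length = (a :: (zs ++ [b])).length := by
    simp [cuspLabels, hl]
  have hR := chordSum_markedRightCusp ρ (x + 1) x ys (slideDown m k s ys) F (k := k + 1)
    (u := u ++ [t]) (ys := zs) (v := v) (a := a) (b := b) (by simpa using h) (by simp [hk]) hl.symm
  have hcusp : ∀ {a b t : ℕ} {zs : List ℕ}, zs.length = ys.length →
      IsChordWord (u ++ (a :: (zs ++ [b]) ++ t :: v)) →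
      wordSum ρ (markedRightCusp k x ys) F (chordMatching (u ++ (a :: (zs ++ [b]) ++ t :: v))) =
        if a = b then T (-1) * F (chordMatching (u ++ (zs ++ t :: v))) else 0 := by
    intro a b t zs hz hc
    have := chordSum_markedRightCusp ρ (x + 1) x ys [] F (k := k) (u := u) (ys := zs) (v := t :: v)
      (a := a) (b := b) (by simpa using hc) hk hz.symm
    rw [hz] at this
    simpa [chordSum, markedRightCusp] using this
  rw [hl] at hR
  have hR' : chordSum ρ (markedRightCusp (k + 1) x ys ++ slideDown m k s ys) F
      (u ++ t :: (a :: (zs ++ [b]) ++ v)) = if a = b then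
        T (-1) * chordSum ρ (slideDown m k s ys) F (u ++ t :: (zs ++ v)) else 0 := by
    simpa [markedRightCusp] using hR
  rw [hR', chordSum_append]
  by_cases hab : a = b
  · subst hab
    have hn := notMem_of_isChordWord (u := u ++ [t]) (m := zs) (v := v) (s := a) (by simpa using h)
    simp only [mem_append, mem_singleton, not_or] at hn
    rw [if_pos rfl, chordSum_mixedSlide_filter ρ s (F' := fun g => T (-1) * F g)
      (fun t => t == a) _ h hk hlab ?_ ?_ ?_, filter_cusp hn.2.1,
      keptLabels_cuspLabels x m₁ m₂ m hn.2.1 hl, ← slideDown_eq_mixedSlide, chordSum_mul]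
    · intro c hc hca
      obtain rfl : c = a := by simpa using hca
      simp [count_eq_zero.2 hn.2.1]
    · simpa using Ne.symm hn.1.2
    · intro p' s' hp hs' hperm
      obtain ⟨p, rfl, hlp⟩ := exists_of_lettersMask_eq hp
      have hc : IsChordWord (u ++ (a :: (p ++ [a]) ++ s' :: v)) := by
        refine h.perm (Perm.append_left u ?_)
        simpa using hperm.symm.append_right v
      rw [hcusp (hlp.trans hl) hc, if_pos rfl, filter_cusp (notMem_of_isChordWord_cusp hc).1]
  · rw [if_neg hab, chordSum_mixedSlide_congr ρ s (F' := fun _ => 0) _ h hk hlab ?_]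
    · simpa [chordSum] using wordSum_mul ρ (mixedSlide k s (cuspLabels x ys m₁ m₂ m)) 0 (fun _ => 0)
        (chordMatching (u ++ t :: (a :: (zs ++ [b]) ++ v)))
    · intro p s' hp hs' hperm _
      have hlp : p.length = zs.length + 2 := by
        simpa [doubledLetters] using congrArg length hp
      obtain _ | ⟨a', p⟩ := p
      · simp at hlp
      obtain rfl | ⟨p, b', rfl⟩ := eq_nil_or_concat' p
      · simp at hlp
      have hlp' : p.length = zs.length := by simpa using hlp
      have hc : IsChordWord (u ++ (a' :: (p ++ [b']) ++ s' :: v)) := by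
        refine h.perm (Perm.append_left u ?_)
        simpa using hperm.symm.append_right v
      rw [hcusp (hlp'.trans hl) hc, if_neg]
      rintro rfl
      have h2 : (a' :: (p ++ [a'])).count a' = 2 := by
        simp [count_eq_zero.2 (notMem_of_isChordWord_cusp hc).1]
      simp only [doubledLetters, map_cons, map_append, map_nil, cons.injEq] at hp
      have hp' := append_inj hp.2 (by simpa using hlp')
      simp only [cons.injEq, and_true] at hp'
      rw [if_pos h2] at hp hp'
      have h₁ := hp.1
      have h₂ := hp'.2
      split_ifs at h₁ h₂
      exact hab ((Option.some.inj h₁).symm.trans (Option.some.inj h₂))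

lemma chordSum_markedLeftCusp_slide (s x : R) (ys : List R) (m₁ m₂ m : Bool) {t : ℕ} {zs : List ℕ}
    (h : IsChordWord (u ++ t :: (zs ++ v))) (hk : u.length = k) (hl : zs.length = ys.length) :
    chordSum ρ (mirrorWord (markedRightCusp (k + 1) x ys) ++
        mixedSlide k s (cuspLabels x ys m₁ m₂ m)) F (u ++ t :: (zs ++ v)) =
      chordSum ρ (slideDown m k s ys ++ mirrorWord (markedRightCusp k x ys)) F (u ++ t :: (zs ++ v))
        := by
  obtain ⟨c, hc⟩ := exists_notMem (u ++ t :: (zs ++ v))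
  simp only [mem_append, mem_cons, not_or] at hc
  have hins : IsChordWord (u ++ t :: (c :: (zs ++ [c]) ++ v)) := by
    have := IsChordWord.insert (u := u ++ [t]) (v := zs ++ v) (c := c) (by simpa using h)
      (by simp; tauto) (by simp; tauto)
    refine this.perm ?_
    simp only [append_assoc, cons_append, nil_append]
    exact Perm.append_left u ((perm_middle.symm.cons c).cons t)
  have hw : ∀ k, mirrorWord (markedRightCusp k x ys) =
      .leftCusp (k + zs.length) x :: slideUp true k (x + 1) ys := fun k => by
    rw [markedRightCusp, mirrorWord_append, mirrorWord_slideDown, hl]; rfl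
  have h₁ := chordSum_markedLeftCusp ρ (x + 1) x ys
    (wordSum ρ (mixedSlide k s (cuspLabels x ys m₁ m₂ m)) F) (k := k + 1)
    (u := u ++ [t]) (ys := zs) (v := v) (c := c) (by simpa using hins) (by simp [hk]) hl.symm
  simp only [append_assoc, cons_append, nil_append] at h₁
  rw [chordSum_append, chordSum_append, hw, hw, h₁]
  -- The factor `T 1` cancels the weight of the left cusp, so that `F'` inserts the pair after the
  -- slide without extra weight.
  have h₂ := chordSum_mixedSlide_filter ρ s (F := F) (F' := fun g => T 1 *
    wordSum ρ (.leftCusp (k + zs.length) x :: slideUp true k (x + 1) ys) F g)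
    (fun t => t == c) (cuspLabels x ys m₁ m₂ m) hins hk (by simp [cuspLabels, hl]) ?_ ?_ ?_
  · rw [filter_cusp hc.2.2.1, keptLabels_cuspLabels x m₁ m₂ m hc.2.2.1 hl,
      ← slideDown_eq_mixedSlide, chordSum_mul] at h₂
    simp only [chordSum, append_assoc, cons_append, nil_append] at h₂ ⊢
    rw [h₂, ← mul_assoc, ← T_add]
    norm_num [T_zero]
  · intro a ha hac
    obtain rfl : a = c := by simpa using hac
    simp [count_eq_zero.2 hc.2.2.1]
  · simpa using Ne.symm hc.2.1
  · intro p' s' hp hs' hperm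
    obtain ⟨p, rfl, hlp⟩ := exists_of_lettersMask_eq hp
    have hc' : IsChordWord (u ++ (c :: (p ++ [c]) ++ s' :: v)) := by
      refine hins.perm (Perm.append_left u ?_)
      simpa using hperm.symm.append_right v
    have h₃ := chordSum_markedLeftCusp ρ (x + 1) x ys F (k := k)
      (u := u) (ys := p) (v := s' :: v) (c := c) (by simpa using hc') hk (hl.symm.trans hlp.symm)
    rw [filter_cusp (notMem_of_isChordWord_cusp hc').1]
    rw [chordSum, hlp] at h₃
    rw [h₃, ← mul_assoc, ← T_add]
    norm_num [T_zero]

end MarkedCusps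

/-! ### Exchange of vertically disjoint events -/

/-- The words by which an event is replaced in the expansion of `resolvedEventSum`. -/
def IsExpansion (ρ : ℤ) (e : FrontEvent R) {ι : Type} [Fintype ι] (W : ι → Word R) : Prop :=
  ∀ n F f, resolvedEventSum ρ (e.moveTo n) F f = ∑ i, wordSum ρ (shiftWord n (W i)) F f

lemma isExpansion_of_not_vertex (ρ : ℤ) {e : FrontEvent R} (he : ∀ k l r, e ≠ .vertex k l r) :
    IsExpansion ρ e fun _ : Unit => [e.moveTo 0] := fun n F f => by
  rw [resolvedEventSum_of_not_vertex ρ fun k l r h => by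
    cases e with
    | vertex k l r => exact he k l r rfl
    | _ => cases h]
  cases e with
  | vertex k l r => exact absurd rfl (he k l r)
  | _ => simp [shiftWord, FrontEvent.moveTo, FrontEvent.pos, wordSum]

lemma isExpansion_vertex (ρ : ℤ) (k : ℕ) (l r : List R) :
    IsExpansion ρ (.vertex k l r) fun φ : (FrontEvent.vertex 0 l r).Resolution ρ =>
      resolveVertex 0 l r φ.1 := fun n F f => by
  simp only [shiftWord_resolveVertex]
  exact resolvedEventSum_vertex ρ n l r F f

lemma exists_expansion {ρ : ℤ} (hρ : (ρ : R) = 0) {e : FrontEvent R} (he : e.isMarked = false) :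
    ∃ (ι : Type) (_ : Fintype ι) (W : ι → Word R), IsExpansion ρ e W ∧
      ∀ i, Piece ρ e.leftEnds e.rightEnds (W i) := by
  cases e with
  | crossing m k x y =>
    obtain rfl : m = false := he
    exact ⟨Unit, _, _, isExpansion_of_not_vertex ρ (by simp), fun _ => .crossing x y⟩
  | leftCusp k x =>
    exact ⟨Unit, _, _, isExpansion_of_not_vertex ρ (by simp), fun _ =>
      .pure (isPure_markedLeftCusp ρ x [])⟩
  | rightCusp k x =>
    exact ⟨Unit, _, _, isExpansion_of_not_vertex ρ (by simp), fun _ =>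
      .pure (isPure_markedRightCusp ρ x [])⟩
  | vertex k l r =>
    exact ⟨_, _, _, isExpansion_vertex ρ k l r, fun φ => piece_resolveVertex hρ φ.2⟩

lemma FrontEvent.moveTo_pos (e : FrontEvent R) : e.moveTo e.pos = e := by cases e <;> rfl

/-- Both events are expanded into words without vertices, and the exchange is made term by term. The
`j` strands between them become the list `mid` in `FarCommute`. -/
lemma transferEq_exchange {ρ : ℤ} {e f : FrontEvent R} {ι κ : Type} [Fintype ι] [Fintype κ]
    {W : ι → Word R} {W' : κ → Word R} (he : IsExpansion ρ e W) (hf : IsExpansion ρ f W')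
    (h : ∀ i j, FarCommute ρ e.leftEnds e.rightEnds (W i) f.leftEnds f.rightEnds (W' j)) {j : ℕ}
    {a b : List R} (hw : IsFront a [e, f.moveTo (e.pos + e.outSize + j)] b) :
    TransferEq (resolvedEventSum ρ) a [e, f.moveTo (e.pos + e.outSize + j)]
      [f.moveTo (e.pos + e.inSize + j), e] := by
  obtain ⟨c, h₁, b', h₂, -⟩ := hw
  obtain ⟨u, d, hu, rfl, rfl⟩ := h₁.exists_split
  obtain ⟨u', d', hu', hc, -⟩ := h₂.exists_split
  have hpos : ∀ n, (f.moveTo n).pos = n ∧ (f.moveTo n).leftEnds = f.leftEnds := fun n => by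
    cases f <;> exact ⟨rfl, rfl⟩
  rw [(hpos _).1] at hu'
  rw [(hpos _).2, ← append_assoc] at hc
  obtain ⟨mid, rfl, hj⟩ : ∃ mid, d = mid ++ (f.leftEnds ++ d') ∧ mid.length = j := by
    have hl := e.length_rightEnds
    rcases append_eq_append_iff.1 hc with ⟨l, rfl, rfl⟩ | ⟨l, hl', hl''⟩
    · exact ⟨l, rfl, by simp at hu'; omega⟩
    · have := congrArg length hl'
      simp only [length_append] at this
      obtain rfl : l = [] := length_eq_zero_iff.1 (by omega)
      exact ⟨[], by simpa using hl''.symm, by simp at this ⊢; omega⟩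
  intro F g hg
  have he' := he e.pos
  rw [e.moveTo_pos] at he'
  simp only [foldr_cons, foldr_nil]
  have e₁ : ∀ n, resolvedEventSum ρ (f.moveTo n) F =
      fun g => ∑ i, wordSum ρ (shiftWord n (W' i)) F g := fun n => funext fun g => hf n F g
  have e₂ : resolvedEventSum ρ e F = fun g => ∑ i, wordSum ρ (shiftWord e.pos (W i)) F g :=
    funext fun g => he' F g
  rw [he', hf, e₁, e₂]
  simp only [wordSum_sum]
  rw [Finset.sum_comm]
  refine Finset.sum_congr rfl fun i _ => Finset.sum_congr rfl fun i' _ => ?_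
  have := h i' i u mid d' F hg
  rw [← wordSum_eq_foldr, ← wordSum_eq_foldr, wordSum_append, wordSum_append] at this
  have hl := e.length_rightEnds
  have hl' := e.length_leftEnds
  rw [length_append, length_append, length_append, length_append, hl, hl', hu, hj, ← add_assoc,
    ← add_assoc] at this
  exact this

lemma transferEq_exchange_unmarked {ρ : ℤ} (hρ : (ρ : R) = 0) {e f : FrontEvent R} {j : ℕ}
    (he : e.isMarked = false) (hf : f.isMarked = false) {a b : List R}
    (hw : IsFront a [e, f.moveTo (e.pos + e.outSize + j)] b) :
    TransferEq (resolvedEventSum ρ) a [e, f.moveTo (e.pos + e.outSize + j)]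
      [f.moveTo (e.pos + e.inSize + j), e] := by
  obtain ⟨ι, _, W, hW, hp⟩ := exists_expansion hρ he
  obtain ⟨κ, _, W', hW', hp'⟩ := exists_expansion hρ hf
  exact transferEq_exchange hW hW' (fun i i' => (hp i).farCommute hρ (hp' i')) hw

lemma transferEq_exchange_marked {ρ : ℤ} (hρ : (ρ : R) = 0) {e f : FrontEvent R} {j : ℕ}
    (h : e.isMarked = true ∧ f.isMarked = true ∨ e.isMarked = true ∧ f.isCusp = true ∨
      e.isCusp = true ∧ f.isMarked = true) {a b : List R}
    (hw : IsFront a [e, f.moveTo (e.pos + e.outSize + j)] b) :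
    TransferEq (resolvedEventSum ρ) a [e, f.moveTo (e.pos + e.outSize + j)]
      [f.moveTo (e.pos + e.inSize + j), e] := by
  have hm : ∀ {e : FrontEvent R}, e.isMarked = true → ∃ k x y, e = .crossing true k x y := by
    rintro (⟨m, k, x, y⟩ | _ | _ | _) h
    · obtain rfl : m = true := h
      exact ⟨k, x, y, rfl⟩
    all_goals cases h
  have hc : ∀ {e : FrontEvent R}, e.isCusp = true → IsPure ρ e.leftEnds e.rightEnds [e.moveTo 0] ∧
      IsExpansion ρ e fun _ : Unit => [e.moveTo 0] := by
    rintro (_ | ⟨k, x⟩ | ⟨k, x⟩ | _) h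
    · cases h
    · exact ⟨isPure_markedLeftCusp ρ x [], isExpansion_of_not_vertex ρ (by simp)⟩
    · exact ⟨isPure_markedRightCusp ρ x [], isExpansion_of_not_vertex ρ (by simp)⟩
    · cases h
  have hx : ∀ k (x y : R), IsExpansion ρ (.crossing true k x y) fun _ : Unit =>
    [.crossing true 0 x y] := fun k x y => isExpansion_of_not_vertex ρ (by simp)
  rcases h with ⟨he, hf⟩ | ⟨he, hf⟩ | ⟨he, hf⟩
  · obtain ⟨k, x, y, rfl⟩ := hm he
    obtain ⟨k', x', y', rfl⟩ := hm hf
    exact transferEq_exchange (hx _ _ _) (hx _ _ _)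
      (fun _ _ => farCommute_crossings hρ _ _ _ _ _) hw
  · obtain ⟨k, x, y, rfl⟩ := hm he
    exact transferEq_exchange (hx _ _ _) (hc hf).2
      (fun _ _ => farCommute_crossing_pure _ _ _ (hc hf).1) hw
  · obtain ⟨k, x, y, rfl⟩ := hm hf
    exact transferEq_exchange (hc he).2 (hx _ _ _)
      (fun _ _ => farCommute_pure_crossing _ _ _ (hc he).1) hw

/-! ### Triple points and cusps as identities of transfer operators -/

lemma transferEq_triple (ρ : ℤ) {k : ℕ} {x y z : R} {m₁ m₂ m₃ : Bool}
    (h₁ : Switchable ρ m₁ x y → Switchable ρ m₂ x z → Switchable ρ m₃ y z)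
    (h₂ : Switchable ρ m₁ x y → Switchable ρ m₃ y z → Switchable ρ m₂ x z)
    (h₃ : Switchable ρ m₂ x z → Switchable ρ m₃ y z → Switchable ρ m₁ x y) {a b : List R}
    (hw : IsFront a [.crossing m₃ (k + 1) y z, .crossing m₂ k x z, .crossing m₁ (k + 1) x y] b) :
    TransferEq (resolvedEventSum ρ) a
      [.crossing m₁ k x y, .crossing m₂ (k + 1) x z, .crossing m₃ k y z]
      [.crossing m₃ (k + 1) y z, .crossing m₂ k x z, .crossing m₁ (k + 1) x y] := by
  refine transferEq_resolved_of_chordSum (n := k + 3) hw.length_le (by simp [VertexFree])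
    (by simp [VertexFree]) fun F L hL hn => ?_
  obtain ⟨u, xs, v, rfl, hu, hxs⟩ := exists_append_of_le_length hn
  obtain ⟨p, q, s, rfl⟩ := length_eq_three.1 hxs
  exact chordSum_triple ρ F h₁ h₂ h₃ hL hu

lemma transferEq_slide_rightCusp (ρ : ℤ) {k : ℕ} {s x : R} {ys : List R} {m₁ m₂ m : Bool}
    {a b : List R} (hw : IsFront a (.crossing m₁ k s (x + 1) :: (slideDown m (k + 1) s ys ++
      .crossing m₂ (k + 1 + ys.length) s x :: markedRightCusp k x ys)) b) :
    TransferEq (resolvedEventSum ρ) a (.crossing m₁ k s (x + 1) :: (slideDown m (k + 1) s ys ++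
        .crossing m₂ (k + 1 + ys.length) s x :: markedRightCusp k x ys))
      (markedRightCusp (k + 1) x ys ++ slideDown m k s ys) := by
  have hn : k + (1 + (1 + (ys.length + 1))) ≤ a.length := by
    have := IsFront.length_le_of_isBraid (k := k) (n := ys.length + 2)
      (w := .crossing m₁ k s (x + 1) :: slideDown m (k + 1) s ys)
      (isBraid_cons.2 ⟨by omega, (isBraid_slideDown m (k + 1) s ys).mono (by omega) (by omega)⟩) hw
    simp only [FrontEvent.pos, FrontEvent.inSize] at this
    omega
  refine transferEq_resolved_of_chordSum hn
    (vertexFree_cons_crossing ((vertexFree_slideDown _ _ _ _).append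
      (vertexFree_cons_crossing (vertexFree_markedRightCusp _ _ _))))
    ((vertexFree_markedRightCusp _ _ _).append (vertexFree_slideDown _ _ _ _)) fun F L hL hn => ?_
  obtain ⟨u, xs, v, rfl, hu, hxs⟩ := exists_append_of_le_length hn
  obtain _ | ⟨t, _ | ⟨p, xs⟩⟩ := xs
  · simp at hxs
  · simp at hxs
  obtain rfl | ⟨zs, q, rfl⟩ := eq_nil_or_concat' xs
  · simp at hxs; omega
  have := chordSum_slide_markedRightCusp ρ F s x ys m₁ m₂ m (u := u) (t := t) (a := p) (zs := zs)
    (b := q) (v := v) hL hu (by simp at hxs; omega)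
  rw [mixedSlide_cuspLabels] at this
  simpa using this

lemma transferEq_leftCusp_slide (ρ : ℤ) {k : ℕ} {s x : R} {ys : List R} {m₁ m₂ m : Bool}
    {a b : List R} (hw : IsFront a (mirrorWord (markedRightCusp (k + 1) x ys) ++
      mixedSlide k s (cuspLabels x ys m₁ m₂ m)) b) :
    TransferEq (resolvedEventSum ρ) a (mirrorWord (markedRightCusp (k + 1) x ys) ++
      mixedSlide k s (cuspLabels x ys m₁ m₂ m))
      (slideDown m k s ys ++ mirrorWord (markedRightCusp k x ys)) := by
  have hn : k + (1 + ys.length) ≤ a.length := by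
    rw [markedRightCusp, mirrorWord_append] at hw
    have := IsFront.length_le (e := .leftCusp (k + 1 + ys.length) x) hw
    simp only [FrontEvent.pos, FrontEvent.inSize] at this
    omega
  refine transferEq_resolved_of_chordSum hn
    ((vertexFree_markedRightCusp _ _ _).mirror.append (by
      rw [mixedSlide_cuspLabels]
      exact vertexFree_cons_crossing ((vertexFree_slideDown _ _ _ _).append (by simp [VertexFree]))))
    ((vertexFree_slideDown _ _ _ _).append (vertexFree_markedRightCusp _ _ _).mirror)
    fun F L hL hn => ?_
  obtain ⟨u, xs, v, rfl, hu, hxs⟩ := exists_append_of_le_length hn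
  obtain _ | ⟨t, zs⟩ := xs
  · simp at hxs; omega
  exact chordSum_markedLeftCusp_slide ρ F s x ys m₁ m₂ m (t := t) (zs := zs) hL hu
    (by simp at hxs; omega)

/-- The mirror image is a strand descending over the branches of a left cusp, which has been
computed directly; transposition carries the identity back. -/
lemma transferEq_slideUp_rightCusp {ρ : ℤ} (hρ : (ρ : R) = 0) {k : ℕ} {s x : R} {ys : List R}
    {m₁ m₂ m : Bool} {a b : List R}
    (hw : IsFront a (.crossing m₂ (k + 1 + ys.length) x s :: (slideUp m (k + 1) s ys ++
          .crossing m₁ k (x + 1) s :: markedRightCusp (k + 1) x ys)) b)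
    (hw' : IsFront a (markedRightCusp k x ys ++ slideUp m k s ys) b) :
    TransferEq (resolvedEventSum ρ) a
      (.crossing m₂ (k + 1 + ys.length) x s :: (slideUp m (k + 1) s ys ++
        .crossing m₁ k (x + 1) s :: markedRightCusp (k + 1) x ys))
      (markedRightCusp k x ys ++ slideUp m k s ys) := by
  have e₁ : mirrorWord (.crossing m₂ (k + 1 + ys.length) x s :: (slideUp m (k + 1) s ys ++
      .crossing m₁ k (x + 1) s :: markedRightCusp (k + 1) x ys)) =
      mirrorWord (markedRightCusp (k + 1) x ys) ++ mixedSlide k s (cuspLabels x ys m₁ m₂ m) := by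
    rw [mixedSlide_cuspLabels, mirrorWord_cons, mirrorWord_append, mirrorWord_cons,
      mirrorWord_slideUp]
    simp [FrontEvent.mirror]
  have e₂ : mirrorWord (markedRightCusp k x ys ++ slideUp m k s ys) =
      slideDown m k s ys ++ mirrorWord (markedRightCusp k x ys) := by
    rw [mirrorWord_append, mirrorWord_slideUp]
  have h₁ := isFront_mirrorWord hw
  have h₂ := isFront_mirrorWord hw'
  have := TransferEq.mirror (isTransfer_resolvedEventSum hρ) h₁ h₂ (by
    rw [e₁] at h₁ ⊢
    rw [e₂]
    exact transferEq_leftCusp_slide ρ h₁)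
  rwa [mirrorWord_mirrorWord, mirrorWord_mirrorWord] at this

/-! ### The moves at a vertex -/

lemma resolvedEventSum_vertex_eq (ρ : ℤ) (k : ℕ) (l r : List R) (F : StateFun) :
    resolvedEventSum ρ (.vertex k l r) F = fun f =>
      ∑ φ : (FrontEvent.vertex 0 l r).Resolution ρ, wordSum ρ (resolveVertex k l r φ.1) F f := rfl

lemma transferEq_slide_vertex (ρ : ℤ) {k : ℕ} {s : R} {l r : List R} {a b : List R}
    (hw : IsFront a (.vertex (k + 1) l r :: slideDown false k s r) b) :
    TransferEq (resolvedEventSum ρ) a (slideDown false k s l ++ [.vertex k l r])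
      (.vertex (k + 1) l r :: slideDown false k s r) := by
  rintro F f ⟨Z, hZ, rfl, rfl⟩
  have hn : k + (1 + l.length) ≤ (Z.map Prod.fst).length := by
    have := hw.length_le
    simp only [FrontEvent.pos, FrontEvent.inSize, length_map] at this ⊢
    omega
  obtain ⟨u, xs, v, hL, hu, hxs⟩ := exists_append_of_le_length hn
  obtain _ | ⟨t, zs⟩ := xs
  · simp at hxs; omega
  have hc := hZ.1
  obtain ⟨χ, rfl⟩ := exists_map_eq_of_nodup (xs := zs) (nodup_range' r.length l.length)
    (by simp at hxs ⊢; omega)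
  rw [hL] at hc ⊢
  rw [foldr_append, (vertexFree_slideDown _ _ _ _).foldr_eq, foldr_cons, foldr_nil, foldr_cons,
    (vertexFree_slideDown _ _ _ _).foldr_eq, resolvedEventSum_vertex_eq, resolvedEventSum_vertex_eq,
    wordSum_sum]
  refine Finset.sum_congr rfl fun φ _ => ?_
  have := chordSum_slide_resolveVertex ρ s φ.2 F χ hu hc
  rwa [chordSum, chordSum, wordSum_append, wordSum_append] at this

/-- An ascending strand becomes a descending one under reflection, with the two sides of the vertex
and of the move exchanged. -/
lemma transferEq_slideUp_vertex {ρ : ℤ} (hρ : (ρ : R) = 0) {k : ℕ} {s : R} {l r : List R}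
    {a b : List R} (hw : IsFront a (slideUp false k s l ++ [.vertex (k + 1) l r]) b)
    (hw' : IsFront a (.vertex k l r :: slideUp false k s r) b) :
    TransferEq (resolvedEventSum ρ) a (slideUp false k s l ++ [.vertex (k + 1) l r])
      (.vertex k l r :: slideUp false k s r) := by
  have e₁ : mirrorWord (slideUp false k s l ++ [.vertex (k + 1) l r]) =
      .vertex (k + 1) r l :: slideDown false k s l := by
    rw [mirrorWord_append, mirrorWord_slideUp]; rfl
  have e₂ : mirrorWord (.vertex k l r :: slideUp false k s r) =
      slideDown false k s r ++ [.vertex k r l] := by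
    rw [mirrorWord_cons, mirrorWord_slideUp]; rfl
  have h₁ := isFront_mirrorWord hw
  have h₂ := isFront_mirrorWord hw'
  have := TransferEq.mirror (isTransfer_resolvedEventSum hρ) h₁ h₂ (by
    rw [e₁] at h₁ ⊢
    rw [e₂]
    exact (transferEq_slide_vertex ρ h₁).symm)
  rwa [mirrorWord_mirrorWord, mirrorWord_mirrorWord] at this

lemma transferEq_rotate_top (ρ : ℤ) {k : ℕ} {x : R} {l r : List R} {a b : List R}
    (hw : IsFront a [.vertex k (x :: l) r] b) :
    TransferEq (resolvedEventSum ρ) a [.vertex k (x :: l) r] (.vertex (k + 1) l (r ++ [x - 1]) ::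
        (slideDown false k x r ++ [.rightCusp (k + r.length) (x - 1)])) := by
  rintro F f ⟨Z, hZ, rfl, rfl⟩
  have hn : k + (l.length + 1) ≤ (Z.map Prod.fst).length := by
    simpa only [FrontEvent.pos, FrontEvent.inSize, length_map, length_cons] using hw.length_le
  obtain ⟨u, xs, v, hL, hu, hxs⟩ := exists_append_of_le_length hn
  have hc := hZ.1
  obtain ⟨χ, rfl⟩ := exists_map_eq_of_nodup (xs := xs) (nodup_range' r.length (l.length + 1))
    (by simpa using hxs.symm)
  rw [hL] at hc ⊢
  rw [foldr_cons, foldr_nil, foldr_cons, VertexFree.foldr_eq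
    ((vertexFree_slideDown _ _ _ _).append (by simp [VertexFree])), resolvedEventSum_vertex_eq,
    resolvedEventSum_vertex_eq]
  refine Fintype.sum_equiv (ι := (FrontEvent.vertex 0 (x :: l) r).Resolution ρ)
    (κ := (FrontEvent.vertex 0 l (r ++ [x - 1])).Resolution ρ) (Equiv.subtypeEquivRight (isGradedVertexMatching_rotate ρ l r x)) _ _
    fun φ => ?_
  have := chordSum_resolveVertex_rotate (ρ := ρ) φ.2 F χ (v := v) hu
    (by simpa [range'_succ] using hc)
  rw [chordSum, chordSum, wordSum_append] at this
  exact this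

lemma isFront_slideUp (m : Bool) (u : List R) (x : R) (l d : List R) :
    IsFront (u ++ (l ++ x :: d)) (slideUp m u.length x l) (u ++ x :: (l ++ d)) := by
  rw [← mirrorWord_slideDown]
  exact isFront_mirrorWord (isFront_slideDown m u x l d)

lemma slideUp_append (m : Bool) (k : ℕ) (x : R) (l l' : List R) :
    slideUp m k x (l ++ l') = slideUp m (k + l.length) x l' ++ slideUp m k x l := by
  rw [← mirrorWord_slideDown, slideDown_append, mirrorWord_append, mirrorWord_slideDown,
    mirrorWord_slideDown]

lemma shiftWord_slideUp (j : ℕ) (m : Bool) (k : ℕ) (x : R) (l : List R) :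
    shiftWord j (slideUp m k x l) = slideUp m (j + k) x l := by
  rw [← mirrorWord_slideDown, shiftWord_mirrorWord, shiftWord_slideDown, mirrorWord_slideDown]

lemma piece_slideUp (ρ : ℤ) (x : R) (l : List R) :
    Piece ρ (l ++ [x]) (x :: l) (slideUp false 0 x l) := by
  induction l with
  | nil => exact .nil _
  | cons y l ih =>
    have := Piece.append (l := y :: (l ++ [x])) (m := [y, x] ++ l) (by simpa using ih.extend [y] [])
      ((Piece.crossing (ρ := ρ) y x).extend [] l)
    simpa [shiftWord_slideUp, shiftWord_cons, FrontEvent.moveTo, FrontEvent.pos, slideUp] using this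

lemma transferEq_slideUp_crossing {ρ : ℤ} (hρ : (ρ : R) = 0) (u l d : List R) (x y z : R) :
    TransferEq (resolvedEventSum ρ) (u ++ (l ++ x :: y :: z :: d))
      (slideUp false u.length x l ++ [.crossing false (u.length + l.length + 1) y z])
      (.crossing false (u.length + l.length + 1) y z :: slideUp false u.length x l) := by
  have := (piece_slideUp ρ x l).farCommute hρ (.crossing y z) u [] d
  refine TransferEq.resolved ((vertexFree_slideUp _ _ _ _).append (by simp [VertexFree]))
    (vertexFree_cons_crossing (vertexFree_slideUp _ _ _ _)) ?_
  simpa [shiftWord_slideUp, shiftWord_cons, FrontEvent.moveTo, FrontEvent.pos, add_assoc] using this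

lemma transferEq_crossing_slideUp {ρ : ℤ} (hρ : (ρ : R) = 0) (u l d : List R) (x y z : R) :
    TransferEq (resolvedEventSum ρ) (u ++ y :: z :: (l ++ x :: d))
      (.crossing false u.length y z :: slideUp false (u.length + 2) x l)
      (slideUp false (u.length + 2) x l ++ [.crossing false u.length y z]) := by
  have := (Piece.crossing y z).farCommute hρ (piece_slideUp ρ x l) u [] d
  refine TransferEq.resolved (vertexFree_cons_crossing (vertexFree_slideUp _ _ _ _))
    ((vertexFree_slideUp _ _ _ _).append (by simp [VertexFree])) ?_
  simpa [shiftWord_slideUp, shiftWord_cons, FrontEvent.moveTo, FrontEvent.pos, add_assoc] using this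

/-- Two strands about to form a cusp may be pulled up over the strands of `l` before they do so. For
each strand of `l` this is a far commutation and one move (II). -/
lemma transferEq_slideUp_slideUp_rightCusp {ρ : ℤ} (hρ : (ρ : R) = 0) (u l d : List R) (x : R) :
    TransferEq (resolvedEventSum ρ) (u ++ (l ++ (x + 1) :: x :: d))
      (slideUp false u.length (x + 1) l ++ (slideUp false (u.length + 1) x l ++
        [.rightCusp u.length x])) [.rightCusp (u.length + l.length) x] := by
  induction l generalizing u with
  | nil => exact .refl
  | cons y l ih =>
    have hE := isTransfer_resolvedEventSum (R := R) hρ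
    have f₁ : IsFront (u ++ (y :: l ++ (x + 1) :: x :: d)) (slideUp false (u.length + 1) (x + 1) l)
        (u ++ y :: (x + 1) :: (l ++ x :: d)) := by
      simpa using isFront_slideUp false (u ++ [y]) (x + 1) l (x :: d)
    have f₂ : IsFront (u ++ y :: (x + 1) :: (l ++ x :: d)) (slideUp false (u.length + 2) x l)
        (u ++ y :: (x + 1) :: x :: (l ++ d)) := by
      simpa using isFront_slideUp false (u ++ [y, x + 1]) x l d
    have f₃ : IsFront (u ++ y :: (x + 1) :: x :: (l ++ d))
        [.crossing false u.length y (x + 1), .crossing false (u.length + 1) y x,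
          .rightCusp u.length x] (u ++ y :: (l ++ d)) := by
      refine ⟨_, .crossing false u _ y (x + 1), u ++ (x + 1) :: x :: y :: (l ++ d), ?_, _,
        .rightCusp u _ x, rfl⟩
      simpa using FrontEvent.Step.crossing false (u ++ [x + 1]) (l ++ d) y x
    have h₁ := ((transferEq_crossing_slideUp hρ u l d x y (x + 1)).append_right
      [.crossing false (u.length + 1) y x, .rightCusp u.length x]).append_left hE f₁
    have h₂ : TransferEq (resolvedEventSum ρ) _ _ _ :=
      transferEq_slide_rightCusp ρ (k := u.length) (s := y) (x := x) (ys := []) (m₁ := false)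
        (m₂ := false) (m := false) f₃
    have h₃ := (h₂.append_left hE f₂).append_left hE f₁
    have h₄ := ih (u ++ [y])
    simp only [slideUp, slideDown, markedRightCusp, length_append, length_cons, length_nil,
      append_assoc, cons_append, nil_append, append_nil, zero_add, add_zero, add_assoc,
      Nat.reduceAdd, add_comm 1 l.length] at h₁ h₃ h₄ ⊢
    exact (h₁.trans h₃).trans h₄

lemma transferEq_kink_above {ρ : ℤ} {k : ℕ} {x y : R} {a : List R} (ha : k + 1 ≤ a.length) :
    TransferEq (resolvedEventSum ρ) a []
      [.leftCusp k y, .crossing false (k + 1) x x, .rightCusp k y] := by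
  refine transferEq_resolved_of_chordSum ha (by simp [VertexFree]) (by simp [VertexFree])
    fun F L hL hn => ?_
  obtain ⟨u, xs, v, rfl, hu, hxs⟩ := exists_append_of_le_length hn
  obtain ⟨s, rfl⟩ := length_eq_one_iff.1 hxs
  exact (chordSum_kink_above ρ F x y hL hu).symm

lemma transferEq_kink_below {ρ : ℤ} {k : ℕ} {x y : R} {a : List R} (ha : k + 1 ≤ a.length) :
    TransferEq (resolvedEventSum ρ) a []
      [.leftCusp (k + 1) y, .crossing false k x x, .rightCusp (k + 1) y] := by
  refine transferEq_resolved_of_chordSum ha (by simp [VertexFree]) (by simp [VertexFree])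
    fun F L hL hn => ?_
  obtain ⟨u, xs, v, rfl, hu, hxs⟩ := exists_append_of_le_length hn
  obtain ⟨s, rfl⟩ := length_eq_one_iff.1 hxs
  exact (chordSum_kink_below ρ F x y hL hu).symm

/-- This version follows from other moves. A kink is created on the bottom left edge and its two new
branches are pulled up over `l`. The right cusp is then carried past the vertex, and the branch of
potential `x` is moved across it by move (IV). What is left around the vertex is the mirror image of
the turn of a top left edge, and undoing that turn gives the claim. -/
lemma transferEq_rotate_bottom {ρ : ℤ} (hρ : (ρ : R) = 0) {k : ℕ} {x : R} {l r a b : List R}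
    (hw : IsFront a [.vertex k (l ++ [x]) r] b) :
    TransferEq (resolvedEventSum ρ) a [.vertex k (l ++ [x]) r]
      (.vertex k l ((x + 1) :: r) :: (slideUp false (k + 1) x r ++ [.rightCusp k x])) := by
  have hE := isTransfer_resolvedEventSum (R := R) hρ
  obtain ⟨_, h, -⟩ := hw
  obtain ⟨u, d, rfl, rfl, hev⟩ : ∃ u d, u.length = k ∧ a = u ++ ((l ++ [x]) ++ d) ∧
      Even ((l ++ [x]).length + r.length) := by
    generalize he : FrontEvent.vertex k (l ++ [x]) r = e at h
    cases h with
    | vertex u d l₁ r₁ hev =>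
      injection he with h₁ h₂ h₃
      subst h₂ h₃
      exact ⟨u, d, h₁.symm, rfl, hev⟩
    | _ => cases he
  have hev' : Even (l.length + ((x + 1) :: r).length) := by
    simp at hev ⊢; rwa [add_assoc, add_comm 1] at hev
  have f₁ : IsFront (u ++ ((l ++ [x]) ++ d)) [.leftCusp (u.length + l.length) x]
      (u ++ (l ++ (x + 1) :: x :: x :: d)) :=
    ⟨_, by simpa using FrontEvent.Step.leftCusp (u ++ l) (x :: d) x, rfl⟩
  have f₂ := isFront_slideUp false u (x + 1) l (x :: x :: d)
  have f₁₂ := isFront_append.2 ⟨_, f₁, f₂⟩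
  have f₃ : IsFront (u ++ (x + 1) :: (l ++ x :: x :: d)) (slideUp false (u.length + 1) x (l ++ [x]))
      (u ++ (x + 1) :: x :: ((l ++ [x]) ++ d)) := by
    simpa using isFront_slideUp false (u ++ [x + 1]) x (l ++ [x]) d
  have f₄ : IsFront (u ++ (l ++ (x + 1) :: x :: x :: d))
      [.crossing false (u.length + l.length + 1) x x] (u ++ (l ++ (x + 1) :: x :: x :: d)) :=
    ⟨_, by simpa [add_assoc] using FrontEvent.Step.crossing false (u ++ (l ++ [x + 1])) d x x, rfl⟩
  -- the pair of branches can be pulled back through `l`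
  have h₁ : TransferEq (resolvedEventSum ρ) (u ++ ((l ++ [x]) ++ d)) []
      (.leftCusp (u.length + l.length) x :: (slideUp false u.length (x + 1) l ++
        (slideUp false (u.length + 1) x (l ++ [x]) ++ [.rightCusp u.length x]))) := by
    refine (transferEq_kink_above (k := u.length + l.length) (x := x) (y := x) (by simp)).trans ?_
    have e₁ := (transferEq_slideUp_slideUp_rightCusp hρ u l (x :: d) x).symm
    have e₂ := (e₁.append_left hE f₄).append_left hE f₁
    have e₃ := (((transferEq_slideUp_crossing hρ u l d (x + 1) x x).append_right
      (slideUp false (u.length + 1) x l ++ [.rightCusp u.length x])).symm).append_left hE f₁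
    have := e₂.trans (by simpa using e₃)
    rw [slideUp_append]
    simpa [slideUp, add_right_comm u.length 1] using this
  have h₂ := transferEq_exchange_unmarked hρ (e := .rightCusp u.length x)
    (f := .vertex 0 (l ++ [x]) r) (j := 0) rfl rfl
    ⟨_, .rightCusp u _ x, _, .vertex u d (l ++ [x]) r hev, rfl⟩
  have h₃ := (h₂.append_left hE f₃).append_left hE f₁₂
  have h₄ : TransferEq (resolvedEventSum ρ) (u ++ (x + 1) :: (l ++ x :: x :: d)) _ _ :=
    transferEq_slideUp_vertex hρ (k := u.length + 1) (s := x) (l := l ++ [x]) (r := r)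
    (b := u ++ (x + 1) :: x :: (r ++ d))
    (isFront_append.2 ⟨_, f₃, _, by
      simpa using FrontEvent.Step.vertex (u ++ [x + 1, x]) d (l ++ [x]) r hev, rfl⟩)
    ⟨u ++ (x + 1) :: (r ++ x :: d), by
      simpa using FrontEvent.Step.vertex (u ++ [x + 1]) (x :: d) (l ++ [x]) r hev, by
      simpa using isFront_slideUp false (u ++ [x + 1]) x r d⟩
  have h₅ := (h₄.append_right [.rightCusp u.length x]).append_left hE f₁₂
  -- The turn of a top left edge is applied to the reflected vertex, whose top left edge has
  -- potential `x + 1`.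
  have g₁ : IsFront (u ++ (((x + 1) :: r) ++ x :: d)) [.vertex u.length ((x + 1) :: r) l]
      (u ++ (l ++ x :: d)) := ⟨_, .vertex u (x :: d) ((x + 1) :: r) l (by rwa [add_comm]), rfl⟩
  have g₂ : IsFront (u ++ (((x + 1) :: r) ++ x :: d))
      (.vertex (u.length + 1) r (l ++ [x + 1 - 1]) :: (slideDown false u.length (x + 1) l ++
        [.rightCusp (u.length + l.length) (x + 1 - 1)])) (u ++ (l ++ x :: d)) := by
    rw [add_sub_cancel_right]
    refine ⟨u ++ (x + 1) :: ((l ++ [x]) ++ x :: d), ?_, ?_⟩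
    · simpa using FrontEvent.Step.vertex (u ++ [x + 1]) (x :: d) r (l ++ [x]) (by rwa [add_comm])
    · refine isFront_append.2 ⟨u ++ (l ++ (x + 1) :: x :: x :: d), ?_, _, ?_, rfl⟩
      · simpa using isFront_slideDown false u (x + 1) l (x :: x :: d)
      · simpa using FrontEvent.Step.rightCusp (u ++ l) (x :: d) x
  have h₆ := TransferEq.mirror hE g₁ g₂ (transferEq_rotate_top ρ g₁)
  have h₇ := h₆.append_right (slideUp false (u.length + 1) x r ++ [.rightCusp u.length x])
  have h₈ := h₁.append_right [.vertex u.length (l ++ [x]) r]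
  simp only [mirrorWord_cons, mirrorWord_append, mirrorWord_slideDown, add_sub_cancel_right] at h₇
  simp only [FrontEvent.pos, FrontEvent.inSize, FrontEvent.outSize, FrontEvent.moveTo,
    FrontEvent.mirror, mirrorWord, reverse_nil, map_nil, append_assoc,
    cons_append, nil_append, add_zero]
    at h₃ h₅ h₇ h₈ ⊢
  exact ((h₈.trans h₃).trans h₅).trans h₇.symm

lemma switchable_eq_iff {ρ : ℤ} (hρ : (ρ : R) = 0) {x y : R} : Switchable ρ false x y ↔ x = y := by
  rw [Switchable, dvd_sub_iff_eq hρ]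
  exact and_iff_right rfl

lemma IsFront.kink_length {k : ℕ} {x y : R} {i : ℕ} {w : Word R} {a b : List R} {m : Bool}
    (h : IsFront a (.leftCusp i y :: .crossing m k x x :: w) b) : k ≤ a.length := by
  obtain ⟨c, h, h'⟩ := h
  have h₁ := h.length_eq.2
  have h₂ := h'.length_le
  simp only [FrontEvent.inSize, FrontEvent.outSize, FrontEvent.pos] at h₁ h₂
  omega

lemma ReidemeisterMove.transferEq {ρ : ℤ} (hρ : (ρ : R) = 0) {w w' : Word R}
    (h : ReidemeisterMove w w') {a b : List R} (hw : IsFront a w b) (hw' : IsFront a w' b) :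
    TransferEq (resolvedEventSum ρ) a w w' := by
  induction h generalizing a b with
  | move0 e f j he hf => exact transferEq_exchange_unmarked hρ he hf hw
  | moveI_below k x => exact transferEq_kink_below hw'.length_le
  | moveI_above k x => exact transferEq_kink_above hw'.kink_length
  | moveII_down k s x =>
    exact transferEq_slide_rightCusp ρ (ys := []) (m₁ := false) (m₂ := false) (m := false) hw
  | moveII_up k s x =>
    exact transferEq_slideUp_rightCusp hρ (ys := []) (m₁ := false) (m₂ := false) (m := false) hw hw'
  | moveIII k x y z =>
    refine transferEq_triple ρ ?_ ?_ ?_ hw' <;> simp only [switchable_eq_iff hρ]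
    · rintro rfl rfl; rfl
    · rintro rfl rfl; rfl
    · rintro rfl rfl; rfl
  | moveIV_down k s l r => exact transferEq_slide_vertex ρ hw'
  | moveIV_up k s l r => exact transferEq_slideUp_vertex hρ hw hw'
  | moveV_top k x l r => exact transferEq_rotate_top ρ hw
  | moveV_bottom k x l r => exact transferEq_rotate_bottom hρ hw
  | mirror _ ih =>
    have h₁ := isFront_mirrorWord hw
    have h₂ := isFront_mirrorWord hw'
    rw [mirrorWord_mirrorWord] at h₁ h₂
    exact TransferEq.mirror (isTransfer_resolvedEventSum hρ) h₁ h₂ (ih h₁ h₂)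

lemma MarkedReidemeisterMove.transferEq {ρ : ℤ} (hρ : (ρ : R) = 0) {w w' : Word R}
    (h : MarkedReidemeisterMove w w') {a b : List R} (hw : IsFront a w b) (hw' : IsFront a w' b) :
    TransferEq (resolvedEventSum ρ) a w w' := by
  induction h generalizing a b with
  | move0 e f j h => exact transferEq_exchange_marked hρ h hw
  | moveII_down k s x ys m₁ m₂ m => exact transferEq_slide_rightCusp ρ hw
  | moveII_up k s x ys m₁ m₂ m => exact transferEq_slideUp_rightCusp hρ hw hw'
  | moveIII k x y z m₁ m₂ m₃ h =>
    -- At most one of the three crossings is regular, so no two of them are switchable and the three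
    -- conditions are vacuous.
    refine transferEq_triple ρ ?_ ?_ ?_ hw' <;>
    · intro h₁ h₂
      have h₃ := h₁.1
      have h₄ := h₂.1
      simp [h₃, h₄] at h
  | moveS k s x =>
    have hn : k + 3 ≤ a.length := hw'.length_le
    refine transferEq_resolved_of_chordSum hn (by simp [VertexFree]) (by simp [VertexFree])
      fun F L hL hn => ?_
    obtain ⟨u, xs, v, rfl, hu, hxs⟩ := exists_append_of_le_length hn
    obtain ⟨p, q, s, rfl⟩ := length_eq_three.1 hxs
    exact chordSum_cusp_exit ρ F _ _ _ _ hL hu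
  | moveT k x y m =>
    refine transferEq_resolved_of_chordSum hw.length_le (by simp [VertexFree]) (by simp [VertexFree])
      fun F L hL hn => ?_
    obtain ⟨u, xs, v, rfl, hu, hxs⟩ := exists_append_of_le_length hn
    obtain ⟨p, q, rfl⟩ := length_eq_two.1 hxs
    exact chordSum_cancel_marked ρ F m x y x y hL hu
  | mirror _ ih =>
    have h₁ := isFront_mirrorWord hw
    have h₂ := isFront_mirrorWord hw'
    rw [mirrorWord_mirrorWord] at h₁ h₂
    exact TransferEq.mirror (isTransfer_resolvedEventSum hρ) h₁ h₂ (ih h₁ h₂)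

end Transfer

/-! ### Reduction of the potentials modulo `ρ` -/

section Reduction

variable {R S : Type} [CommRing R] [CommRing S]

/-- The same event with its potentials replaced by their images. -/
def FrontEvent.map (π : R → S) : FrontEvent R → FrontEvent S
  | .crossing m k x y => .crossing m k (π x) (π y)
  | .leftCusp k x => .leftCusp k (π x)
  | .rightCusp k x => .rightCusp k (π x)
  | .vertex k l r => .vertex k (l.map π) (r.map π)

lemma FrontEvent.Step.map (π : R →+* S) {e : FrontEvent R} {a b : List R} (h : e.Step a b) :
    (e.map π).Step (a.map π) (b.map π) := by
  cases h with
  | crossing m u d x y =>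
    simpa [FrontEvent.map] using FrontEvent.Step.crossing m (u.map π) (d.map π) (π x) (π y)
  | leftCusp u d x =>
    simpa [FrontEvent.map] using FrontEvent.Step.leftCusp (u.map π) (d.map π) (π x)
  | rightCusp u d x =>
    simpa [FrontEvent.map] using FrontEvent.Step.rightCusp (u.map π) (d.map π) (π x)
  | vertex u d l r h =>
    simpa [FrontEvent.map] using FrontEvent.Step.vertex (u.map π) (d.map π) (l.map π) (r.map π)
      (by simpa using h)

lemma IsFront.map (π : R →+* S) {w : Word R} {a b : List R} (h : IsFront a w b) :
    IsFront (a.map π) (w.map (FrontEvent.map π)) (b.map π) := by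
  induction w generalizing a with
  | nil => exact congrArg _ h
  | cons e w ih =>
    obtain ⟨c, h, h'⟩ := h
    exact ⟨_, h.map π, ih h'⟩

lemma map_mirrorWord (π : R → S) (w : Word R) :
    (mirrorWord w).map (FrontEvent.map π) = mirrorWord (w.map (FrontEvent.map π)) := by
  rw [mirrorWord, mirrorWord, map_map, ← map_reverse, map_map]
  refine map_congr_left fun e _ => ?_
  cases e <;> rfl

lemma map_slideDown (π : R → S) (m : Bool) (k : ℕ) (x : R) (l : List R) :
    (slideDown m k x l).map (FrontEvent.map π) = slideDown m k (π x) (l.map π) := by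
  induction l generalizing k with
  | nil => rfl
  | cons y l ih => rw [slideDown, map_cons, ih]; rfl

lemma map_slideUp (π : R → S) (m : Bool) (k : ℕ) (x : R) (l : List R) :
    (slideUp m k x l).map (FrontEvent.map π) = slideUp m k (π x) (l.map π) := by
  rw [← mirrorWord_slideDown, map_mirrorWord, map_slideDown, mirrorWord_slideDown]

lemma map_markedRightCusp (π : R →+* S) (k : ℕ) (x : R) (l : List R) :
    (markedRightCusp k x l).map (FrontEvent.map π) = markedRightCusp k (π x) (l.map π) := by
  simp [markedRightCusp, map_slideDown, FrontEvent.map]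

lemma FrontEvent.map_moveTo (π : R → S) (k : ℕ) (e : FrontEvent R) :
    (e.moveTo k).map π = (e.map π).moveTo k := by cases e <;> rfl

lemma FrontEvent.map_data (π : R → S) (e : FrontEvent R) :
    (e.map π).pos = e.pos ∧ (e.map π).inSize = e.inSize ∧ (e.map π).outSize = e.outSize ∧
      (e.map π).isMarked = e.isMarked ∧ (e.map π).isCusp = e.isCusp := by
  cases e <;> simp [FrontEvent.map, pos, inSize, outSize, isMarked, isCusp]

lemma ReidemeisterMove.map (π : R →+* S) {w w' : Word R} (h : ReidemeisterMove w w') :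
    ReidemeisterMove (w.map (FrontEvent.map π)) (w'.map (FrontEvent.map π)) := by
  induction h with
  | move0 e f j he hf =>
    have h₁ := e.map_data π
    have := move0 (e.map π) (f.map π) j (by rwa [h₁.2.2.2.1]) (by rwa [(f.map_data π).2.2.2.1])
    rw [h₁.1, h₁.2.1, h₁.2.2.1] at this
    simpa only [map_cons, map_nil, FrontEvent.map_moveTo] using this
  | moveI_below k x => simpa [FrontEvent.map] using moveI_below k (π x)
  | moveI_above k x => simpa [FrontEvent.map] using moveI_above k (π x)
  | moveII_down k s x =>
    simpa [FrontEvent.map, map_slideDown] using moveII_down k (π s) (π x)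
  | moveII_up k s x => simpa [FrontEvent.map, map_slideUp] using moveII_up k (π s) (π x)
  | moveIII k x y z => exact moveIII k (π x) (π y) (π z)
  | moveIV_down k s l r =>
    simpa [FrontEvent.map, map_slideDown] using moveIV_down k (π s) (l.map π) (r.map π)
  | moveIV_up k s l r =>
    simpa [FrontEvent.map, map_slideUp] using moveIV_up k (π s) (l.map π) (r.map π)
  | moveV_top k x l r =>
    simpa [FrontEvent.map, map_slideDown] using moveV_top k (π x) (l.map π) (r.map π)
  | moveV_bottom k x l r =>
    simpa [FrontEvent.map, map_slideUp] using moveV_bottom k (π x) (l.map π) (r.map π)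
  | mirror _ ih => rw [map_mirrorWord, map_mirrorWord]; exact ih.mirror

lemma MarkedReidemeisterMove.map (π : R →+* S) {w w' : Word R} (h : MarkedReidemeisterMove w w') :
    MarkedReidemeisterMove (w.map (FrontEvent.map π)) (w'.map (FrontEvent.map π)) := by
  induction h with
  | move0 e f j h =>
    have h₁ := e.map_data π
    have h₂ := f.map_data π
    have := move0 (e.map π) (f.map π) j
      (by rwa [h₁.2.2.2.1, h₂.2.2.2.1, h₁.2.2.2.2, h₂.2.2.2.2])
    rw [h₁.1, h₁.2.1, h₁.2.2.1] at this
    simpa only [map_cons, map_nil, FrontEvent.map_moveTo] using this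
  | moveII_down k s x ys m₁ m₂ m =>
    simpa [FrontEvent.map, map_slideDown, map_markedRightCusp] using
      moveII_down k (π s) (π x) (ys.map π) m₁ m₂ m
  | moveII_up k s x ys m₁ m₂ m =>
    simpa [FrontEvent.map, map_slideUp, map_markedRightCusp] using
      moveII_up k (π s) (π x) (ys.map π) m₁ m₂ m
  | moveIII k x y z m₁ m₂ m₃ h => exact moveIII k (π x) (π y) (π z) m₁ m₂ m₃ h
  | moveS k s x => simpa [FrontEvent.map] using moveS k (π s) (π x)
  | moveT k x y m => exact moveT k (π x) (π y) m
  | mirror _ ih => rw [map_mirrorWord, map_mirrorWord]; exact ih.mirror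

lemma map_sortedPotentials (π : R → S) (st : List (ℕ × R)) :
    (sortedPotentials st).map π = sortedPotentials (st.map (Prod.map id π)) := by
  rw [sortedPotentials, sortedPotentials, ← map_insertionSort (fun s t => s.1 ≤ t.1) _
    (Prod.map id π) st (by simp), map_map, map_map]
  rfl

lemma filter_map_prodMap (π : R → S) (q : ℕ → Bool) (st : List (ℕ × R)) :
    (st.map (Prod.map id π)).filter (fun t => q t.1) =
      (st.filter fun t => q t.1).map (Prod.map id π) := by
  rw [filter_map]; rfl

lemma map_permutationBraid (π : R → S) (k : ℕ) (st : List (ℕ × R)) :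
    (permutationBraid k st).map (FrontEvent.map π) =
      permutationBraid k (st.map (Prod.map id π)) := by
  induction st generalizing k with
  | nil => rfl
  | cons t st ih =>
    rw [permutationBraid, map_append, ih, map_slideDown, map_sortedPotentials,
      ← filter_map_prodMap π fun i => decide (i < t.1)]
    rfl

lemma map_complementBraid (π : R → S) (k : ℕ) (st : List (ℕ × R)) :
    (complementBraid k st).map (FrontEvent.map π) = complementBraid k (st.map (Prod.map id π)) := by
  induction st generalizing k with
  | nil => rfl
  | cons t st ih =>
    rw [complementBraid, map_append, ih, map_slideDown, map_sortedPotentials,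
      ← filter_map_prodMap π fun i => decide (t.1 < i)]
    rw [map_cons, complementBraid, filter_map_prodMap π fun i => decide (i < (Prod.map id π t).1),
      length_map]
    rfl

lemma map_markedRightCusps (π : R → S) (k : ℕ) (μ : ℕ → R) (φ : ℕ → ℕ) (s n : ℕ) :
    (markedRightCusps k μ φ s n).map (FrontEvent.map π) =
      markedRightCusps k (fun t => π (μ t)) φ s n := by
  rw [markedRightCusps, markedRightCusps, map_flatMap]
  refine flatMap_congr fun i _ => ?_
  split_ifs
  · simp [map_slideDown, FrontEvent.map, Function.comp_def]
  · rfl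

lemma halfEdgePotential_map (π : R →+* S) (l r : List R) (t : ℕ) :
    halfEdgePotential (l.map π) (r.map π) t = π (halfEdgePotential l r t) := by
  rw [halfEdgePotential, ← map_append, ← map_zero π, getD_map]
  rfl

lemma map_resolveVertex (π : R →+* S) (k : ℕ) (l r : List R) (φ : ℕ → ℕ) :
    (resolveVertex k l r φ).map (FrontEvent.map π) = resolveVertex k (l.map π) (r.map π) φ := by
  have h : (fun t => π (halfEdgePotential l r t)) = halfEdgePotential (l.map π) (r.map π) :=
    funext fun t => (halfEdgePotential_map π l r t).symm
  simp only [resolveVertex, map_append, map_mirrorWord, map_markedRightCusps, map_permutationBraid,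
    map_complementBraid, h, map_map, length_map]
  simp only [Function.comp_def, Prod.map, id, halfEdgePotential_map]

/-- Divisibility by `ρ` is the same before and after `π`. -/
def DetectsDvd (ρ : ℤ) (π : R →+* S) : Prop := ∀ x, (ρ : S) ∣ π x ↔ (ρ : R) ∣ x

variable {ρ : ℤ} {π : R →+* S}

open Classical in
lemma DetectsDvd.eventSum_map (h : DetectsDvd ρ π) (e : FrontEvent R) :
    eventSum ρ (e.map π) = eventSum ρ e := by
  funext F f
  cases e with
  | crossing m k x y =>
    have : Switchable ρ m (π x) (π y) ↔ Switchable ρ m x y := by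
      rw [Switchable, ← map_sub, h, Switchable]
    exact congrArg₂ (· + ·) rfl (if_congr (and_congr_left' this) rfl rfl)
  | _ => rfl

lemma DetectsDvd.wordSum_map (h : DetectsDvd ρ π) (w : Word R) (F : StateFun) :
    wordSum ρ (w.map (FrontEvent.map π)) F = wordSum ρ w F := by
  induction w with
  | nil => rfl
  | cons e w ih => rw [map_cons, wordSum_cons, ih, h.eventSum_map, wordSum_cons]

lemma DetectsDvd.isGradedVertexMatching (h : DetectsDvd ρ π) (l r : List R) (φ : ℕ → ℕ) :
    IsGradedVertexMatching ρ l r φ ↔ IsGradedVertexMatching ρ (l.map π) (r.map π) φ := by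
  simp only [IsGradedVertexMatching, length_map, halfEdgePotential_map, ← map_sub, ← map_one π, h _]

/-- The operators depend on potentials only through divisibility by `ρ`. The graded matchings at a
vertex are also the same before and after reduction, so the sum runs over the same resolutions. -/
lemma DetectsDvd.resolvedEventSum_map (h : DetectsDvd ρ π) (e : FrontEvent R) :
    resolvedEventSum ρ (e.map π) = resolvedEventSum ρ e := by
  by_cases he : ∃ k l r, e = .vertex k l r
  · obtain ⟨k, l, r, rfl⟩ := he
    funext F f
    refine (Fintype.sum_equiv (ι := (FrontEvent.vertex k l r).Resolution ρ)
      (κ := (FrontEvent.vertex k (l.map π) (r.map π)).Resolution ρ)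
      (Equiv.subtypeEquivRight (h.isGradedVertexMatching l r)) _ _ fun φ => ?_).symm
    have := congrFun (h.wordSum_map (resolveVertex k l r φ.1) F) f
    rw [map_resolveVertex] at this
    exact this.symm
  · have he' : ∀ k l r, e ≠ .vertex k l r := fun k l r h => he ⟨k, l, r, h⟩
    rw [resolvedEventSum_of_not_vertex ρ he', resolvedEventSum_of_not_vertex ρ, h.eventSum_map]
    intro k l r h'
    cases e with
    | vertex k l r => exact he' k l r rfl
    | _ => cases h'

lemma DetectsDvd.graphSum_map (h : DetectsDvd ρ π) (w : Word R) (F : StateFun) :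
    (w.map (FrontEvent.map π)).foldr (resolvedEventSum ρ) F = graphSum ρ w F := by
  induction w with
  | nil => rfl
  | cons e w ih => rw [map_cons, foldr_cons, ih, h.resolvedEventSum_map, graphSum_cons]

lemma detectsDvd_mk (ρ : ℤ) : DetectsDvd ρ (Ideal.Quotient.mk (Ideal.span {(ρ : R)})) := fun x => by
  have h : ((ρ : ℤ) : R ⧸ Ideal.span {(ρ : R)}) = 0 := by
    rw [← map_intCast (Ideal.Quotient.mk (Ideal.span {(ρ : R)})), Ideal.Quotient.eq_zero_iff_mem]
    exact Ideal.mem_span_singleton_self _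
  rw [h, zero_dvd_iff, Ideal.Quotient.eq_zero_iff_mem, Ideal.mem_span_singleton]

/-- Congruences modulo `ρ` become equalities in the quotient. A chord word coding the matching,
zipped with the reduced potentials, is then a graded state. -/
lemma IsGradedMatching.mem_gradedPairings (h : DetectsDvd ρ π) (hρ : (ρ : S) = 0) {a : List R}
    {f : ℕ → ℕ} (hf : IsGradedMatching ρ a f) : f ∈ gradedPairings (a.map π) := by
  obtain ⟨L, hL, hlen, rfl⟩ := hf.1.exists_chordWord
  have h₁ : (L.zip (a.map π)).map Prod.fst = L := map_fst_zip (by simp [hlen])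
  refine ⟨L.zip (a.map π), ⟨by rwa [h₁], ?_⟩, map_snd_zip (by simp [hlen]), by rw [h₁]⟩
  rw [pairwise_iff_getElem]
  intro i j hi hj hij he
  simp only [length_zip, length_map, hlen, min_self] at hi hj
  simp only [getElem_zip, getElem_map] at he ⊢
  have hfi : chordMatching L i = j := (codes_chordMatching hL i j).2
    (Or.inr ⟨hij.ne, by omega, by
      rw [getElem?_eq_getElem (by omega), getElem?_eq_getElem (by omega), he]⟩)
  have := hf.2 i (by omega)
  rw [hfi, ← h, getD_eq_getElem _ _ hi, getD_eq_getElem _ _ hj, map_sub, map_sub, map_one, sub_sub,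
    dvd_sub_iff_eq hρ] at this
  exact this

lemma transferEq_of_move (hρ : (ρ : S) = 0) (π : R →+* S) {a b : List R} {D D' : MarkedFront a b}
    (h : D.Move D') : TransferEq (resolvedEventSum ρ) (a.map π) (D.word.map (FrontEvent.map π))
      (D'.word.map (FrontEvent.map π)) := by
  obtain ⟨p, w, w', s, hD, hD', h⟩ := h
  have hw := D.isFront.map π
  have hw' := D'.isFront.map π
  rw [hD, map_append, map_append, isFront_append] at hw
  rw [hD', map_append, map_append, isFront_append] at hw'
  obtain ⟨d, hpw, hs⟩ := hw
  obtain ⟨d', hpw', hs'⟩ := hw'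
  obtain ⟨c, hp, hw⟩ := isFront_append.1 hpw
  obtain ⟨c', hp', hw'⟩ := isFront_append.1 hpw'
  -- The slice to the left of the move is determined by the left border and the common initial word,
  -- and the slice to its right, by reflection, by the right border and the common final word.
  obtain rfl := isFront_unique hp hp'
  obtain rfl := isFront_unique (isFront_mirrorWord hs) (isFront_mirrorWord hs')
  have hE := isTransfer_resolvedEventSum hρ
  rw [hD, hD', map_append, map_append, map_append, map_append]
  refine TransferEq.append_right (TransferEq.append_left hE hp ?_) _
  rcases h with h | h
  · exact (h.map π).transferEq hρ hw hw'
  · exact (h.map π).transferEq hρ hw hw'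

lemma transferEq_of_equivalent (hρ : (ρ : S) = 0) (π : R →+* S) {a b : List R}
    {D D' : MarkedFront a b} (h : D.Equivalent D') :
    TransferEq (resolvedEventSum ρ) (a.map π) (D.word.map (FrontEvent.map π))
      (D'.word.map (FrontEvent.map π)) := by
  induction h with
  | rel _ _ h => exact transferEq_of_move hρ π h
  | refl _ => exact .refl
  | symm _ _ _ ih => exact ih.symm
  | trans _ _ _ _ _ ih ih' => exact ih.trans ih'

/-- The state sums are those of the reduced diagrams over the quotient by `ρ`. There `φ` is a graded
pairing, and equivalent diagrams act alike on it. -/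
lemma rulingPolynomial_eq_of_equivalent (ρ : ℤ) {a b : List R} {D D' : MarkedFront a b}
    (h : D.Equivalent D') {φ : ℕ → ℕ} (hφ : IsGradedMatching ρ a φ) (ψ : ℕ → ℕ) :
    rulingPolynomial ρ D φ ψ = rulingPolynomial ρ D' φ ψ := by
  have hd := detectsDvd_mk (R := R) ρ
  have hρ : ((ρ : ℤ) : R ⧸ Ideal.span {(ρ : R)}) = 0 := by
    rw [← map_intCast (Ideal.Quotient.mk (Ideal.span {(ρ : R)})), Ideal.Quotient.eq_zero_iff_mem]
    exact Ideal.mem_span_singleton_self _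
  rw [rulingPolynomial_eq_graphSum, rulingPolynomial_eq_graphSum, ← hd.graphSum_map,
    ← hd.graphSum_map]
  exact transferEq_of_equivalent hρ _ h _ (hφ.mem_gradedPairings hd hρ)

end Reduction

theorem theorem3 (m : ℕ) (ρ : ℤ) (a b : List (ZMod m)) (D D' : MarkedFront a b)
    (hDD' : MarkedFront.Equivalent D D') (φ ψ : ℕ → ℕ)
    (hφ : IsGradedMatching ρ a φ) (hψ : IsGradedMatching ρ b ψ) :
    Finite (GraphRuling ρ D φ ψ) ∧ Finite (GraphRuling ρ D' φ ψ) ∧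
      (∃ F : GraphRuling ρ D φ ψ ≃ GraphRuling ρ D' φ ψ, ∀ S, (F S).weight = S.weight) ∧
      rulingPolynomial ρ D φ ψ = rulingPolynomial ρ D' φ ψ := by
  have h := rulingPolynomial_eq_of_equivalent ρ hDD' hφ ψ
  exact ⟨finite_graphRuling ρ D φ ψ, finite_graphRuling ρ D' φ ψ,
    exists_weight_preserving_equiv ρ D D' φ ψ h, h⟩
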